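/- **Setting.** Let $(\alpha_x)_{x\in\mathbb Z^3}$ be i.i.d. standard Gaussian random variables on a probability space $(\Omega,\mathbb P)$ and let $\epsilon>0$ be small. Let $\ell$ and $L$ be the powers of two with $\log_2\ell=\lfloor\log_2(\epsilon^{-1}|\log\epsilon|^{-4})\rfloor$ and $\log_2L=\lceil\log_2(\epsilon^{-1}|\log\epsilon|^{4})\rceil$. **Geometry.** For $L_0\in\mathbb N$ let $Q_{L_0}(r)=r+\{0,\dots,L_0-1\}^3$. An $L_0$-*measurable box* is a $Q_{L_0}(r)$ with $r\in L_0\mathbb Z^3$, and a set is $L_0$-*measurable* if it is a union of such boxes. For $A\subset\mathbb Z^3$ let $\hat A\subset\mathbb R^3$ be the union of the closed unit boxes centred at the points of $A$; $A$ is *connected* if $\hat A$ is connected (and non-empty). Let $\delta(A)$ be the union of the $L$-measurable boxes $Q$ with $\inf\{\|p-q\|_\infty:p\in\hat Q,\,q\in\hat A\}<\ell$, let $\mathrm{Int}(A)$ be the set of lattice points in the bounded connected components of $\mathbb R^3\setminus\hat A$, and let $c(A)=\delta(A)\cup\mathrm{Int}(A)$ be the *closed hull* of $A$. **Fields.** For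 a box $Q$ and $f:Q\to\mathbb R$ write $f(Q)=|Q|^{-1}\sum_{x\in Q}f_x$. For $\lambda\ge0$ let $g^{\lambda,D}_Q=\epsilon(-\Delta^D_Q+\lambda)^{-1}\alpha$ and $g^{\lambda,N}_Q=\epsilon(-\Delta^N_Q+\lambda)^{-1}(\alpha-\alpha(Q))$, where $\Delta^D_Q,\Delta^N_Q$ are the nearest-neighbour Dirichlet and Neumann Laplacians on $Q$ and $-\Delta^N_Q$ is inverted on functions of mean zero. The field $g^{\lambda,D}_Q$ is extended by $0$ off $Q$. The gradient $\nabla_e g$ is taken over the edges $e$ that meet $Q$ in the Dirichlet case and over the edges inside $Q$ in the Neumann case. Let $m_{Q,y}=\sum_{e\ni y,\,e\cap Q\ne\varnothing}(\nabla_e g^{\lambda,D}_Q)^2$. Conditions on $g^\lambda$ below are required for both $g^{\lambda,D}$ and $g^{\lambda,N}$. **Good sets.** Fix $A,B>0$. A box $Q$ of side $L_0$ is *nice* if for all $\lambda\in[0,L_0^{-1})$: * with $r=\log^{90}L_0$, $r^{-3}\sum_{\|y-x\|_\infty\le r}m_{Q,y}\ge A\epsilon^2$ for every $x\in Q$ at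 $\ell^\infty$-distance at least $L_0/16$ from the outer boundary of $Q$; * $\|g^\lambda_Q\|_\infty\le\epsilon L_0^{1/2}|\log\epsilon|^{30}$ and $\|\nabla g^\lambda_Q\|_\infty\le\epsilon|\log\epsilon|^{30}$; * $A\epsilon^2\le\|\nabla g_Q^\lambda\|_2^2/|Q|\le B\epsilon^2$; * $\|\alpha\|_{\infty,Q}\le|\log\epsilon|^{30}$ and $|\alpha(Q)|\sqrt{|Q|}\le|\log\epsilon|^{30}$. For an $L_0$-measurable box $Q=Q_{L_0}(r)$ let $Q_\eta=Q_{L_0}(r+\eta)$, $\eta\in\mathcal N=\frac{L_0}{16}\{-32,\dots,32\}^3$. The box $Q$ is *good* if every $Q_\eta$ is nice. For a bounded $L_0$-measurable set $Y$ let $N_Y^{L_0}=|Y|/L_0^3$. Such a $Y$ is *good at scale $L_0$* if it contains at most $|\log\epsilon|^{-55}N_Y^{L_0}$ $L_0$-measurable boxes that are not good. **Regular and clean sets.** Put $F_\lambda(Q)=\max_\eta\|g^\lambda_{Q_\eta}\|_2^2/|Q_\eta|$, $F^\nabla_\lambda(Q)=\max_\eta\|\nabla g^\lambda_{Q_\eta}\|_2^2/|Q_\eta|$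 and $R(Q)=\max_\eta\|\alpha\|_{\infty,Q_\eta}$. The set $Y$ is *regular at scale $L_0$* if for $\lambda\in\{0,L_0^{-2}\log^8L_0\}$, with all sums over the $L_0$-measurable boxes $Q\subset Y$ (and with $\lambda^{-1/2}\wedge L_0=L_0$ for $\lambda=0$): $$\sum_Q F^\nabla_\lambda\mathbf 1\{F^\nabla_\lambda\ge\epsilon^2|\log\epsilon|\}\le\epsilon^{9/4}N_Y^{L_0},\qquad \sum_QF_\lambda\mathbf 1\{F_\lambda\ge\epsilon^2(\lambda^{-1/2}\wedge L_0)|\log\epsilon|\}\le|\log\epsilon|^2N_Y^{L_0},$$ $$\sum_QR^2\mathbf 1\{R>|\log\epsilon|^{50}\}\le|\log\epsilon|^{-75}N_Y^{L_0},\qquad \sum_Q\sum_\eta|\alpha(Q_\eta)|\le L_0^{-3/2}\log^{50}(L_0)\,N_Y^{L_0}.$$ A bounded connected $L$-measurable set $Y$ is *clean* if $Y$ is good and $\delta(Y)$ is regular at each of the scales $L_0\in\{\ell/2,\ell,L\}$. Let $\mathbb D=\mathbb D(\omega)$ be the union of $c(Y)$ over all bounded connected $L$-measurable sets $Y$ that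 are not clean, and put $\mathbb D_\Lambda=\mathbb D\cap\Lambda$. **Lemma.** There are $A_0,B_0>0$ such that for all $0<A\le A_0$ and $B\ge B_0$ there are constants $\epsilon_0,c,C>0$ for which the following holds for every $\epsilon\in(0,\epsilon_0)$. 1. For every bounded $L$-measurable $\Lambda\subset\mathbb Z^3$ the random variable $|\mathbb D_\Lambda|$ is square integrable and $$\operatorname{Var}(|\mathbb D_\Lambda|)\le C e^{-c\log^2\epsilon}\,|\Lambda|.$$ 2. For every increasing sequence $\Lambda_N$ of bounded $L$-measurable sets with $\bigcup_N\Lambda_N=\mathbb Z^3$, almost surely there is $N_0(\omega)$ such that $$\frac{|\mathbb D_{\Lambda_N}|}{|\Lambda_N|}\le C e^{-c|\log\epsilon|^2}\qquad\text{for all }N\ge N_0(\omega).$$ -/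

import Mathlib

open MeasureTheory ProbabilityTheory Filter

namespace RFO

/-! ### Lattice geometry in dimension three -/

/-- Sites of the lattice `ℤ³`.  The metric that Mathlib puts on this type is the `ℓ^∞` metric. -/
abbrev Site := Fin 3 → ℤ

/-- The cube `x + {0, …, n - 1}³`. -/
noncomputable def cube (n : ℕ) (x : Site) : Finset Site :=
  Fintype.piFinset fun i => Finset.Ico (x i) (x i + n)

/-- `r ∈ n ℤ³`. -/
def Aligned (n : ℕ) (r : Site) : Prop := ∀ i, (n : ℤ) ∣ r i

/-- `Y` is `n`-measurable: a union of cubes of side `n` with corners in `n ℤ³`. -/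
def ScaleMeasurable (n : ℕ) (Y : Set Site) : Prop :=
  ∃ R : Set Site, (∀ r ∈ R, Aligned n r) ∧ Y = ⋃ r ∈ R, (cube n r : Set Site)

/-- A site seen as a point of `ℝ³`. -/
def toReal (x : Site) : Fin 3 → ℝ := fun i => (x i : ℝ)

/-- The union of the closed unit boxes centred at the sites of `A`
(balls of `Fin 3 → ℝ` are balls of the `ℓ^∞` norm). -/
def solid (A : Set Site) : Set (Fin 3 → ℝ) :=
  ⋃ x ∈ A, Metric.closedBall (toReal x) (1 / 2)

/-- `A` is connected if the union of the closed unit boxes around its sites is connected. -/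
def LatticeConnected (A : Set Site) : Prop := IsConnected (solid A)

/-- The `n`-enlargement of `A`: the union of the `n`-measurable cubes at `ℓ^∞` distance less
than `ℓ` from `A`, the distance being measured between the unions of unit boxes. -/
def enlarge (ℓ n : ℕ) (A : Set Site) : Set Site :=
  ⋃ r ∈ {r : Site | Aligned n r ∧
    ∃ p ∈ solid (cube n r : Set Site), ∃ q ∈ solid A, dist p q < ℓ}, (cube n r : Set Site)

/-- The sites in the bounded connected components of the complement of `solid A`. -/
def interiorSites (A : Set Site) : Set Site :=
  {x | toReal x ∉ solid A ∧
    Bornology.IsBounded (connectedComponentIn (solid A)ᶜ (toReal x))}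

/-- The closed hull `c(A) = δ(A) ∪ Int(A)`. -/
def closedHull (ℓ L : ℕ) (A : Set Site) : Set Site := enlarge ℓ L A ∪ interiorSites A

/-! ### The two length scales -/

/-- `log₂ ℓ = ⌊log₂ (ε⁻¹ |log ε|⁻⁴)⌋` (for small `ε`, where the right side is nonnegative). -/
noncomputable def ell (ε : ℝ) : ℕ :=
  2 ^ ⌊Real.logb 2 (ε⁻¹ * |Real.log ε| ^ (-4 : ℤ))⌋₊

/-- `log₂ L = ⌈log₂ (ε⁻¹ |log ε|⁴)⌉` (for small `ε`, where the right side is nonnegative). -/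
noncomputable def bigL (ε : ℝ) : ℕ :=
  2 ^ ⌈Real.logb 2 (ε⁻¹ * |Real.log ε| ^ 4)⌉₊

/-- The three scales `ℓ/2, ℓ, L` (for small `ε` all of them are powers of two). -/
noncomputable def scales (ε : ℝ) : Finset ℕ := {ell ε / 2, ell ε, bigL ε}

/-! ### Discrete Laplacians and the fields `g` -/

/-- The two kinds of boundary conditions. -/
inductive BC
  | dirichlet
  | neumann

/-- The unit vector of `ℤ³` in direction `i`. -/
def unit (i : Fin 3) : Site := Pi.single i 1

/-- Spatial average `f(Q)` over a finite set. -/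
noncomputable def average (f : Site → ℝ) (Q : Finset Site) : ℝ := (∑ x ∈ Q, f x) / Q.card

/-- `-Δ_Q f (x)`, for `x ∈ Q` and `f` vanishing off `Q`. In the Dirichlet case the sum runs over
all neighbours of `x`, in the Neumann case over the neighbours in `Q`. -/
def negLaplacian (Q : Finset Site) (f : Site → ℝ) (x : Site) : BC → ℝ
  | .dirichlet => ∑ i, ((f x - f (x + unit i)) + (f x - f (x - unit i)))
  | .neumann => ∑ i, ((if x + unit i ∈ Q then f x - f (x + unit i) else 0) +
      (if x - unit i ∈ Q then f x - f (x - unit i) else 0))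

/-- `g` is the field `ε (-Δ_Q + lam)⁻¹ a` (Dirichlet), respectively
`ε (-Δ_Q + lam)⁻¹ (a - a(Q))` (Neumann), extended by `0` off `Q`. In the Neumann case `-Δ_Q` is
inverted on the functions of mean zero; for `lam > 0` the mean-zero condition is automatic. -/
def IsField (ε lam : ℝ) (Q : Finset Site) (a g : Site → ℝ) : BC → Prop
  | .dirichlet => (∀ x ∉ Q, g x = 0) ∧
      ∀ x ∈ Q, negLaplacian Q g x .dirichlet + lam * g x = ε * a x
  | .neumann => (∀ x ∉ Q, g x = 0) ∧ ∑ x ∈ Q, g x = 0 ∧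
      ∀ x ∈ Q, negLaplacian Q g x .neumann + lam * g x = ε * (a x - average a Q)

/-- The field `g^{lam}_Q` (see `field_spec` and `IsField.unique` below). -/
noncomputable def field (ε lam : ℝ) (Q : Finset Site) (a : Site → ℝ) (bc : BC) : Site → ℝ :=
  Classical.epsilon fun g => IsField ε lam Q a g bc

/-! ### The fields are well defined -/

section WellDefined

variable {Q : Finset Site} {lam : ℝ}

theorem negLaplacian_add (f g : Site → ℝ) (x : Site) (bc : BC) :
    negLaplacian Q (f + g) x bc = negLaplacian Q f x bc + negLaplacian Q g x bc := by
  cases bc <;> simp only [negLaplacian, ← Finset.sum_add_distrib, Pi.add_apply] <;>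
    refine Finset.sum_congr rfl fun i _ => ?_
  · ring
  · split_ifs <;> ring

theorem negLaplacian_smul (t : ℝ) (f : Site → ℝ) (x : Site) (bc : BC) :
    negLaplacian Q (t • f) x bc = t * negLaplacian Q f x bc := by
  cases bc <;> simp only [negLaplacian, Finset.mul_sum, Pi.smul_apply, smul_eq_mul] <;>
    refine Finset.sum_congr rfl fun i _ => ?_
  · ring
  · split_ifs <;> ring

theorem sum_negLaplacian_neumann (f : Site → ℝ) :
    ∑ x ∈ Q, negLaplacian Q f x .neumann = 0 := by
  simp only [negLaplacian]
  rw [Finset.sum_comm]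
  refine Finset.sum_eq_zero fun i _ => ?_
  rw [Finset.sum_add_distrib, ← Finset.sum_filter, ← Finset.sum_filter]
  have : ∑ x ∈ Q with x - unit i ∈ Q, (f x - f (x - unit i)) =
      ∑ x ∈ Q with x + unit i ∈ Q, (f (x + unit i) - f x) := by
    refine Finset.sum_nbij' (fun x => x - unit i) (fun x => x + unit i) ?_ ?_ ?_ ?_ ?_ <;>
      simp +contextual
  rw [this, ← Finset.sum_add_distrib]
  exact Finset.sum_eq_zero fun x _ => by ring

/-- At a positive maximum of a solution of the homogeneous equation all neighbours agree. -/
theorem eq_at_max_dirichlet {g : Site → ℝ} (hl : 0 ≤ lam) (h0 : ∀ x ∉ Q, g x = 0)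
    (h : ∀ x ∈ Q, negLaplacian Q g x .dirichlet + lam * g x = 0) {x : Site} (hx : x ∈ Q)
    (hpos : 0 < g x) (hmax : ∀ y ∈ Q, g y ≤ g x) : g (x + unit 0) = g x := by
  have hm : ∀ y, g y ≤ g x := fun y => by
    by_cases hy : y ∈ Q
    · exact hmax y hy
    · rw [h0 y hy]; exact hpos.le
  have e := h x hx
  simp only [negLaplacian, Fin.sum_univ_three] at e
  have := mul_nonneg hl hpos.le
  linarith [hm (x + unit 0), hm (x + unit 1), hm (x + unit 2), hm (x - unit 0),
    hm (x - unit 1), hm (x - unit 2)]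

theorem eq_at_max_neumann {g : Site → ℝ} (hl : 0 ≤ lam)
    (h : ∀ x ∈ Q, negLaplacian Q g x .neumann + lam * g x = 0) {x : Site} (hx : x ∈ Q)
    (hpos : 0 < g x) (hmax : ∀ y ∈ Q, g y ≤ g x) (i : Fin 3) :
    (x + unit i ∈ Q → g (x + unit i) = g x) ∧ (x - unit i ∈ Q → g (x - unit i) = g x) := by
  have e := h x hx
  have hlg := mul_nonneg hl hpos.le
  have hn : ∀ j ∈ Finset.univ, 0 ≤ (if x + unit j ∈ Q then g x - g (x + unit j) else 0) +
      (if x - unit j ∈ Q then g x - g (x - unit j) else 0) := by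
    intro j _
    refine add_nonneg ?_ ?_ <;> split_ifs with hj
    · linarith [hmax _ hj]
    · exact le_rfl
    · linarith [hmax _ hj]
    · exact le_rfl
  simp only [negLaplacian] at e
  have hs := Finset.single_le_sum hn (Finset.mem_univ i)
  constructor
  · intro hi
    have h2 : 0 ≤ (if x - unit i ∈ Q then g x - g (x - unit i) else 0) := by
      split_ifs with hj
      · linarith [hmax _ hj]
      · exact le_rfl
    rw [if_pos hi] at hs
    linarith [hmax _ hi]
  · intro hi
    have h2 : 0 ≤ (if x + unit i ∈ Q then g x - g (x + unit i) else 0) := by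
      split_ifs with hj
      · linarith [hmax _ hj]
      · exact le_rfl
    rw [if_pos hi] at hs
    linarith [hmax _ hi]

theorem mem_cube {n : ℕ} {x y : Site} : y ∈ cube n x ↔ ∀ i, x i ≤ y i ∧ y i < x i + n := by
  simp [cube, Fintype.mem_piFinset]

/-- A property that passes between neighbours in a cube holds everywhere or nowhere. -/
theorem cube_connected {n : ℕ} {r : Site} (p : Site → Prop)
    (h : ∀ x ∈ cube n r, ∀ i, x - unit i ∈ cube n r → (p x ↔ p (x - unit i))) :
    ∀ x ∈ cube n r, (p x ↔ p r) := by
  have key : ∀ m : ℕ, ∀ x ∈ cube n r, (∑ i, (x i - r i)) = m → (p x ↔ p r) := by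
    intro m
    induction m with
    | zero =>
      intro x hx hs
      have : x = r := by
        rw [mem_cube] at hx
        rw [Fin.sum_univ_three] at hs
        funext i
        have h0 := hx 0
        have h1 := hx 1
        have h2 := hx 2
        fin_cases i <;> simp at * <;> omega
      rw [this]
    | succ m ih =>
      intro x hx hs
      obtain ⟨i, hi⟩ : ∃ i, r i < x i := by
        by_contra! hc
        have : ∑ i, (x i - r i) ≤ 0 := Finset.sum_nonpos fun i _ => by linarith [hc i]
        rw [hs] at this
        push_cast at this
        omega
      have hx' : x - unit i ∈ cube n r := by
        rw [mem_cube] at hx ⊢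
        intro j
        have := hx j
        rcases eq_or_ne j i with rfl | hj
        · simp [unit]; omega
        · simp [unit, hj]; omega
      rw [h x hx i hx']
      refine ih _ hx' ?_
      have : ∑ j, ((x - unit i) j - r j) = ∑ j, (x j - r j) - ∑ j, unit i j := by
        rw [← Finset.sum_sub_distrib]
        exact Finset.sum_congr rfl fun j _ => by simp; ring
      rw [this, hs]
      simp [unit]
  intro x hx
  have hnn : 0 ≤ ∑ i, (x i - r i) := Finset.sum_nonneg fun i _ => by
    have := (mem_cube.1 hx i).1
    linarith
  exact key (∑ i, (x i - r i)).toNat x hx (by rw [Int.toNat_of_nonneg hnn])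

theorem IsField.nonpos_of_zero {n : ℕ} {r : Site} {g : Site → ℝ} {bc : BC} (hl : 0 ≤ lam)
    (hg : IsField 0 lam (cube n r) 0 g bc) : ∀ x ∈ cube n r, g x ≤ 0 := by
  by_contra! hc
  obtain ⟨z, hz, hzpos⟩ := hc
  obtain ⟨x, hx, hmax⟩ := (cube n r).exists_max_image g ⟨z, hz⟩
  have hpos : 0 < g x := hzpos.trans_le (hmax z hz)
  cases bc with
  | dirichlet =>
    obtain ⟨h0, h⟩ := hg
    simp only [zero_mul] at h
    have step : ∀ k : ℕ, g (x + k • unit 0) = g x := by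
      intro k
      induction k with
      | zero => simp
      | succ k ih =>
        have hk : x + k • unit 0 ∈ cube n r := by
          by_contra hk
          rw [h0 _ hk] at ih
          linarith
        have := eq_at_max_dirichlet hl h0 h hk (by rw [ih]; exact hpos)
          (by rw [ih]; exact hmax)
        rw [succ_nsmul, ← add_assoc, this, ih]
    have hmem : x + n • unit 0 ∈ cube n r := by
      by_contra hk
      have := step n
      rw [h0 _ hk] at this
      linarith
    have h1 := (mem_cube.1 hmem 0).2
    have h2 := (mem_cube.1 hx 0).1
    simp [unit] at h1
    omega
  | neumann =>
    obtain ⟨_, hs, h⟩ := hg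
    simp only [zero_mul] at h
    have hall := cube_connected (n := n) (r := r) (fun y => g y = g x) (by
      intro y hy i hyi
      constructor
      · intro e
        have := (eq_at_max_neumann hl h hy (by rw [e]; exact hpos) (by rw [e]; exact hmax) i).2 hyi
        rw [this, e]
      · intro e
        have := (eq_at_max_neumann hl h hyi (by rw [e]; exact hpos) (by rw [e]; exact hmax) i).1
          (by simpa using hy)
        rw [← e, ← this, sub_add_cancel])
    have hr : g r = g x := (hall x hx).1 rfl
    have : 0 < ∑ y ∈ cube n r, g y :=
      Finset.sum_pos (fun y hy => by rw [(hall y hy).2 hr]; exact hpos) ⟨x, hx⟩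
    linarith

theorem average_sub (a b : Site → ℝ) : average (a - b) Q = average a Q - average b Q := by
  simp [average, sub_div]

theorem IsField.sub {ε : ℝ} {a g g' : Site → ℝ} {bc : BC}
    (hg : IsField ε lam Q a g bc) (hg' : IsField ε lam Q a g' bc) :
    IsField 0 lam Q 0 (g - g') bc := by
  have e : ∀ x, negLaplacian Q (g - g') x bc = negLaplacian Q g x bc - negLaplacian Q g' x bc := by
    intro x
    rw [sub_eq_add_neg, ← neg_one_smul ℝ g', negLaplacian_add, negLaplacian_smul]
    ring
  cases bc with
  | dirichlet =>
    refine ⟨fun x hx => by simp [hg.1 x hx, hg'.1 x hx], fun x hx => ?_⟩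
    rw [e, Pi.sub_apply]
    linarith [hg.2 x hx, hg'.2 x hx]
  | neumann =>
    refine ⟨fun x hx => by simp [hg.1 x hx, hg'.1 x hx], by simp [hg.2.1, hg'.2.1],
      fun x hx => ?_⟩
    rw [e, Pi.sub_apply]
    linarith [hg.2.2 x hx, hg'.2.2 x hx]

/-- On a cube the field is unique. -/
theorem IsField.unique {ε : ℝ} {n : ℕ} {r : Site} {a g g' : Site → ℝ} {bc : BC} (hl : 0 ≤ lam)
    (hg : IsField ε lam (cube n r) a g bc) (hg' : IsField ε lam (cube n r) a g' bc) : g = g' := by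
  funext x
  by_cases hx : x ∈ cube n r
  · have h1 := (hg.sub hg').nonpos_of_zero hl x hx
    have h2 := (hg'.sub hg).nonpos_of_zero hl x hx
    simp only [Pi.sub_apply] at h1 h2
    linarith
  · have h1 : g x = 0 := by cases bc <;> exact hg.1 x hx
    have h2 : g' x = 0 := by cases bc <;> exact hg'.1 x hx
    rw [h1, h2]

/-- Extension by zero. -/
noncomputable def extendZero (Q : Finset Site) (f : Q → ℝ) (x : Site) : ℝ := by
  classical exact if h : x ∈ Q then f ⟨x, h⟩ else 0

theorem extendZero_of_mem (f : Q → ℝ) {x : Site} (hx : x ∈ Q) :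
    extendZero Q f x = f ⟨x, hx⟩ := by simp [extendZero, hx]

theorem extendZero_of_not_mem (f : Q → ℝ) {x : Site} (hx : x ∉ Q) :
    extendZero Q f x = 0 := by simp [extendZero, hx]

theorem extendZero_add (f g : Q → ℝ) :
    extendZero Q (f + g) = extendZero Q f + extendZero Q g := by
  funext x
  by_cases hx : x ∈ Q <;> simp [extendZero, hx]

theorem extendZero_smul (t : ℝ) (f : Q → ℝ) : extendZero Q (t • f) = t • extendZero Q f := by
  funext x
  by_cases hx : x ∈ Q <;> simp [extendZero, hx]

/-- `-Δ_Q + lam`, plus the sum of the function in the Neumann case. -/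
noncomputable def fieldOperator (Q : Finset Site) (lam : ℝ) (bc : BC) :
    (Q → ℝ) →ₗ[ℝ] (Q → ℝ) where
  toFun f x := negLaplacian Q (extendZero Q f) x bc + lam * f x +
    (match bc with | .dirichlet => 0 | .neumann => ∑ y, f y)
  map_add' f g := by
    funext x
    rw [extendZero_add]
    cases bc <;>
      simp only [negLaplacian_add, Pi.add_apply, Finset.sum_add_distrib] <;> ring
  map_smul' t f := by
    funext x
    rw [extendZero_smul]
    cases bc <;>
      simp only [negLaplacian_smul, Pi.smul_apply, smul_eq_mul, RingHom.id_apply,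
        ← Finset.mul_sum] <;> ring

theorem isField_of_operator {ε : ℝ} (hl : 0 ≤ lam) (hQ : Q.Nonempty) {a : Site → ℝ} {bc : BC}
    {f : Q → ℝ} (hf : ∀ x : Q, fieldOperator Q lam bc f x = ε * (a x -
      (match bc with | .dirichlet => 0 | .neumann => average a Q))) :
    IsField ε lam Q a (extendZero Q f) bc := by
  cases bc with
  | dirichlet =>
    refine ⟨fun x hx => extendZero_of_not_mem f hx, fun x hx => ?_⟩
    have := hf ⟨x, hx⟩
    simp only [fieldOperator, LinearMap.coe_mk, AddHom.coe_mk, add_zero, sub_zero] at this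
    rw [extendZero_of_mem f hx, this]
  | neumann =>
    simp only [fieldOperator, LinearMap.coe_mk, AddHom.coe_mk] at hf
    have hcard : (0 : ℝ) < Q.card := by exact_mod_cast hQ.card_pos
    have hs1 : ∑ x : Q, negLaplacian Q (extendZero Q f) x .neumann = 0 := by
      rw [Finset.sum_coe_sort Q (fun x => negLaplacian Q (extendZero Q f) x .neumann)]
      exact sum_negLaplacian_neumann _
    have hs2 : ∑ x : Q, ε * (a x - average a Q) = 0 := by
      rw [Finset.sum_coe_sort Q (fun x => ε * (a x - average a Q)), ← Finset.mul_sum,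
        Finset.sum_sub_distrib, Finset.sum_const, average, nsmul_eq_mul]
      field_simp
      ring
    have hsum : ∑ y, f y = 0 := by
      have h1 := Finset.sum_congr (s₁ := Finset.univ) rfl fun x _ => hf x
      rw [hs2, Finset.sum_add_distrib, Finset.sum_add_distrib, hs1, ← Finset.mul_sum,
        Finset.sum_const, nsmul_eq_mul] at h1
      simp only [Finset.card_univ, Fintype.card_coe] at h1
      have h2 : (lam + Q.card) * ∑ y, f y = 0 := by linarith
      rcases mul_eq_zero.1 h2 with h | h
      · linarith
      · exact h
    refine ⟨fun x hx => extendZero_of_not_mem f hx, ?_, fun x hx => ?_⟩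
    · rw [← Finset.sum_coe_sort Q, ← hsum]
      exact Finset.sum_congr rfl fun x _ => extendZero_of_mem f x.2
    · have := hf ⟨x, hx⟩
      rw [hsum, add_zero] at this
      rw [extendZero_of_mem f hx, this]

/-- On a cube the field exists. -/
theorem exists_isField (ε : ℝ) (hl : 0 ≤ lam) {n : ℕ} (hn : 0 < n) (r : Site) (a : Site → ℝ)
    (bc : BC) : ∃ g, IsField ε lam (cube n r) a g bc := by
  have hQ : (cube n r).Nonempty := ⟨r, mem_cube.2 fun i => ⟨le_rfl, by omega⟩⟩
  have hinj : Function.Injective (fieldOperator (cube n r) lam bc) := by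
    rw [injective_iff_map_eq_zero]
    intro f hf
    have h1 : IsField 0 lam (cube n r) 0 (extendZero (cube n r) f) bc :=
      isField_of_operator hl hQ fun x => by rw [hf]; simp
    have h2 : IsField 0 lam (cube n r) 0 0 bc := by
      have := h1.sub h1
      rwa [sub_self] at this
    funext x
    rw [← extendZero_of_mem f x.2, h1.unique hl h2]
    rfl
  have hsurj := LinearMap.injective_iff_surjective.1 hinj
  obtain ⟨f, hf⟩ := hsurj fun x => ε * (a x -
      (match bc with | .dirichlet => 0 | .neumann => average a (cube n r)))
  cases bc <;> exact ⟨_, isField_of_operator hl hQ fun x => congrFun hf x⟩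

theorem field_spec (ε : ℝ) (hl : 0 ≤ lam) {n : ℕ} (hn : 0 < n) (r : Site) (a : Site → ℝ)
    (bc : BC) : IsField ε lam (cube n r) a (field ε lam (cube n r) a bc) bc :=
  Classical.epsilon_spec (exists_isField ε hl hn r a bc)

end WellDefined

/-- The positively oriented nearest-neighbour edges on which `∇ g_Q` lives: those that meet `Q`
(Dirichlet), respectively those with both ends in `Q` (Neumann). -/
def edges (Q : Finset Site) : BC → Finset (Site × Site)
  | .dirichlet => Q.biUnion fun x => Finset.univ.biUnion fun i =>
      {(x, x + unit i), (x - unit i, x)}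
  | .neumann => (Q.biUnion fun x => Finset.univ.biUnion fun i =>
      {(x, x + unit i), (x - unit i, x)}).filter fun e => e.1 ∈ Q ∧ e.2 ∈ Q

/-- The discrete gradient along an oriented edge. -/
def grad (f : Site → ℝ) (e : Site × Site) : ℝ := f e.2 - f e.1

/-- `‖∇ g‖₂²`. -/
def gradSq (Q : Finset Site) (bc : BC) (g : Site → ℝ) : ℝ := ∑ e ∈ edges Q bc, grad g e ^ 2

/-- The potential `m_{Q, y}`: the sum of `(∇_e g)²` over the edges `e ∋ y` that meet `Q`. -/
def potential (Q : Finset Site) (g : Site → ℝ) (y : Site) : ℝ :=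
  ∑ e ∈ (edges Q .dirichlet).filter (fun e => e.1 = y ∨ e.2 = y), grad g e ^ 2

/-- The outer boundary of `Q`. -/
def outerBoundary (Q : Finset Site) : Set Site :=
  {z | z ∉ Q ∧ ∃ x ∈ Q, ∑ i, |x i - z i| = 1}

/-- The event `𝒜_Q(r)`: the averaged potential is at least `A ε²` around each site of `Q` at
distance at least `L₀ / 16` from the outer boundary. -/
def PotentialLarge (A ε : ℝ) (L₀ : ℕ) (Q : Finset Site) (g : Site → ℝ) (r : ℝ) : Prop :=
  ∀ x ∈ Q, (∀ z ∈ outerBoundary Q, (L₀ : ℝ) / 16 ≤ dist x z) →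
    A * ε ^ 2 ≤
      (∑ y ∈ Finset.Icc (fun i => x i - ⌊r⌋) (fun i => x i + ⌊r⌋), potential Q g y) / r ^ 3

/-! ### Nice boxes, good boxes, good sets -/

/-- A box `Q` of side `L₀` is nice for the disorder `a`. -/
structure Nice (A B ε : ℝ) (L₀ : ℕ) (a : Site → ℝ) (Q : Finset Site) : Prop where
  potential_large : ∀ lam : ℝ, 0 ≤ lam → lam < (L₀ : ℝ)⁻¹ →
    PotentialLarge A ε L₀ Q (field ε lam Q a .dirichlet) (Real.log L₀ ^ 90)
  field_le : ∀ bc : BC, ∀ lam : ℝ, 0 ≤ lam → lam < (L₀ : ℝ)⁻¹ →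
    ∀ x ∈ Q, |field ε lam Q a bc x| ≤ ε * (L₀ : ℝ) ^ (1 / 2 : ℝ) * |Real.log ε| ^ 30
  grad_le : ∀ bc : BC, ∀ lam : ℝ, 0 ≤ lam → lam < (L₀ : ℝ)⁻¹ →
    ∀ e ∈ edges Q bc, |grad (field ε lam Q a bc) e| ≤ ε * |Real.log ε| ^ 30
  le_gradSq : ∀ bc : BC, ∀ lam : ℝ, 0 ≤ lam → lam < (L₀ : ℝ)⁻¹ →
    A * ε ^ 2 ≤ gradSq Q bc (field ε lam Q a bc) / Q.card
  gradSq_le : ∀ bc : BC, ∀ lam : ℝ, 0 ≤ lam → lam < (L₀ : ℝ)⁻¹ →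
    gradSq Q bc (field ε lam Q a bc) / Q.card ≤ B * ε ^ 2
  disorder_le : ∀ x ∈ Q, |a x| ≤ |Real.log ε| ^ 30
  average_le : |average a Q| * Real.sqrt Q.card ≤ |Real.log ε| ^ 30

/-- Index set of the shifts: `η = (L₀ / 16) k` with `k ∈ {-32, …, 32}³`. -/
abbrev Shift := Fin 3 → Finset.Icc (-32 : ℤ) 32

/-- The shifted cube `Q_η` of the cube with corner `r`, `η = (L₀ / 16) k`
(at the scales in use `16 ∣ L₀` as soon as `ε` is small). -/
noncomputable def shifted (L₀ : ℕ) (r : Site) (k : Shift) : Finset Site :=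
  cube L₀ fun i => r i + ((L₀ / 16 : ℕ) : ℤ) * (k i : ℤ)

/-- The `L₀`-measurable cube with corner `r` is good. -/
def GoodBox (A B ε : ℝ) (L₀ : ℕ) (a : Site → ℝ) (r : Site) : Prop :=
  ∀ k : Shift, Nice A B ε L₀ a (shifted L₀ r k)

/-- The function `Ξ` on `L₀`-measurable cubes (indexed by their corners). -/
noncomputable def Xi (A B ε : ℝ) (L₀ : ℕ) (a : Site → ℝ) : Site → ℝ :=
  Set.indicator {r | GoodBox A B ε L₀ a r} 1

/-- The corners of the `L₀`-measurable cubes contained in `Y`. -/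
def boxesIn (L₀ : ℕ) (Y : Set Site) : Set Site :=
  {r | Aligned L₀ r ∧ (cube L₀ r : Set Site) ⊆ Y}

/-- `[F; G]_Y`, the sum of `F(Q) G(Q)` over the `L₀`-measurable cubes `Q ⊆ Y`. -/
noncomputable def bracket (L₀ : ℕ) (Y : Set Site) (F G : Site → ℝ) : ℝ :=
  ∑ᶠ r ∈ boxesIn L₀ Y, F r * G r

/-- `N_Y^{L₀} = |Y| / L₀³`. -/
noncomputable def boxCount (L₀ : ℕ) (Y : Set Site) : ℝ := (Y.ncard : ℝ) / (L₀ : ℝ) ^ 3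

/-- `Y` is good at scale `L₀`. -/
def GoodSet (A B ε : ℝ) (L₀ : ℕ) (a : Site → ℝ) (Y : Set Site) : Prop :=
  bracket L₀ Y (fun r => 1 - Xi A B ε L₀ a r) 1 ≤ |Real.log ε| ^ (-55 : ℤ) * boxCount L₀ Y

/-! ### Regular and clean sets -/

/-- `F_lam`: the largest mean square of the field over the shifts of a cube. -/
noncomputable def fieldEnergy (ε lam : ℝ) (L₀ : ℕ) (a : Site → ℝ) (bc : BC) (r : Site) : ℝ :=
  ⨆ k : Shift, (∑ x ∈ shifted L₀ r k, field ε lam (shifted L₀ r k) a bc x ^ 2) /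
    (shifted L₀ r k).card

/-- `F^∇_lam`: the largest mean square of the gradient of the field over the shifts of a cube. -/
noncomputable def gradEnergy (ε lam : ℝ) (L₀ : ℕ) (a : Site → ℝ) (bc : BC) (r : Site) : ℝ :=
  ⨆ k : Shift, gradSq (shifted L₀ r k) bc (field ε lam (shifted L₀ r k) a bc) /
    (shifted L₀ r k).card

/-- `R`: the largest value of `|a|` on the shifts of a cube. -/
noncomputable def maxDisorder (L₀ : ℕ) (a : Site → ℝ) (r : Site) : ℝ :=
  ⨆ k : Shift, ⨆ x : shifted L₀ r k, |a x|

/-- `lam^{-1/2} ∧ L₀`, which is `L₀` for `lam = 0`. -/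
noncomputable def cutoff (lam : ℝ) (L₀ : ℕ) : ℝ :=
  if lam = 0 then (L₀ : ℝ) else min (lam ^ (-1 / 2 : ℝ)) (L₀ : ℝ)

/-- The two masses `0` and `L₀⁻² log⁸ L₀`. -/
noncomputable def masses (L₀ : ℕ) : Set ℝ := {0, (L₀ : ℝ) ^ (-2 : ℤ) * Real.log L₀ ^ 8}

/-- `Y` is regular at scale `L₀`. -/
structure RegularSet (ε : ℝ) (L₀ : ℕ) (a : Site → ℝ) (Y : Set Site) : Prop where
  grad_energy : ∀ bc : BC, ∀ lam ∈ masses L₀,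
    bracket L₀ Y (gradEnergy ε lam L₀ a bc)
      (Set.indicator {r | ε ^ 2 * |Real.log ε| ≤ gradEnergy ε lam L₀ a bc r} 1)
      ≤ ε ^ (9 / 4 : ℝ) * boxCount L₀ Y
  field_energy : ∀ bc : BC, ∀ lam ∈ masses L₀,
    bracket L₀ Y (fieldEnergy ε lam L₀ a bc)
      (Set.indicator
        {r | ε ^ 2 * cutoff lam L₀ * |Real.log ε| ≤ fieldEnergy ε lam L₀ a bc r} 1)
      ≤ |Real.log ε| ^ 2 * boxCount L₀ Y
  disorder : bracket L₀ Y (fun r => maxDisorder L₀ a r ^ 2)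
      (Set.indicator {r | |Real.log ε| ^ 50 < maxDisorder L₀ a r} 1)
      ≤ |Real.log ε| ^ (-75 : ℤ) * boxCount L₀ Y
  averages : bracket L₀ Y (fun r => ∑ k : Shift, |average a (shifted L₀ r k)|) 1
      ≤ (L₀ : ℝ) ^ (-3 / 2 : ℝ) * Real.log L₀ ^ 50 * boxCount L₀ Y

/-- `Y` is clean: `Y` is good, and its `L`-enlargement `δ(Y)` is regular, at each of the scales
`ℓ/2, ℓ, L`. -/
def Clean (A B ε : ℝ) (a : Site → ℝ) (Y : Set Site) : Prop :=
  ∀ L₀ ∈ scales ε, GoodSet A B ε L₀ a Y ∧ RegularSet ε L₀ a (enlarge (ell ε) (bigL ε) Y)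

/-- `𝔻`: the union of the closed hulls of the bounded connected `L`-measurable sets that are not
clean for the disorder `a`. -/
def badSet (A B ε : ℝ) (a : Site → ℝ) : Set Site :=
  ⋃ Y ∈ {Y : Set Site | Y.Finite ∧ LatticeConnected Y ∧ ScaleMeasurable (bigL ε) Y ∧
    ¬ Clean A B ε a Y}, closedHull (ell ε) (bigL ε) Y

/-- `|𝔻 ∩ Λ|`. -/
noncomputable def badCount (A B ε : ℝ) (a : Site → ℝ) (Λ : Set Site) : ℝ :=
  ((badSet A B ε a ∩ Λ).ncard : ℝ)

end RFO

open scoped ENNReal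

namespace RFO

/-! ### Eigenfunctions of the one-dimensional Laplacians -/

/-! Write t = |log ε|, s = t^(-80), τ = exp(-t^5). Every box q of side L receives a random weight
W_q ≥ 0 (`boxWeight`), assembled from the observables that decide cleanness. Each observable is
truncated from below and divided by the bound that cleanness imposes on it. Three properties of the
weights carry the proof.

Locality: W_q depends only on the disorder in a cube of side 5L around q (`dependsOn_boxWeight`).
Smallness: E exp(125 s W_q) ≤ 1 + τ (`lintegral_exp_boxWeight_le`). Domination: if Y consists of N
boxes of side L and is not clean, then the boxes in or next to Y have total weight larger than N,
and every site of the closed hull of Y is within 2N boxes of Y (`heavy_of_not_clean`). Hence x ∈ 𝔻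
forces a `Heavy` configuration near x.

Smallness rests on an explicit diagonalisation of both Laplacians by products of sines or cosines.
The coefficients of the disorder in this basis are again i.i.d. standard Gaussians, and the energies
are weighted sums of their squares. Sums of inverse eigenvalues over the spectrum then give
sub-Gaussian tails for fields and gradients and exponential moments for energies. A union bound
gives niceness of a box up to an error that beats every exp(t^10), uniformly in the mass:
monotonicity in the mass, the maximum principle and a polynomially fine net of masses reduce the
continuum of masses to finitely many.

The heavy event is estimated by a union bound (`measure_heavy_le`). There are exponentially many
connected sets of N boxes, far too many against a tail of order exp(-sN/2) with s small. So a
connected set is covered by the neighbourhood of a walk of 2N steps that is recorded only once every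
K steps, K being of order 1/s. This leaves exp(sN/12) covers of at most 375 K³ N boxes, and since
τK³ is tiny, the enlarged volume costs no more than the entropy. Colouring boxes modulo 5 makes the
weights of one colour independent, and Markov's inequality for exp - 1 retains a factor τ, which
makes the bound small already for N = 1.

Consequently P(x ∈ 𝔻) ≤ H with H of order t^640 exp(-t^5), and up to probability H exp(-sR/4) the
event x ∈ 𝔻 is decided by the disorder within 4R + 3 boxes of x. Covariances therefore decay
exponentially at distance of order L/s, and summing them gives Var ≤ C H (L/s)³ |Λ|. Since L³ is
about e^(3t), the factor exp(-t^5) absorbs everything and leaves exp(-t²). The almost sure statement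
follows from Chebyshev and Borel–Cantelli, applied to one set in each dyadic range of volumes,
together with monotonicity of Λ ↦ |𝔻_Λ| (`ae_eventually_le_of_chebyshev`). -/

/-- The frequencies of the eigenfunctions on `{0, …, n - 1}`. -/
noncomputable def freq (n k : ℕ) : BC → ℝ
  | .dirichlet => Real.pi * (k + 1) / (n + 1)
  | .neumann => Real.pi * k / n

/-- The normalising constants of the eigenfunctions. -/
noncomputable def amp (n k : ℕ) : BC → ℝ
  | .dirichlet => Real.sqrt (2 / (n + 1))
  | .neumann => if k = 0 then Real.sqrt (1 / n) else Real.sqrt (2 / n)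

/-- The normalised eigenfunctions of the one-dimensional Laplacian on `{0, …, n - 1}`. -/
noncomputable def mode (bc : BC) (n k : ℕ) (t : ℤ) : ℝ :=
  match bc with
  | .dirichlet => amp n k .dirichlet * Real.sin (freq n k .dirichlet * (t + 1))
  | .neumann => amp n k .neumann * Real.cos (freq n k .neumann * (t + 1 / 2))

/-- The eigenvalues of the one-dimensional Laplacian on `{0, …, n - 1}`. -/
noncomputable def eig (bc : BC) (n k : ℕ) : ℝ := 2 - 2 * Real.cos (freq n k bc)

theorem mode_eigen (bc : BC) (n k : ℕ) (t : ℤ) :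
    (mode bc n k t - mode bc n k (t + 1)) + (mode bc n k t - mode bc n k (t - 1)) =
      eig bc n k * mode bc n k t := by
  cases bc with
  | dirichlet =>
    simp only [mode, eig]
    push_cast
    set θ := freq n k .dirichlet
    have h1 : θ * ((t : ℝ) + 1 + 1) = θ * (t + 1) + θ := by ring
    have h2 : θ * ((t : ℝ) - 1 + 1) = θ * (t + 1) - θ := by ring
    rw [h1, h2, Real.sin_add, Real.sin_sub]
    ring
  | neumann =>
    simp only [mode, eig]
    push_cast
    set θ := freq n k .neumann
    have h1 : θ * ((t : ℝ) + 1 + 1 / 2) = θ * (t + 1 / 2) + θ := by ring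
    have h2 : θ * ((t : ℝ) - 1 + 1 / 2) = θ * (t + 1 / 2) - θ := by ring
    rw [h1, h2, Real.cos_add, Real.cos_sub]
    ring

/-- The ghost sites -1 and n encode the boundary condition. Sine modes vanish there, while cosine
modes are symmetric about -1/2 and n - 1/2, so their discrete normal derivative vanishes. The box
Laplacian of a mode thus equals its free lattice Laplacian. -/
theorem mode_dirichlet_neg_one (n k : ℕ) : mode .dirichlet n k (-1) = 0 := by simp [mode]

theorem mode_dirichlet_end (n k : ℕ) : mode .dirichlet n k n = 0 := by
  have h : freq n k .dirichlet * (((n : ℕ) : ℤ) + 1 : ℝ) = ((k + 1 : ℕ) : ℝ) * Real.pi := by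
    have : (n : ℝ) + 1 ≠ 0 := by positivity
    simp only [freq]
    push_cast
    field_simp
  simp only [mode]
  rw [h, Real.sin_nat_mul_pi, mul_zero]

theorem mode_neumann_neg_one (n k : ℕ) : mode .neumann n k (-1) = mode .neumann n k 0 := by
  simp only [mode]
  rw [← Real.cos_neg]
  congr 2
  push_cast
  ring

theorem mode_neumann_end {n : ℕ} (hn : 0 < n) (k : ℕ) :
    mode .neumann n k n = mode .neumann n k (n - 1) := by
  simp only [mode]
  have hn' : (n : ℝ) ≠ 0 := by positivity
  have h : freq n k .neumann * (((n : ℤ) - 1 : ℤ) + 1 / 2 : ℝ) =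
      (k : ℝ) * (2 * Real.pi) - freq n k .neumann * (((n : ℤ) : ℝ) + 1 / 2) := by
    simp only [freq]
    push_cast
    field_simp
    ring
  rw [h, Real.cos_nat_mul_two_pi_sub]

theorem freq_nonneg (bc : BC) (n k : ℕ) : 0 ≤ freq n k bc := by
  cases bc <;> simp only [freq] <;> positivity

theorem freq_le_pi (bc : BC) {n k : ℕ} (hk : k < n) : freq n k bc ≤ Real.pi := by
  have hk' : (k : ℝ) + 1 ≤ n := by exact_mod_cast hk
  have hn : (0 : ℝ) < n := by linarith [k.cast_nonneg (α := ℝ)]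
  have := Real.pi_pos
  cases bc <;> simp only [freq]
  · rw [div_le_iff₀ (by positivity)]
    nlinarith
  · rw [div_le_iff₀ (by positivity)]
    nlinarith

theorem freq_injective (bc : BC) {n k l : ℕ} (hn : 0 < n) (h : freq n k bc = freq n l bc) :
    k = l := by
  have hn' : (n : ℝ) ≠ 0 := by positivity
  have hn1 : (n : ℝ) + 1 ≠ 0 := by positivity
  have := Real.pi_pos.ne'
  cases bc <;> simp only [freq] at h <;> field_simp at h
  · exact_mod_cast add_right_cancel h
  · exact_mod_cast h

theorem eig_injective (bc : BC) {n k l : ℕ} (hk : k < n) (hl : l < n)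
    (h : eig bc n k = eig bc n l) : k = l := by
  refine freq_injective bc (by omega) (Real.injOn_cos ⟨freq_nonneg bc n k, freq_le_pi bc hk⟩
    ⟨freq_nonneg bc n l, freq_le_pi bc hl⟩ ?_)
  simp only [eig] at h
  linarith

theorem eig_eq (bc : BC) (n k : ℕ) : eig bc n k = 4 * Real.sin (freq n k bc / 2) ^ 2 := by
  rw [eig, Real.sin_sq_eq_half_sub]
  rw [mul_div_cancel₀ _ (two_ne_zero)]
  ring

theorem eig_nonneg (bc : BC) (n k : ℕ) : 0 ≤ eig bc n k := by rw [eig_eq]; positivity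

theorem eig_le (bc : BC) (n k : ℕ) : eig bc n k ≤ 4 := by
  rw [eig]; linarith [Real.neg_one_le_cos (freq n k bc)]

/-- Jordan's inequality sin x ≥ 2x/π applied to 4 sin²(θ/2). Writing `max k 1` gives the Dirichlet
ground state k = 0 the same formula as the other modes. -/
theorem le_eig {bc : BC} {n k : ℕ} (hk : k < n) (h : bc = .dirichlet ∨ 0 < k) :
    (max k 1 : ℕ) ^ 2 / (n : ℝ) ^ 2 ≤ eig bc n k := by
  have hn : (1 : ℝ) ≤ n := by exact_mod_cast (by omega : 1 ≤ n)
  have hpi := Real.pi_pos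
  have h1 : (max k 1 : ℕ) / (n : ℝ) ≤ 2 * (freq n k bc / Real.pi) := by
    rcases h with rfl | h
    · have : ((max k 1 : ℕ) : ℝ) ≤ k + 1 := by exact_mod_cast (by omega : max k 1 ≤ k + 1)
      simp only [freq]
      rw [mul_div_assoc, mul_div_cancel_left₀ _ hpi.ne', ← mul_div_assoc,
        div_le_div_iff₀ (by positivity) (by positivity)]
      have h0 : (0 : ℝ) ≤ k := by positivity
      nlinarith [mul_nonneg h0 (by linarith : (0 : ℝ) ≤ n - 1)]
    · rw [max_eq_left (by omega)]
      have h0 : (0 : ℝ) ≤ (k : ℝ) / n := by positivity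
      cases bc <;> simp only [freq]
      · rw [mul_div_assoc, mul_div_cancel_left₀ _ hpi.ne', ← mul_div_assoc,
          div_le_div_iff₀ (by positivity) (by positivity)]
        have h0 : (0 : ℝ) ≤ k := by positivity
        nlinarith [mul_nonneg h0 (by linarith : (0 : ℝ) ≤ n - 1)]
      · rw [mul_div_assoc, mul_div_cancel_left₀ _ hpi.ne']
        linarith
  have h2 : 2 / Real.pi * (freq n k bc / 2) ≤ Real.sin (freq n k bc / 2) :=
    Real.mul_le_sin (by linarith [freq_nonneg bc n k]) (by linarith [freq_le_pi bc hk])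
  rw [eig_eq, ← div_pow]
  have h3 : (max k 1 : ℕ) / (n : ℝ) ≤ 2 * Real.sin (freq n k bc / 2) := by
    refine h1.trans ?_
    have : 2 * (freq n k bc / Real.pi) = 2 * (2 / Real.pi * (freq n k bc / 2)) := by ring
    rw [this]
    linarith
  have := pow_le_pow_left₀ (by positivity) h3 2
  linarith [this, mul_pow 2 (Real.sin (freq n k bc / 2)) 2]

theorem amp_sq_le (bc : BC) {n : ℕ} (hn : 0 < n) (k : ℕ) : amp n k bc ^ 2 ≤ 2 / n := by
  have hn' : (0 : ℝ) < n := by positivity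
  cases bc <;> simp only [amp]
  · rw [Real.sq_sqrt (by positivity)]
    gcongr
    linarith
  · split_ifs
    · rw [Real.sq_sqrt (by positivity)]
      gcongr
      norm_num
    · rw [Real.sq_sqrt (by positivity)]

theorem mode_sq_le (bc : BC) {n : ℕ} (hn : 0 < n) (k : ℕ) (t : ℤ) :
    mode bc n k t ^ 2 ≤ 2 / n := by
  refine le_trans ?_ (amp_sq_le bc hn k)
  cases bc <;> simp only [mode, mul_pow]
  · exact mul_le_of_le_one_right (sq_nonneg _) (Real.sin_sq_le_one _)
  · exact mul_le_of_le_one_right (sq_nonneg _) (Real.cos_sq_le_one _)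

theorem mode_grad_sq_le (bc : BC) {n : ℕ} (hn : 0 < n) (k : ℕ) (t : ℤ) :
    (mode bc n k (t + 1) - mode bc n k t) ^ 2 ≤ 2 / n * eig bc n k := by
  refine le_trans ?_ (mul_le_mul_of_nonneg_right (amp_sq_le bc hn k) (eig_nonneg bc n k))
  rw [eig_eq]
  cases bc <;> simp only [mode, ← mul_sub, mul_pow] <;>
    refine mul_le_mul_of_nonneg_left ?_ (sq_nonneg _) <;> push_cast
  · set θ := freq n k .dirichlet
    rw [Real.sin_sub_sin]
    have h1 : (θ * ((t : ℝ) + 1 + 1) - θ * (t + 1)) / 2 = θ / 2 := by ring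
    rw [h1]
    have := Real.cos_sq_le_one ((θ * ((t : ℝ) + 1 + 1) + θ * (t + 1)) / 2)
    nlinarith [sq_nonneg (Real.sin (θ / 2))]
  · set θ := freq n k .neumann
    rw [Real.cos_sub_cos]
    have h1 : (θ * ((t : ℝ) + 1 + 1 / 2) - θ * (t + 1 / 2)) / 2 = θ / 2 := by ring
    rw [h1]
    have := Real.sin_sq_le_one ((θ * ((t : ℝ) + 1 + 1 / 2) + θ * (t + 1 / 2)) / 2)
    nlinarith [sq_nonneg (Real.sin (θ / 2))]

/-- Symmetry of the Laplacian in the form of a discrete Wronskian W: multiplied by the difference of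
the eigenvalues, the inner product telescopes to W(0) - W(n), and both terms vanish by the boundary
conditions. The eigenvalues are distinct because cos is injective on [0, π]. -/
theorem sum_mode_mul_of_ne (bc : BC) {n k l : ℕ} (hk : k < n) (hl : l < n) (hkl : k ≠ l) :
    ∑ t ∈ Finset.range n, mode bc n k t * mode bc n l t = 0 := by
  have key : (eig bc n k - eig bc n l) *
      ∑ t ∈ Finset.range n, mode bc n k t * mode bc n l t = 0 := by
    set W : ℕ → ℝ := fun t => mode bc n k t * mode bc n l (t - 1) -
      mode bc n k (t - 1) * mode bc n l t with hW
    have h1 : (eig bc n k - eig bc n l) *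
        ∑ t ∈ Finset.range n, mode bc n k t * mode bc n l t =
        ∑ t ∈ Finset.range n, (W t - W (t + 1)) := by
      rw [Finset.mul_sum]
      refine Finset.sum_congr rfl fun t _ => ?_
      have e1 := mode_eigen bc n k t
      have e2 := mode_eigen bc n l t
      simp only [hW]
      push_cast
      rw [add_sub_cancel_right]
      linear_combination (-mode bc n l t) * e1 + mode bc n k t * e2
    rw [h1, Finset.sum_range_sub']
    simp only [hW]
    cases bc
    · simp [mode_dirichlet_neg_one, mode_dirichlet_end]
    · simp [mode_neumann_neg_one, mode_neumann_end (by omega : 0 < n)]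
  rcases mul_eq_zero.1 key with h | h
  · exact absurd (eig_injective bc hk hl (by linarith)) hkl
  · exact h

/-- The double-angle formula reduces the norm to a sum of cosines in arithmetic progression, which
telescopes after multiplication by 2 sin θ. The constant Neumann mode k = 0, where sin θ = 0, is
treated apart; this is why its normalisation differs. -/
theorem sum_mode_sq (bc : BC) {n k : ℕ} (hk : k < n) :
    ∑ t ∈ Finset.range n, mode bc n k t * mode bc n k t = 1 := by
  have hn : (0 : ℝ) < n := by exact_mod_cast (by omega : 0 < n)
  have hpi := Real.pi_pos
  have hk' : (k : ℝ) + 1 ≤ n := by exact_mod_cast hk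
  cases bc with
  | dirichlet =>
    set θ := freq n k .dirichlet with hθ
    have hθ0 : 0 < θ := by simp only [hθ, freq]; positivity
    have hθ1 : θ < Real.pi := by
      simp only [hθ, freq]
      rw [div_lt_iff₀ (by positivity)]
      nlinarith
    have hs : Real.sin θ ≠ 0 := (Real.sin_pos_of_pos_of_lt_pi hθ0 hθ1).ne'
    have hsum : ∑ t ∈ Finset.range n, Real.cos (2 * (θ * ((t : ℝ) + 1))) = -1 := by
      have h1 : (2 * Real.sin θ) * ∑ t ∈ Finset.range n, Real.cos (2 * (θ * ((t : ℝ) + 1))) =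
          ∑ t ∈ Finset.range n, (Real.sin (θ * (2 * ((t + 1 : ℕ) : ℝ) + 1)) -
            Real.sin (θ * (2 * (t : ℝ) + 1))) := by
        rw [Finset.mul_sum]
        refine Finset.sum_congr rfl fun t _ => ?_
        rw [Real.sin_sub_sin]
        push_cast
        congr 2 <;> ring_nf
      rw [Finset.sum_range_sub (fun t : ℕ => Real.sin (θ * (2 * (t : ℝ) + 1)))] at h1
      have h2 : θ * (2 * (n : ℝ) + 1) = ((k + 1 : ℕ) : ℝ) * (2 * Real.pi) - θ := by
        simp only [hθ, freq]
        push_cast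
        field_simp
        ring
      rw [h2, Real.sin_nat_mul_two_pi_sub] at h1
      simp only [Nat.cast_zero, mul_zero, zero_add, mul_one] at h1
      have h3 : (2 * Real.sin θ) * (∑ t ∈ Finset.range n, Real.cos (2 * (θ * ((t : ℝ) + 1))) + 1)
          = 0 := by rw [mul_add, h1]; ring
      rcases mul_eq_zero.1 h3 with h | h
      · exact absurd h (by positivity)
      · linarith
    have h4 : ∀ t ∈ Finset.range n, mode .dirichlet n k t * mode .dirichlet n k t =
        1 / (n + 1) - 1 / (n + 1) * Real.cos (2 * (θ * ((t : ℝ) + 1))) := by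
      intro t _
      simp only [mode, ← hθ, amp]
      have e := Real.mul_self_sqrt (by positivity : (0 : ℝ) ≤ 2 / (n + 1))
      have e2 := Real.cos_two_mul' (θ * ((t : ℝ) + 1))
      have e3 := Real.sin_sq_add_cos_sq (θ * ((t : ℝ) + 1))
      push_cast
      set S := Real.sin (θ * ((t : ℝ) + 1))
      set R := Real.sqrt (2 / (n + 1))
      have : R * S * (R * S) = (R * R) * S ^ 2 := by ring
      rw [this, e, e2]
      have e4 : Real.cos (θ * ((t : ℝ) + 1)) ^ 2 = 1 - S ^ 2 := by linarith
      rw [e4]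
      ring
    rw [Finset.sum_congr rfl h4, Finset.sum_sub_distrib, ← Finset.mul_sum, hsum]
    simp
    field_simp
  | neumann =>
    rcases Nat.eq_zero_or_pos k with rfl | hk0
    · simp [mode, amp, freq, ← pow_two, Real.sq_sqrt]
      field_simp
    · set θ := freq n k .neumann with hθ
      have hk0' : (0 : ℝ) < k := by positivity
      have hθ0 : 0 < θ := by simp only [hθ, freq]; positivity
      have hθ1 : θ < Real.pi := by
        simp only [hθ, freq]
        rw [div_lt_iff₀ (by positivity)]
        nlinarith
      have hs : Real.sin θ ≠ 0 := (Real.sin_pos_of_pos_of_lt_pi hθ0 hθ1).ne'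
      have hsum : ∑ t ∈ Finset.range n, Real.cos (2 * (θ * ((t : ℝ) + 1 / 2))) = 0 := by
        have h1 : (2 * Real.sin θ) * ∑ t ∈ Finset.range n, Real.cos (2 * (θ * ((t : ℝ) + 1 / 2))) =
            ∑ t ∈ Finset.range n, (Real.sin (θ * (2 * ((t + 1 : ℕ) : ℝ))) -
              Real.sin (θ * (2 * (t : ℝ)))) := by
          rw [Finset.mul_sum]
          refine Finset.sum_congr rfl fun t _ => ?_
          rw [Real.sin_sub_sin]
          push_cast
          congr 2 <;> ring_nf
        rw [Finset.sum_range_sub (fun t : ℕ => Real.sin (θ * (2 * (t : ℝ))))] at h1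
        have h2 : θ * (2 * (n : ℝ)) = ((2 * k : ℕ) : ℝ) * Real.pi := by
          simp only [hθ, freq]
          push_cast
          field_simp
        rw [h2, Real.sin_nat_mul_pi] at h1
        simp only [Nat.cast_zero, mul_zero, Real.sin_zero, sub_zero] at h1
        rcases mul_eq_zero.1 h1 with h | h
        · exact absurd h (by positivity)
        · exact h
      have h4 : ∀ t ∈ Finset.range n, mode .neumann n k t * mode .neumann n k t =
          1 / n + 1 / n * Real.cos (2 * (θ * ((t : ℝ) + 1 / 2))) := by
        intro t _
        simp only [mode, ← hθ, amp, hk0.ne', if_false]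
        have e := Real.mul_self_sqrt (by positivity : (0 : ℝ) ≤ 2 / n)
        have e2 := Real.cos_two_mul (θ * ((t : ℝ) + 1 / 2))
        push_cast
        set S := Real.cos (θ * ((t : ℝ) + 1 / 2))
        set R := Real.sqrt (2 / n)
        have : R * S * (R * S) = (R * R) * S ^ 2 := by ring
        rw [this, e, e2]
        ring
      rw [Finset.sum_congr rfl h4, Finset.sum_add_distrib, ← Finset.mul_sum, hsum]
      simp
      field_simp

theorem sum_mode_mul (bc : BC) {n : ℕ} (k l : Fin n) :
    ∑ t : Fin n, mode bc n k (t : ℕ) * mode bc n l (t : ℕ) = if k = l then 1 else 0 := by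
  rw [Fin.sum_univ_eq_sum_range (fun t => mode bc n k (t : ℕ) * mode bc n l (t : ℕ))]
  split_ifs with h
  · rw [h]; exact sum_mode_sq bc l.2
  · exact sum_mode_mul_of_ne bc k.2 l.2 fun e => h (Fin.ext e)

/-- Completeness of the eigenfunctions. -/
theorem sum_mode_mul_mode (bc : BC) {n : ℕ} (s t : Fin n) :
    ∑ k : Fin n, mode bc n k (s : ℕ) * mode bc n k (t : ℕ) = if s = t then 1 else 0 := by
  let U : Matrix (Fin n) (Fin n) ℝ := Matrix.of fun k t => mode bc n k (t : ℕ)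
  have h1 : U * U.transpose = 1 := by
    ext k l
    simp only [Matrix.mul_apply, Matrix.transpose_apply, U, Matrix.of_apply, Matrix.one_apply]
    exact sum_mode_mul bc k l
  -- Completeness comes for free from orthonormality: n orthonormal vectors in dimension n form a
  -- square matrix, whose right inverse is also a left inverse.
  have h2 : U.transpose * U = 1 := mul_eq_one_comm.1 h1
  have := congrFun (congrFun h2 s) t
  simpa only [Matrix.mul_apply, Matrix.transpose_apply, U, Matrix.of_apply, Matrix.one_apply]
    using this

/-! ### Eigenfunctions on a cube -/

theorem sum_Ico_eq_sum_fin (f : ℤ → ℝ) (a : ℤ) (n : ℕ) :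
    ∑ t ∈ Finset.Ico a (a + n), f (t - a) = ∑ s : Fin n, f (s : ℕ) := by
  rw [Fin.sum_univ_eq_sum_range (fun s => f (s : ℕ))]
  refine Finset.sum_nbij' (fun t => (t - a).toNat) (fun s => a + s) ?_ ?_ ?_ ?_ ?_
  · intro t ht; simp at ht ⊢; omega
  · intro t ht; simp at ht ⊢; omega
  · intro t ht; simp at ht ⊢; omega
  · intro t ht; simp
  · intro t ht
    simp at ht
    rw [Int.toNat_of_nonneg (by omega)]

/-- Sums of products over a cube factorize. -/
theorem sum_cube_prod (f : Fin 3 → ℤ → ℝ) (n : ℕ) (r : Site) :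
    ∑ x ∈ cube n r, ∏ i, f i (x i - r i) = ∏ i, ∑ s : Fin n, f i (s : ℕ) := by
  rw [cube, ← Finset.prod_univ_sum (fun i => Finset.Ico (r i) (r i + n))
    (fun i t => f i (t - r i))]
  exact Finset.prod_congr rfl fun i _ => sum_Ico_eq_sum_fin (f i) (r i) n

theorem card_cube (n : ℕ) (r : Site) : (cube n r).card = n ^ 3 := by
  simp [cube]

/-- Multi-indices of eigenfunctions on a cube of side `n`. -/
abbrev Mode (n : ℕ) := Fin 3 → Fin n

/-- Product eigenfunctions on the cube `cube n r`. -/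
noncomputable def mode3 (bc : BC) (n : ℕ) (r : Site) (k : Mode n) (x : Site) : ℝ :=
  ∏ i, mode bc n (k i) (x i - r i)

/-- The eigenvalues of `-Δ` on a cube. -/
noncomputable def eig3 (bc : BC) {n : ℕ} (k : Mode n) : ℝ := ∑ i, eig bc n (k i)

theorem sum_mode3_mul (bc : BC) {n : ℕ} (r : Site) (k l : Mode n) :
    ∑ x ∈ cube n r, mode3 bc n r k x * mode3 bc n r l x = if k = l then 1 else 0 := by
  simp only [mode3, ← Finset.prod_mul_distrib]
  rw [sum_cube_prod (fun i t => mode bc n (k i) t * mode bc n (l i) t)]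
  simp only [sum_mode_mul]
  rw [Finset.prod_ite_zero]
  simp [funext_iff]

theorem sum_mode3_mul_mode3 (bc : BC) {n : ℕ} {r x y : Site} (hx : x ∈ cube n r)
    (hy : y ∈ cube n r) :
    ∑ k : Mode n, mode3 bc n r k x * mode3 bc n r k y = if x = y then 1 else 0 := by
  rw [mem_cube] at hx hy
  have key : ∀ i, ∑ j : Fin n, mode bc n j (x i - r i) * mode bc n j (y i - r i) =
      if x i = y i then 1 else 0 := by
    intro i
    have h1 := hx i
    have h2 := hy i
    have e1 : x i - r i = (((⟨(x i - r i).toNat, by omega⟩ : Fin n) : ℕ) : ℤ) := by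
      simp only []; omega
    have e2 : y i - r i = (((⟨(y i - r i).toNat, by omega⟩ : Fin n) : ℕ) : ℤ) := by
      simp only []; omega
    rw [e1, e2, sum_mode_mul_mode]
    refine if_congr ?_ rfl rfl
    rw [Fin.mk.injEq]
    omega
  simp only [mode3, ← Finset.prod_mul_distrib]
  have := Finset.prod_univ_sum (fun _ : Fin 3 => (Finset.univ : Finset (Fin n)))
    (fun i j => mode bc n j (x i - r i) * mode bc n j (y i - r i))
  rw [Fintype.piFinset_univ] at this
  rw [← this]
  simp only [key]
  rw [Finset.prod_ite_zero]
  simp [funext_iff]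

theorem mode3_sq_le (bc : BC) {n : ℕ} (hn : 0 < n) (r : Site) (k : Mode n) (x : Site) :
    mode3 bc n r k x ^ 2 ≤ (2 / n) ^ 3 := by
  rw [mode3, ← Finset.prod_pow]
  refine (Finset.prod_le_prod (fun i _ => sq_nonneg _)
    fun i _ => mode_sq_le bc hn (k i) (x i - r i)).trans (by simp [div_pow])

theorem mode3_grad_sq_le (bc : BC) {n : ℕ} (hn : 0 < n) (r : Site) (k : Mode n) (x : Site)
    (i : Fin 3) :
    (mode3 bc n r k (x + unit i) - mode3 bc n r k x) ^ 2 ≤ (2 / n) ^ 3 * eig3 bc k := by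
  have h : ∀ j, mode bc n (k j) (x j - r j) ^ 2 ≤ 2 / n := fun j => mode_sq_le bc hn _ _
  have hpos : (0 : ℝ) ≤ 2 / n := by positivity
  have main : (mode3 bc n r k (x + unit i) - mode3 bc n r k x) ^ 2 ≤
      (2 / n) ^ 3 * eig bc n (k i) := by
    have e : mode3 bc n r k (x + unit i) - mode3 bc n r k x =
        (mode bc n (k i) (x i - r i + 1) - mode bc n (k i) (x i - r i)) *
          ∏ j ∈ Finset.univ.erase i, mode bc n (k j) (x j - r j) := by
      rw [mode3, mode3, ← Finset.mul_prod_erase _ _ (Finset.mem_univ i),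
        ← Finset.mul_prod_erase (Finset.univ) (fun j => mode bc n (k j) (x j - r j))
          (Finset.mem_univ i), sub_mul]
      congr 2
      · simp [unit]; ring_nf
      · refine Finset.prod_congr rfl fun j hj => ?_
        simp [unit, Finset.ne_of_mem_erase hj]
    rw [e, mul_pow, ← Finset.prod_pow]
    have h2 : ∏ j ∈ Finset.univ.erase i, mode bc n (k j) (x j - r j) ^ 2 ≤ (2 / (n : ℝ)) ^ 2 := by
      refine (Finset.prod_le_prod (fun j _ => sq_nonneg _) fun j _ => h j).trans ?_
      simp [div_pow]
    refine (mul_le_mul (mode_grad_sq_le bc hn _ _) h2 (Finset.prod_nonneg fun j _ => sq_nonneg _)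
      (mul_nonneg hpos (eig_nonneg _ _ _))).trans (le_of_eq ?_)
    ring
  refine main.trans (mul_le_mul_of_nonneg_left ?_ (by positivity))
  exact Finset.single_le_sum (f := fun j => eig bc n (k j)) (fun j _ => eig_nonneg _ _ _)
    (Finset.mem_univ i)

theorem eig3_nonneg (bc : BC) {n : ℕ} (k : Mode n) : 0 ≤ eig3 bc k :=
  Finset.sum_nonneg fun _ _ => eig_nonneg _ _ _

theorem eig3_le (bc : BC) {n : ℕ} (k : Mode n) : eig3 bc k ≤ 12 := by
  rw [eig3, Fin.sum_univ_three]
  linarith [eig_le bc n (k 0), eig_le bc n (k 1), eig_le bc n (k 2)]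

/-- The modes on which `-Δ` is inverted: all of them (Dirichlet), the nonconstant ones (Neumann). -/
def Active (bc : BC) {n : ℕ} (k : Mode n) : Prop := bc = .dirichlet ∨ ∃ i, 0 < (k i : ℕ)

/-- The factor 3 pays for vanishing Neumann components. A zero component contributes 1 to the sum S
on the left and possibly nothing to the eigenvalue. An active mode has at most two of them, so the
eigenvalue is at least (S - 2)/n², and S ≥ 3 gives S - 2 ≥ S/3. -/
theorem le_eig3 {bc : BC} {n : ℕ} {k : Mode n} (hk : Active bc k) :
    (∑ i, (max (k i : ℕ) 1 : ℕ) ^ 2 : ℝ) / (3 * n ^ 2) ≤ eig3 bc k := by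
  have hn : (0 : ℝ) < n := by exact_mod_cast (k 0).pos
  rcases hk with rfl | ⟨i, hi⟩
  · rw [eig3, Finset.sum_div]
    refine Finset.sum_le_sum fun j _ => le_trans ?_ (le_eig (k j).2 (Or.inl rfl))
    gcongr
    nlinarith
  · have h1 : ∀ j, (((max (k j : ℕ) 1 : ℕ) : ℝ) ^ 2 - 1) / n ^ 2 ≤ eig bc n (k j) := by
      intro j
      rcases Nat.eq_zero_or_pos (k j : ℕ) with h | h
      · rw [h]; simpa using eig_nonneg bc n 0
      · refine le_trans ?_ (le_eig (k j).2 (Or.inr h))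
        gcongr
        linarith
    have h2 : ((max (k i : ℕ) 1 : ℕ) : ℝ) ^ 2 / n ^ 2 ≤ eig bc n (k i) :=
      le_eig (k i).2 (Or.inr hi)
    have h3 : ∀ j, (1 : ℝ) ≤ ((max (k j : ℕ) 1 : ℕ) : ℝ) ^ 2 := fun j => by
      have : (1 : ℝ) ≤ ((max (k j : ℕ) 1 : ℕ) : ℝ) := by exact_mod_cast le_max_right _ _
      nlinarith
    rw [eig3]
    have h4 : ∑ j, (((max (k j : ℕ) 1 : ℕ) : ℝ) ^ 2 - (if j = i then 0 else 1)) / n ^ 2 ≤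
        ∑ j, eig bc n (k j) := by
      refine Finset.sum_le_sum fun j _ => ?_
      split_ifs with hj
      · rw [hj, sub_zero]; exact h2
      · exact h1 j
    refine le_trans ?_ h4
    rw [← Finset.sum_div, div_le_div_iff₀ (by positivity) (by positivity), ← mul_assoc]
    refine mul_le_mul_of_nonneg_right ?_ (by positivity)
    rw [Finset.sum_sub_distrib]
    have h5 : ∑ j : Fin 3, (if j = i then (0 : ℝ) else 1) = 2 := by
      fin_cases i <;> simp [Fin.sum_univ_three] <;> norm_num
    rw [h5, Fin.sum_univ_three]
    linarith [h3 0, h3 1, h3 2]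

theorem eig3_pos {bc : BC} {n : ℕ} {k : Mode n} (hk : Active bc k) : 0 < eig3 bc k := by
  have hn : (0 : ℝ) < n := by exact_mod_cast (k 0).pos
  refine lt_of_lt_of_le ?_ (le_eig3 hk)
  refine div_pos (Finset.sum_pos (fun j _ => ?_) Finset.univ_nonempty) (by positivity)
  have : 0 < ((max (k j : ℕ) 1 : ℕ) : ℝ) := by exact_mod_cast (by omega : 0 < max (k j : ℕ) 1)
  positivity

theorem inv_sq_le_eig3 {bc : BC} {n : ℕ} {k : Mode n} (hk : Active bc k) :
    1 / (n : ℝ) ^ 2 ≤ eig3 bc k := by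
  have hn : (0 : ℝ) < n := by exact_mod_cast (k 0).pos
  refine le_trans ?_ (le_eig3 hk)
  rw [div_le_div_iff₀ (by positivity) (by positivity), one_mul]
  refine mul_le_mul_of_nonneg_right ?_ (by positivity)
  have h3 : ∀ j, (1 : ℝ) ≤ ((max (k j : ℕ) 1 : ℕ) : ℝ) ^ 2 := fun j => by
    have : (1 : ℝ) ≤ ((max (k j : ℕ) 1 : ℕ) : ℝ) := by exact_mod_cast le_max_right _ _
    nlinarith
  rw [Fin.sum_univ_three]
  linarith [h3 0, h3 1, h3 2]

/-! ### Spectral representation of the fields on a cube. -/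

/-- The function with given coefficients in the eigenbasis. -/
noncomputable def synth (bc : BC) {n : ℕ} (r : Site) (c : Mode n → ℝ) (x : Site) : ℝ :=
  ∑ k, c k * mode3 bc n r k x

theorem synth_eigen (bc : BC) {n : ℕ} (r : Site) (c : Mode n → ℝ) (x : Site) :
    ∑ i, ((synth bc r c x - synth bc r c (x + unit i)) +
      (synth bc r c x - synth bc r c (x - unit i))) =
      ∑ k, c k * eig3 bc k * mode3 bc n r k x := by
  have h : ∀ k : Mode n, ∑ i, ((mode3 bc n r k x - mode3 bc n r k (x + unit i)) +
      (mode3 bc n r k x - mode3 bc n r k (x - unit i))) = eig3 bc k * mode3 bc n r k x := by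
    intro k
    rw [eig3, Finset.sum_mul]
    refine Finset.sum_congr rfl fun i _ => ?_
    have e : ∀ t : ℤ, mode3 bc n r k (x + t • unit i) = mode bc n (k i) (x i - r i + t) *
        ∏ j ∈ Finset.univ.erase i, mode bc n (k j) (x j - r j) := by
      intro t
      rw [mode3, ← Finset.mul_prod_erase _ _ (Finset.mem_univ i)]
      congr 1
      · simp [unit]; ring_nf
      · refine Finset.prod_congr rfl fun j hj => ?_
        simp [unit, Finset.ne_of_mem_erase hj]
    have e0 := e 0
    have e1 := e 1
    have e2 := e (-1)
    simp only [zero_smul, one_smul, add_zero, neg_smul, ← sub_eq_add_neg] at e0 e1 e2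
    rw [e0, e1, e2, ← mul_assoc, ← mode_eigen]
    ring
  simp only [synth, ← Finset.sum_sub_distrib, ← Finset.sum_add_distrib]
  rw [Finset.sum_comm]
  refine Finset.sum_congr rfl fun k _ => ?_
  rw [mul_assoc, ← h k, Finset.mul_sum]
  exact Finset.sum_congr rfl fun i _ => by ring

/-- Restriction to a finite set, extended by zero. -/
noncomputable def cut (Q : Finset Site) (f : Site → ℝ) (x : Site) : ℝ := if x ∈ Q then f x else 0

theorem mode3_eq_mul (bc : BC) {n : ℕ} (r : Site) (k : Mode n) (x : Site) (i : Fin 3) :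
    mode3 bc n r k x = mode bc n (k i) (x i - r i) *
      ∏ j ∈ Finset.univ.erase i, mode bc n (k j) (x j - r j) := by
  rw [mode3, ← Finset.mul_prod_erase _ _ (Finset.mem_univ i)]

theorem mem_cube_add_unit {n : ℕ} {r x : Site} (hx : x ∈ cube n r) {i : Fin 3}
    (h : x + unit i ∉ cube n r) : x i - r i = n - 1 := by
  rw [mem_cube] at hx h
  push Not at h
  obtain ⟨j, hj⟩ := h
  have h1 := hx j
  rcases eq_or_ne j i with rfl | hji
  · simp [unit] at hj; omega
  · simp [unit, hji] at hj; omega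

theorem mem_cube_sub_unit {n : ℕ} {r x : Site} (hx : x ∈ cube n r) {i : Fin 3}
    (h : x - unit i ∉ cube n r) : x i - r i = 0 := by
  rw [mem_cube] at hx h
  push Not at h
  obtain ⟨j, hj⟩ := h
  have h1 := hx j
  rcases eq_or_ne j i with rfl | hji
  · simp [unit] at hj; omega
  · simp [unit, hji] at hj; omega

theorem synth_eq_of_mode_eq (bc : BC) {n : ℕ} (r : Site) (c : Mode n → ℝ) {x y : Site} (i : Fin 3)
    (h : ∀ j, j ≠ i → x j = y j)
    (hm : ∀ k : Mode n, mode bc n (k i) (x i - r i) = mode bc n (k i) (y i - r i)) :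
    synth bc r c x = synth bc r c y := by
  refine Finset.sum_congr rfl fun k _ => ?_
  rw [mode3_eq_mul bc r k x i, mode3_eq_mul bc r k y i, hm]
  congr 2
  exact Finset.prod_congr rfl fun j hj => by rw [h j (Finset.ne_of_mem_erase hj)]

theorem synth_eq_zero_of_mode_eq (bc : BC) {n : ℕ} (r : Site) (c : Mode n → ℝ) {x : Site}
    (i : Fin 3) (hm : ∀ k : Mode n, mode bc n (k i) (x i - r i) = 0) :
    synth bc r c x = 0 := by
  refine Finset.sum_eq_zero fun k _ => ?_
  rw [mode3_eq_mul bc r k x i, hm]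
  simp

theorem cut_synth_add_unit {n : ℕ} {r : Site} (c : Mode n → ℝ) {x : Site} (hx : x ∈ cube n r)
    (i : Fin 3) : cut (cube n r) (synth .dirichlet r c) (x + unit i) =
      synth .dirichlet r c (x + unit i) := by
  rw [cut]
  split_ifs with h
  · rfl
  · refine (synth_eq_zero_of_mode_eq _ r c i fun k => ?_).symm
    have := mem_cube_add_unit hx h
    have e : (x + unit i) i - r i = n := by simp [unit]; omega
    rw [e, mode_dirichlet_end]

theorem cut_synth_sub_unit {n : ℕ} {r : Site} (c : Mode n → ℝ) {x : Site} (hx : x ∈ cube n r)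
    (i : Fin 3) : cut (cube n r) (synth .dirichlet r c) (x - unit i) =
      synth .dirichlet r c (x - unit i) := by
  rw [cut]
  split_ifs with h
  · rfl
  · refine (synth_eq_zero_of_mode_eq _ r c i fun k => ?_).symm
    have := mem_cube_sub_unit hx h
    have e : (x - unit i) i - r i = -1 := by simp [unit]; omega
    rw [e, mode_dirichlet_neg_one]

/-- By the behaviour of the modes at the ghost sites, cutting a combination of modes off outside the
cube does not disturb the box Laplacian. In the Dirichlet case the combination is already zero at
outer neighbours; in the Neumann case the omitted differences are zero. -/
theorem negLaplacian_cut_synth (bc : BC) {n : ℕ} {r : Site} (c : Mode n → ℝ) {x : Site}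
    (hx : x ∈ cube n r) :
    negLaplacian (cube n r) (cut (cube n r) (synth bc r c)) x bc =
      ∑ k, c k * eig3 bc k * mode3 bc n r k x := by
  have hx0 : cut (cube n r) (synth bc r c) x = synth bc r c x := by simp [cut, hx]
  have hn : 0 < n := by
    have := mem_cube.1 hx 0
    omega
  rw [← synth_eigen]
  cases bc with
  | dirichlet =>
    simp only [negLaplacian]
    refine Finset.sum_congr rfl fun i _ => ?_
    rw [hx0, cut_synth_add_unit c hx, cut_synth_sub_unit c hx]
  | neumann =>
    simp only [negLaplacian]
    refine Finset.sum_congr rfl fun i _ => ?_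
    rw [hx0]
    congr 1
    · split_ifs with h
      · simp [cut, h]
      · rw [synth_eq_of_mode_eq _ r c (y := x + unit i) i (fun j hj => by simp [unit, hj])
          fun k => ?_, sub_self]
        have := mem_cube_add_unit hx h
        have e : (x + unit i) i - r i = n := by simp [unit]; omega
        rw [e, this, mode_neumann_end hn]
    · split_ifs with h
      · simp [cut, h]
      · rw [synth_eq_of_mode_eq _ r c (y := x - unit i) i (fun j hj => by simp [unit, hj])
          fun k => ?_, sub_self]
        have := mem_cube_sub_unit hx h
        have e : (x - unit i) i - r i = -1 := by simp [unit]; omega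
        rw [e, this, mode_neumann_neg_one]

/-- The coefficients of a function on a cube in the eigenbasis. -/
noncomputable def coef (bc : BC) {n : ℕ} (r : Site) (a : Site → ℝ) (k : Mode n) : ℝ :=
  ∑ x ∈ cube n r, a x * mode3 bc n r k x

theorem synth_coef (bc : BC) {n : ℕ} {r : Site} (a : Site → ℝ) {x : Site} (hx : x ∈ cube n r) :
    synth bc r (fun k : Mode n => coef bc r a k) x = a x := by
  simp only [synth, coef, Finset.sum_mul]
  rw [Finset.sum_comm]
  simp only [mul_assoc, ← Finset.mul_sum]
  rw [Finset.sum_congr rfl fun y hy => by rw [sum_mode3_mul_mode3 bc hy hx]]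
  simp [hx]

theorem sum_synth_mul_synth (bc : BC) {n : ℕ} (r : Site) (c d : Mode n → ℝ) :
    ∑ x ∈ cube n r, synth bc r c x * synth bc r d x = ∑ k, c k * d k := by
  simp only [synth, Finset.sum_mul_sum]
  rw [Finset.sum_comm]
  refine Finset.sum_congr rfl fun k _ => ?_
  rw [Finset.sum_comm]
  have : ∀ l, ∑ x ∈ cube n r, c k * mode3 bc n r k x * (d l * mode3 bc n r l x) =
      c k * d l * if k = l then 1 else 0 := by
    intro l
    rw [← sum_mode3_mul bc r k l, Finset.mul_sum]
    exact Finset.sum_congr rfl fun x _ => by ring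
  simp [this]

open Classical in
/-- The coefficients of `ε (-Δ_Q + lam)⁻¹ a` in the eigenbasis. -/
noncomputable def fieldCoef (bc : BC) (ε lam : ℝ) {n : ℕ} (r : Site) (a : Site → ℝ)
    (k : Mode n) : ℝ :=
  if Active bc k then ε * coef bc r a k / (eig3 bc k + lam) else 0

theorem mode3_inactive {n : ℕ} (r : Site) {k : Mode n} (hk : ¬ Active .neumann k) (x : Site) :
    mode3 .neumann n r k x = Real.sqrt (1 / n) ^ 3 := by
  have h : ∀ i, (k i : ℕ) = 0 := by
    intro i
    by_contra hc
    exact hk (Or.inr ⟨i, Nat.pos_of_ne_zero hc⟩)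
  simp [mode3, mode, h, amp, freq]

theorem sum_inactive {n : ℕ} (hn : 0 < n) {r : Site} (a : Site → ℝ) (x : Site) :
    (∑ k : Mode n, open Classical in if Active .neumann k then 0 else
      coef .neumann r a k * mode3 .neumann n r k x) = average a (cube n r) := by
  classical
  have h0 : ¬ Active .neumann (fun _ => ⟨0, hn⟩ : Mode n) := by
    rintro (h | ⟨i, hi⟩)
    · cases h
    · simp at hi
  rw [Finset.sum_eq_single (fun _ => ⟨0, hn⟩ : Mode n)]
  · rw [if_neg h0, coef]
    simp only [mode3_inactive r h0]
    rw [← Finset.sum_mul, average, card_cube]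
    have : Real.sqrt (1 / (n : ℝ)) * Real.sqrt (1 / n) = 1 / n := Real.mul_self_sqrt (by positivity)
    calc (∑ y ∈ cube n r, a y) * √(1 / ↑n) ^ 3 * √(1 / ↑n) ^ 3 =
        (∑ y ∈ cube n r, a y) * (Real.sqrt (1 / (n : ℝ)) * Real.sqrt (1 / n)) ^ 3 := by ring
      _ = _ := by rw [this]; push_cast; field_simp
  · intro k _ hk
    rw [if_pos]
    refine Or.inr ?_
    by_contra hc
    push Not at hc
    exact hk (funext fun i => Fin.ext (Nat.le_zero.1 (hc i)))
  · simp

/-- Dividing each active coefficient by its eigenvalue plus the mass solves the equation up to the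
inactive modes. There are none in the Dirichlet case; in the Neumann case the only one is the
constant mode, whose contribution is the average of the disorder, as the definition of the field
requires. -/
theorem isField_synth (bc : BC) (ε : ℝ) {lam : ℝ} (hl : 0 ≤ lam) {n : ℕ} (hn : 0 < n) (r : Site)
    (a : Site → ℝ) : IsField ε lam (cube n r) a
      (cut (cube n r) (synth bc r (fun k : Mode n => fieldCoef bc ε lam r a k))) bc := by
  classical
  have hx0 : ∀ x ∉ cube n r,
      cut (cube n r) (synth bc r (fun k : Mode n => fieldCoef bc ε lam r a k)) x = 0 :=
    fun x hx => by simp [cut, hx]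
  have heq : ∀ x ∈ cube n r, negLaplacian (cube n r)
      (cut (cube n r) (synth bc r (fun k : Mode n => fieldCoef bc ε lam r a k))) x bc +
      lam * cut (cube n r) (synth bc r (fun k : Mode n => fieldCoef bc ε lam r a k)) x =
      ε * (a x - ∑ k : Mode n, if Active bc k then 0 else coef bc r a k * mode3 bc n r k x) := by
    intro x hx
    rw [negLaplacian_cut_synth bc _ hx]
    rw [← synth_coef bc a hx]
    simp only [cut, hx, if_true, synth]
    rw [Finset.mul_sum, ← Finset.sum_add_distrib, ← Finset.sum_sub_distrib, Finset.mul_sum]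
    refine Finset.sum_congr rfl fun k _ => ?_
    simp only [fieldCoef]
    split_ifs with hk
    · have := eig3_pos hk
      field_simp
      ring
    · ring
  cases bc with
  | dirichlet =>
    refine ⟨hx0, fun x hx => ?_⟩
    rw [heq x hx]
    congr 1
    simp [Active]
  | neumann =>
    refine ⟨hx0, ?_, fun x hx => by rw [heq x hx, sum_inactive hn]⟩
    have h0 : ¬ Active .neumann (fun _ => ⟨0, hn⟩ : Mode n) := by
      rintro (h | ⟨i, hi⟩)
      · cases h
      · simp at hi
    -- The mean-zero condition is tested by pairing the solution with the constant mode, on which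
    -- its coefficient is zero.
    have h1 := sum_synth_mul_synth .neumann r
      (fun k : Mode n => fieldCoef .neumann ε lam r a k) (Pi.single (fun _ => ⟨0, hn⟩) 1)
    have h2 : ∀ x, synth .neumann r (Pi.single (fun _ => ⟨0, hn⟩ : Mode n) 1) x =
        Real.sqrt (1 / n) ^ 3 := by
      intro x
      rw [synth, Finset.sum_eq_single (fun _ => ⟨0, hn⟩ : Mode n)]
      · rw [mode3_inactive r h0]; simp
      · intro k _ hk; rw [Pi.single_eq_of_ne hk]; simp
      · simp
    simp only [h2, ← Finset.sum_mul] at h1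
    have h3 : ∑ k : Mode n, fieldCoef .neumann ε lam r a k *
        (Pi.single (fun _ => ⟨0, hn⟩ : Mode n) (1 : ℝ) : Mode n → ℝ) k = 0 := by
      refine Finset.sum_eq_zero fun k _ => ?_
      by_cases hk : k = fun _ => ⟨0, hn⟩
      · rw [fieldCoef, if_neg (by rw [hk]; exact h0), zero_mul]
      · rw [Pi.single_eq_of_ne hk, mul_zero]
    rw [h3] at h1
    have hpos : 0 < Real.sqrt (1 / (n : ℝ)) ^ 3 := by positivity
    rcases mul_eq_zero.1 h1 with h | h
    · rw [← h]
      exact Finset.sum_congr rfl fun x hx => by simp [cut, hx]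
    · exact absurd h hpos.ne'

theorem field_eq (bc : BC) (ε : ℝ) {lam : ℝ} (hl : 0 ≤ lam) {n : ℕ} (hn : 0 < n) (r : Site)
    (a : Site → ℝ) : field ε lam (cube n r) a bc =
      cut (cube n r) (synth bc r (fun k : Mode n => fieldCoef bc ε lam r a k)) :=
  (field_spec ε hl hn r a bc).unique hl (isField_synth bc ε hl hn r a)

/-! ### Energies -/

/-- The lower endpoints of the edges in direction `i`. -/
def edgeBase (Q : Finset Site) (i : Fin 3) : BC → Finset Site
  | .dirichlet => Q ∪ Q.image fun x => x - unit i
  | .neumann => Q.filter fun x => x + unit i ∈ Q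

theorem unit_injective : Function.Injective unit := fun i j h => by
  by_contra hij
  have := congrFun h i
  simp [unit, hij] at this

theorem mem_edges_dirichlet {Q : Finset Site} {e : Site × Site} :
    e ∈ edges Q .dirichlet ↔ ∃ i, e.2 = e.1 + unit i ∧ (e.1 ∈ Q ∨ e.2 ∈ Q) := by
  simp only [edges, Finset.mem_biUnion, Finset.mem_univ, true_and, Finset.mem_insert,
    Finset.mem_singleton]
  constructor
  · rintro ⟨x, hx, i, rfl | rfl⟩
    · exact ⟨i, rfl, Or.inl hx⟩
    · exact ⟨i, by simp, Or.inr hx⟩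
  · rintro ⟨i, h, h1 | h1⟩
    · exact ⟨e.1, h1, i, Or.inl (Prod.ext rfl h)⟩
    · exact ⟨e.2, h1, i, Or.inr (Prod.ext (by simp [h]) rfl)⟩

theorem mem_edges_neumann {Q : Finset Site} {e : Site × Site} :
    e ∈ edges Q .neumann ↔ ∃ i, e.2 = e.1 + unit i ∧ (e.1 ∈ Q ∧ e.2 ∈ Q) := by
  have : e ∈ edges Q .neumann ↔ e ∈ edges Q .dirichlet ∧ (e.1 ∈ Q ∧ e.2 ∈ Q) := by
    simp only [edges, Finset.mem_filter]
  rw [this, mem_edges_dirichlet]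
  constructor
  · rintro ⟨⟨i, h, _⟩, h2⟩; exact ⟨i, h, h2⟩
  · rintro ⟨i, h, h2⟩; exact ⟨⟨i, h, Or.inl h2.1⟩, h2⟩

theorem mem_edges {Q : Finset Site} {bc : BC} {e : Site × Site} :
    e ∈ edges Q bc ↔ ∃ i, e.2 = e.1 + unit i ∧ e.1 ∈ edgeBase Q i bc := by
  cases bc with
  | dirichlet =>
    rw [mem_edges_dirichlet]
    refine exists_congr fun i => and_congr_right fun h => ?_
    simp only [edgeBase, Finset.mem_union, Finset.mem_image, h]
    refine or_congr Iff.rfl ⟨fun h => ⟨_, h, by simp⟩, ?_⟩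
    rintro ⟨x, hx, hx2⟩
    rw [← hx2]; simpa using hx
  | neumann =>
    rw [mem_edges_neumann]
    refine exists_congr fun i => and_congr_right fun h => ?_
    simp only [edgeBase, Finset.mem_filter, h]

theorem sum_edges (Q : Finset Site) (bc : BC) (F : Site × Site → ℝ) :
    ∑ e ∈ edges Q bc, F e = ∑ i, ∑ x ∈ edgeBase Q i bc, F (x, x + unit i) := by
  rw [Finset.sum_sigma']
  symm
  refine Finset.sum_bij (fun p _ => (p.2, p.2 + unit p.1)) ?_ ?_ ?_ ?_
  · rintro ⟨i, x⟩ h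
    simp only [Finset.mem_sigma, Finset.mem_univ, true_and] at h
    exact mem_edges.2 ⟨i, rfl, h⟩
  · rintro ⟨i, x⟩ _ ⟨j, y⟩ _ h
    simp only [Prod.mk.injEq] at h
    obtain ⟨rfl, h⟩ := h
    rw [unit_injective (add_left_cancel h)]
  · intro e he
    obtain ⟨i, h, h1⟩ := mem_edges.1 he
    exact ⟨⟨i, e.1⟩, by simpa using h1, Prod.ext rfl h.symm⟩
  · intros; rfl

/-- Summation by parts. There are no boundary terms: in the Dirichlet case g vanishes off Q, and in
the Neumann case only edges inside Q occur on either side. -/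
theorem gradSq_eq_sum_mul (Q : Finset Site) (bc : BC) {g : Site → ℝ} (hg : ∀ x ∉ Q, g x = 0) :
    gradSq Q bc g = ∑ x ∈ Q, g x * negLaplacian Q g x bc := by
  rw [gradSq, sum_edges]
  have hshift : ∀ i, ∀ F : Site → ℝ, (∀ x ∉ Q, F x = 0) →
      ∑ x ∈ edgeBase Q i .dirichlet, F x = ∑ x ∈ Q, F x := by
    intro i F hF
    exact (Finset.sum_subset Finset.subset_union_left fun x _ hx => hF x hx).symm
  have hshift' : ∀ i, ∀ F : Site → ℝ, (∀ x ∉ Q, F x = 0) →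
      ∑ x ∈ edgeBase Q i .dirichlet, F (x + unit i) = ∑ x ∈ Q, F x := by
    intro i F hF
    rw [edgeBase, ← Finset.sum_subset (s₁ := Q.image fun x => x - unit i) Finset.subset_union_right,
      Finset.sum_image (fun x _ y _ h => sub_left_injective h)]
    · simp
    · intro x _ hx
      refine hF _ fun h => hx (Finset.mem_image.2 ⟨_, h, by simp⟩)
  cases bc with
  | dirichlet =>
    simp only [negLaplacian, Finset.mul_sum, grad]
    rw [Finset.sum_comm (s := Q)]
    refine Finset.sum_congr rfl fun i _ => ?_
    have h1 := hshift i (fun x => g x * (g x - g (x + unit i))) fun x hx => by simp [hg x hx]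
    have h2 := hshift' i (fun x => g x * (g x - g (x - unit i))) fun x hx => by simp [hg x hx]
    simp only [add_sub_cancel_right] at h2
    simp only [mul_add, Finset.sum_add_distrib]
    rw [← h1, ← h2, ← Finset.sum_add_distrib]
    exact Finset.sum_congr rfl fun x _ => by ring
  | neumann =>
    simp only [negLaplacian, Finset.mul_sum, grad, edgeBase]
    rw [Finset.sum_comm (s := Q)]
    refine Finset.sum_congr rfl fun i _ => ?_
    have h2 : ∑ x ∈ Q, g x * (if x - unit i ∈ Q then g x - g (x - unit i) else 0) =
        ∑ x ∈ Q with x + unit i ∈ Q, g (x + unit i) * (g (x + unit i) - g x) := by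
      simp only [mul_ite, mul_zero, ← Finset.sum_filter]
      refine Finset.sum_nbij' (fun x => x - unit i) (fun x => x + unit i) ?_ ?_ ?_ ?_ ?_ <;>
        simp +contextual
    simp only [mul_add, Finset.sum_add_distrib]
    rw [h2]
    simp only [mul_ite, mul_zero, ← Finset.sum_filter]
    rw [← Finset.sum_add_distrib]
    exact Finset.sum_congr rfl fun x _ => by ring

theorem sum_field_sq (bc : BC) (ε : ℝ) {lam : ℝ} (hl : 0 ≤ lam) {n : ℕ} (hn : 0 < n) (r : Site)
    (a : Site → ℝ) : ∑ x ∈ cube n r, field ε lam (cube n r) a bc x ^ 2 =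
      ∑ k : Mode n, fieldCoef bc ε lam r a k ^ 2 := by
  rw [field_eq bc ε hl hn]
  simp only [pow_two]
  rw [← sum_synth_mul_synth bc r]
  exact Finset.sum_congr rfl fun x hx => by simp [cut, hx]

theorem gradSq_field (bc : BC) (ε : ℝ) {lam : ℝ} (hl : 0 ≤ lam) {n : ℕ} (hn : 0 < n) (r : Site)
    (a : Site → ℝ) : gradSq (cube n r) bc (field ε lam (cube n r) a bc) =
      ∑ k : Mode n, eig3 bc k * fieldCoef bc ε lam r a k ^ 2 := by
  rw [field_eq bc ε hl hn, gradSq_eq_sum_mul _ _ fun x hx => by simp [cut, hx]]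
  have : ∀ x ∈ cube n r, cut (cube n r) (synth bc r fun k : Mode n => fieldCoef bc ε lam r a k) x *
      negLaplacian (cube n r) (cut (cube n r) (synth bc r fun k : Mode n => fieldCoef bc ε lam r a k)) x bc
      = synth bc r (fun k : Mode n => fieldCoef bc ε lam r a k) x *
        synth bc r (fun k : Mode n => fieldCoef bc ε lam r a k * eig3 bc k) x := by
    intro x hx
    rw [negLaplacian_cut_synth bc _ hx]
    simp [cut, hx, synth]
  rw [Finset.sum_congr rfl this, sum_synth_mul_synth]
  exact Finset.sum_congr rfl fun k _ => by ring

/-! ### Sums over the spectrum -/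

theorem sum_one_div_sq_le (n : ℕ) :
    ∑ t ∈ Finset.range n, 1 / ((max t 1 : ℕ) : ℝ) ^ 2 ≤ 3 := by
  have h : ∀ m : ℕ, ∑ t ∈ Finset.range (m + 2), 1 / ((max t 1 : ℕ) : ℝ) ^ 2 ≤
      3 - 1 / ((m : ℝ) + 1) := by
    intro m
    induction m with
    | zero => norm_num [Finset.sum_range_succ]
    | succ m ih =>
      rw [Finset.sum_range_succ]
      refine (add_le_add_left ih _).trans ?_
      rw [max_eq_left (by omega)]
      push_cast
      have h1 : (1 : ℝ) / ((m : ℝ) + 2) ^ 2 ≤ 1 / ((m + 1) * (m + 2)) := by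
        apply one_div_le_one_div_of_le (by positivity)
        nlinarith [(m.cast_nonneg : (0 : ℝ) ≤ m)]
      have h2 : (1 : ℝ) / ((m + 1) * (m + 2)) = 1 / (m + 1) - 1 / (m + 2) := by
        field_simp; ring
      have e : (m : ℝ) + 1 + 1 = m + 2 := by ring
      rw [e]
      linarith
  calc _ ≤ ∑ t ∈ Finset.range (n + 2), 1 / ((max t 1 : ℕ) : ℝ) ^ 2 :=
        Finset.sum_le_sum_of_subset_of_nonneg (by simp) fun _ _ _ => by positivity
    _ ≤ 3 - 1 / ((n : ℝ) + 1) := h n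
    _ ≤ 3 := by linarith [show (0 : ℝ) ≤ 1 / ((n : ℝ) + 1) by positivity]

/-- A sum over multi-indices is controlled by their largest component. -/
theorem sum_mode_le_of_max {n : ℕ} (F : Mode n → ℝ) (G : Fin n → ℝ) (hG : ∀ t, 0 ≤ G t)
    (h : ∀ k i, (∀ j, k j ≤ k i) → F k ≤ G (k i)) :
    ∑ k, F k ≤ 3 * ∑ t : Fin n, ((t : ℕ) + 1 : ℝ) ^ 2 * G t := by
  have h1 : ∀ k : Mode n, F k ≤ ∑ i, if ∀ j, k j ≤ k i then G (k i) else 0 := by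
    intro k
    obtain ⟨i, -, hi⟩ := Finset.exists_max_image Finset.univ k Finset.univ_nonempty
    have hi' : ∀ j, k j ≤ k i := fun j => hi j (Finset.mem_univ j)
    refine (h k i hi').trans ?_
    have := Finset.single_le_sum (f := fun i => if ∀ j, k j ≤ k i then G (k i) else 0)
      (fun i _ => by split_ifs; exacts [hG _, le_rfl]) (Finset.mem_univ i)
    simpa only [if_pos hi'] using this
  refine (Finset.sum_le_sum fun k _ => h1 k).trans ?_
  rw [Finset.sum_comm]
  have h2 : ∀ i : Fin 3, ∑ k : Mode n, (if ∀ j, k j ≤ k i then G (k i) else 0) ≤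
      ∑ t : Fin n, ((t : ℕ) + 1 : ℝ) ^ 2 * G t := by
    intro i
    rw [← Finset.sum_fiberwise_of_maps_to (s := Finset.univ) (t := Finset.univ)
      (g := fun k : Mode n => k i) (fun _ _ => Finset.mem_univ _)]
    refine Finset.sum_le_sum fun t _ => ?_
    rw [← Finset.sum_filter, Finset.filter_filter]
    have hsub : (Finset.univ.filter fun k : Mode n => k i = t ∧ ∀ j, k j ≤ k i) ⊆
        Fintype.piFinset fun j => if j = i then {t} else Finset.Iic t := by
      intro k hk
      simp only [Finset.mem_filter, Finset.mem_univ, true_and] at hk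
      rw [Fintype.mem_piFinset]
      intro j
      split_ifs with hj
      · rw [hj]; simp [hk.1]
      · simpa [hk.1] using hk.2 j
    have hcard : (Fintype.piFinset fun j : Fin 3 => if j = i then {t} else Finset.Iic t).card =
        ((t : ℕ) + 1) ^ 2 := by
      rw [Fintype.card_piFinset, Fin.prod_univ_three]
      fin_cases i <;> simp <;> ring
    have e : ∑ k : Mode n with k i = t ∧ ∀ j, k j ≤ k i, G (k i) =
        ((Finset.univ.filter fun k : Mode n => k i = t ∧ ∀ j, k j ≤ k i).card : ℝ) * G t := by
      rw [← nsmul_eq_mul, ← Finset.sum_const]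
      refine Finset.sum_congr rfl fun k hk => ?_
      simp only [Finset.mem_filter] at hk
      rw [hk.2.1]
    rw [e]
    refine mul_le_mul_of_nonneg_right ?_ (hG t)
    have := Finset.card_le_card hsub
    rw [hcard] at this
    exact_mod_cast this
  refine (Finset.sum_le_sum fun i _ => h2 i).trans ?_
  simp

open Classical in
/-- The inverse eigenvalue, zero for inactive modes. -/
noncomputable def invEig (bc : BC) {n : ℕ} (k : Mode n) : ℝ :=
  if Active bc k then (eig3 bc k)⁻¹ else 0

theorem invEig_nonneg (bc : BC) {n : ℕ} (k : Mode n) : 0 ≤ invEig bc k := by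
  rw [invEig]; split_ifs
  · exact inv_nonneg.2 (eig3_nonneg bc k)
  · exact le_rfl

theorem invEig_le_div (bc : BC) {n : ℕ} (k : Mode n) (i : Fin 3) :
    invEig bc k ≤ 3 * n ^ 2 / ((max (k i : ℕ) 1 : ℕ) : ℝ) ^ 2 := by
  have hn : (0 : ℝ) < n := by exact_mod_cast (k 0).pos
  have hm : 0 < ((max (k i : ℕ) 1 : ℕ) : ℝ) := by exact_mod_cast (by omega : 0 < max (k i : ℕ) 1)
  rw [invEig]
  split_ifs with hk
  · have h1 := le_eig3 hk
    have h2 : ((max (k i : ℕ) 1 : ℕ) : ℝ) ^ 2 ≤ ∑ i, ((max (k i : ℕ) 1 : ℕ) : ℝ) ^ 2 :=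
      Finset.single_le_sum (f := fun i => ((max (k i : ℕ) 1 : ℕ) : ℝ) ^ 2)
        (fun _ _ => sq_nonneg _) (Finset.mem_univ i)
    rw [← inv_div]
    refine inv_anti₀ (by positivity) (le_trans ?_ h1)
    gcongr
  · positivity

theorem invEig_le (bc : BC) {n : ℕ} (k : Mode n) : invEig bc k ≤ (n : ℝ) ^ 2 := by
  have hn : (0 : ℝ) < n := by exact_mod_cast (k 0).pos
  rw [invEig]
  split_ifs with hk
  · rw [← inv_inv ((n : ℝ) ^ 2)]
    refine inv_anti₀ (by positivity) ?_
    rw [← one_div]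
    exact inv_sq_le_eig3 hk
  · positivity

/-- The sum over the spectrum behaves like ∑ t² · n²/t² over t < n: in dimension three the density
of modes cancels the decay of the inverse eigenvalues, and the gradient energy is of the order of
the volume. -/
theorem sum_invEig_le (bc : BC) (n : ℕ) : ∑ k : Mode n, invEig bc k ≤ 36 * n ^ 3 := by
  refine (sum_mode_le_of_max _ (fun t : Fin n => 3 * n ^ 2 / ((max (t : ℕ) 1 : ℕ) : ℝ) ^ 2)
    (fun t => by positivity) fun k i _ => invEig_le_div bc k i).trans ?_
  have h : ∀ t : Fin n, ((t : ℕ) + 1 : ℝ) ^ 2 * (3 * n ^ 2 / ((max (t : ℕ) 1 : ℕ) : ℝ) ^ 2) ≤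
      12 * n ^ 2 := by
    intro t
    have hm : 0 < ((max (t : ℕ) 1 : ℕ) : ℝ) := by exact_mod_cast (by omega : 0 < max (t : ℕ) 1)
    have h2 : ((t : ℕ) + 1 : ℝ) ≤ 2 * ((max (t : ℕ) 1 : ℕ) : ℝ) := by
      exact_mod_cast (by omega : (t : ℕ) + 1 ≤ 2 * max (t : ℕ) 1)
    rw [mul_div_assoc', div_le_iff₀ (by positivity)]
    have := pow_le_pow_left₀ (by positivity) h2 2
    have hn2 : (0 : ℝ) ≤ 3 * n ^ 2 := by positivity
    nlinarith
  refine (mul_le_mul_of_nonneg_left (Finset.sum_le_sum fun t _ => h t) (by norm_num)).trans ?_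
  simp
  apply le_of_eq
  ring

/-- Here the sum behaves like ∑ t² · n⁴/t⁴ and converges, so the lowest modes dominate. This is why
the field itself has size √n at scale n. -/
theorem sum_invEig_sq_le (bc : BC) (n : ℕ) : ∑ k : Mode n, invEig bc k ^ 2 ≤ 324 * n ^ 4 := by
  refine (sum_mode_le_of_max _ (fun t : Fin n => (3 * n ^ 2 / ((max (t : ℕ) 1 : ℕ) : ℝ) ^ 2) ^ 2)
    (fun t => by positivity) fun k i _ =>
      pow_le_pow_left₀ (invEig_nonneg bc k) (invEig_le_div bc k i) 2).trans ?_
  have h : ∀ t : Fin n, ((t : ℕ) + 1 : ℝ) ^ 2 * (3 * n ^ 2 / ((max (t : ℕ) 1 : ℕ) : ℝ) ^ 2) ^ 2 ≤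
      36 * n ^ 4 * (1 / ((max (t : ℕ) 1 : ℕ) : ℝ) ^ 2) := by
    intro t
    have hm : 0 < ((max (t : ℕ) 1 : ℕ) : ℝ) := by exact_mod_cast (by omega : 0 < max (t : ℕ) 1)
    have h2 : ((t : ℕ) + 1 : ℝ) ≤ 2 * ((max (t : ℕ) 1 : ℕ) : ℝ) := by
      exact_mod_cast (by omega : (t : ℕ) + 1 ≤ 2 * max (t : ℕ) 1)
    have e1 : (3 * n ^ 2 / ((max (t : ℕ) 1 : ℕ) : ℝ) ^ 2) ^ 2 =
      9 * n ^ 4 / ((max (t : ℕ) 1 : ℕ) : ℝ) ^ 4 := by field_simp; ring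
    have e2 : 36 * (n : ℝ) ^ 4 * (1 / ((max (t : ℕ) 1 : ℕ) : ℝ) ^ 2) =
      (2 * ((max (t : ℕ) 1 : ℕ) : ℝ)) ^ 2 * (9 * n ^ 4 / ((max (t : ℕ) 1 : ℕ) : ℝ) ^ 4) := by
      field_simp; ring
    rw [e1, e2]
    exact mul_le_mul_of_nonneg_right (pow_le_pow_left₀ (by positivity) h2 2) (by positivity)
  refine (mul_le_mul_of_nonneg_left (Finset.sum_le_sum fun t _ => h t) (by norm_num)).trans ?_
  rw [← Finset.mul_sum, Fin.sum_univ_eq_sum_range (fun t => 1 / ((max t 1 : ℕ) : ℝ) ^ 2)]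
  have := sum_one_div_sq_le n
  have hn4 : (0 : ℝ) ≤ 36 * n ^ 4 := by positivity
  nlinarith

/-! ### Dependence of the fields on the mass -/

theorem abs_fieldCoef_le (bc : BC) {ε lam : ℝ} (hl : 0 ≤ lam) {n : ℕ} (r : Site) (a : Site → ℝ)
    (k : Mode n) : |fieldCoef bc ε lam r a k| ≤ |fieldCoef bc ε 0 r a k| := by
  rw [fieldCoef, fieldCoef]
  split_ifs with hk
  · have := eig3_pos hk
    rw [abs_div, abs_div, add_zero, abs_of_pos this,
      abs_of_pos (by linarith : 0 < eig3 bc k + lam)]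
    exact div_le_div_of_nonneg_left (abs_nonneg _) this (by linarith)
  · exact le_rfl

theorem fieldCoef_zero (bc : BC) (ε : ℝ) {n : ℕ} (r : Site) (a : Site → ℝ) (k : Mode n) :
    fieldCoef bc ε 0 r a k = ε * coef bc r a k * invEig bc k := by
  rw [fieldCoef, invEig]
  split_ifs
  · rw [add_zero, div_eq_mul_inv]
  · simp

theorem sum_field_sq_le (bc : BC) (ε : ℝ) {lam : ℝ} (hl : 0 ≤ lam) {n : ℕ} (hn : 0 < n) (r : Site)
    (a : Site → ℝ) : ∑ x ∈ cube n r, field ε lam (cube n r) a bc x ^ 2 ≤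
      ε ^ 2 * ∑ k : Mode n, invEig bc k ^ 2 * coef bc r a k ^ 2 := by
  rw [sum_field_sq bc ε hl hn, Finset.mul_sum]
  refine Finset.sum_le_sum fun k _ => ?_
  have := sq_le_sq.2 (abs_fieldCoef_le bc hl r a k (ε := ε))
  rw [fieldCoef_zero] at this
  linarith [this]

theorem gradSq_field_le (bc : BC) (ε : ℝ) {lam : ℝ} (hl : 0 ≤ lam) {n : ℕ} (hn : 0 < n) (r : Site)
    (a : Site → ℝ) : gradSq (cube n r) bc (field ε lam (cube n r) a bc) ≤
      ε ^ 2 * ∑ k : Mode n, invEig bc k * coef bc r a k ^ 2 := by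
  rw [gradSq_field bc ε hl hn, Finset.mul_sum]
  refine Finset.sum_le_sum fun k _ => ?_
  have h := sq_le_sq.2 (abs_fieldCoef_le bc hl r a k (ε := ε))
  refine (mul_le_mul_of_nonneg_left h (eig3_nonneg bc k)).trans (le_of_eq ?_)
  rw [fieldCoef_zero, invEig]
  split_ifs with hk
  · have := eig3_pos hk
    field_simp
  · ring

theorem gradSq_field_zero (bc : BC) (ε : ℝ) {n : ℕ} (hn : 0 < n) (r : Site)
    (a : Site → ℝ) : gradSq (cube n r) bc (field ε 0 (cube n r) a bc) =
      ε ^ 2 * ∑ k : Mode n, invEig bc k * coef bc r a k ^ 2 := by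
  rw [gradSq_field bc ε le_rfl hn, Finset.mul_sum]
  refine Finset.sum_congr rfl fun k _ => ?_
  rw [fieldCoef_zero, invEig]
  split_ifs with hk
  · have := eig3_pos hk
    field_simp
  · ring

theorem gradSq_field_le_zero (bc : BC) (ε : ℝ) {lam : ℝ} (hl : 0 ≤ lam) {n : ℕ} (hn : 0 < n)
    (r : Site) (a : Site → ℝ) : gradSq (cube n r) bc (field ε lam (cube n r) a bc) ≤
      gradSq (cube n r) bc (field ε 0 (cube n r) a bc) := by
  rw [gradSq_field_zero bc ε hn]
  exact gradSq_field_le bc ε hl hn r a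

theorem sum_field_sq_le_zero (bc : BC) (ε : ℝ) {lam : ℝ} (hl : 0 ≤ lam) {n : ℕ} (hn : 0 < n)
    (r : Site) (a : Site → ℝ) : ∑ x ∈ cube n r, field ε lam (cube n r) a bc x ^ 2 ≤
      ∑ x ∈ cube n r, field ε 0 (cube n r) a bc x ^ 2 := by
  rw [sum_field_sq bc ε hl hn, sum_field_sq bc ε le_rfl hn]
  exact Finset.sum_le_sum fun k _ => sq_le_sq.2 (abs_fieldCoef_le bc hl r a k)

theorem field_of_not_mem (bc : BC) (ε : ℝ) {lam : ℝ} (hl : 0 ≤ lam) {n : ℕ} (hn : 0 < n)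
    {r x : Site} (a : Site → ℝ) (hx : x ∉ cube n r) : field ε lam (cube n r) a bc x = 0 := by
  rw [field_eq bc ε hl hn]; simp [cut, hx]

/-- The maximum principle. -/
theorem le_of_negLaplacian_add {Q : Finset Site} {bc : BC} {lam M : ℝ} (hl : 0 < lam) (hM : 0 ≤ M)
    {w : Site → ℝ} (h0 : ∀ x ∉ Q, w x = 0)
    (h : ∀ x ∈ Q, negLaplacian Q w x bc + lam * w x ≤ lam * M) : ∀ x ∈ Q, w x ≤ M := by
  by_contra! hc
  obtain ⟨z, hz, hzM⟩ := hc
  obtain ⟨x, hx, hmax⟩ := Q.exists_max_image w ⟨z, hz⟩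
  have hxM : M < w x := hzM.trans_le (hmax z hz)
  have hm : ∀ y, w y ≤ w x := fun y => by
    by_cases hy : y ∈ Q
    · exact hmax y hy
    · rw [h0 y hy]; linarith
  have hn : 0 ≤ negLaplacian Q w x bc := by
    cases bc with
    | dirichlet =>
      exact Finset.sum_nonneg fun i _ => by linarith [hm (x + unit i), hm (x - unit i)]
    | neumann =>
      refine Finset.sum_nonneg fun i _ => add_nonneg ?_ ?_ <;> split_ifs
      · linarith [hm (x + unit i)]
      · exact le_rfl
      · linarith [hm (x - unit i)]
      · exact le_rfl
  have := h x hx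
  nlinarith

theorem negLaplacian_sub {Q : Finset Site} (f g : Site → ℝ) (x : Site) (bc : BC) :
    negLaplacian Q (f - g) x bc = negLaplacian Q f x bc - negLaplacian Q g x bc := by
  rw [sub_eq_add_neg, ← neg_one_smul ℝ g, negLaplacian_add, negLaplacian_smul]
  ring

/-- The difference w of the massless and the massive field solves (-Δ + lam) w = lam · (massless
field), so |w| ≤ M by the maximum principle. A bound at mass zero thus controls all masses. -/
theorem abs_field_le_two_mul (bc : BC) (ε : ℝ) {lam : ℝ} (hl : 0 ≤ lam) {n : ℕ} (hn : 0 < n)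
    (r : Site) (a : Site → ℝ) {M : ℝ} (hM : ∀ x ∈ cube n r, |field ε 0 (cube n r) a bc x| ≤ M) :
    ∀ x ∈ cube n r, |field ε lam (cube n r) a bc x| ≤ 2 * M := by
  intro x hx
  have hM0 : 0 ≤ M := (abs_nonneg _).trans (hM x hx)
  rcases hl.eq_or_lt with rfl | hl'
  · linarith [hM x hx]
  set g := field ε lam (cube n r) a bc with hg
  set g0 := field ε 0 (cube n r) a bc with hg0
  have e : ∀ y ∈ cube n r, negLaplacian (cube n r) g y bc + lam * g y =
      negLaplacian (cube n r) g0 y bc := by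
    intro y hy
    have h1 := field_spec ε hl hn r a bc
    have h2 := field_spec ε le_rfl hn r a bc
    cases bc with
    | dirichlet => have := h1.2 y hy; have := h2.2 y hy; linarith
    | neumann => have := h1.2.2 y hy; have := h2.2.2 y hy; linarith
  have z : ∀ y ∉ cube n r, (g0 - g) y = 0 := fun y hy => by
    simp [hg, hg0, field_of_not_mem bc ε hl hn a hy, field_of_not_mem bc ε le_rfl hn a hy]
  have z' : ∀ y ∉ cube n r, (g - g0) y = 0 := fun y hy => by
    simp [hg, hg0, field_of_not_mem bc ε hl hn a hy, field_of_not_mem bc ε le_rfl hn a hy]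
  have w1 := le_of_negLaplacian_add (bc := bc) hl' hM0 z (fun y hy => by
    rw [negLaplacian_sub, Pi.sub_apply]
    have := e y hy
    have := (abs_le.1 (hM y hy)).2
    nlinarith) x hx
  have w2 := le_of_negLaplacian_add (bc := bc) hl' hM0 z' (fun y hy => by
    rw [negLaplacian_sub, Pi.sub_apply]
    have := e y hy
    have := (abs_le.1 (hM y hy)).1
    nlinarith) x hx
  have := abs_le.1 (hM x hx)
  simp only [Pi.sub_apply] at w1 w2
  rw [abs_le]
  constructor <;> linarith

theorem abs_mode3_le (bc : BC) {n : ℕ} (hn : 0 < n) (r : Site) (k : Mode n) (x : Site) :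
    |mode3 bc n r k x| ≤ 3 := by
  have h := mode3_sq_le bc hn r k x
  have hn' : (1 : ℝ) ≤ n := by exact_mod_cast hn
  have h2 : (2 / (n : ℝ)) ^ 3 ≤ 2 ^ 3 := by
    gcongr
    rw [div_le_iff₀ (by positivity)]
    linarith
  exact abs_le_of_sq_le_sq (by linarith) (by norm_num)

theorem abs_coef_le (bc : BC) {n : ℕ} (hn : 0 < n) {r : Site} {a : Site → ℝ} {M : ℝ}
    (hM : ∀ x ∈ cube n r, |a x| ≤ M) (k : Mode n) : |coef bc r a k| ≤ 3 * n ^ 3 * M := by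
  refine (Finset.abs_sum_le_sum_abs _ _).trans ?_
  refine (Finset.sum_le_sum (g := fun _ => M * 3) fun x hx => ?_).trans ?_
  · rw [abs_mul]
    exact mul_le_mul (hM x hx) (abs_mode3_le bc hn r k x) (abs_nonneg _)
      ((abs_nonneg _).trans (hM x hx))
  · rw [Finset.sum_const, card_cube, nsmul_eq_mul]
    push_cast
    apply le_of_eq
    ring

/-- The resolvent identity, mode by mode, with every factor estimated crudely. Only a polynomial
Lipschitz constant in the mass is needed, because a polynomially fine net of masses costs little in
a union bound. -/
theorem abs_field_sub_le (bc : BC) {ε lam lam' : ℝ} (hε : 0 ≤ ε) (hl : 0 ≤ lam) (hl' : 0 ≤ lam')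
    {n : ℕ} (hn : 0 < n) {r : Site} {a : Site → ℝ} {M : ℝ} (hM0 : 0 ≤ M)
    (hM : ∀ x ∈ cube n r, |a x| ≤ M)
    (x : Site) : |field ε lam (cube n r) a bc x - field ε lam' (cube n r) a bc x| ≤
      9 * ε * n ^ 10 * M * |lam - lam'| := by
  have hn' : (0 : ℝ) < n := by exact_mod_cast hn
  rw [field_eq bc ε hl hn, field_eq bc ε hl' hn]
  by_cases hx : x ∈ cube n r
  swap
  · simp only [cut, hx, if_false, sub_zero, abs_zero]
    positivity
  simp only [cut, hx, if_true, synth]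
  rw [← Finset.sum_sub_distrib]
  refine (Finset.abs_sum_le_sum_abs _ _).trans ?_
  refine (Finset.sum_le_sum (g := fun _ => 9 * ε * n ^ 7 * M * |lam - lam'|) fun k _ => ?_).trans ?_
  · rw [← sub_mul, abs_mul]
    have h1 : |fieldCoef bc ε lam r a k - fieldCoef bc ε lam' r a k| ≤
        ε * (3 * n ^ 3 * M) * (n ^ 4 * |lam - lam'|) := by
      rw [fieldCoef, fieldCoef]
      split_ifs with hk
      · have hμ := eig3_pos hk
        have e : ε * coef bc r a k / (eig3 bc k + lam) - ε * coef bc r a k / (eig3 bc k + lam') =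
            ε * coef bc r a k * ((lam' - lam) / ((eig3 bc k + lam) * (eig3 bc k + lam'))) := by
          field_simp
          ring
        rw [e, abs_mul, abs_mul, abs_of_nonneg hε, abs_div, abs_sub_comm lam']
        refine mul_le_mul (mul_le_mul_of_nonneg_left (abs_coef_le bc hn hM k) hε) ?_
          (by positivity) (by positivity)
        have h2 := inv_sq_le_eig3 hk
        rw [abs_of_pos (by positivity : 0 < (eig3 bc k + lam) * (eig3 bc k + lam')),
          div_le_iff₀ (by positivity)]
        have h3 : 1 / (n : ℝ) ^ 2 * (1 / (n : ℝ) ^ 2) ≤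
            (eig3 bc k + lam) * (eig3 bc k + lam') :=
          mul_le_mul (by linarith) (by linarith) (by positivity) (by positivity)
        have h4 := mul_le_mul_of_nonneg_left h3
          (by positivity : 0 ≤ (n : ℝ) ^ 4 * |lam - lam'|)
        refine le_trans (le_of_eq ?_) h4
        field_simp
      · rw [sub_zero, abs_zero]; positivity
    refine (mul_le_mul h1 (abs_mode3_le bc hn r k x) (abs_nonneg _) (by positivity)).trans
      (le_of_eq ?_)
    ring
  · rw [Finset.sum_const, nsmul_eq_mul, Finset.card_univ]
    simp only [Fintype.card_fun, Fintype.card_fin]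
    push_cast
    apply le_of_eq
    ring

/-! ### A deterministic criterion for niceness -/

theorem sum_grad_sq_le_potential {Q : Finset Site} (g : Site → ℝ) {y : Site} (hy : y ∈ Q) :
    ∑ i, ((g y - g (y + unit i)) ^ 2 + (g y - g (y - unit i)) ^ 2) ≤ potential Q g y := by
  rw [potential, Finset.sum_filter, sum_edges]
  refine Finset.sum_le_sum fun i _ => ?_
  have hu : y ≠ y - unit i := fun h => by
    have := congrFun h i
    simp [unit] at this
    omega
  have hsub : ({y, y - unit i} : Finset Site) ⊆ edgeBase Q i .dirichlet := by
    intro z hz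
    simp only [Finset.mem_insert, Finset.mem_singleton] at hz
    rcases hz with rfl | rfl
    · exact Finset.mem_union_left _ hy
    · exact Finset.mem_union_right _ (Finset.mem_image_of_mem _ hy)
  refine le_trans (le_of_eq ?_) (Finset.sum_le_sum_of_subset_of_nonneg hsub fun x _ _ => ?_)
  · rw [Finset.sum_pair hu]
    simp [grad]
    ring
  · split_ifs
    · positivity
    · exact le_rfl

theorem sq_negLaplacian_le {Q : Finset Site} (g : Site → ℝ) {y : Site} (hy : y ∈ Q) :
    negLaplacian Q g y .dirichlet ^ 2 ≤ 6 * potential Q g y := by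
  refine le_trans ?_ (mul_le_mul_of_nonneg_left (sum_grad_sq_le_potential g hy) (by norm_num))
  simp only [negLaplacian]
  have h := sq_sum_le_card_mul_sum_sq (s := (Finset.univ : Finset (Fin 3)))
    (f := fun i => (g y - g (y + unit i)) + (g y - g (y - unit i)))
  refine h.trans ?_
  have h2 : ∀ i, ((g y - g (y + unit i)) + (g y - g (y - unit i))) ^ 2 ≤
      2 * ((g y - g (y + unit i)) ^ 2 + (g y - g (y - unit i)) ^ 2) := fun i => by
    nlinarith [sq_nonneg ((g y - g (y + unit i)) - (g y - g (y - unit i)))]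
  have h3 := Finset.sum_le_sum (s := (Finset.univ : Finset (Fin 3))) fun i _ => h2 i
  rw [← Finset.mul_sum] at h3
  simp only [Finset.card_univ, Fintype.card_fin]
  push_cast
  linarith

/-- By the equation, ε a(y) is the sum of -Δg(y), which is controlled by the gradients at y, and of
lam g(y), which is small. The potential therefore cannot be small on average where the disorder is
not. -/
theorem sq_mul_sq_le_potential {ε lam : ℝ} (hl : 0 ≤ lam) {n : ℕ} (hn : 0 < n) (r : Site)
    (a : Site → ℝ) {y : Site} (hy : y ∈ cube n r) :
    ε ^ 2 * a y ^ 2 ≤ 12 * potential (cube n r) (field ε lam (cube n r) a .dirichlet) y +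
      2 * (lam * field ε lam (cube n r) a .dirichlet y) ^ 2 := by
  have h := (field_spec ε hl hn r a .dirichlet).2 y hy
  have h2 := sq_negLaplacian_le (field ε lam (cube n r) a .dirichlet) hy
  rw [← mul_pow, ← h]
  nlinarith [sq_nonneg (negLaplacian (cube n r) (field ε lam (cube n r) a .dirichlet) y .dirichlet
    - lam * field ε lam (cube n r) a .dirichlet y)]

theorem sum_coef_sq (bc : BC) {n : ℕ} (r : Site) (a : Site → ℝ) :
    ∑ k : Mode n, coef bc r a k ^ 2 = ∑ x ∈ cube n r, a x ^ 2 := by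
  simp only [pow_two]
  rw [← sum_synth_mul_synth bc r]
  exact Finset.sum_congr rfl fun x hx => by rw [synth_coef bc a hx]

/-- Parseval's identity. The only inactive mode is the constant Neumann mode, and the square of its
coefficient is the square of the average times the volume. -/
theorem sum_coef_sq_active {n : ℕ} (hn : 0 < n) (bc : BC) (r : Site) (a : Site → ℝ) :
    ∑ x ∈ cube n r, a x ^ 2 ≤ (∑ k : Mode n, open Classical in
      if Active bc k then coef bc r a k ^ 2 else 0) +
      (|average a (cube n r)| * Real.sqrt (cube n r).card) ^ 2 := by
  classical
  rw [← sum_coef_sq bc, mul_pow, Real.sq_sqrt (by positivity), card_cube, sq_abs]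
  cases bc with
  | dirichlet =>
    simp only [Active, true_or, if_true]
    exact le_add_of_nonneg_right (by positivity)
  | neumann =>
    have h0 : ¬ Active .neumann (fun _ => ⟨0, hn⟩ : Mode n) := by
      rintro (h | ⟨i, hi⟩)
      · cases h
      · simp at hi
    have h1 : ∀ k : Mode n, coef .neumann r a k ^ 2 =
        (if Active .neumann k then coef .neumann r a k ^ 2 else 0) +
        (if k = (fun _ => ⟨0, hn⟩ : Mode n) then coef .neumann r a k ^ 2 else 0) := by
      intro k
      by_cases hk : k = (fun _ => ⟨0, hn⟩ : Mode n)
      · rw [if_neg (by rw [hk]; exact h0), if_pos hk, zero_add]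
      · rw [if_neg hk, if_pos, add_zero]
        refine Or.inr ?_
        by_contra hc
        push Not at hc
        exact hk (funext fun i => Fin.ext (Nat.le_zero.1 (hc i)))
    rw [Finset.sum_congr rfl fun k _ => h1 k, Finset.sum_add_distrib]
    refine add_le_add_right (le_of_eq ?_) _
    rw [Finset.sum_ite_eq' Finset.univ (fun _ => ⟨0, hn⟩ : Mode n), if_pos (Finset.mem_univ _),
      coef]
    simp only [mode3_inactive r h0]
    rw [← Finset.sum_mul, average, card_cube, mul_pow, ← pow_mul, pow_mul' _ 3 2,
      Real.sq_sqrt (by positivity)]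
    push_cast
    field_simp

theorem update_mem_outerBoundary {n : ℕ} {r x : Site} (hx : x ∈ cube n r) (i : Fin 3) {t s : ℤ}
    (ht : t < r i ∨ r i + n ≤ t) (hs : r i ≤ s ∧ s < r i + n) (hst : |s - t| = 1) :
    Function.update x i t ∈ outerBoundary (cube n r) := by
  refine ⟨fun h => ?_, Function.update x i s, ?_, ?_⟩
  · have := mem_cube.1 h i
    simp at this
    omega
  · rw [mem_cube] at hx ⊢
    intro j
    rcases eq_or_ne j i with rfl | hj
    · simpa using hs
    · simpa [hj] using hx j
  · rw [Finset.sum_eq_single i]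
    · simpa using hst
    · intro j _ hj; simp [hj]
    · simp

theorem dist_update_self (x : Site) (i : Fin 3) (t : ℤ) :
    dist x (Function.update x i t) = |(x i : ℝ) - t| := by
  apply le_antisymm
  · rw [dist_pi_le_iff (abs_nonneg _)]
    intro j
    rcases eq_or_ne j i with rfl | hj
    · simp [Int.dist_eq]
    · simp [hj]
  · have := dist_le_pi_dist x (Function.update x i t) i
    simpa [Int.dist_eq] using this

/-- A ball around a site far from the outer boundary of a cube is contained in the cube. -/
theorem Icc_subset_cube {n : ℕ} (hn : 0 < n) {r x : Site} (hx : x ∈ cube n r) {R : ℝ}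
    (hR : R + 1 ≤ n / 16) (h : ∀ z ∈ outerBoundary (cube n r), (n : ℝ) / 16 ≤ dist x z) :
    Finset.Icc (fun i => x i - ⌊R⌋) (fun i => x i + ⌊R⌋) ⊆ cube n r := by
  intro y hy
  rw [Finset.mem_Icc] at hy
  rw [mem_cube] at hx ⊢
  intro i
  have hl : x i - ⌊R⌋ ≤ y i := hy.1 i
  have hu : y i ≤ x i + ⌊R⌋ := hy.2 i
  have hf := Int.floor_le R
  have h1 := h _ (update_mem_outerBoundary (mem_cube.2 hx) i (t := r i - 1) (s := r i)
    (by omega) (by omega) (by simp))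
  have h2 := h _ (update_mem_outerBoundary (mem_cube.2 hx) i (t := r i + n) (s := r i + n - 1)
    (by omega) (by omega) (by simp))
  rw [dist_update_self] at h1 h2
  have hxi := hx i
  rw [abs_of_nonneg (by rw [sub_nonneg]; exact_mod_cast (by omega))] at h1
  rw [abs_sub_comm, abs_of_nonneg (by rw [sub_nonneg]; exact_mod_cast (by omega))] at h2
  push_cast at h1 h2
  have h3 : (⌊R⌋ : ℝ) ≤ (x i : ℝ) - r i := by linarith
  have h4 : (⌊R⌋ : ℝ) + 1 ≤ (r i : ℝ) + n - x i := by linarith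
  have h3' : ⌊R⌋ ≤ x i - r i := by exact_mod_cast h3
  have h4' : ⌊R⌋ + 1 ≤ r i + n - x i := by exact_mod_cast h4
  omega

theorem pow_three_le_card_ball {R : ℝ} (hR1 : 1 ≤ R) (x : Site) :
    R ^ 3 ≤ ((Finset.Icc (fun i => x i - ⌊R⌋) (fun i => x i + ⌊R⌋)).card : ℝ) := by
  have hf : 1 ≤ ⌊R⌋ := Int.le_floor.2 (by exact_mod_cast hR1)
  have e2 : ∀ z : ℤ, (z + ⌊R⌋ + 1 - (z - ⌊R⌋)).toNat = (2 * ⌊R⌋ + 1).toNat := fun z => by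
    congr 1; ring
  have hf' : (1 : ℝ) ≤ ⌊R⌋ := by exact_mod_cast hf
  have e3 : (((2 * ⌊R⌋ + 1).toNat : ℤ) : ℝ) = 2 * (⌊R⌋ : ℝ) + 1 := by
    rw [Int.toNat_of_nonneg (by omega)]
    push_cast; ring
  rw [Int.cast_natCast] at e3
  rw [Pi.card_Icc]
  simp only [Int.card_Icc, e2, Finset.prod_const, Finset.card_univ, Fintype.card_fin]
  push_cast
  refine pow_le_pow_left₀ (by linarith) ?_ 3
  linarith [e3, Int.lt_floor_add_one R]

/-- Events whose intersection implies niceness of the cube `cube n r`. -/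
structure NiceEvents (B ε T : ℝ) (n : ℕ) (r : Site) (a : Site → ℝ) : Prop where
  field_le : ∀ bc, ∀ x ∈ cube n r, |field ε 0 (cube n r) a bc x| ≤ ε * Real.sqrt n * T / 2
  grad_le : ∀ bc, ∀ j : ℕ, j ≤ n ^ 10 → ∀ e ∈ edges (cube n r) bc,
    |grad (field ε (j / (n : ℝ) ^ 11) (cube n r) a bc) e| ≤ ε * T / 2
  energy_le : ∀ bc, ∑ k : Mode n, invEig bc k * coef bc r a k ^ 2 ≤ B * n ^ 3
  le_sum_ball : ∀ x ∈ cube n r,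
    Finset.Icc (fun i => x i - ⌊Real.log n ^ 90⌋) (fun i => x i + ⌊Real.log n ^ 90⌋) ⊆ cube n r →
    ((Finset.Icc (fun i => x i - ⌊Real.log n ^ 90⌋)
      (fun i => x i + ⌊Real.log n ^ 90⌋)).card : ℝ) / 4 ≤
      ∑ y ∈ Finset.Icc (fun i => x i - ⌊Real.log n ^ 90⌋) (fun i => x i + ⌊Real.log n ^ 90⌋),
        a y ^ 2
  le_sum_cube : (n : ℝ) ^ 3 / 4 ≤ ∑ y ∈ cube n r, a y ^ 2
  disorder_le : ∀ x ∈ cube n r, |a x| ≤ T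
  average_le : |average a (cube n r)| * Real.sqrt (cube n r).card ≤ T

section

variable {A B ε T : ℝ} {n : ℕ} {r : Site} {a : Site → ℝ}

theorem NiceEvents.abs_field_le (h : NiceEvents B ε T n r a) (hn : 0 < n) (bc : BC) {lam : ℝ}
    (hl : 0 ≤ lam) : ∀ x ∈ cube n r,
      |field ε lam (cube n r) a bc x| ≤ ε * Real.sqrt n * T := fun x hx => by
  have := abs_field_le_two_mul bc ε hl hn r a (h.field_le bc) x hx
  linarith

/-- The net of masses j/n^11 with j ≤ n^10 covers [0, 1/n). Rounding a mass down to the net changes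
the field by at most 9εT/n, which is at most εT/4 for n ≥ 36. The two endpoints of an edge use up
the half of the bound that the events on the net leave free. -/
theorem NiceEvents.abs_grad_le (h : NiceEvents B ε T n r a) (hε : 0 < ε) (hT : 0 ≤ T) (hn : 36 ≤ n)
    (bc : BC) {lam : ℝ} (hl : 0 ≤ lam) (hl' : lam < (n : ℝ)⁻¹) : ∀ e ∈ edges (cube n r) bc,
      |grad (field ε lam (cube n r) a bc) e| ≤ ε * T := by
  intro e he
  have hn36 : (36 : ℝ) ≤ n := by exact_mod_cast hn
  have hn' : (0 : ℝ) < n := by linarith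
  set j := ⌊lam * (n : ℝ) ^ 11⌋₊ with hj
  have hj1 : (j : ℝ) ≤ lam * (n : ℝ) ^ 11 := Nat.floor_le (by positivity)
  have hj2 : lam * (n : ℝ) ^ 11 < j + 1 := Nat.lt_floor_add_one _
  have hj3 : j ≤ n ^ 10 := by
    have : lam * (n : ℝ) ^ 11 ≤ n ^ 10 := by
      have := mul_le_mul_of_nonneg_right hl'.le (by positivity : (0 : ℝ) ≤ (n : ℝ) ^ 11)
      refine this.trans (le_of_eq ?_)
      field_simp
    exact_mod_cast hj1.trans this
  have hd : |lam - j / (n : ℝ) ^ 11| ≤ 1 / (n : ℝ) ^ 11 := by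
    have e1 : lam - j / (n : ℝ) ^ 11 = (lam * (n : ℝ) ^ 11 - j) / (n : ℝ) ^ 11 := by field_simp
    rw [e1, abs_div, abs_of_pos (by positivity : (0 : ℝ) < (n : ℝ) ^ 11)]
    gcongr
    rw [abs_le]
    constructor <;> linarith
  have hs : ∀ x, |field ε lam (cube n r) a bc x - field ε (j / (n : ℝ) ^ 11) (cube n r) a bc x| ≤
      ε * T / 4 := by
    intro x
    refine (abs_field_sub_le bc hε.le hl (by positivity) (by omega) hT h.disorder_le x).trans ?_
    refine (mul_le_mul_of_nonneg_left hd (by positivity)).trans ?_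
    have e2 : 9 * ε * (n : ℝ) ^ 10 * T * (1 / (n : ℝ) ^ 11) = 9 / n * (ε * T) := by field_simp
    rw [e2]
    have : 9 / (n : ℝ) ≤ 1 / 4 := by rw [div_le_div_iff₀ hn' (by norm_num)]; linarith
    have := mul_le_mul_of_nonneg_right this (by positivity : 0 ≤ ε * T)
    linarith
  have h0 := h.grad_le bc j hj3 e he
  have h1 := hs e.1
  have h2 := hs e.2
  rw [grad] at h0 ⊢
  rw [abs_le] at *
  constructor <;> linarith [h0.1, h0.2, h1.1, h1.2, h2.1, h2.2]

/-- With lam < 1/n and |g| ≤ ε√n T the mass term is at most εT/√n, negligible against the disorder ε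
a. -/
theorem NiceEvents.sq_mul_field_le (h : NiceEvents B ε T n r a) (hε : 0 < ε)
    (hn : 0 < n) (hTn : 16 * T ^ 2 ≤ n) (bc : BC) {lam : ℝ} (hl : 0 ≤ lam) (hl' : lam < (n : ℝ)⁻¹) :
    ∀ x ∈ cube n r, (lam * field ε lam (cube n r) a bc x) ^ 2 ≤ ε ^ 2 / 16 := by
  intro x hx
  have hn' : (0 : ℝ) < n := by exact_mod_cast hn
  have h1 := h.abs_field_le hn bc hl x hx
  have h2 := pow_le_pow_left₀ (abs_nonneg _) h1 2
  rw [sq_abs, mul_pow, mul_pow, Real.sq_sqrt hn'.le] at h2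
  have h3 := pow_le_pow_left₀ hl hl'.le 2
  rw [mul_pow]
  refine (mul_le_mul h3 h2 (sq_nonneg _) (by positivity)).trans ?_
  have e : (n : ℝ)⁻¹ ^ 2 * (ε ^ 2 * n * T ^ 2) = ε ^ 2 * (T ^ 2 / n) := by field_simp
  rw [e, div_eq_mul_one_div (ε ^ 2)]
  refine mul_le_mul_of_nonneg_left ?_ (sq_nonneg _)
  rw [div_le_div_iff₀ hn' (by norm_num)]
  linarith

/-- For active modes, ε² coef² = ((μ + lam) c)² ≤ 24 μ c² + 2 lam² c², because μ ≤ 12. Summing over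
modes, at least (1/4 - 1/16) ε² n³ is bounded by 24 times the energy plus ε² n³/8. This leaves
n³ε²/16 and explains the constant 1/384 = 1/(24 · 16). -/
theorem NiceEvents.le_gradSq (h : NiceEvents B ε T n r a) (hε : 0 < ε)
    (hn : 0 < n) (hTn : 16 * T ^ 2 ≤ n) (bc : BC) {lam : ℝ} (hl : 0 ≤ lam)
    (hl' : lam < (n : ℝ)⁻¹) :
    1 / 384 * ε ^ 2 * n ^ 3 ≤ gradSq (cube n r) bc (field ε lam (cube n r) a bc) := by
  classical
  have hn' : (1 : ℝ) ≤ n := by exact_mod_cast hn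
  have h1 := sum_coef_sq_active hn bc r a
  have h2 := h.le_sum_cube
  have h3 := pow_le_pow_left₀ (by positivity) h.average_le 2
  have hn3 : (n : ℝ) ≤ n ^ 3 := by nlinarith [sq_nonneg ((n : ℝ) - 1), mul_pos (by linarith : (0:ℝ) < n) (by linarith : (0:ℝ) < n)]
  have h4 : ε ^ 2 * (∑ k : Mode n, if Active bc k then coef bc r a k ^ 2 else 0) ≤
      24 * gradSq (cube n r) bc (field ε lam (cube n r) a bc) +
        2 * lam ^ 2 * ∑ x ∈ cube n r, field ε lam (cube n r) a bc x ^ 2 := by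
    rw [gradSq_field bc ε hl hn, sum_field_sq bc ε hl hn, Finset.mul_sum, Finset.mul_sum,
      Finset.mul_sum, ← Finset.sum_add_distrib]
    refine Finset.sum_le_sum fun k _ => ?_
    rw [fieldCoef]
    split_ifs with hk
    · have hμ := eig3_pos hk
      have hμ' := eig3_le bc k
      set c := ε * coef bc r a k / (eig3 bc k + lam) with hc
      have e : ε ^ 2 * coef bc r a k ^ 2 = ((eig3 bc k + lam) * c) ^ 2 := by
        rw [hc, mul_div_cancel₀ _ (by positivity), mul_pow]
      rw [e]
      have := mul_le_mul_of_nonneg_left hμ' (mul_nonneg hμ.le (sq_nonneg c))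
      nlinarith [sq_nonneg ((eig3 bc k - lam) * c)]
    · simp
  have h5 : lam ^ 2 * ∑ x ∈ cube n r, field ε lam (cube n r) a bc x ^ 2 ≤ n ^ 3 * (ε ^ 2 / 16) := by
    rw [Finset.mul_sum]
    refine (Finset.sum_le_sum fun x hx => ?_).trans (le_of_eq ?_) (b := ∑ _x ∈ cube n r, ε ^ 2 / 16)
    · rw [← mul_pow]
      exact h.sq_mul_field_le hε hn hTn bc hl hl' x hx
    · rw [Finset.sum_const, card_cube, nsmul_eq_mul]
      push_cast
      ring
  have h6 : (n : ℝ) ^ 3 / 4 - n ^ 3 / 16 ≤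
      ∑ k : Mode n, if Active bc k then coef bc r a k ^ 2 else 0 := by
    linarith
  have h7 := mul_le_mul_of_nonneg_left h6 (sq_nonneg ε)
  nlinarith

/-- The ball around x lies in the cube because its radius is below n/16, so the disorder in it has
mean square at least 1/4. Subtracting the mass term, at most ε²/8 per site, leaves ε²/96 per site
for the potential, more than the required A ε². -/
theorem NiceEvents.potentialLarge (h : NiceEvents B ε T n r a) (hε : 0 < ε)
    (hn : 0 < n) (hTn : 16 * T ^ 2 ≤ n) {lam : ℝ} (hl : 0 ≤ lam) (hl' : lam < (n : ℝ)⁻¹)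
    (hA : A ≤ 1 / 384) (hR1 : 1 ≤ Real.log n ^ 90) (hR2 : Real.log n ^ 90 + 1 ≤ n / 16) :
    PotentialLarge A ε n (cube n r) (field ε lam (cube n r) a .dirichlet) (Real.log n ^ 90) := by
  intro x hx hd
  have hsub := Icc_subset_cube hn hx hR2 hd
  have h1 := h.le_sum_ball x hx hsub
  set R := Real.log n ^ 90
  set S := Finset.Icc (fun i => x i - ⌊R⌋) (fun i => x i + ⌊R⌋) with hS
  have hcard : R ^ 3 ≤ (S.card : ℝ) := pow_three_le_card_ball hR1 x
  have h2 : ∑ y ∈ S, ε ^ 2 * a y ^ 2 ≤ ∑ y ∈ S,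
      (12 * potential (cube n r) (field ε lam (cube n r) a .dirichlet) y + ε ^ 2 / 8) := by
    refine Finset.sum_le_sum fun y hy => ?_
    have := sq_mul_sq_le_potential hl hn r a (hsub hy) (ε := ε)
    have := h.sq_mul_field_le hε hn hTn .dirichlet hl hl' y (hsub hy)
    linarith
  rw [← Finset.mul_sum, Finset.sum_add_distrib, ← Finset.mul_sum, Finset.sum_const,
    nsmul_eq_mul] at h2
  have h3 := mul_le_mul_of_nonneg_left h1 (sq_nonneg ε)
  rw [le_div_iff₀ (by positivity)]
  have h4 := mul_le_mul_of_nonneg_left hcard (sq_nonneg ε)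
  have h5 : A * ε ^ 2 * R ^ 3 ≤ 1 / 384 * (ε ^ 2 * R ^ 3) := by
    rw [mul_assoc]
    exact mul_le_mul_of_nonneg_right hA (by positivity)
  have h6 : 0 ≤ ε ^ 2 * (S.card : ℝ) := by positivity
  linarith

theorem NiceEvents.nice (h : NiceEvents B ε (|Real.log ε| ^ 30) n r a) (hε : 0 < ε) (hn : 36 ≤ n)
    (hTn : 16 * (|Real.log ε| ^ 30) ^ 2 ≤ n) (hA : A ≤ 1 / 384) (hR1 : 1 ≤ Real.log n ^ 90)
    (hR2 : Real.log n ^ 90 + 1 ≤ n / 16) : Nice A B ε n a (cube n r) := by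
  have hn0 : 0 < n := by omega
  have hn3 : (0 : ℝ) < ((cube n r).card : ℝ) := by rw [card_cube]; positivity
  refine ⟨fun lam hl hl' => h.potentialLarge hε hn0 hTn hl hl' hA hR1 hR2,
    fun bc lam hl _ x hx => ?_, fun bc lam hl hl' => h.abs_grad_le hε (by positivity) hn bc hl hl',
    fun bc lam hl hl' => ?_, fun bc lam hl _ => ?_, h.disorder_le, h.average_le⟩
  · rw [← Real.sqrt_eq_rpow]
    exact h.abs_field_le hn0 bc hl x hx
  · rw [le_div_iff₀ hn3, card_cube]
    push_cast
    refine le_trans ?_ (h.le_gradSq hε hn0 hTn bc hl hl')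
    rw [mul_assoc, mul_assoc]
    exact mul_le_mul_of_nonneg_right hA (by positivity)
  · rw [div_le_iff₀ hn3, card_cube]
    push_cast
    refine (gradSq_field_le bc ε hl hn0 r a).trans ?_
    have := mul_le_mul_of_nonneg_left (h.energy_le bc) (sq_nonneg ε)
    linarith

end

/-! ### Gaussian estimates -/

theorem lintegral_exp_mul_sq_gaussianReal {u : ℝ} (hu : u < 1 / 2) :
    ∫⁻ x, ENNReal.ofReal (Real.exp (u * x ^ 2)) ∂(gaussianReal 0 1) =
      ENNReal.ofReal (Real.sqrt (1 / (1 - 2 * u))) := by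
  rw [gaussianReal_of_var_ne_zero _ one_ne_zero,
    lintegral_withDensity_eq_lintegral_mul _ (measurable_gaussianPDF 0 1) (by fun_prop)]
  have h1 : ∀ x : ℝ, (gaussianPDF 0 1 * fun x => ENNReal.ofReal (Real.exp (u * x ^ 2))) x =
      ENNReal.ofReal ((Real.sqrt (2 * Real.pi))⁻¹ * Real.exp (-(1 / 2 - u) * x ^ 2)) := by
    intro x
    rw [Pi.mul_apply, gaussianPDF, ← ENNReal.ofReal_mul (gaussianPDFReal_nonneg _ _ _),
      gaussianPDFReal]
    simp only [NNReal.coe_one, mul_one, sub_zero]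
    rw [mul_assoc, ← Real.exp_add]
    congr 3
    ring
  simp only [h1]
  rw [← ofReal_integral_eq_lintegral_ofReal
    ((integrable_exp_neg_mul_sq (by linarith)).const_mul _)
    (ae_of_all _ fun x => by positivity), integral_const_mul, integral_gaussian]
  congr 1
  rw [← Real.sqrt_inv, ← Real.sqrt_mul (by positivity)]
  congr 1
  have : 1 / 2 - u ≠ 0 := by linarith
  have : 1 - 2 * u ≠ 0 := by linarith
  have := Real.pi_pos.ne'
  field_simp

theorem sqrt_le_exp_two_mul {u : ℝ} (h0 : 0 ≤ u) (h1 : u ≤ 1 / 4) :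
    Real.sqrt (1 / (1 - 2 * u)) ≤ Real.exp (2 * u) := by
  rw [Real.sqrt_le_left (Real.exp_pos _).le, ← Real.exp_nat_mul, div_le_iff₀ (by linarith)]
  have := Real.add_one_le_exp (((2 : ℕ) : ℝ) * (2 * u))
  push_cast at *
  nlinarith

theorem sqrt_third_le_exp : Real.sqrt (1 / (1 - 2 * (-1 : ℝ))) ≤ Real.exp (-(1 / 2)) := by
  rw [Real.sqrt_le_left (Real.exp_pos _).le, ← Real.exp_nat_mul]
  have e : ((2 : ℕ) : ℝ) * (-(1 / 2)) = -1 := by norm_num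
  rw [e, Real.exp_neg, ← one_div]
  have := Real.exp_one_lt_d9
  have := Real.exp_pos 1
  rw [div_le_div_iff₀ (by norm_num) (by positivity)]
  linarith

section

variable {Ω : Type*} [MeasurableSpace Ω] {P : Measure Ω} {ι : Type*}

theorem lintegral_exp_sum_eq_prod [Fintype ι] {b : ι → Ω → ℝ} (hm : ∀ i, Measurable (b i))
    (hi : iIndepFun b P) (f : ι → ℝ → ℝ) (hf : ∀ i, Measurable (f i)) :
    ∫⁻ ω, ENNReal.ofReal (Real.exp (∑ i, f i (b i ω))) ∂P =
      ∏ i, ∫⁻ ω, ENNReal.ofReal (Real.exp (f i (b i ω))) ∂P := by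
  have h := lintegral_prod_eq_prod_lintegral_of_indepFun Finset.univ
    (fun i ω => ENNReal.ofReal (Real.exp (f i (b i ω))))
    (hi.comp (fun i x => ENNReal.ofReal (Real.exp (f i x))) fun i => by
      have := hf i; fun_prop) (fun i => by have := hf i; have := hm i; fun_prop)
  rw [← h]
  refine lintegral_congr fun ω => ?_
  rw [Real.exp_sum, ENNReal.ofReal_prod_of_nonneg fun i _ => (Real.exp_pos _).le]

theorem lintegral_exp_mul_gaussian {b : Ω → ℝ} (hl : HasLaw b (gaussianReal 0 1) P) (c : ℝ) :
    ∫⁻ ω, ENNReal.ofReal (Real.exp (c * b ω)) ∂P = ENNReal.ofReal (Real.exp (c ^ 2 / 2)) := by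
  have h := mgf_gaussianReal hl.map_eq c
  rw [mgf] at h
  have hi : Integrable (fun ω => Real.exp (c * b ω)) P := by
    by_contra hc
    rw [integral_undef hc] at h
    exact absurd h (Real.exp_pos _).ne
  rw [← ofReal_integral_eq_lintegral_ofReal hi (ae_of_all _ fun ω => (Real.exp_pos _).le), h]
  simp

theorem lintegral_exp_sum_mul_gaussian [Fintype ι] {b : ι → Ω → ℝ} (hm : ∀ i, Measurable (b i))
    (hl : ∀ i, HasLaw (b i) (gaussianReal 0 1) P) (hi : iIndepFun b P) (c : ι → ℝ) :
    ∫⁻ ω, ENNReal.ofReal (Real.exp (∑ i, c i * b i ω)) ∂P =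
      ENNReal.ofReal (Real.exp ((∑ i, c i ^ 2) / 2)) := by
  rw [lintegral_exp_sum_eq_prod hm hi (fun i x => c i * x) fun i => by fun_prop]
  simp only [lintegral_exp_mul_gaussian (hl _)]
  rw [← ENNReal.ofReal_prod_of_nonneg fun i _ => (Real.exp_pos _).le, ← Real.exp_sum,
    Finset.sum_div]

/-- Markov's inequality for an exponential. -/
theorem measure_le_of_lintegral_exp {f : Ω → ℝ} (hf : Measurable f) {t D : ℝ}
    (h : ∫⁻ ω, ENNReal.ofReal (Real.exp (f ω)) ∂P ≤ ENNReal.ofReal D) :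
    P {ω | t ≤ f ω} ≤ ENNReal.ofReal (D * Real.exp (-t)) := by
  have h1 := mul_meas_ge_le_lintegral₀ (μ := P) (f := fun ω => ENNReal.ofReal (Real.exp (f ω)))
    (by fun_prop) (ENNReal.ofReal (Real.exp t))
  have h2 : {ω | ENNReal.ofReal (Real.exp t) ≤ ENNReal.ofReal (Real.exp (f ω))} =
      {ω | t ≤ f ω} := by
    ext ω
    simp only [Set.mem_ofPred_eq]
    rw [ENNReal.ofReal_le_ofReal_iff (Real.exp_pos _).le, Real.exp_le_exp]
  rw [h2] at h1
  have h3 := mul_le_mul_right (h1.trans h) (ENNReal.ofReal (Real.exp (-t)))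
  rw [← mul_assoc, ← ENNReal.ofReal_mul (Real.exp_pos _).le, ← Real.exp_add] at h3
  simp only [neg_add_cancel, Real.exp_zero, ENNReal.ofReal_one, one_mul] at h3
  refine h3.trans (le_of_eq ?_)
  rw [← ENNReal.ofReal_mul (Real.exp_pos _).le, mul_comm]

theorem measure_abs_sum_mul_gaussian_ge_le [Fintype ι] {b : ι → Ω → ℝ}
    (hm : ∀ i, Measurable (b i)) (hl : ∀ i, HasLaw (b i) (gaussianReal 0 1) P)
    (hi : iIndepFun b P) {c : ι → ℝ} {V t : ℝ} (hV : ∑ i, c i ^ 2 ≤ V) (hV0 : 0 < V)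
    (ht : 0 ≤ t) :
    P {ω | t ≤ |∑ i, c i * b i ω|} ≤ ENNReal.ofReal (2 * Real.exp (-(t ^ 2 / (2 * V)))) := by
  have key : ∀ d : ι → ℝ, ∑ i, d i ^ 2 ≤ V →
      P {ω | t ≤ ∑ i, d i * b i ω} ≤ ENNReal.ofReal (Real.exp (-(t ^ 2 / (2 * V)))) := by
    intro d hd
    -- The parameter t/V is the optimal one in Chernoff's bound for variance V.
    have h1 := lintegral_exp_sum_mul_gaussian hm hl hi (fun i => t / V * d i)
    have h2 := measure_le_of_lintegral_exp (P := P)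
      (f := fun ω => ∑ i, t / V * d i * b i ω) (by fun_prop) (t := t / V * t) h1.le
    refine (measure_mono fun ω hω => ?_).trans (h2.trans (ENNReal.ofReal_le_ofReal ?_))
    · simp only [Set.mem_ofPred_eq, mul_assoc, ← Finset.mul_sum] at hω ⊢
      exact mul_le_mul_of_nonneg_left hω (by positivity)
    · rw [← Real.exp_add, Real.exp_le_exp]
      simp only [mul_pow, ← Finset.mul_sum]
      have h3 : (t / V) ^ 2 * ∑ i, d i ^ 2 ≤ (t / V) ^ 2 * V :=
        mul_le_mul_of_nonneg_left hd (by positivity)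
      have e1 : (t / V) ^ 2 * V = t ^ 2 / V := by field_simp
      have e2 : t / V * t = t ^ 2 / V := by ring
      have e3 : t ^ 2 / (2 * V) = t ^ 2 / V / 2 := by field_simp
      rw [e2, e3]
      linarith
  have h1 := key c hV
  have h2 := key (fun i => -c i) (by simpa using hV)
  calc P {ω | t ≤ |∑ i, c i * b i ω|}
      ≤ P ({ω | t ≤ ∑ i, c i * b i ω} ∪ {ω | t ≤ ∑ i, -c i * b i ω}) := by
        refine measure_mono fun ω hω => ?_
        simp only [Set.mem_ofPred_eq, Set.mem_union, neg_mul, Finset.sum_neg_distrib] at hω ⊢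
        exact le_abs.1 hω
    _ ≤ _ := measure_union_le _ _
    _ ≤ _ := add_le_add h1 h2
    _ = _ := by
        rw [← ENNReal.ofReal_add (Real.exp_pos _).le (Real.exp_pos _).le,
          two_mul (Real.exp _)]

theorem lintegral_exp_sum_mul_sq_le [Fintype ι] {b : ι → Ω → ℝ} (hm : ∀ i, Measurable (b i))
    (hl : ∀ i, HasLaw (b i) (gaussianReal 0 1) P) (hi : iIndepFun b P) {w : ι → ℝ}
    (hw0 : ∀ i, 0 ≤ w i) (hw : ∀ i, w i ≤ 1 / 4) :
    ∫⁻ ω, ENNReal.ofReal (Real.exp (∑ i, w i * b i ω ^ 2)) ∂P ≤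
      ENNReal.ofReal (Real.exp (2 * ∑ i, w i)) := by
  rw [lintegral_exp_sum_eq_prod hm hi (fun i x => w i * x ^ 2) fun i => by fun_prop,
    Finset.mul_sum, Real.exp_sum, ENNReal.ofReal_prod_of_nonneg fun i _ => (Real.exp_pos _).le]
  refine Finset.prod_le_prod' fun i _ => ?_
  rw [(hl i).lintegral_comp (f := fun x => ENNReal.ofReal (Real.exp (w i * x ^ 2)))
    (by fun_prop), lintegral_exp_mul_sq_gaussianReal (by linarith [hw i])]
  exact ENNReal.ofReal_le_ofReal (sqrt_le_exp_two_mul (hw0 i) (hw i))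

/-- Chernoff's bound with parameter -1: E exp(-X²) = 3^(-1/2) ≤ e^(-1/2), so exp(-∑ X²) has mean at
most e^(-N/2) for N variables, and the threshold N/4 loses half of the exponent. -/
theorem measure_sum_sq_le_le [Fintype ι] {b : ι → Ω → ℝ} (hm : ∀ i, Measurable (b i))
    (hl : ∀ i, HasLaw (b i) (gaussianReal 0 1) P) (hi : iIndepFun b P) :
    P {ω | ∑ i, b i ω ^ 2 ≤ (Fintype.card ι : ℝ) / 4} ≤
      ENNReal.ofReal (Real.exp (-((Fintype.card ι : ℝ) / 4))) := by
  have h1 : ∫⁻ ω, ENNReal.ofReal (Real.exp (∑ i, (-1) * b i ω ^ 2)) ∂P ≤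
      ENNReal.ofReal (Real.exp (-((Fintype.card ι : ℝ) / 2))) := by
    rw [lintegral_exp_sum_eq_prod hm hi (fun i x => (-1) * x ^ 2) fun i => by fun_prop]
    have h2 : ∀ i, ∫⁻ ω, ENNReal.ofReal (Real.exp ((-1) * b i ω ^ 2)) ∂P ≤
        ENNReal.ofReal (Real.exp (-(1 / 2))) := by
      intro i
      rw [(hl i).lintegral_comp (f := fun x => ENNReal.ofReal (Real.exp ((-1) * x ^ 2)))
        (by fun_prop), lintegral_exp_mul_sq_gaussianReal (by norm_num)]
      exact ENNReal.ofReal_le_ofReal sqrt_third_le_exp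
    refine (Finset.prod_le_prod' fun i _ => h2 i).trans (le_of_eq ?_)
    rw [Finset.prod_const, ← ENNReal.ofReal_pow (Real.exp_pos _).le, ← Real.exp_nat_mul,
      Finset.card_univ]
    congr 2
    ring
  have h3 := measure_le_of_lintegral_exp (by fun_prop) (t := -((Fintype.card ι : ℝ) / 4)) h1
  refine (measure_mono fun ω hω => ?_).trans (h3.trans (le_of_eq ?_))
  · simp only [Set.mem_ofPred_eq, neg_mul, one_mul, Finset.sum_neg_distrib] at hω ⊢
    linarith
  · rw [← Real.exp_add]
    congr 2
    ring

/-- Orthonormal combinations are jointly Gaussian with identity covariance, and for jointly Gaussian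
variables vanishing covariance means independence. This makes the coefficients of the disorder in
the eigenbasis i.i.d. standard Gaussians. -/
theorem hasLaw_sum_mul_gaussian [Fintype ι] {b : ι → Ω → ℝ}
    (hl : ∀ i, HasLaw (b i) (gaussianReal 0 1) P) (hi : iIndepFun b P) {κ : Type*} [Fintype κ]
    [DecidableEq κ] (φ : κ → ι → ℝ) (hφ : ∀ k l, ∑ i, φ k i * φ l i = if k = l then 1 else 0) :
    (∀ k, HasLaw (fun ω => ∑ i, b i ω * φ k i) (gaussianReal 0 1) P) ∧
      iIndepFun (fun k ω => ∑ i, b i ω * φ k i) P := by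
  classical
  have : IsProbabilityMeasure P := hi.isProbabilityMeasure
  have hg : HasGaussianLaw (fun ω i => b i ω) P :=
    hi.hasGaussianLaw fun i => (hl i).hasGaussianLaw
  let L : (ι → ℝ) →L[ℝ] (κ → ℝ) :=
    ContinuousLinearMap.pi fun k => ∑ i, φ k i • ContinuousLinearMap.proj i
  have hL : HasGaussianLaw (fun ω k => ∑ i, b i ω * φ k i) P := by
    have := hg.map_fun L
    refine this.congr (ae_of_all _ fun ω => ?_)
    funext k
    simp [L, mul_comm]
  have hmem : ∀ i, MemLp (b i) 2 P := fun i => (hl i).hasGaussianLaw.memLp_two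
  have hcov1 : ∀ i j, cov[b i, b j; P] = if i = j then 1 else 0 := by
    intro i j
    split_ifs with hij
    · subst hij
      rw [covariance_self (hl i).aemeasurable, (hl i).variance_eq]
      simp
    · exact (hi.indepFun hij).covariance_eq_zero (hmem i) (hmem j)
  have hcov : ∀ k l, cov[fun ω => ∑ i, b i ω * φ k i, fun ω => ∑ i, b i ω * φ l i; P] =
      if k = l then 1 else 0 := by
    intro k l
    have e : ∀ k, (fun ω => ∑ i, b i ω * φ k i) = ∑ i, fun ω => b i ω * φ k i := fun k => by
      funext ω; simp
    rw [e, e, covariance_sum_sum (fun i => (hmem i).mul_const _) (fun i => (hmem i).mul_const _)]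
    simp only [covariance_mul_const_left, covariance_mul_const_right, hcov1]
    simp only [← hφ, ite_mul, one_mul, zero_mul, Finset.sum_ite_eq, Finset.mem_univ, if_true]
  refine ⟨fun k => ⟨hL.aemeasurable.eval k, ?_⟩, ?_⟩
  · rw [(hL.eval k).map_eq_gaussianReal]
    have hmean : P[fun ω => ∑ i, b i ω * φ k i] = 0 := by
      rw [integral_finsetSum _ fun i _ => ((hmem i).integrable one_le_two).mul_const _]
      refine Finset.sum_eq_zero fun i _ => ?_
      rw [integral_mul_const, (hl i).integral_eq]
      simp
    have hvar : Var[fun ω => ∑ i, b i ω * φ k i; P] = 1 := by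
      rw [← covariance_self (hL.aemeasurable.eval k), hcov]
      simp
    rw [hmean, hvar]
    simp
  · exact hL.iIndepFun_of_covariance_eq_zero fun k l hkl => by rw [hcov, if_neg hkl]

end

/-! ### The canonical Gaussian disorder and its coefficients in the eigenbasis. -/

/-- The law of i.i.d. standard Gaussian variables indexed by the sites. -/
noncomputable def gaussField : Measure (Site → ℝ) := Measure.infinitePi fun _ => gaussianReal 0 1

instance : IsProbabilityMeasure gaussField := by unfold gaussField; infer_instance

theorem hasLaw_eval (x : Site) :
    HasLaw (fun a : Site → ℝ => a x) (gaussianReal 0 1) gaussField :=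
  (measurePreserving_eval_infinitePi (fun _ : Site => gaussianReal 0 1) x).hasLaw

theorem iIndepFun_eval : iIndepFun (fun (x : Site) (a : Site → ℝ) => a x) gaussField :=
  iIndepFun_infinitePi (X := fun _ x => x) fun _ => measurable_id

theorem measurable_coef (bc : BC) {n : ℕ} (r : Site) (k : Mode n) :
    Measurable fun a => coef bc r a k := by
  unfold coef; fun_prop

theorem gaussian_coef (bc : BC) {n : ℕ} (r : Site) :
    (∀ k : Mode n, HasLaw (fun a => coef bc r a k) (gaussianReal 0 1) gaussField) ∧
      iIndepFun (fun (k : Mode n) a => coef bc r a k) gaussField := by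
  have h := hasLaw_sum_mul_gaussian (P := gaussField) (ι := cube n r)
    (b := fun x a => a x) (fun x => hasLaw_eval x)
    (iIndepFun_eval.precomp Subtype.val_injective) (fun (k : Mode n) x => mode3 bc n r k x)
    (fun k l => by
      rw [Finset.sum_coe_sort (cube n r) (fun x => mode3 bc n r k x * mode3 bc n r l x)]
      exact sum_mode3_mul bc r k l)
  have e : ∀ (k : Mode n) (a : Site → ℝ), coef bc r a k = ∑ x : cube n r, a x * mode3 bc n r k x :=
    fun k a => (Finset.sum_coe_sort (cube n r) (fun x => a x * mode3 bc n r k x)).symm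
  simp only [e]
  exact h

/-! ### Probability that a cube is not nice -/

open Classical in
/-- The coefficients of `(-Δ + lam)⁻¹` in the eigenbasis. -/
noncomputable def resolventCoef (bc : BC) (lam : ℝ) {n : ℕ} (k : Mode n) : ℝ :=
  if Active bc k then (eig3 bc k + lam)⁻¹ else 0

theorem fieldCoef_eq (bc : BC) (ε lam : ℝ) {n : ℕ} (r : Site) (a : Site → ℝ) (k : Mode n) :
    fieldCoef bc ε lam r a k = ε * resolventCoef bc lam k * coef bc r a k := by
  rw [fieldCoef, resolventCoef]
  split_ifs
  · rw [div_eq_mul_inv]; ring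
  · simp

theorem resolventCoef_nonneg (bc : BC) {lam : ℝ} (hl : 0 ≤ lam) {n : ℕ} (k : Mode n) :
    0 ≤ resolventCoef bc lam k := by
  rw [resolventCoef]
  split_ifs with hk
  · have := eig3_nonneg bc k; positivity
  · exact le_rfl

theorem resolventCoef_le (bc : BC) {lam : ℝ} (hl : 0 ≤ lam) {n : ℕ} (k : Mode n) :
    resolventCoef bc lam k ≤ invEig bc k := by
  rw [resolventCoef, invEig]
  split_ifs with hk
  · exact inv_anti₀ (eig3_pos hk) (by linarith)
  · exact le_rfl

theorem field_eq_sum (bc : BC) (ε : ℝ) {lam : ℝ} (hl : 0 ≤ lam) {n : ℕ} (hn : 0 < n) {r x : Site}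
    (hx : x ∈ cube n r) (a : Site → ℝ) : field ε lam (cube n r) a bc x =
      ∑ k : Mode n, (ε * resolventCoef bc lam k * mode3 bc n r k x) * coef bc r a k := by
  rw [field_eq bc ε hl hn]
  simp only [cut, hx, if_true, synth, fieldCoef_eq]
  exact Finset.sum_congr rfl fun k _ => by ring

theorem grad_field_eq_sum (bc : BC) (ε : ℝ) {lam : ℝ} (hl : 0 ≤ lam) {n : ℕ} (hn : 0 < n)
    {r : Site} {x : Site} {i : Fin 3} (he : x ∈ edgeBase (cube n r) i bc) (a : Site → ℝ) :
    grad (field ε lam (cube n r) a bc) (x, x + unit i) =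
      ∑ k : Mode n, (ε * resolventCoef bc lam k *
        (mode3 bc n r k (x + unit i) - mode3 bc n r k x)) * coef bc r a k := by
  have h : grad (field ε lam (cube n r) a bc) (x, x + unit i) =
      synth bc r (fun k : Mode n => fieldCoef bc ε lam r a k) (x + unit i) -
      synth bc r (fun k : Mode n => fieldCoef bc ε lam r a k) x := by
    rw [field_eq bc ε hl hn, grad]
    simp only
    cases bc with
    -- An edge that leaves the cube causes no exception: the combination of sine modes vanishes at
    -- its outer end, as the field does.
    | dirichlet =>
      simp only [edgeBase, Finset.mem_union, Finset.mem_image] at he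
      rcases he with he | ⟨y, hy, rfl⟩
      · rw [cut_synth_add_unit _ he]
        simp [cut, he]
      · rw [cut_synth_sub_unit _ hy, sub_add_cancel]
        simp [cut, hy]
    | neumann =>
      simp only [edgeBase, Finset.mem_filter] at he
      simp [cut, he.1, he.2]
  rw [h, synth, synth, ← Finset.sum_sub_distrib]
  refine Finset.sum_congr rfl fun k _ => ?_
  rw [fieldCoef_eq]
  ring

/-- This is the variance of the field at a site. Modes are bounded by (2/n)^(3/2), so the constant
is 8 · 324 = 2592. -/
theorem sum_field_coef_sq_le (bc : BC) (ε : ℝ) {lam : ℝ} (hl : 0 ≤ lam) {n : ℕ} (hn : 0 < n)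
    (r x : Site) : ∑ k : Mode n, (ε * resolventCoef bc lam k * mode3 bc n r k x) ^ 2 ≤
      2592 * ε ^ 2 * n := by
  have hn' : (0 : ℝ) < n := by exact_mod_cast hn
  calc ∑ k : Mode n, (ε * resolventCoef bc lam k * mode3 bc n r k x) ^ 2
      ≤ ∑ k : Mode n, ε ^ 2 * (2 / n) ^ 3 * invEig bc k ^ 2 := by
        refine Finset.sum_le_sum fun k _ => ?_
        rw [mul_pow, mul_pow]
        have h1 := pow_le_pow_left₀ (resolventCoef_nonneg bc hl k) (resolventCoef_le bc hl k) 2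
        have h2 := mul_le_mul h1 (mode3_sq_le bc hn r k x) (sq_nonneg _) (sq_nonneg _)
        nlinarith [mul_le_mul_of_nonneg_left h2 (sq_nonneg ε)]
    _ ≤ ε ^ 2 * (2 / n) ^ 3 * (324 * n ^ 4) := by
        rw [← Finset.mul_sum]
        exact mul_le_mul_of_nonneg_left (sum_invEig_sq_le bc n) (by positivity)
    _ = 2592 * ε ^ 2 * n := by field_simp; ring

/-- A gradient of a mode gains a factor μ in the square, which cancels one inverse eigenvalue. The
variance is then bounded uniformly in n; the final constant is only chosen to agree with that of the
field. -/
theorem sum_grad_coef_sq_le (bc : BC) (ε : ℝ) {lam : ℝ} (hl : 0 ≤ lam) {n : ℕ} (hn : 0 < n)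
    (r x : Site) (i : Fin 3) : ∑ k : Mode n, (ε * resolventCoef bc lam k *
      (mode3 bc n r k (x + unit i) - mode3 bc n r k x)) ^ 2 ≤ 2592 * ε ^ 2 := by
  have hn' : (0 : ℝ) < n := by exact_mod_cast hn
  calc ∑ k : Mode n, (ε * resolventCoef bc lam k *
        (mode3 bc n r k (x + unit i) - mode3 bc n r k x)) ^ 2
      ≤ ∑ k : Mode n, ε ^ 2 * (2 / n) ^ 3 * invEig bc k := by
        refine Finset.sum_le_sum fun k _ => ?_
        rw [mul_pow, mul_pow]
        have h1 := pow_le_pow_left₀ (resolventCoef_nonneg bc hl k) (resolventCoef_le bc hl k) 2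
        have h2 := mul_le_mul h1 (mode3_grad_sq_le bc hn r k x i) (sq_nonneg _) (sq_nonneg _)
        have h3 : invEig bc k ^ 2 * ((2 / n) ^ 3 * eig3 bc k) = (2 / n) ^ 3 * invEig bc k := by
          rw [invEig]
          split_ifs with hk
          · have := eig3_pos hk
            field_simp
          · ring
        rw [h3] at h2
        nlinarith [mul_le_mul_of_nonneg_left h2 (sq_nonneg ε)]
    _ ≤ ε ^ 2 * (2 / n) ^ 3 * (36 * n ^ 3) := by
        rw [← Finset.mul_sum]
        exact mul_le_mul_of_nonneg_left (sum_invEig_le bc n) (by positivity)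
    _ = 288 * ε ^ 2 := by field_simp; ring
    _ ≤ 2592 * ε ^ 2 := by nlinarith [sq_nonneg ε]

theorem measure_field_ge_le (bc : BC) {ε T : ℝ} (hε : 0 < ε) (hT : 0 ≤ T) {n : ℕ} (hn : 0 < n)
    {r x : Site} (hx : x ∈ cube n r) :
    gaussField {a | ε * Real.sqrt n * T / 2 ≤ |field ε 0 (cube n r) a bc x|} ≤
      ENNReal.ofReal (2 * Real.exp (-(T ^ 2 / 20736))) := by
  have hn' : (0 : ℝ) < n := by exact_mod_cast hn
  have h := measure_abs_sum_mul_gaussian_ge_le (fun k => measurable_coef bc r k)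
    (gaussian_coef bc (n := n) r).1 (gaussian_coef bc r).2
    (sum_field_coef_sq_le bc ε le_rfl hn r x) (by positivity)
    (t := ε * Real.sqrt n * T / 2) (by positivity)
  simp only [field_eq_sum bc ε le_rfl hn hx]
  refine h.trans (le_of_eq ?_)
  rw [div_pow, mul_pow, mul_pow, Real.sq_sqrt hn'.le]
  congr 4
  field_simp
  ring

theorem measure_grad_ge_le (bc : BC) {ε T : ℝ} (hε : 0 < ε) (hT : 0 ≤ T) {n : ℕ} (hn : 0 < n)
    {r : Site} {lam : ℝ} (hl : 0 ≤ lam) {e : Site × Site} (he : e ∈ edges (cube n r) bc) :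
    gaussField {a | ε * T / 2 ≤ |grad (field ε lam (cube n r) a bc) e|} ≤
      ENNReal.ofReal (2 * Real.exp (-(T ^ 2 / 20736))) := by
  obtain ⟨i, h1, h2⟩ := mem_edges.1 he
  have he' : e = (e.1, e.1 + unit i) := Prod.ext rfl h1
  have h := measure_abs_sum_mul_gaussian_ge_le (fun k => measurable_coef bc r k)
    (gaussian_coef bc (n := n) r).1 (gaussian_coef bc r).2
    (sum_grad_coef_sq_le bc ε hl hn r e.1 i) (by positivity)
    (t := ε * T / 2) (by positivity)
  rw [he']
  simp only [grad_field_eq_sum bc ε hl hn h2]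
  refine h.trans (le_of_eq ?_)
  rw [div_pow, mul_pow]
  congr 4
  field_simp
  ring

/-- Division by 4n² brings every coefficient below 1/4, the range in which E exp(wX²) ≤ exp(2w) is
available. The exponent is then twice the sum of the coefficients, at most 2 · 36 n³/(4n²) = 18n. -/
theorem lintegral_exp_grad_energy_le (bc : BC) {n : ℕ} (hn : 0 < n) (r : Site) :
    ∫⁻ a, ENNReal.ofReal (Real.exp ((∑ k : Mode n, invEig bc k * coef bc r a k ^ 2) /
      (4 * n ^ 2))) ∂gaussField ≤ ENNReal.ofReal (Real.exp (18 * n)) := by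
  have hn' : (0 : ℝ) < n := by exact_mod_cast hn
  have h := lintegral_exp_sum_mul_sq_le (fun k => measurable_coef bc r k)
    (gaussian_coef bc (n := n) r).1 (gaussian_coef bc r).2
    (w := fun k => invEig bc k / (4 * n ^ 2))
    (fun k => div_nonneg (invEig_nonneg bc k) (by positivity)) fun k => by
      rw [div_le_div_iff₀ (by positivity) (by norm_num)]
      linarith [invEig_le bc k]
  have e : ∀ a, (∑ k : Mode n, invEig bc k * coef bc r a k ^ 2) / (4 * n ^ 2) =
      ∑ k : Mode n, invEig bc k / (4 * n ^ 2) * coef bc r a k ^ 2 := fun a => by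
    rw [Finset.sum_div]
    exact Finset.sum_congr rfl fun k _ => by ring
  simp only [e]
  refine h.trans (ENNReal.ofReal_le_ofReal (Real.exp_le_exp.2 ?_))
  rw [← Finset.sum_div, mul_div_assoc', div_le_iff₀ (by positivity)]
  have := sum_invEig_le bc n
  nlinarith

theorem lintegral_exp_field_energy_le (bc : BC) {n : ℕ} (hn : 0 < n) (r : Site) :
    ∫⁻ a, ENNReal.ofReal (Real.exp ((∑ k : Mode n, invEig bc k ^ 2 * coef bc r a k ^ 2) /
      (4 * n ^ 4))) ∂gaussField ≤ ENNReal.ofReal (Real.exp 162) := by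
  have hn' : (0 : ℝ) < n := by exact_mod_cast hn
  have h := lintegral_exp_sum_mul_sq_le (fun k => measurable_coef bc r k)
    (gaussian_coef bc (n := n) r).1 (gaussian_coef bc r).2
    (w := fun k => invEig bc k ^ 2 / (4 * n ^ 4))
    (fun k => by positivity) fun k => by
      rw [div_le_div_iff₀ (by positivity) (by norm_num)]
      have := pow_le_pow_left₀ (invEig_nonneg bc k) (invEig_le bc k) 2
      have e4 : ((n : ℝ) ^ 2) ^ 2 = n ^ 4 := by ring
      rw [e4] at this
      linarith
  have e : ∀ a, (∑ k : Mode n, invEig bc k ^ 2 * coef bc r a k ^ 2) / (4 * n ^ 4) =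
      ∑ k : Mode n, invEig bc k ^ 2 / (4 * n ^ 4) * coef bc r a k ^ 2 := fun a => by
    rw [Finset.sum_div]
    exact Finset.sum_congr rfl fun k _ => by ring
  simp only [e]
  refine h.trans (ENNReal.ofReal_le_ofReal (Real.exp_le_exp.2 ?_))
  rw [← Finset.sum_div, mul_div_assoc', div_le_iff₀ (by positivity)]
  have := sum_invEig_sq_le bc n
  linarith

/-- With B ≥ 76 the threshold B n³/(4n²) is at least 19n, which exceeds the exponent 18n of the
exponential moment by n. -/
theorem measure_energy_ge_le (bc : BC) {B : ℝ} (hB : 76 ≤ B) {n : ℕ} (hn : 0 < n) (r : Site) :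
    gaussField {a | B * n ^ 3 ≤ ∑ k : Mode n, invEig bc k * coef bc r a k ^ 2} ≤
      ENNReal.ofReal (Real.exp (-n)) := by
  have hn' : (0 : ℝ) < n := by exact_mod_cast hn
  have hm := measurable_coef bc (n := n) r
  have h := measure_le_of_lintegral_exp (by fun_prop) (lintegral_exp_grad_energy_le bc hn r)
    (t := 19 * n)
  refine (measure_mono fun a ha => ?_).trans (h.trans (le_of_eq ?_))
  · simp only [Set.mem_ofPred_eq] at ha ⊢
    rw [le_div_iff₀ (by positivity)]
    have : 76 * (n : ℝ) ^ 3 ≤ B * n ^ 3 := mul_le_mul_of_nonneg_right hB (by positivity)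
    linarith
  · rw [← Real.exp_add]
    congr 2
    ring

theorem measure_sum_sq_lt_le (S : Finset Site) :
    gaussField {a | ∑ y ∈ S, a y ^ 2 ≤ (S.card : ℝ) / 4} ≤
      ENNReal.ofReal (Real.exp (-((S.card : ℝ) / 4))) := by
  have h := measure_sum_sq_le_le (P := gaussField) (ι := S) (b := fun x a => a x)
    (fun x => measurable_pi_apply _) (fun x => hasLaw_eval x)
    (iIndepFun_eval.precomp Subtype.val_injective)
  simp only [Fintype.card_coe] at h
  have e : ∀ a : Site → ℝ, ∑ x : S, a x ^ 2 = ∑ y ∈ S, a y ^ 2 := fun a =>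
    Finset.sum_coe_sort S fun x => a x ^ 2
  simpa only [e] using h

theorem measure_abs_sum_ge_le (S : Finset Site) (c : Site → ℝ) {V t : ℝ}
    (hV : ∑ x ∈ S, c x ^ 2 ≤ V) (hV0 : 0 < V) (ht : 0 ≤ t) :
    gaussField {a | t ≤ |∑ x ∈ S, c x * a x|} ≤
      ENNReal.ofReal (2 * Real.exp (-(t ^ 2 / (2 * V)))) := by
  have h := measure_abs_sum_mul_gaussian_ge_le (P := gaussField) (ι := S) (b := fun x a => a x)
    (fun x => measurable_pi_apply _) (fun x => hasLaw_eval x)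
    (iIndepFun_eval.precomp Subtype.val_injective) (c := fun x => c x)
    (by rw [Finset.sum_coe_sort S fun x => c x ^ 2]; exact hV) hV0 ht
  have e : ∀ a : Site → ℝ, ∑ x : S, c x * a x = ∑ y ∈ S, c y * a y := fun a =>
    Finset.sum_coe_sort S fun x => c x * a x
  simpa only [e] using h

theorem card_edges_le (n : ℕ) (r : Site) (bc : BC) : (edges (cube n r) bc).card ≤ 6 * n ^ 3 := by
  have h : (edges (cube n r) .dirichlet).card ≤ 6 * n ^ 3 := by
    have h2 : ∀ x : Site, (Finset.univ.biUnion fun i : Fin 3 =>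
        ({(x, x + unit i), (x - unit i, x)} : Finset (Site × Site))).card ≤ 6 := fun x =>
      Finset.card_biUnion_le.trans
        ((Finset.sum_le_sum fun i _ => Finset.card_le_two).trans (by simp))
    refine Finset.card_biUnion_le.trans ((Finset.sum_le_sum fun x _ => h2 x).trans ?_)
    rw [Finset.sum_const, card_cube, smul_eq_mul, mul_comm]
  cases bc with
  | dirichlet => exact h
  | neumann => exact (Finset.card_filter_le _ _).trans h

theorem measure_exists_le {α ι : Type*} [MeasurableSpace α] (μ : Measure α) (s : Finset ι)
    (p : ι → α → Prop) {N D : ℝ} (hs : (s.card : ℝ) ≤ N) (hD : 0 ≤ D)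
    (h : ∀ i ∈ s, μ {a | p i a} ≤ ENNReal.ofReal D) :
    μ {a | ∃ i ∈ s, p i a} ≤ ENNReal.ofReal (N * D) := by
  have e : {a | ∃ i ∈ s, p i a} = ⋃ i ∈ s, {a | p i a} := by ext; simp
  rw [e]
  refine (measure_biUnion_finset_le _ _).trans ((Finset.sum_le_sum h).trans ?_)
  rw [Finset.sum_const, nsmul_eq_mul, ← ENNReal.ofReal_natCast,
    ← ENNReal.ofReal_mul (Nat.cast_nonneg _)]
  exact ENNReal.ofReal_le_ofReal (mul_le_mul_of_nonneg_right hs hD)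

/-- Bound for the probability that one of the events in `NiceEvents` fails. -/
noncomputable def niceError (T : ℝ) (n : ℕ) : ℝ :=
  100 * n ^ 13 * (Real.exp (-(T ^ 2 / 20736)) + Real.exp (-(n / 4)) +
    Real.exp (-(Real.log n ^ 90 / 4)))

theorem measure_not_niceEvents_le {B ε T : ℝ} (hB : 76 ≤ B) (hε : 0 < ε) (hT : 0 ≤ T) {n : ℕ}
    (hn : 0 < n) (hR : 1 ≤ Real.log n ^ 90) (r : Site) :
    gaussField {a | ¬ NiceEvents B ε T n r a} ≤ ENNReal.ofReal (niceError T n) := by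
  have hn' : (1 : ℝ) ≤ n := by exact_mod_cast hn
  set E1 := Real.exp (-(T ^ 2 / 20736)) with hE1
  set E2 := Real.exp (-((n : ℝ) / 4)) with hE2
  set E3 := Real.exp (-(Real.log n ^ 90 / 4)) with hE3
  have p1 : 0 < E1 := Real.exp_pos _
  have p2 : 0 < E2 := Real.exp_pos _
  have p3 : 0 < E3 := Real.exp_pos _
  set m := (n : ℝ) ^ 13 with hm
  have m1 : 1 ≤ m := one_le_pow₀ hn'
  have m3 : (n : ℝ) ^ 3 ≤ m := pow_le_pow_right₀ hn' (by norm_num)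
  have hcard : ((cube n r).card : ℝ) = n ^ 3 := by rw [card_cube]; push_cast; ring
  have A1 : ∀ bc, gaussField {a | ∃ x ∈ cube n r,
      ε * Real.sqrt n * T / 2 ≤ |field ε 0 (cube n r) a bc x|} ≤ ENNReal.ofReal (m * (2 * E1)) :=
    fun bc => measure_exists_le _ _ _ (by rw [hcard]; exact m3) (by positivity)
      fun x hx => measure_field_ge_le bc hε hT hn hx
  -- The union runs over n^10 + 1 masses and at most 6n³ edges, that is at most 12 n^13 pairs; this
  -- is the origin of the power 13 in `niceError`.
  have A2 : ∀ bc, gaussField {a | ∃ p ∈ Finset.range (n ^ 10 + 1) ×ˢ edges (cube n r) bc,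
      ε * T / 2 ≤ |grad (field ε (p.1 / (n : ℝ) ^ 11) (cube n r) a bc) p.2|} ≤
      ENNReal.ofReal (12 * m * (2 * E1)) := by
    intro bc
    refine measure_exists_le _ _ _ ?_ (by positivity) fun p hp => ?_
    · rw [Finset.card_product, Finset.card_range]
      have h1 : (((edges (cube n r) bc).card : ℕ) : ℝ) ≤ 6 * n ^ 3 := by
        exact_mod_cast card_edges_le n r bc
      have h2 : (((n ^ 10 + 1 : ℕ)) : ℝ) ≤ 2 * n ^ 10 := by
        push_cast
        linarith [one_le_pow₀ hn' (n := 10)]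
      push_cast at h2 ⊢
      refine (mul_le_mul h2 h1 (by positivity) (by positivity)).trans (le_of_eq ?_)
      rw [hm]; ring
    · exact measure_grad_ge_le bc hε hT hn (by positivity) (Finset.mem_product.1 hp).2
  have A3 := fun bc => measure_energy_ge_le bc hB hn r
  have A4 : gaussField {a | ∃ x ∈ cube n r,
      ∑ y ∈ Finset.Icc (fun i => x i - ⌊Real.log n ^ 90⌋) (fun i => x i + ⌊Real.log n ^ 90⌋),
        a y ^ 2 ≤ ((Finset.Icc (fun i => x i - ⌊Real.log n ^ 90⌋)
      (fun i => x i + ⌊Real.log n ^ 90⌋)).card : ℝ) / 4} ≤ ENNReal.ofReal (m * E3) := by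
    refine measure_exists_le _ _ _ (by rw [hcard]; exact m3) (by positivity) fun x hx => ?_
    refine (measure_sum_sq_lt_le _).trans (ENNReal.ofReal_le_ofReal (Real.exp_le_exp.2 ?_))
    have h1 := pow_three_le_card_ball hR x
    have h2 : Real.log n ^ 90 ≤ (Real.log n ^ 90) ^ 3 := le_self_pow₀ hR (by norm_num)
    linarith
  have A5 : gaussField {a | ∑ y ∈ cube n r, a y ^ 2 ≤ (n : ℝ) ^ 3 / 4} ≤ ENNReal.ofReal E2 := by
    have h := measure_sum_sq_lt_le (cube n r)
    rw [hcard] at h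
    refine h.trans (ENNReal.ofReal_le_ofReal (Real.exp_le_exp.2 ?_))
    have : (n : ℝ) ≤ n ^ 3 := le_self_pow₀ hn' (by norm_num)
    linarith
  have hEE : Real.exp (-(T ^ 2 / (2 * 1))) ≤ E1 := by
    rw [hE1, Real.exp_le_exp, neg_le_neg_iff]
    apply div_le_div_of_nonneg_left (sq_nonneg T) <;> norm_num
  have A6 : gaussField {a | ∃ x ∈ cube n r, T ≤ |a x|} ≤ ENNReal.ofReal (m * (2 * E1)) := by
    refine measure_exists_le _ _ _ (by rw [hcard]; exact m3) (by positivity) fun x _ => ?_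
    have h := measure_abs_sum_ge_le {x} (fun _ => 1) (V := 1) (by simp) one_pos hT
    simp only [Finset.sum_singleton, one_mul] at h
    exact h.trans (ENNReal.ofReal_le_ofReal (by linarith))
  have A7 : gaussField {a | T ≤ |average a (cube n r)| * Real.sqrt (cube n r).card} ≤
      ENNReal.ofReal (2 * E1) := by
    have hc : (0 : ℝ) < (n : ℝ) ^ 3 := by positivity
    have h := measure_abs_sum_ge_le (cube n r) (fun _ => (Real.sqrt (n ^ 3))⁻¹) (V := 1)
      (by
        rw [Finset.sum_const, nsmul_eq_mul, hcard, inv_pow, Real.sq_sqrt hc.le,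
          mul_inv_cancel₀ hc.ne']) one_pos hT
    have e : ∀ a : Site → ℝ, |average a (cube n r)| * Real.sqrt (cube n r).card =
        |∑ x ∈ cube n r, (Real.sqrt ((n : ℝ) ^ 3))⁻¹ * a x| := by
      intro a
      rw [← Finset.mul_sum, abs_mul, average, abs_div, hcard, abs_of_pos hc,
        abs_of_pos (inv_pos.2 (Real.sqrt_pos.2 hc)), div_mul_eq_mul_div, mul_comm (|∑ x ∈ _, a x|),
        mul_div_right_comm]
      congr 1
      rw [div_eq_iff hc.ne', ← div_eq_inv_mul, eq_div_iff (Real.sqrt_pos.2 hc).ne',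
        Real.mul_self_sqrt hc.le]
    simp only [e]
    exact h.trans (ENNReal.ofReal_le_ofReal (by linarith))
  have hsub : {a | ¬ NiceEvents B ε T n r a} ⊆
      ({a | ∃ x ∈ cube n r, ε * Real.sqrt n * T / 2 ≤ |field ε 0 (cube n r) a .dirichlet x|} ∪
       {a | ∃ x ∈ cube n r, ε * Real.sqrt n * T / 2 ≤ |field ε 0 (cube n r) a .neumann x|}) ∪
      ({a | ∃ p ∈ Finset.range (n ^ 10 + 1) ×ˢ edges (cube n r) .dirichlet,
        ε * T / 2 ≤ |grad (field ε (p.1 / (n : ℝ) ^ 11) (cube n r) a .dirichlet) p.2|} ∪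
       {a | ∃ p ∈ Finset.range (n ^ 10 + 1) ×ˢ edges (cube n r) .neumann,
        ε * T / 2 ≤ |grad (field ε (p.1 / (n : ℝ) ^ 11) (cube n r) a .neumann) p.2|}) ∪
      ({a | B * n ^ 3 ≤ ∑ k : Mode n, invEig .dirichlet k * coef .dirichlet r a k ^ 2} ∪
       {a | B * n ^ 3 ≤ ∑ k : Mode n, invEig .neumann k * coef .neumann r a k ^ 2}) ∪
      ({a | ∃ x ∈ cube n r,
        ∑ y ∈ Finset.Icc (fun i => x i - ⌊Real.log n ^ 90⌋) (fun i => x i + ⌊Real.log n ^ 90⌋),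
        a y ^ 2 ≤ ((Finset.Icc (fun i => x i - ⌊Real.log n ^ 90⌋)
        (fun i => x i + ⌊Real.log n ^ 90⌋)).card : ℝ) / 4} ∪
       {a | ∑ y ∈ cube n r, a y ^ 2 ≤ (n : ℝ) ^ 3 / 4}) ∪
      ({a | ∃ x ∈ cube n r, T ≤ |a x|} ∪
       {a | T ≤ |average a (cube n r)| * Real.sqrt (cube n r).card}) := by
    intro a ha
    by_contra hc
    simp only [Set.mem_union, Set.mem_ofPred_eq, not_or, not_exists, not_and, not_le] at hc ha
    obtain ⟨⟨⟨⟨⟨c1, c2⟩, ⟨c3, c4⟩⟩, ⟨c5, c6⟩⟩, ⟨c7, c8⟩⟩, ⟨c9, c10⟩⟩ := hc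
    refine ha ⟨fun bc x hx => ?_, fun bc j hj e he => ?_, fun bc => ?_, fun x hx _ => (c7 x hx).le,
      c8.le, fun x hx => (c9 x hx).le, c10.le⟩
    · cases bc
      · exact (c1 x hx).le
      · exact (c2 x hx).le
    · cases bc
      · exact (c3 (j, e) (by simp [he]; omega)).le
      · exact (c4 (j, e) (by simp [he]; omega)).le
    · cases bc
      · exact c5.le
      · exact c6.le
  have un : ∀ {s t : Set (Site → ℝ)} {u v : ℝ}, gaussField s ≤ ENNReal.ofReal u →
      gaussField t ≤ ENNReal.ofReal v → 0 ≤ u → 0 ≤ v →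
      gaussField (s ∪ t) ≤ ENNReal.ofReal (u + v) := fun hs ht hu hv => by
    rw [ENNReal.ofReal_add hu hv]
    exact (measure_union_le _ _).trans (add_le_add hs ht)
  have E2' : Real.exp (-(n : ℝ)) ≤ E2 := by
    rw [hE2, Real.exp_le_exp]; linarith
  refine (measure_mono hsub).trans ((un (un (un (un (un (A1 _) (A1 _) ?_ ?_)
    (un (A2 _) (A2 _) ?_ ?_) ?_ ?_) (un (A3 _) (A3 _) ?_ ?_) ?_ ?_) (un A4 A5 ?_ ?_) ?_ ?_)
    (un A6 A7 ?_ ?_) ?_ ?_).trans (ENNReal.ofReal_le_ofReal ?_)) <;> try positivity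
  rw [niceError, ← hE1, ← hE2, ← hE3, ← hm]
  have q1 : E1 ≤ m * E1 := le_mul_of_one_le_left p1.le m1
  have q2 : E2 ≤ m * E2 := le_mul_of_one_le_left p2.le m1
  have q3 : 0 ≤ m * E3 := by positivity
  have q4 : 0 ≤ m * E1 := by positivity
  have q5 : 0 ≤ m * E2 := by positivity
  linarith

/-! ### Coarse geometry -/

/-- `x` and `y` have `ℓ^∞` distance at most `d`. -/
def Near (d : ℤ) (x y : Site) : Prop := ∀ i, |x i - y i| ≤ d

theorem Near.symm {d : ℤ} {x y : Site} (h : Near d x y) : Near d y x := fun i => by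
  rw [abs_sub_comm]; exact h i

theorem Near.trans {d d' : ℤ} {x y z : Site} (h : Near d x y) (h' : Near d' y z) :
    Near (d + d') x z := fun i =>
  (abs_sub_le _ (y i) _).trans (add_le_add (h i) (h' i))

theorem Near.mono {d d' : ℤ} {x y : Site} (h : Near d x y) (hd : d ≤ d') : Near d' x y :=
  fun i => (h i).trans hd

theorem Near.refl {d : ℤ} (hd : 0 ≤ d) (x : Site) : Near d x x := fun i => by simpa using hd

/-- The index of the cube of side `n` that contains `x`. -/
def boxIndex (n : ℕ) (x : Site) : Site := fun i => x i / n

theorem mem_cube_iff_boxIndex {n : ℕ} (hn : 0 < n) {x q : Site} :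
    x ∈ cube n (fun i => n * q i) ↔ boxIndex n x = q := by
  have hn' : (0 : ℤ) < n := by exact_mod_cast hn
  rw [mem_cube, funext_iff]
  refine forall_congr' fun i => ?_
  rw [boxIndex, Int.ediv_eq_iff_of_pos hn']
  constructor <;> rintro ⟨h1, h2⟩ <;> constructor <;> nlinarith

theorem Near.boxIndex {n : ℕ} (hn : 0 < n) {x y : Site} {d : ℤ} (h : Near (d * n) x y) :
    Near d (boxIndex n x) (boxIndex n y) := by
  have hn' : (0 : ℤ) < n := by exact_mod_cast hn
  have key : ∀ s t : ℤ, s ≤ t + d * n → s / n ≤ t / n + d := fun s t hst => by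
    rw [← Int.add_mul_ediv_right t d hn'.ne']
    exact Int.ediv_le_ediv hn' hst
  intro i
  have := abs_le.1 (h i)
  rw [abs_le]
  simp only [RFO.boxIndex]
  constructor
  · linarith [key (y i) (x i) (by linarith)]
  · linarith [key (x i) (y i) (by linarith)]

theorem ScaleMeasurable.mem_of_boxIndex_eq {n : ℕ} (hn : 0 < n) {Y : Set Site}
    (hY : ScaleMeasurable n Y) {x y : Site} (hx : x ∈ Y) (h : boxIndex n y = boxIndex n x) :
    y ∈ Y := by
  obtain ⟨R, hR, rfl⟩ := hY
  simp only [Set.mem_iUnion, Finset.mem_coe] at hx ⊢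
  obtain ⟨r, hr, hxr⟩ := hx
  refine ⟨r, hr, ?_⟩
  choose q hq using hR r hr
  have e : r = fun i => n * q i := funext hq
  rw [e, mem_cube_iff_boxIndex hn] at hxr ⊢
  rw [h, hxr]

theorem toReal_mem_solid {A : Set Site} {x : Site} (hx : x ∈ A) : toReal x ∈ solid A :=
  Set.mem_biUnion hx (Metric.mem_closedBall_self (by norm_num))

theorem isClosed_solid {A : Set Site} (hA : A.Finite) : IsClosed (solid A) :=
  hA.isClosed_biUnion fun _ _ => Metric.isClosed_closedBall

theorem mem_solid {A : Set Site} {p : Fin 3 → ℝ} :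
    p ∈ solid A ↔ ∃ x ∈ A, ∀ i, |p i - x i| ≤ 1 / 2 := by
  simp only [solid, Set.mem_iUnion, exists_prop]
  refine exists_congr fun x => and_congr_right fun _ => ?_
  rw [Metric.mem_closedBall, dist_pi_le_iff (by norm_num)]
  simp only [Real.dist_eq, toReal]

/-- A finite set of sites is linked if it is connected for `ℓ^∞` adjacency. -/
def Linked (V : Finset Site) : Prop :=
  ∀ S ⊆ V, S.Nonempty → S ≠ V → ∃ s ∈ S, ∃ t ∈ V, t ∉ S ∧ Near 1 t s

/-- A proper non-empty set S of box indices splits the solid of Y into two closed parts. By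
connectedness these share a point, and that point is within 1/2 of a site of each part. The two
sites differ by at most 1, hence so do their box indices. -/
theorem LatticeConnected.linked {n : ℕ} (hn : 0 < n) {Y : Set Site} (hY : Y.Finite)
    (hc : LatticeConnected Y) {V : Finset Site} (hV : ∀ q, q ∈ V ↔ ∃ y ∈ Y, boxIndex n y = q) :
    Linked V := by
  intro S hS hne hSV
  by_contra! hno
  obtain ⟨v, hv, hvS⟩ : ∃ v ∈ V, v ∉ S := by
    by_contra! h
    exact hSV (Finset.Subset.antisymm hS h)
  obtain ⟨s, hs⟩ := hne
  have hc' := isPreconnected_closed_iff.1 hc.isPreconnected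
    (solid {y ∈ Y | boxIndex n y ∈ S}) (solid {y ∈ Y | boxIndex n y ∉ S})
    (isClosed_solid (hY.subset (Set.sep_subset _ _)))
    (isClosed_solid (hY.subset (Set.sep_subset _ _))) ?_ ?_ ?_
  · obtain ⟨p, -, h1, h2⟩ := hc'
    obtain ⟨x, ⟨hx, hxS⟩, hpx⟩ := mem_solid.1 h1
    obtain ⟨y, ⟨hy, hyS⟩, hpy⟩ := mem_solid.1 h2
    refine hno _ hxS _ ((hV _).2 ⟨y, hy, rfl⟩) hyS (Near.boxIndex hn fun i => ?_)
    have h3 := hpx i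
    have h4 := hpy i
    have : |(y i : ℝ) - x i| ≤ 1 := by
      rw [abs_le] at *
      constructor <;> linarith
    have h5 : |y i - x i| ≤ 1 := by exact_mod_cast this
    have h6 : (1 : ℤ) ≤ n := by exact_mod_cast hn
    linarith
  · intro p hp
    obtain ⟨x, hx, hpx⟩ := mem_solid.1 hp
    by_cases h : boxIndex n x ∈ S
    · exact Or.inl (mem_solid.2 ⟨x, ⟨hx, h⟩, hpx⟩)
    · exact Or.inr (mem_solid.2 ⟨x, ⟨hx, h⟩, hpx⟩)
  · obtain ⟨y, hy, rfl⟩ := (hV s).1 (hS hs)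
    exact ⟨toReal y, toReal_mem_solid hy, toReal_mem_solid ⟨hy, hs⟩⟩
  · obtain ⟨y, hy, rfl⟩ := (hV v).1 hv
    exact ⟨toReal y, toReal_mem_solid hy, toReal_mem_solid ⟨hy, hvS⟩⟩

/-- A linked set is covered by a walk whose length is at most twice its cardinality. -/
theorem Linked.exists_walk {V : Finset Site} (hV : Linked V) {q : Site} (hq : q ∈ V) :
    ∃ f : ℕ → Site, f 0 = q ∧ (∀ i, Near 1 (f (i + 1)) (f i)) ∧
      ∀ v ∈ V, ∃ i ≤ 2 * V.card, f i = v := by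
  have key : ∀ m : ℕ, m < V.card → ∃ S ⊆ V, S.card = m + 1 ∧ q ∈ S ∧ ∃ f : ℕ → Site, f 0 = q ∧
      (∀ i, Near 1 (f (i + 1)) (f i)) ∧ ∀ v ∈ S, ∃ i ≤ 2 * m, f i = v := by
    intro m
    induction m with
    | zero =>
      intro _
      refine ⟨{q}, by simpa using hq, by simp, by simp, fun _ => q, rfl,
        fun i => Near.refl zero_le_one _, fun v hv => ⟨0, le_rfl, ?_⟩⟩
      exact (Finset.mem_singleton.1 hv).symm
    | succ m ih =>
      intro hm
      obtain ⟨S, hSV, hcard, hqS, f, hf0, hf, hcov⟩ := ih (by omega)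
      obtain ⟨s, hs, t, ht, htS, hst⟩ := hV S hSV ⟨q, hqS⟩ (by rintro rfl; omega)
      obtain ⟨j, hj, hfj⟩ := hcov s hs
      refine ⟨insert t S, Finset.insert_subset ht hSV, by
        rw [Finset.card_insert_of_notMem htS, hcard], Finset.mem_insert_of_mem hqS,
        -- A detour: follow the walk to s, reached at time j, step to the new point t, return to s,
        -- and continue with a delay of two. Each new point costs two steps.
        fun i => if i ≤ j then f i else if i = j + 1 then t else f (i - 2), ?_, ?_, ?_⟩
      · simp [hf0]
      · intro i
        by_cases h1 : i + 1 ≤ j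
        · simp only [h1, if_true, (by omega : i ≤ j)]
          exact hf i
        · rcases Nat.lt_trichotomy i j with h | h | h
          · omega
          · subst h
            simp only [h1, if_false, if_true, le_refl]
            rw [hfj]; exact hst
          · have e1 : ¬ i ≤ j := by omega
            have e2 : ¬ i + 1 = j + 1 := by omega
            simp only [h1, e1, e2, if_false]
            split_ifs with h3
            · subst h3
              simp only [show j + 1 + 1 - 2 = j by omega]
              rw [hfj]; exact hst.symm
            · have : i + 1 - 2 = (i - 2) + 1 := by omega
              rw [this]
              exact hf _
      · intro v hv
        rcases Finset.mem_insert.1 hv with rfl | hv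
        · exact ⟨j + 1, by omega, by simp⟩
        · obtain ⟨i, hi, hfi⟩ := hcov v hv
          by_cases hij : i ≤ j
          · exact ⟨i, by omega, by simp [hij, hfi]⟩
          · refine ⟨i + 2, by omega, ?_⟩
            have e1 : ¬ i + 2 ≤ j := by omega
            have e2 : ¬ i + 2 = j + 1 := by omega
            simp [e1, e2, hfi]
  have hpos : 0 < V.card := Finset.card_pos.2 ⟨q, hq⟩
  obtain ⟨S, hSV, hcard, -, f, hf0, hf, hcov⟩ := key (V.card - 1) (by omega)
  have hSV' : S = V := Finset.eq_of_subset_of_card_le hSV (by omega)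
  refine ⟨f, hf0, hf, fun v hv => ?_⟩
  obtain ⟨i, hi, hfi⟩ := hcov v (by rwa [hSV'])
  exact ⟨i, by omega, hfi⟩

theorem near_of_steps {f : ℕ → Site} (hf : ∀ i, Near 1 (f (i + 1)) (f i)) (i j : ℕ) :
    Near j (f (i + j)) (f i) := by
  induction j with
  | zero => exact Near.refl (by simp) _
  | succ j ih =>
    have := (hf (i + j)).trans ih
    rw [← add_assoc]
    exact this.mono (by push_cast; linarith)

/-- The ray from x in direction ±e₀ is unbounded. If it avoided the solid of Y it would lie in the
component of x, which is bounded. A point of the solid on the ray belongs to the unit box of a site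
whose other coordinates differ from those of x by at most 1/2, so they agree. -/
theorem exists_mem_on_ray {Y : Set Site} {x : Site} (hx : x ∈ interiorSites Y) (σ : ℝ)
    (hσ : σ = 1 ∨ σ = -1) : ∃ y ∈ Y, (∀ i, i ≠ 0 → y i = x i) ∧ 0 ≤ σ * ((y 0 : ℝ) - x 0) := by
  obtain ⟨hx1, hx2⟩ := hx
  let γ : ℝ → Fin 3 → ℝ := fun t i => toReal x i + if i = 0 then σ * t else 0
  have hγ : Continuous γ := by
    refine continuous_pi fun i => ?_
    by_cases hi : i = 0 <;> simp only [γ, hi, if_true, if_false] <;> fun_prop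
  have hγ0 : γ 0 = toReal x := by funext i; simp [γ]
  by_cases hd : γ '' Set.Ici 0 ⊆ (solid Y)ᶜ
  · exfalso
    have h1 : γ '' Set.Ici 0 ⊆ connectedComponentIn (solid Y)ᶜ (toReal x) :=
      (isPreconnected_Ici.image γ hγ.continuousOn).subset_connectedComponentIn
        ⟨0, Set.mem_Ici.2 le_rfl, hγ0⟩ hd
    obtain ⟨C, hC⟩ := (hx2.subset h1).exists_norm_le
    have hC0 : 0 ≤ C := (norm_nonneg _).trans (hC _ ⟨0, Set.mem_Ici.2 le_rfl, rfl⟩)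
    have h2 := hC (γ (C + |(x 0 : ℝ)| + 1))
      ⟨_, Set.mem_Ici.2 (by positivity), rfl⟩
    have h3 := (norm_le_pi_norm (γ (C + |(x 0 : ℝ)| + 1)) 0).trans h2
    simp only [γ, if_true, Real.norm_eq_abs, toReal] at h3
    have h4 := abs_le.1 h3
    rcases hσ with rfl | rfl
    · linarith [neg_abs_le (x 0 : ℝ), h4.2]
    · linarith [le_abs_self (x 0 : ℝ), h4.1]
  · rw [Set.not_subset] at hd
    obtain ⟨_, ⟨t, ht, rfl⟩, hts⟩ := hd
    rw [Set.notMem_compl_iff] at hts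
    obtain ⟨y, hy, hty⟩ := mem_solid.1 hts
    refine ⟨y, hy, fun i hi => ?_, ?_⟩
    · have := hty i
      simp only [γ, hi, if_false, add_zero, toReal] at this
      have h1 : |(x i : ℝ) - y i| < 1 := by linarith
      have h2 : |x i - y i| < 1 := by exact_mod_cast h1
      have := abs_lt.1 h2
      omega
    · have := hty 0
      simp only [γ, if_true, toReal] at this
      have ht0 : 0 ≤ t := ht
      have h1 := abs_le.1 this
      rcases hσ with rfl | rfl
      · have h2 : (x 0 : ℝ) - 1 < y 0 := by linarith [h1.2]
        have h3 : x 0 - 1 < y 0 := by exact_mod_cast h2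
        have h4 : x 0 ≤ y 0 := by omega
        have h5 : (x 0 : ℝ) ≤ y 0 := by exact_mod_cast h4
        linarith
      · have h2 : (y 0 : ℝ) < x 0 + 1 := by linarith [h1.1]
        have h3 : y 0 < x 0 + 1 := by exact_mod_cast h2
        have h4 : y 0 ≤ x 0 := by omega
        have h5 : (y 0 : ℝ) ≤ x 0 := by exact_mod_cast h4
        linarith

/-- A distance below ℓ ≤ n between unions of unit boxes means that the closest sites differ by at
most n in each coordinate, so the boxes of side n that contain them coincide or touch. -/
theorem exists_near_of_mem_enlarge {ℓ n : ℕ} (hn : 0 < n) (hℓ : ℓ ≤ n) {Y : Set Site} {x : Site}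
    (hx : x ∈ enlarge ℓ n Y) : ∃ y ∈ Y, Near 1 (boxIndex n x) (boxIndex n y) := by
  simp only [enlarge, Set.mem_iUnion, Set.mem_ofPred_eq, exists_prop, Finset.mem_coe] at hx
  obtain ⟨r, ⟨hr, p, hp, q, hq, hpq⟩, hxr⟩ := hx
  choose s hs using hr
  have e : r = fun i => n * s i := funext hs
  obtain ⟨x', hx', hpx⟩ := mem_solid.1 hp
  obtain ⟨y, hy, hqy⟩ := mem_solid.1 hq
  refine ⟨y, hy, ?_⟩
  have hxx' : boxIndex n x = boxIndex n x' := by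
    rw [Finset.mem_coe] at hx'
    rw [e, mem_cube_iff_boxIndex hn] at hxr hx'
    rw [hxr, hx']
  rw [hxx']
  refine Near.boxIndex hn fun i => ?_
  have h1 := hpx i
  have h2 := hqy i
  have h3 := (dist_le_pi_dist p q i).trans_lt hpq
  rw [Real.dist_eq] at h3
  have h4 : |(x' i : ℝ) - y i| < ℓ + 1 := by
    rw [abs_le] at h1 h2
    rw [abs_lt] at *
    constructor <;> linarith
  have h5 : |x' i - y i| < ℓ + 1 := by exact_mod_cast h4
  have h6 : (ℓ : ℤ) ≤ n := by exact_mod_cast hℓ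
  linarith

theorem subset_enlarge {ℓ n : ℕ} (hn : 0 < n) (hℓ : 0 < ℓ) (Y : Set Site) : Y ⊆ enlarge ℓ n Y := by
  intro y hy
  simp only [enlarge, Set.mem_iUnion, Set.mem_ofPred_eq, exists_prop, Finset.mem_coe]
  have hmem : y ∈ cube n (fun i => n * boxIndex n y i) := (mem_cube_iff_boxIndex hn).2 rfl
  exact ⟨_, ⟨fun i => dvd_mul_right _ _, toReal y, toReal_mem_solid hmem, toReal y,
    toReal_mem_solid hy, by simpa using hℓ⟩, hmem⟩

/-- A site of the closed hull is close to the set, in terms of the number of boxes in the set. -/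
theorem exists_near_of_mem_closedHull {ℓ n : ℕ} (hn : 0 < n) (hℓ : ℓ ≤ n) {Y : Set Site}
    {V : Finset Site} (hV : ∀ q, q ∈ V ↔ ∃ y ∈ Y, boxIndex n y = q) (hlink : Linked V) {x : Site}
    (hx : x ∈ closedHull ℓ n Y) : ∃ q ∈ V, Near (2 * V.card) q (boxIndex n x) := by
  rcases hx with hx | hx
  · obtain ⟨y, hy, h⟩ := exists_near_of_mem_enlarge hn hℓ hx
    have hq := (hV _).2 ⟨y, hy, rfl⟩
    have : 0 < V.card := Finset.card_pos.2 ⟨_, hq⟩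
    exact ⟨_, hq, h.symm.mono (by omega)⟩
  · obtain ⟨y, hy, hy1, hy2⟩ := exists_mem_on_ray hx 1 (Or.inl rfl)
    obtain ⟨z, hz, hz1, hz2⟩ := exists_mem_on_ray hx (-1) (Or.inr rfl)
    have hqy := (hV _).2 ⟨y, hy, rfl⟩
    have hqz := (hV _).2 ⟨z, hz, rfl⟩
    refine ⟨_, hqy, fun i => ?_⟩
    -- An interior site x lies between sites y and z of Y on one coordinate line. The boxes of y and
    -- z are joined by a walk of at most 2|V| steps, so the box of x, caught between them, is no
    -- further than that from the box of y.
    obtain ⟨f, hf0, hf, hcov⟩ := hlink.exists_walk hqz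
    obtain ⟨j, hj, hfj⟩ := hcov _ hqy
    have h1 := near_of_steps hf 0 j 0
    rw [zero_add, hfj, hf0] at h1
    by_cases hi : i = 0
    · subst hi
      have hn' : (0 : ℤ) < n := by exact_mod_cast hn
      have a1 : (x 0 : ℝ) ≤ y 0 := by linarith
      have a2 : (z 0 : ℝ) ≤ x 0 := by linarith
      have b1 : boxIndex n x 0 ≤ boxIndex n y 0 := Int.ediv_le_ediv hn' (by exact_mod_cast a1)
      have b2 : boxIndex n z 0 ≤ boxIndex n x 0 := Int.ediv_le_ediv hn' (by exact_mod_cast a2)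
      have hj' : (j : ℤ) ≤ 2 * V.card := by exact_mod_cast hj
      rw [abs_le] at h1 ⊢
      constructor <;> omega
    · have : boxIndex n y i = boxIndex n x i := by simp only [boxIndex, hy1 i hi]
      rw [this, sub_self, abs_zero]
      positivity

/-! ### Coarse covers of walks -/

/-- A cube of side `5 K` around the coarse cube of side `K` with index `v`. -/
noncomputable def block (K : ℕ) (v : Site) : Finset Site := cube (5 * K) fun i => K * (v i - 2)

/-- The sites adjacent to `v`, including `v`. -/
noncomputable def neighbours (v : Site) : Finset Site := Finset.Icc (fun i => v i - 1) (fun i => v i + 1)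

theorem card_neighbours (v : Site) : (neighbours v).card = 27 := by
  have e : ∀ i, v i + 1 + 1 - (v i - 1) = 3 := fun i => by ring
  rw [neighbours, Pi.card_Icc]
  simp only [Int.card_Icc, e, Int.reduceToNat, Finset.prod_const, Finset.card_univ,
    Fintype.card_fin]
  norm_num

theorem mem_neighbours {v w : Site} : w ∈ neighbours v ↔ Near 1 w v := by
  rw [neighbours, Finset.mem_Icc, Pi.le_def, Pi.le_def, ← forall_and]
  refine forall_congr' fun i => ?_
  rw [abs_le]
  constructor <;> rintro ⟨h1, h2⟩ <;> constructor <;> linarith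

open Classical in
/-- The unions of the blocks along the coarse walks of length `J` from `v`. -/
noncomputable def covers (K : ℕ) : ℕ → Site → Finset (Finset Site)
  | 0, v => {block K v}
  | J + 1, v => (neighbours v).biUnion fun w => (covers K J w).image fun S => block K v ∪ S

theorem card_covers_le (K J : ℕ) (v : Site) : (covers K J v).card ≤ 27 ^ J := by
  induction J generalizing v with
  | zero => simp [covers]
  | succ J ih =>
    refine Finset.card_biUnion_le.trans ?_
    refine (Finset.sum_le_sum fun w _ => Finset.card_image_le.trans (ih w)).trans ?_
    rw [Finset.sum_const, card_neighbours, smul_eq_mul, pow_succ, mul_comm]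

theorem card_le_of_mem_covers {K J : ℕ} {v : Site} {S : Finset Site} (hS : S ∈ covers K J v) :
    S.card ≤ (J + 1) * (5 * K) ^ 3 := by
  induction J generalizing v S with
  | zero =>
    rw [covers, Finset.mem_singleton] at hS
    rw [hS, block, card_cube]
    omega
  | succ J ih =>
    rw [covers, Finset.mem_biUnion] at hS
    obtain ⟨w, _, hS⟩ := hS
    obtain ⟨S', hS', rfl⟩ := Finset.mem_image.1 hS
    have h1 := Finset.card_union_le (block K v) S'
    have h2 := ih hS'
    have h3 : (block K v).card = (5 * K) ^ 3 := card_cube _ _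
    rw [h3] at h1
    calc _ ≤ _ := h1
      _ ≤ (5 * K) ^ 3 + (J + 1) * (5 * K) ^ 3 := by omega
      _ = _ := by ring

theorem mem_block {K : ℕ} (hK : 0 < K) {x y : Site} (h : Near (K + 1) y x) :
    y ∈ block K (boxIndex K x) := by
  rw [block, mem_cube]
  intro i
  have hK' : (0 : ℤ) < K := by exact_mod_cast hK
  have h1 := abs_le.1 (h i)
  have h2 := Int.mul_ediv_add_emod (x i) K
  have h3 := Int.emod_nonneg (x i) hK'.ne'
  have h4 := Int.emod_lt_of_pos (x i) hK'
  simp only [boxIndex]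
  push_cast
  constructor <;> nlinarith

/-- During K steps the walk stays within K of where it was, so the block around the coarse cube of
its position contains those steps and their neighbours. The coarse cubes met at successive multiples
of K are adjacent, which leaves 27 choices each time. -/
theorem exists_cover {K : ℕ} (hK : 0 < K) (J : ℕ) {f : ℕ → Site}
    (hf : ∀ i, Near 1 (f (i + 1)) (f i)) :
    ∃ S ∈ covers K J (boxIndex K (f 0)), ∀ i ≤ (J + 1) * K, ∀ y, Near 1 y (f i) → y ∈ S := by
  classical
  induction J generalizing f with
  | zero =>
    refine ⟨_, Finset.mem_singleton_self _, fun i hi y hy => mem_block hK ?_⟩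
    have h1 := near_of_steps hf 0 i
    rw [zero_add] at h1
    refine (hy.trans h1).mono ?_
    have : (i : ℤ) ≤ K := by exact_mod_cast (by simpa using hi : i ≤ K)
    linarith
  | succ J ih =>
    obtain ⟨S, hS, hcov⟩ := ih (f := fun i => f (K + i)) fun i => hf (K + i)
    have hnear : Near 1 (boxIndex K (f K)) (boxIndex K (f 0)) := by
      refine Near.boxIndex hK ?_
      have := near_of_steps hf 0 K
      rw [zero_add] at this
      simpa using this
    refine ⟨block K (boxIndex K (f 0)) ∪ S, ?_, fun i hi y hy => ?_⟩
    · rw [covers, Finset.mem_biUnion]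
      exact ⟨_, mem_neighbours.2 hnear, Finset.mem_image_of_mem _ hS⟩
    · rcases le_total i K with hiK | hiK
      · refine Finset.mem_union_left _ (mem_block hK ?_)
        have h1 := near_of_steps hf 0 i
        rw [zero_add] at h1
        refine (hy.trans h1).mono ?_
        have : (i : ℤ) ≤ K := by exact_mod_cast hiK
        linarith
      · refine Finset.mem_union_right _ (hcov (i - K) ?_ y ?_)
        · have : (J + 1 + 1) * K = (J + 1) * K + K := by ring
          omega
        · rwa [Nat.add_sub_cancel' hiK]

/-! ### Independence of local functions -/

/-- Extension by zero of a function on a finite set of sites. -/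
noncomputable def extendSites (S : Finset Site) (u : S → ℝ) (x : Site) : ℝ :=
  if h : x ∈ S then u ⟨x, h⟩ else 0

theorem measurable_extendSites (S : Finset Site) : Measurable (extendSites S) := by
  refine measurable_pi_lambda _ fun x => ?_
  by_cases h : x ∈ S
  · simp only [extendSites, h, dif_pos]; fun_prop
  · simp only [extendSites, h, dif_neg, not_false_iff]; fun_prop

theorem indepFun_of_dependsOn {β β' : Type*} [MeasurableSpace β] [MeasurableSpace β']
    {f : (Site → ℝ) → β} {g : (Site → ℝ) → β'} (hf : Measurable f) (hg : Measurable g)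
    {S T : Finset Site} (hfS : DependsOn f (S : Set Site)) (hgT : DependsOn g (T : Set Site))
    (hST : Disjoint S T) : IndepFun f g gaussField := by
  have h := iIndepFun_eval.indepFun_finset S T hST fun x => measurable_pi_apply x
  have h2 := h.comp (hf.comp (measurable_extendSites S)) (hg.comp (measurable_extendSites T))
  have e1 : (f ∘ extendSites S) ∘ (fun (a : Site → ℝ) (i : S) => a i) = f := by
    funext a
    exact hfS fun x hx => by simp [extendSites, Finset.mem_coe.1 hx]
  have e2 : (g ∘ extendSites T) ∘ (fun (a : Site → ℝ) (i : T) => a i) = g := by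
    funext a
    exact hgT fun x hx => by simp [extendSites, Finset.mem_coe.1 hx]
  rwa [e1, e2] at h2

theorem lintegral_prod_of_dependsOn {I : Finset Site} {F : Site → (Site → ℝ) → ℝ≥0∞}
    {U : Site → Finset Site} (hF : ∀ q, Measurable (F q))
    (hU : ∀ q, DependsOn (F q) (U q : Set Site))
    (hd : ∀ q ∈ I, ∀ p ∈ I, q ≠ p → Disjoint (U q) (U p)) :
    ∫⁻ a, ∏ q ∈ I, F q a ∂gaussField = ∏ q ∈ I, ∫⁻ a, F q a ∂gaussField := by
  classical
  induction I using Finset.induction_on with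
  | empty => simp
  | insert q I hq ih =>
    rw [Finset.prod_insert hq, ← ih fun q hq p hp => hd q (Finset.mem_insert_of_mem hq) p
      (Finset.mem_insert_of_mem hp)]
    simp only [Finset.prod_insert hq]
    refine lintegral_mul_eq_lintegral_mul_lintegral_of_indepFun (hF q)
      (Finset.measurable_prod _ fun p _ => hF p) ?_
    refine indepFun_of_dependsOn (hF q) (Finset.measurable_prod _ fun p _ => hF p) (hU q)
      (T := I.biUnion U) (fun a b hab => Finset.prod_congr rfl fun p hp => hU p fun x hx =>
        hab x ?_) ?_
    · exact Finset.mem_coe.2 (Finset.mem_biUnion.2 ⟨p, hp, Finset.mem_coe.1 hx⟩)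
    · rw [Finset.disjoint_biUnion_right]
      exact fun p hp => hd q (Finset.mem_insert_self _ _) p (Finset.mem_insert_of_mem hp)
        (by rintro rfl; exact hq hp)

theorem disjoint_block {L : ℕ} {q p : Site} {i : Fin 3} (h : 5 ≤ |q i - p i|) :
    Disjoint (block L q) (block L p) := by
  rw [Finset.disjoint_left]
  intro x hx hx'
  have h1 := mem_cube.1 hx i
  have h2 := mem_cube.1 hx' i
  have hL : (0 : ℤ) ≤ L := by positivity
  push_cast at h1 h2
  rcases le_abs.1 h with h | h
  · nlinarith
  · nlinarith

/-! ### Chernoff bounds for local weights and the entropy of heavy sets. -/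

section Heavy

variable {L : ℕ} {W : Site → (Site → ℝ) → ℝ} {s τ : ℝ}

/-- Exponential moments of sums of local functions. -/
theorem lintegral_exp_sum_le (hWm : ∀ q, Measurable (W q))
    (hWd : ∀ q, DependsOn (W q) (block L q : Set Site)) (hτ : 0 ≤ τ)
    (hW : ∀ q, ∫⁻ a, ENNReal.ofReal (Real.exp (125 * s * W q a)) ∂gaussField ≤
      ENNReal.ofReal (1 + τ)) (S : Finset Site) :
    ∫⁻ a, ENNReal.ofReal (Real.exp (s * ∑ q ∈ S, W q a)) ∂gaussField ≤
      ENNReal.ofReal ((1 + τ) ^ S.card) := by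
  classical
  -- Two boxes of the same colour modulo 5 that are distinct differ by at least 5 in some
  -- coordinate, so their blocks of side 5L are disjoint. The 125 colours account for the factor 125
  -- in the exponential moment of a single weight.
  let cls : Site → Fin 3 → ZMod 5 := fun q i => (q i : ZMod 5)
  have hcard : (Fintype.card (Fin 3 → ZMod 5) : ℝ) = 125 := by
    simp [ZMod.card]
  have hpt : ∀ a, ENNReal.ofReal (Real.exp (s * ∑ q ∈ S, W q a)) ≤
      ∑ c : Fin 3 → ZMod 5, ENNReal.ofReal (1 / 125) * ∏ q ∈ S with cls q = c,
        ENNReal.ofReal (Real.exp (125 * s * W q a)) := by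
    intro a
    have e : s * ∑ q ∈ S, W q a = ∑ c : Fin 3 → ZMod 5, (1 / 125 : ℝ) •
        (∑ q ∈ S with cls q = c, 125 * s * W q a) := by
      rw [← Finset.sum_fiberwise S cls, Finset.mul_sum]
      refine Finset.sum_congr rfl fun c _ => ?_
      rw [← Finset.mul_sum, smul_eq_mul]
      ring
    -- Jensen's inequality over the colours replaces the dependent sum by an average of exponentials
    -- of sums of independent variables.
    have h := convexOn_exp.map_sum_le (t := (Finset.univ : Finset (Fin 3 → ZMod 5)))
      (w := fun _ => (1 / 125 : ℝ)) (p := fun c => ∑ q ∈ S with cls q = c, 125 * s * W q a)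
      (fun _ _ => by norm_num)
      (by rw [Finset.sum_const, nsmul_eq_mul, Finset.card_univ, hcard]; norm_num)
      (fun _ _ => Set.mem_univ _)
    rw [e]
    refine (ENNReal.ofReal_le_ofReal h).trans (le_of_eq ?_)
    rw [ENNReal.ofReal_sum_of_nonneg fun c _ => by positivity]
    refine Finset.sum_congr rfl fun c _ => ?_
    rw [smul_eq_mul, ENNReal.ofReal_mul (by norm_num), Real.exp_sum,
      ENNReal.ofReal_prod_of_nonneg fun _ _ => (Real.exp_pos _).le]
  refine (lintegral_mono hpt).trans ?_
  have hmeas : ∀ q, Measurable fun a => ENNReal.ofReal (Real.exp (125 * s * W q a)) := fun q => by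
    have := hWm q; fun_prop
  rw [lintegral_finsetSum _ fun c _ => (Finset.measurable_prod _ fun q _ => hmeas q).const_mul _]
  have hc : ∀ c : Fin 3 → ZMod 5, ∫⁻ a, ENNReal.ofReal (1 / 125) * ∏ q ∈ S with cls q = c,
      ENNReal.ofReal (Real.exp (125 * s * W q a)) ∂gaussField ≤
      ENNReal.ofReal (1 / 125) * ENNReal.ofReal ((1 + τ) ^ S.card) := by
    intro c
    rw [lintegral_const_mul _ (Finset.measurable_prod _ fun q _ => hmeas q)]
    refine mul_le_mul_right ?_ _
    rw [lintegral_prod_of_dependsOn hmeas (U := block L)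
      (fun q a b hab => by rw [hWd q hab])]
    · refine (Finset.prod_le_prod' fun q _ => hW q).trans ?_
      rw [Finset.prod_const, ← ENNReal.ofReal_pow (by linarith)]
      exact ENNReal.ofReal_le_ofReal (pow_le_pow_right₀ (by linarith) (Finset.card_filter_le _ _))
    · intro q hq p hp hqp
      have hq' := (Finset.mem_filter.1 hq).2
      have hp' := (Finset.mem_filter.1 hp).2
      obtain ⟨i, hi⟩ := Function.ne_iff.1 hqp
      have h1 : (q i : ZMod 5) = (p i : ZMod 5) := by
        have := congrFun (hq'.trans hp'.symm) i
        exact this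
      have h2 : ((5 : ℕ) : ℤ) ∣ p i - q i := (ZMod.intCast_eq_intCast_iff_dvd_sub _ _ _).1 h1
      refine disjoint_block (i := i) ?_
      rw [abs_sub_comm]
      have h3 := Int.le_of_dvd (abs_pos.2 (sub_ne_zero.2 hi.symm)) ((dvd_abs _ _).2 h2)
      exact_mod_cast h3
  refine (Finset.sum_le_sum fun c _ => hc c).trans (le_of_eq ?_)
  rw [Finset.sum_const, nsmul_eq_mul, Finset.card_univ, ← mul_assoc, ← ENNReal.ofReal_natCast,
    hcard, ← ENNReal.ofReal_mul (by norm_num)]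
  norm_num

/-- This is u ≤ sinh u at u = x/2. It bounds exp(x) - 1 below by a quantity that is linear for small
x and still exponential for large x. -/
theorem mul_exp_half_le (x : ℝ) (hx : 0 ≤ x) : x * Real.exp (x / 2) ≤ Real.exp x - 1 := by
  have h := Real.self_le_sinh_iff.2 (by linarith : 0 ≤ x / 2)
  rw [Real.sinh_eq] at h
  have h2 := mul_le_mul_of_nonneg_right h (Real.exp_pos (x / 2)).le
  have e1 : Real.exp (x / 2) * Real.exp (x / 2) = Real.exp x := by
    rw [← Real.exp_add]; congr 1; ring
  have e2 : Real.exp (-(x / 2)) * Real.exp (x / 2) = 1 := by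
    rw [← Real.exp_add]; simp
  have e3 : (Real.exp (x / 2) - Real.exp (-(x / 2))) / 2 * Real.exp (x / 2) =
      (Real.exp x - 1) / 2 := by rw [div_mul_eq_mul_div, sub_mul, e1, e2]
  rw [e3] at h2
  linarith

theorem one_add_pow_sub_one_le (hτ : 0 ≤ τ) (m : ℕ) :
    (1 + τ) ^ m - 1 ≤ τ * m * Real.exp (τ * m) := by
  have h1 : (1 + τ) ^ m ≤ Real.exp (τ * m) := by
    rw [mul_comm, Real.exp_nat_mul]
    exact pow_le_pow_left₀ (by linarith) (by linarith [Real.add_one_le_exp τ]) m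
  have h2 := Real.add_one_le_exp (-(τ * m))
  have h3 := mul_le_mul_of_nonneg_right h2 (Real.exp_pos (τ * m)).le
  rw [← Real.exp_add, neg_add_cancel, Real.exp_zero] at h3
  linarith

/-- Markov's inequality is applied to exp(s ∑ W) - 1 instead of exp(s ∑ W). Its mean is at most (1 +
τ)^m - 1, of order τm, so a factor τ survives; since s is small, the bound exp(-sN/2) alone would
say nothing for small N. -/
theorem measure_sum_gt_le (hWm : ∀ q, Measurable (W q))
    (hWd : ∀ q, DependsOn (W q) (block L q : Set Site)) (hW0 : ∀ q a, 0 ≤ W q a) (hs : 0 < s)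
    (hτ : 0 ≤ τ) (hW : ∀ q, ∫⁻ a, ENNReal.ofReal (Real.exp (125 * s * W q a)) ∂gaussField ≤
      ENNReal.ofReal (1 + τ)) (S : Finset Site) {N m : ℝ} (hN : 0 < N) (hm : S.card ≤ m) :
    gaussField {a | N < ∑ q ∈ S, W q a} ≤
      ENNReal.ofReal (τ * m * Real.exp (τ * m) / (s * N * Real.exp (s * N / 2))) := by
  have hmeas : Measurable fun a => Real.exp (s * ∑ q ∈ S, W q a) := by fun_prop
  have h := lintegral_exp_sum_le hWm hWd hτ hW S
  have hint : Integrable (fun a => Real.exp (s * ∑ q ∈ S, W q a)) gaussField := by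
    refine ⟨hmeas.aestronglyMeasurable, ?_⟩
    rw [hasFiniteIntegral_iff_ofReal (ae_of_all _ fun a => (Real.exp_pos _).le)]
    exact h.trans_lt ENNReal.ofReal_lt_top
  have hI : ∫ a, Real.exp (s * ∑ q ∈ S, W q a) ∂gaussField ≤ (1 + τ) ^ S.card := by
    rw [integral_eq_lintegral_of_nonneg_ae (ae_of_all _ fun a => (Real.exp_pos _).le)
      hmeas.aestronglyMeasurable]
    exact ENNReal.toReal_le_of_le_ofReal (by positivity) h
  have hM := mul_meas_ge_le_integral_of_nonneg
    (f := fun a => Real.exp (s * ∑ q ∈ S, W q a) - 1) (μ := gaussField)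
    (ae_of_all _ fun a => by
      simp only [Pi.zero_apply, sub_nonneg]
      exact Real.one_le_exp (mul_nonneg hs.le (Finset.sum_nonneg fun q _ => hW0 q a)))
    (hint.sub (integrable_const _)) (s * N * Real.exp (s * N / 2))
  rw [integral_sub hint (integrable_const _)] at hM
  simp only [integral_const, probReal_univ, smul_eq_mul, mul_one] at hM
  have hpos : 0 < s * N * Real.exp (s * N / 2) := by positivity
  have h1 : gaussField {a | N < ∑ q ∈ S, W q a} ≤ gaussField {a | s * N * Real.exp (s * N / 2) ≤
      Real.exp (s * ∑ q ∈ S, W q a) - 1} := by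
    refine measure_mono fun a ha => ?_
    simp only [Set.mem_ofPred_eq] at ha ⊢
    refine (mul_exp_half_le _ (by positivity)).trans ?_
    have := Real.exp_le_exp.2 (mul_le_mul_of_nonneg_left ha.le hs.le)
    linarith
  refine h1.trans ?_
  rw [← ofReal_measureReal]
  refine ENNReal.ofReal_le_ofReal ?_
  rw [le_div_iff₀ hpos, mul_comm]
  refine hM.trans ?_
  have h2 := one_add_pow_sub_one_le hτ S.card
  have h3 : τ * S.card ≤ τ * m := mul_le_mul_of_nonneg_left hm hτ
  have h4 : τ * S.card * Real.exp (τ * S.card) ≤ τ * m * Real.exp (τ * m) :=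
    mul_le_mul h3 (Real.exp_le_exp.2 h3) (Real.exp_pos _).le
      (le_trans (by positivity) h3)
  linarith

/-- There is a linked set of `N` boxes near `p` whose neighbourhood has total weight more than
`N`. -/
def Heavy (W : Site → (Site → ℝ) → ℝ) (N : ℕ) (p : Site) (a : Site → ℝ) : Prop :=
  ∃ V V' : Finset Site, V.card = N ∧ Linked V ∧ (∃ q ∈ V, Near (2 * N) q p) ∧
    (∀ v ∈ V', ∃ q ∈ V, Near 1 v q) ∧ (N : ℝ) < ∑ v ∈ V', W v a

theorem Heavy.pos {N : ℕ} {p : Site} {a : Site → ℝ} (h : Heavy W N p a) : 0 < N := by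
  obtain ⟨V, V', hV, -, ⟨q, hq, -⟩, -⟩ := h
  rw [← hV]
  exact Finset.card_pos.2 ⟨q, hq⟩

/-- Weights are nonnegative, so replacing the set of boxes by a cover can only increase the total
weight. The union bound then runs over covers by coarse walks instead of over connected sets. -/
theorem heavy_exists_cover (hW0 : ∀ q a, 0 ≤ W q a) {K : ℕ} (hK : 0 < K) {N : ℕ} {p : Site}
    {a : Site → ℝ} (h : Heavy W N p a) :
    ∃ q ∈ Finset.Icc (fun i => p i - 2 * N) (fun i => p i + 2 * N),
      ∃ S ∈ covers K (2 * N / K) (boxIndex K q), (N : ℝ) < ∑ v ∈ S, W v a := by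
  obtain ⟨V, V', hV, hlink, ⟨q, hq, hqp⟩, hV', hsum⟩ := h
  refine ⟨q, ?_, ?_⟩
  · rw [Finset.mem_Icc, Pi.le_def, Pi.le_def, ← forall_and]
    intro i
    have := abs_le.1 (hqp i)
    constructor <;> linarith
  obtain ⟨f, hf0, hf, hcov⟩ := hlink.exists_walk hq
  obtain ⟨S, hS, hSc⟩ := exists_cover hK (2 * N / K) hf
  rw [hf0] at hS
  refine ⟨S, hS, hsum.trans_le (Finset.sum_le_sum_of_subset_of_nonneg ?_ fun v _ _ => hW0 v a)⟩
  intro v hv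
  obtain ⟨w, hw, hvw⟩ := hV' v hv
  obtain ⟨i, hi, rfl⟩ := hcov w hw
  refine hSc i ?_ v hvw
  rw [hV] at hi
  have h1 := Nat.div_add_mod (2 * N) K
  have h2 := Nat.mod_lt (2 * N) hK
  have h3 : (2 * N / K + 1) * K = K * (2 * N / K) + K := by ring
  omega

theorem cube_le_exp {x : ℝ} (hx : 0 ≤ x) : x ^ 3 ≤ 6 * Real.exp x := by
  have := Real.pow_div_factorial_le_exp x hx 3
  norm_num [Nat.factorial] at this
  linarith

/-- The available exponent is sN/2. Three losses of sN/12 each are paid from it: the number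
27^(2N/K) of coarse walks, by K ≥ 96/s and 27 ≤ e⁴; the (5N)³ starting points, by x³ ≤ 6eˣ; and the
volume factor exp(τm), by the assumption on K³τ. What remains is sN/4. -/
theorem measure_heavy_le (hWm : ∀ q, Measurable (W q))
    (hWd : ∀ q, DependsOn (W q) (block L q : Set Site)) (hW0 : ∀ q a, 0 ≤ W q a) (hs : 0 < s)
    (hτ : 0 ≤ τ) (hW : ∀ q, ∫⁻ a, ENNReal.ofReal (Real.exp (125 * s * W q a)) ∂gaussField ≤
      ENNReal.ofReal (1 + τ)) {K : ℕ} (hK : 96 / s ≤ K) (hτK : 375 * K ^ 3 * τ ≤ s / 12)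
    {N : ℕ} (hN : 0 < N) (p : Site) :
    gaussField {a | Heavy W N p a} ≤
      ENNReal.ofReal (486000000 * K ^ 3 * τ / s ^ 4 * Real.exp (-(s * N / 4))) := by
  have hN1 : (1 : ℝ) ≤ N := by exact_mod_cast hN
  have hK0 : (0 : ℝ) < K := lt_of_lt_of_le (by positivity) hK
  have hK0' : 0 < K := by exact_mod_cast hK0
  have hK1 : (1 : ℝ) ≤ K := by exact_mod_cast hK0'
  set J := 2 * N / K with hJ
  have hJle : (J : ℝ) ≤ 2 * N / K := by
    have := Nat.cast_div_le (α := ℝ) (m := 2 * N) (n := K)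
    push_cast at this
    exact this
  set m : ℝ := 375 * K ^ 3 * N with hm
  set D : ℝ := τ * m * Real.exp (τ * m) / (s * N * Real.exp (s * N / 2)) with hD
  have hD0 : 0 ≤ D := by positivity
  have h1 : ∀ q, ∀ S ∈ covers K J (boxIndex K q),
      gaussField {a | (N : ℝ) < ∑ v ∈ S, W v a} ≤ ENNReal.ofReal D := by
    intro q S hS
    refine measure_sum_gt_le hWm hWd hW0 hs hτ hW S (by linarith) ?_
    have h := card_le_of_mem_covers hS
    have h' : (S.card : ℝ) ≤ (J + 1) * (5 * K) ^ 3 := by exact_mod_cast h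
    have h2 : (J : ℝ) + 1 ≤ 3 * N := by
      have : 2 * (N : ℝ) / K ≤ 2 * N := div_le_self (by positivity) hK1
      linarith
    refine h'.trans ((mul_le_mul_of_nonneg_right h2 (by positivity)).trans (le_of_eq ?_))
    rw [hm]; ring
  have h2 : ∀ q, gaussField {a | ∃ S ∈ covers K J (boxIndex K q), (N : ℝ) < ∑ v ∈ S, W v a} ≤
      ENNReal.ofReal (27 ^ J * D) := fun q =>
    measure_exists_le _ _ _ (by exact_mod_cast card_covers_le K J (boxIndex K q)) hD0 (h1 q)
  have h3 := measure_exists_le gaussField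
    (Finset.Icc (fun i => p i - 2 * N) (fun i => p i + 2 * N))
    (fun q a => ∃ S ∈ covers K J (boxIndex K q), (N : ℝ) < ∑ v ∈ S, W v a)
    (N := (5 * N) ^ 3) (D := 27 ^ J * D) (by
      have e : ∀ i, (p i + 2 * (N : ℤ) + 1 - (p i - 2 * N)).toNat = 4 * N + 1 := fun i => by omega
      rw [Pi.card_Icc]
      simp only [Int.card_Icc, e, Finset.prod_const, Finset.card_univ, Fintype.card_fin]
      push_cast
      exact pow_le_pow_left₀ (by positivity) (by linarith) 3) (by positivity) fun q _ => h2 q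
  refine (measure_mono fun a ha => heavy_exists_cover hW0 hK0' ha).trans
    (h3.trans (ENNReal.ofReal_le_ofReal ?_))
  have b1 : (27 : ℝ) ^ J ≤ Real.exp (s * N / 12) := by
    have h27 : (27 : ℝ) ≤ Real.exp 4 := by
      have h := Real.add_one_le_exp (1 : ℝ)
      have h2 : Real.exp 4 = Real.exp 1 ^ 4 := by rw [← Real.exp_nat_mul]; norm_num
      have h3 := Real.exp_one_gt_d9
      rw [h2]
      have h4 : (2.7 : ℝ) ^ 4 ≤ Real.exp 1 ^ 4 := pow_le_pow_left₀ (by norm_num) (by linarith) 4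
      norm_num at h4 ⊢
      linarith
    refine (pow_le_pow_left₀ (by norm_num) h27 J).trans ?_
    rw [← Real.exp_nat_mul, Real.exp_le_exp]
    have e1 : 2 * (N : ℝ) / K ≤ s * N / 48 := by
      rw [div_le_div_iff₀ hK0 (by norm_num)]
      rw [div_le_iff₀ hs] at hK
      nlinarith
    linarith
  have b2 : (5 * (N : ℝ)) ^ 3 ≤ 1296000 / s ^ 3 * Real.exp (s * N / 12) := by
    have h := cube_le_exp (x := s * N / 12) (by positivity)
    have e : (5 * (N : ℝ)) ^ 3 = 216000 / s ^ 3 * (s * N / 12) ^ 3 := by field_simp; ring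
    rw [e]
    refine (mul_le_mul_of_nonneg_left h (by positivity)).trans (le_of_eq ?_)
    ring
  have b3 : D ≤ 375 * K ^ 3 * τ / s * (Real.exp (s * N / 12) * Real.exp (-(s * N / 2))) := by
    have e1 : D = τ * m / (s * N) * (Real.exp (τ * m) * Real.exp (-(s * N / 2))) := by
      rw [hD, Real.exp_neg]
      field_simp
    have e2 : τ * m / (s * N) = 375 * K ^ 3 * τ / s := by
      rw [hm]
      field_simp
    have e3 : τ * m ≤ s * N / 12 := by
      rw [hm]
      have := mul_le_mul_of_nonneg_right hτK (by linarith : (0 : ℝ) ≤ N)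
      linarith
    rw [e1, e2]
    have := Real.exp_le_exp.2 e3
    gcongr
  calc (5 * (N : ℝ)) ^ 3 * (27 ^ J * D)
      ≤ (1296000 / s ^ 3 * Real.exp (s * N / 12)) * (Real.exp (s * N / 12) *
        (375 * K ^ 3 * τ / s * (Real.exp (s * N / 12) * Real.exp (-(s * N / 2))))) := by
        gcongr
    _ = 486000000 * K ^ 3 * τ / s ^ 4 * (Real.exp (s * N / 12) * Real.exp (s * N / 12) *
        Real.exp (s * N / 12) * Real.exp (-(s * N / 2))) := by
        field_simp; ring
    _ = _ := by
        rw [← Real.exp_add, ← Real.exp_add, ← Real.exp_add]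
        congr 2
        ring

/-- The probability that there is a large heavy set near `p`. -/
theorem measure_exists_heavy_le (hWm : ∀ q, Measurable (W q))
    (hWd : ∀ q, DependsOn (W q) (block L q : Set Site)) (hW0 : ∀ q a, 0 ≤ W q a) (hs : 0 < s)
    (hs4 : s ≤ 4)
    (hτ : 0 ≤ τ) (hW : ∀ q, ∫⁻ a, ENNReal.ofReal (Real.exp (125 * s * W q a)) ∂gaussField ≤
      ENNReal.ofReal (1 + τ)) {K : ℕ} (hK : 96 / s ≤ K) (hτK : 375 * K ^ 3 * τ ≤ s / 12)
    (R : ℕ) (p : Site) :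
    gaussField {a | ∃ N, R < N ∧ Heavy W N p a} ≤
      ENNReal.ofReal (8 * 486000000 * K ^ 3 * τ / s ^ 5 * Real.exp (-(s * R / 4))) := by
  set H : ℝ := 486000000 * K ^ 3 * τ / s ^ 4 with hH
  have hH0 : 0 ≤ H := by positivity
  set ρ := Real.exp (-(s / 4)) with hρ
  have hρ1 : ρ < 1 := by rw [hρ, Real.exp_lt_one_iff]; linarith
  have hsub : {a | ∃ N, R < N ∧ Heavy W N p a} ⊆ ⋃ j : ℕ, {a | Heavy W (R + 1 + j) p a} := by
    rintro a ⟨N, hRN, hN⟩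
    refine Set.mem_iUnion.2 ⟨N - (R + 1), ?_⟩
    rwa [Set.mem_ofPred_eq, Nat.add_sub_cancel' (by omega)]
  have hb : ∀ j : ℕ, gaussField {a | Heavy W (R + 1 + j) p a} ≤
      ENNReal.ofReal (H * Real.exp (-(s * R / 4)) * ρ ^ j) := by
    intro j
    refine (measure_heavy_le hWm hWd hW0 hs hτ hW hK hτK (by omega) p).trans
      (ENNReal.ofReal_le_ofReal ?_)
    rw [← hH, mul_assoc, hρ, ← Real.exp_nat_mul, ← Real.exp_add]
    refine mul_le_mul_of_nonneg_left (Real.exp_le_exp.2 ?_) hH0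
    push_cast
    nlinarith
  refine (measure_mono hsub).trans ((measure_iUnion_le _).trans
    ((ENNReal.tsum_le_tsum hb).trans ?_))
  have hsum : Summable fun j : ℕ => H * Real.exp (-(s * R / 4)) * ρ ^ j :=
    (summable_geometric_of_lt_one (Real.exp_pos _).le hρ1).mul_left _
  rw [← ENNReal.ofReal_tsum_of_nonneg (fun j => by positivity) hsum, tsum_mul_left,
    tsum_geometric_of_lt_one (Real.exp_pos _).le hρ1]
  refine ENNReal.ofReal_le_ofReal ?_
  have h1 : (1 - ρ)⁻¹ ≤ 8 / s := by
    rw [inv_le_comm₀ (by linarith) (by positivity), inv_div]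
    have h2 := mul_exp_half_le (s / 4) (by positivity)
    have h3 : ρ ≤ 1 / (1 + s / 4) := by
      rw [hρ, Real.exp_neg, ← one_div]
      exact one_div_le_one_div_of_le (by positivity) (by linarith [Real.add_one_le_exp (s / 4)])
    -- This is where s ≤ 4 is used.
    have h4 : 1 / (1 + s / 4) ≤ 1 - s / 8 := by
      rw [div_le_iff₀ (by positivity)]
      nlinarith
    linarith
  calc H * Real.exp (-(s * R / 4)) * (1 - ρ)⁻¹ ≤ H * Real.exp (-(s * R / 4)) * (8 / s) :=
        mul_le_mul_of_nonneg_left h1 (by positivity)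
    _ = _ := by rw [hH]; field_simp

end Heavy

/-! ### Locality -/

section Locality

variable {A B ε lam : ℝ} {n : ℕ} {Q : Finset Site} {a b : Site → ℝ} {r : Site}

theorem average_congr (h : ∀ x ∈ Q, a x = b x) : average a Q = average b Q := by
  rw [average, average, Finset.sum_congr rfl h]

theorem isField_congr (h : ∀ x ∈ Q, a x = b x) (bc : BC) :
    (fun g => IsField ε lam Q a g bc) = fun g => IsField ε lam Q b g bc := by
  funext g
  cases bc with
  | dirichlet =>
    simp only [IsField]
    exact propext (and_congr_right fun _ => forall₂_congr fun x hx => by rw [h x hx])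
  | neumann =>
    simp only [IsField]
    exact propext (and_congr_right fun _ => and_congr_right fun _ =>
      forall₂_congr fun x hx => by rw [h x hx, average_congr h])

theorem field_congr (h : ∀ x ∈ Q, a x = b x) (bc : BC) :
    field ε lam Q a bc = field ε lam Q b bc := by
  rw [field, field, isField_congr h]

theorem Nice.congr (h : ∀ x ∈ Q, a x = b x) (ha : Nice A B ε n a Q) : Nice A B ε n b Q := by
  obtain ⟨h1, h2, h3, h4, h5, h6, h7⟩ := ha
  simp only [field_congr h] at h1 h2 h3 h4 h5
  rw [average_congr h] at h7
  exact ⟨h1, h2, h3, h4, h5, fun x hx => by rw [← h x hx]; exact h6 x hx, h7⟩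

theorem nice_congr (h : ∀ x ∈ Q, a x = b x) : Nice A B ε n a Q ↔ Nice A B ε n b Q :=
  ⟨fun ha => ha.congr h, fun hb => hb.congr fun x hx => (h x hx).symm⟩

/-- Two configurations agree on the shifts of a cube. -/
def AgreeShifts (n : ℕ) (r : Site) (a b : Site → ℝ) : Prop :=
  ∀ k : Shift, ∀ x ∈ shifted n r k, a x = b x

theorem goodBox_congr (h : AgreeShifts n r a b) : GoodBox A B ε n a r ↔ GoodBox A B ε n b r :=
  forall_congr' fun k => nice_congr (h k)

theorem Xi_congr (h : AgreeShifts n r a b) : Xi A B ε n a r = Xi A B ε n b r := by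
  classical
  simp only [Xi, Set.indicator_apply, Set.mem_ofPred_eq, goodBox_congr h]

theorem fieldEnergy_congr (h : AgreeShifts n r a b) (bc : BC) :
    fieldEnergy ε lam n a bc r = fieldEnergy ε lam n b bc r :=
  iSup_congr fun k => by rw [field_congr (h k)]

theorem gradEnergy_congr (h : AgreeShifts n r a b) (bc : BC) :
    gradEnergy ε lam n a bc r = gradEnergy ε lam n b bc r :=
  iSup_congr fun k => by rw [field_congr (h k)]

theorem maxDisorder_congr (h : AgreeShifts n r a b) : maxDisorder n a r = maxDisorder n b r :=
  iSup_congr fun k => iSup_congr fun x => by rw [h k x x.2]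

theorem sum_average_congr (h : AgreeShifts n r a b) :
    ∑ k : Shift, |average a (shifted n r k)| = ∑ k : Shift, |average b (shifted n r k)| :=
  Finset.sum_congr rfl fun k _ => by rw [average_congr (h k)]

theorem bracket_congr {Y : Set Site} {F G F' G' : Site → ℝ}
    (h : ∀ r ∈ boxesIn n Y, F r * G r = F' r * G' r) : bracket n Y F G = bracket n Y F' G' :=
  finsum_mem_congr rfl h

theorem goodSet_congr {Y : Set Site} (h : ∀ r ∈ boxesIn n Y, AgreeShifts n r a b) :
    GoodSet A B ε n a Y ↔ GoodSet A B ε n b Y := by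
  rw [GoodSet, GoodSet, bracket_congr fun r hr => by rw [Xi_congr (h r hr)]]

theorem RegularSet.congr {Y : Set Site} (h : ∀ r ∈ boxesIn n Y, AgreeShifts n r a b)
    (ha : RegularSet ε n a Y) : RegularSet ε n b Y := by
  classical
  obtain ⟨h1, h2, h3, h4⟩ := ha
  refine ⟨fun bc lam hl => ?_, fun bc lam hl => ?_, ?_, ?_⟩
  · rw [← bracket_congr fun r hr => ?_]
    · exact h1 bc lam hl
    · simp only [Set.indicator_apply, Set.mem_ofPred_eq, gradEnergy_congr (h r hr)]
  · rw [← bracket_congr fun r hr => ?_]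
    · exact h2 bc lam hl
    · simp only [Set.indicator_apply, Set.mem_ofPred_eq, fieldEnergy_congr (h r hr)]
  · rw [← bracket_congr fun r hr => ?_]
    · exact h3
    · simp only [Set.indicator_apply, Set.mem_ofPred_eq, maxDisorder_congr (h r hr)]
  · rw [← bracket_congr fun r hr => ?_]
    · exact h4
    · simp only [sum_average_congr (h r hr)]

theorem Clean.congr {Y : Set Site} (hY : Y ⊆ enlarge (ell ε) (bigL ε) Y)
    (h : ∀ n ∈ scales ε, ∀ r ∈ boxesIn n (enlarge (ell ε) (bigL ε) Y), AgreeShifts n r a b)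
    (ha : Clean A B ε a Y) : Clean A B ε b Y := fun n hn =>
  ⟨(goodSet_congr fun r hr => h n hn r ⟨hr.1, hr.2.trans hY⟩).1 (ha n hn).1,
    (ha n hn).2.congr (h n hn)⟩

end Locality

/-! ### Measurability -/

section Measurability

variable {A B ε lam : ℝ} {n : ℕ} {r : Site}

theorem continuous_average (Q : Finset Site) : Continuous fun a : Site → ℝ => average a Q := by
  unfold average; fun_prop

theorem continuous_field (bc : BC) (hl : 0 ≤ lam) (hn : 0 < n) (x : Site) :
    Continuous fun a => field ε lam (cube n r) a bc x := by
  by_cases hx : x ∈ cube n r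
  · simp only [field_eq_sum bc ε hl hn hx, coef]
    fun_prop
  · simp only [field_of_not_mem bc ε hl hn _ hx]
    fun_prop

theorem continuous_gradSq (bc : BC) (hl : 0 ≤ lam) (hn : 0 < n) :
    Continuous fun a => gradSq (cube n r) bc (field ε lam (cube n r) a bc) := by
  have := fun x => continuous_field (ε := ε) (r := r) bc hl hn x
  unfold gradSq grad
  fun_prop

/-- For a fixed mass every requirement is a non-strict inequality between continuous functions of
the disorder. Closedness survives the intersection over the uncountable range of masses, where
measurability alone would not. -/
theorem isClosed_nice (hn : 0 < n) : IsClosed {a | Nice A B ε n a (cube n r)} := by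
  have e : {a | Nice A B ε n a (cube n r)} =
      {a | (∀ lam : ℝ, 0 ≤ lam → lam < (n : ℝ)⁻¹ →
        PotentialLarge A ε n (cube n r) (field ε lam (cube n r) a .dirichlet) (Real.log n ^ 90))} ∩
      {a | ∀ bc : BC, ∀ lam : ℝ, 0 ≤ lam → lam < (n : ℝ)⁻¹ → ∀ x ∈ cube n r,
        |field ε lam (cube n r) a bc x| ≤ ε * (n : ℝ) ^ (1 / 2 : ℝ) * |Real.log ε| ^ 30} ∩
      {a | ∀ bc : BC, ∀ lam : ℝ, 0 ≤ lam → lam < (n : ℝ)⁻¹ → ∀ e ∈ edges (cube n r) bc,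
        |grad (field ε lam (cube n r) a bc) e| ≤ ε * |Real.log ε| ^ 30} ∩
      {a | ∀ bc : BC, ∀ lam : ℝ, 0 ≤ lam → lam < (n : ℝ)⁻¹ →
        A * ε ^ 2 ≤ gradSq (cube n r) bc (field ε lam (cube n r) a bc) / (cube n r).card} ∩
      {a | ∀ bc : BC, ∀ lam : ℝ, 0 ≤ lam → lam < (n : ℝ)⁻¹ →
        gradSq (cube n r) bc (field ε lam (cube n r) a bc) / (cube n r).card ≤ B * ε ^ 2} ∩
      {a | ∀ x ∈ cube n r, |a x| ≤ |Real.log ε| ^ 30} ∩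
      {a | |average a (cube n r)| * Real.sqrt (cube n r).card ≤ |Real.log ε| ^ 30} := by
    ext a
    constructor
    · rintro ⟨h1, h2, h3, h4, h5, h6, h7⟩
      exact ⟨⟨⟨⟨⟨⟨h1, h2⟩, h3⟩, h4⟩, h5⟩, h6⟩, h7⟩
    · rintro ⟨⟨⟨⟨⟨⟨h1, h2⟩, h3⟩, h4⟩, h5⟩, h6⟩, h7⟩
      exact ⟨h1, h2, h3, h4, h5, h6, h7⟩
  rw [e]
  have hf : ∀ bc : BC, ∀ lam : ℝ, 0 ≤ lam → ∀ x,
      Continuous fun a => field ε lam (cube n r) a bc x :=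
    fun bc lam hl x => continuous_field bc hl hn x
  refine ((((((?_ : IsClosed _).inter ?_).inter ?_).inter ?_).inter ?_).inter ?_).inter ?_
  · simp only [Set.ofPred_forall, PotentialLarge, potential, grad]
    refine isClosed_iInter fun lam => isClosed_iInter fun hl => isClosed_iInter fun _ =>
      isClosed_iInter fun x => isClosed_iInter fun _ => isClosed_iInter fun _ =>
      isClosed_le continuous_const ?_
    have := hf .dirichlet lam hl
    fun_prop
  · simp only [Set.ofPred_forall]
    exact isClosed_iInter fun bc => isClosed_iInter fun lam => isClosed_iInter fun hl =>
      isClosed_iInter fun _ => isClosed_iInter fun x => isClosed_iInter fun _ =>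
      isClosed_le (hf bc lam hl x).abs continuous_const
  · simp only [Set.ofPred_forall, grad]
    exact isClosed_iInter fun bc => isClosed_iInter fun lam => isClosed_iInter fun hl =>
      isClosed_iInter fun _ => isClosed_iInter fun e => isClosed_iInter fun _ =>
      isClosed_le ((hf bc lam hl e.2).sub (hf bc lam hl e.1)).abs continuous_const
  · simp only [Set.ofPred_forall]
    exact isClosed_iInter fun bc => isClosed_iInter fun lam => isClosed_iInter fun hl =>
      isClosed_iInter fun _ => isClosed_le continuous_const ((continuous_gradSq bc hl hn).div_const _)
  · simp only [Set.ofPred_forall]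
    exact isClosed_iInter fun bc => isClosed_iInter fun lam => isClosed_iInter fun hl =>
      isClosed_iInter fun _ => isClosed_le ((continuous_gradSq bc hl hn).div_const _) continuous_const
  · simp only [Set.ofPred_forall]
    exact isClosed_iInter fun x => isClosed_iInter fun _ =>
      isClosed_le (continuous_apply x).abs continuous_const
  · exact isClosed_le ((continuous_average _).abs.mul continuous_const) continuous_const

theorem measurableSet_goodBox (hn : 0 < n) : MeasurableSet {a | GoodBox A B ε n a r} := by
  simp only [GoodBox, Set.ofPred_forall]
  exact MeasurableSet.iInter fun k => (isClosed_nice hn).measurableSet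

theorem measurable_fieldEnergy (bc : BC) (hl : 0 ≤ lam) (hn : 0 < n) :
    Measurable fun a => fieldEnergy ε lam n a bc r := by
  unfold fieldEnergy
  refine Measurable.iSup fun k => ?_
  have := fun x => (continuous_field (ε := ε) (r := fun i => r i + ((n / 16 : ℕ) : ℤ) * (k i : ℤ))
    bc hl hn x).measurable
  unfold shifted
  fun_prop

theorem measurable_gradEnergy (bc : BC) (hl : 0 ≤ lam) (hn : 0 < n) :
    Measurable fun a => gradEnergy ε lam n a bc r := by
  unfold gradEnergy
  refine Measurable.iSup fun k => ?_
  exact (continuous_gradSq bc hl hn).measurable.div_const _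

theorem measurable_maxDisorder : Measurable fun a => maxDisorder n a r := by
  unfold maxDisorder
  exact Measurable.iSup fun k => Measurable.iSup fun x => (measurable_pi_apply _).abs

theorem measurable_sum_average :
    Measurable fun a => ∑ k : Shift, |average a (shifted n r k)| := by
  have := fun k => (continuous_average (shifted n r k)).measurable
  refine Finset.measurable_sum _ fun k _ => ?_
  have := this k
  exact this.abs

theorem finite_boxesIn (hn : 0 < n) {Y : Set Site} (hY : Y.Finite) : (boxesIn n Y).Finite :=
  hY.subset fun r hr => hr.2 (by
    rw [Finset.mem_coe, mem_cube]
    intro i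
    constructor <;> omega)

theorem bracket_eq_sum (hn : 0 < n) {Y : Set Site} (hY : Y.Finite) (F G : Site → ℝ) :
    bracket n Y F G = ∑ r ∈ (finite_boxesIn hn hY).toFinset, F r * G r := by
  rw [bracket, finsum_mem_eq_finite_toFinset_sum _ (finite_boxesIn hn hY)]

theorem measurable_bracket (hn : 0 < n) {Y : Set Site} (hY : Y.Finite)
    {F G : (Site → ℝ) → Site → ℝ} (hF : ∀ r, Measurable fun a => F a r)
    (hG : ∀ r, Measurable fun a => G a r) : Measurable fun a => bracket n Y (F a) (G a) := by
  simp only [bracket_eq_sum hn hY]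
  exact Finset.measurable_sum _ fun r _ => (hF r).mul (hG r)

theorem measurable_indicator_setOf {p : (Site → ℝ) → Site → Prop}
    (hp : ∀ r, MeasurableSet {a | p a r}) (r : Site) :
    Measurable fun a => Set.indicator {r | p a r} (1 : Site → ℝ) r := by
  classical
  simp only [Set.indicator_apply, Set.mem_ofPred_eq, Pi.one_apply]
  exact Measurable.ite (hp r) measurable_const measurable_const

theorem masses_nonneg {lam : ℝ} (h : lam ∈ masses n) : 0 ≤ lam := by
  rcases h with rfl | rfl
  · exact le_rfl
  · positivity

theorem finite_masses (n : ℕ) : (masses n).Finite := by unfold masses; exact Set.toFinite _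

theorem measurableSet_goodSet (hn : 0 < n) {Y : Set Site} (hY : Y.Finite) :
    MeasurableSet {a | GoodSet A B ε n a Y} :=
  measurableSet_le (measurable_bracket hn hY (fun r => measurable_const.sub
    (measurable_indicator_setOf (fun _ => measurableSet_goodBox hn) r)) fun _ => measurable_const)
    measurable_const

theorem measurableSet_regularSet (hn : 0 < n) {Y : Set Site} (hY : Y.Finite) :
    MeasurableSet {a | RegularSet ε n a Y} := by
  have e : {a | RegularSet ε n a Y} =
      (⋂ bc ∈ ({.dirichlet, .neumann} : Set BC), ⋂ lam ∈ masses n,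
        {a | bracket n Y (gradEnergy ε lam n a bc)
          (Set.indicator {r | ε ^ 2 * |Real.log ε| ≤ gradEnergy ε lam n a bc r} 1)
          ≤ ε ^ (9 / 4 : ℝ) * boxCount n Y}) ∩
      (⋂ bc ∈ ({.dirichlet, .neumann} : Set BC), ⋂ lam ∈ masses n,
        {a | bracket n Y (fieldEnergy ε lam n a bc)
          (Set.indicator
            {r | ε ^ 2 * cutoff lam n * |Real.log ε| ≤ fieldEnergy ε lam n a bc r} 1)
          ≤ |Real.log ε| ^ 2 * boxCount n Y}) ∩
      {a | bracket n Y (fun r => maxDisorder n a r ^ 2)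
        (Set.indicator {r | |Real.log ε| ^ 50 < maxDisorder n a r} 1)
        ≤ |Real.log ε| ^ (-75 : ℤ) * boxCount n Y} ∩
      {a | bracket n Y (fun r => ∑ k : Shift, |average a (shifted n r k)|) 1
        ≤ (n : ℝ) ^ (-3 / 2 : ℝ) * Real.log n ^ 50 * boxCount n Y} := by
    have hbc : ∀ bc : BC, bc ∈ ({.dirichlet, .neumann} : Set BC) := fun bc => by cases bc <;> simp
    ext a
    simp only [Set.mem_inter_iff, Set.mem_iInter, Set.mem_ofPred_eq]
    constructor
    · rintro ⟨h1, h2, h3, h4⟩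
      exact ⟨⟨⟨fun bc _ => h1 bc, fun bc _ => h2 bc⟩, h3⟩, h4⟩
    · rintro ⟨⟨⟨h1, h2⟩, h3⟩, h4⟩
      exact ⟨fun bc => h1 bc (hbc bc), fun bc => h2 bc (hbc bc), h3, h4⟩
  rw [e]
  refine ((MeasurableSet.inter ?_ ?_).inter ?_).inter ?_
  · refine MeasurableSet.biInter (Set.toFinite _).countable fun bc _ =>
      MeasurableSet.biInter (finite_masses n).countable fun lam hlam =>
      measurableSet_le (measurable_bracket hn hY (fun r => ?_) fun r => ?_) measurable_const
    · exact measurable_gradEnergy bc (masses_nonneg hlam) hn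
    · exact measurable_indicator_setOf (fun r => measurableSet_le measurable_const
        (measurable_gradEnergy bc (masses_nonneg hlam) hn)) r
  · refine MeasurableSet.biInter (Set.toFinite _).countable fun bc _ =>
      MeasurableSet.biInter (finite_masses n).countable fun lam hlam =>
      measurableSet_le (measurable_bracket hn hY (fun r => ?_) fun r => ?_) measurable_const
    · exact measurable_fieldEnergy bc (masses_nonneg hlam) hn
    · exact measurable_indicator_setOf (fun r => measurableSet_le measurable_const
        (measurable_fieldEnergy bc (masses_nonneg hlam) hn)) r
  · exact measurableSet_le (measurable_bracket hn hY (fun r => measurable_maxDisorder.pow_const 2)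
      fun r => measurable_indicator_setOf (fun r => measurableSet_lt measurable_const
        measurable_maxDisorder) r) measurable_const
  · exact measurableSet_le (measurable_bracket hn hY (fun r => measurable_sum_average)
      fun r => measurable_const) measurable_const

theorem finite_enlarge {ℓ n : ℕ} (hn : 0 < n) (hℓ : ℓ ≤ n) {Y : Set Site} (hY : Y.Finite) :
    (enlarge ℓ n Y).Finite := by
  refine Set.Finite.subset (s := ⋃ y ∈ Y, ⋃ q ∈ neighbours (boxIndex n y),
    (cube n (fun i => n * q i) : Set Site)) ?_ fun x hx => ?_
  · exact hY.biUnion fun y _ => (Finset.finite_toSet _).biUnion fun q _ => Finset.finite_toSet _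
  · obtain ⟨y, hy, h⟩ := exists_near_of_mem_enlarge hn hℓ hx
    exact Set.mem_biUnion hy (Set.mem_biUnion (mem_neighbours.2 h)
      ((mem_cube_iff_boxIndex hn).2 rfl))

theorem measurableSet_clean (h0 : ∀ n ∈ scales ε, 0 < n) (hℓ : ell ε ≤ bigL ε) {Y : Set Site}
    (hY : Y.Finite) : MeasurableSet {a | Clean A B ε a Y} := by
  have e : {a | Clean A B ε a Y} = ⋂ n ∈ scales ε, {a | GoodSet A B ε n a Y} ∩
      {a | RegularSet ε n a (enlarge (ell ε) (bigL ε) Y)} := by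
    ext a; simp [Clean]
  rw [e]
  refine MeasurableSet.biInter (Finset.countable_toSet _) fun n hn => ?_
  have hL : 0 < bigL ε := h0 _ (by simp [scales])
  exact (measurableSet_goodSet (h0 n hn) hY).inter
    (measurableSet_regularSet (h0 n hn) (finite_enlarge hL hℓ hY))

/-- A union of hulls of unclean sets, over an arbitrary family of finite sets, is measurable. -/
theorem measurableSet_exists_not_clean (h0 : ∀ n ∈ scales ε, 0 < n) (hℓ : ell ε ≤ bigL ε)
    (p : Set Site → Prop) (hp : ∀ Y, p Y → Y.Finite) :
    MeasurableSet {a | ∃ Y, p Y ∧ ¬ Clean A B ε a Y} := by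
  have e : {a | ∃ Y, p Y ∧ ¬ Clean A B ε a Y} = ⋃ Y ∈ {Y | p Y}, {a | Clean A B ε a Y}ᶜ := by
    ext a; simp
  rw [e]
  -- The lattice has only countably many finite subsets, so the union over all candidate sets is
  -- countable.
  refine MeasurableSet.biUnion ((Set.countable_ofPred_finite_subset
    (Set.countable_univ (α := Site))).mono fun Y hY => ?_) fun Y hY => ?_
  · exact ⟨hp Y hY, Set.subset_univ _⟩
  · exact (measurableSet_clean h0 hℓ (hp Y hY)).compl

end Measurability

/-! ### Exponential moments of truncated observables -/

section Moments

variable {Ω : Type*} [MeasurableSpace Ω] {P : Measure Ω} {ι : Type*}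

/-- The exponential of a maximum is at most the sum of the exponentials. This treats the maxima over
shifts, over sites and over signs. -/
theorem lintegral_exp_le_of_exists {s : Finset ι} {F : Ω → ℝ} {f : ι → Ω → ℝ} {N D : ℝ}
    (hf : ∀ i, Measurable (f i)) (h : ∀ ω, ∃ i ∈ s, F ω ≤ f i ω)
    (hD : ∀ i ∈ s, ∫⁻ ω, ENNReal.ofReal (Real.exp (f i ω)) ∂P ≤ ENNReal.ofReal D)
    (hD0 : 0 ≤ D) (hs : (s.card : ℝ) ≤ N) :
    ∫⁻ ω, ENNReal.ofReal (Real.exp (F ω)) ∂P ≤ ENNReal.ofReal (N * D) := by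
  have h1 : ∀ ω, ENNReal.ofReal (Real.exp (F ω)) ≤ ∑ i ∈ s, ENNReal.ofReal (Real.exp (f i ω)) := by
    intro ω
    obtain ⟨i, hi, hF⟩ := h ω
    exact (ENNReal.ofReal_le_ofReal (Real.exp_le_exp.2 hF)).trans
      (Finset.single_le_sum (f := fun i => ENNReal.ofReal (Real.exp (f i ω)))
        (fun _ _ => zero_le) hi)
  refine (lintegral_mono h1).trans ?_
  rw [lintegral_finsetSum _ fun i _ => by have := hf i; fun_prop]
  refine (Finset.sum_le_sum hD).trans ?_
  rw [Finset.sum_const, nsmul_eq_mul, ← ENNReal.ofReal_natCast, ← ENNReal.ofReal_mul (by positivity)]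
  exact ENNReal.ofReal_le_ofReal (mul_le_mul_of_nonneg_right hs hD0)

/-- `F 1{F ≥ θ}`. -/
noncomputable def trunc (θ F : ℝ) : ℝ := if θ ≤ F then F else 0

theorem trunc_nonneg {θ F : ℝ} (h : 0 ≤ F) : 0 ≤ trunc θ F := by
  rw [trunc]; split_ifs <;> simp [h]

theorem measurable_trunc (θ : ℝ) : Measurable (trunc θ) :=
  Measurable.ite measurableSet_Ici measurable_id measurable_const

theorem le_add_trunc {θ F : ℝ} (hθ : 0 ≤ θ) : F ≤ θ + trunc θ F := by
  rw [trunc]; split_ifs <;> linarith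

/-- On {F ≥ θ} one has sF ≤ uF/2 ≤ uF - uθ/2, and elsewhere the truncated variable is zero. The
exponential moment of a truncation is therefore 1 plus an error that is exponentially small in the
threshold. -/
theorem lintegral_exp_trunc_le [IsProbabilityMeasure P] {F : Ω → ℝ} (hF : Measurable F)
    (hF0 : ∀ ω, 0 ≤ F ω) {s u θ D : ℝ} (hu : 0 ≤ u) (hs : s ≤ u / 2)
    (hD : ∫⁻ ω, ENNReal.ofReal (Real.exp (u * F ω)) ∂P ≤ ENNReal.ofReal D) :
    ∫⁻ ω, ENNReal.ofReal (Real.exp (s * trunc θ (F ω))) ∂P ≤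
      ENNReal.ofReal (1 + D * Real.exp (-(u * θ / 2))) := by
  -- A negative D would be read as 0 by `ENNReal.ofReal`, which contradicts the fact that the moment
  -- is at least 1.
  by_cases hDn : D < 0
  · rw [ENNReal.ofReal_of_nonpos hDn.le] at hD
    have h1 : (1 : ℝ≥0∞) ≤ 0 := by
      refine le_trans ?_ hD
      calc (1 : ℝ≥0∞) = ∫⁻ _, 1 ∂P := by simp
        _ ≤ _ := lintegral_mono fun ω => by
          rw [← ENNReal.ofReal_one]
          exact ENNReal.ofReal_le_ofReal (Real.one_le_exp (mul_nonneg hu (hF0 ω)))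
    exact absurd h1 (by simp)
  push Not at hDn
  have hpt : ∀ ω, ENNReal.ofReal (Real.exp (s * trunc θ (F ω))) ≤
      1 + ENNReal.ofReal (Real.exp (-(u * θ / 2))) * ENNReal.ofReal (Real.exp (u * F ω)) := by
    intro ω
    rw [trunc]
    split_ifs with h
    · rw [← ENNReal.ofReal_mul (Real.exp_pos _).le, ← Real.exp_add]
      refine le_trans (ENNReal.ofReal_le_ofReal (Real.exp_le_exp.2 ?_)) le_add_self
      have h1 := mul_le_mul_of_nonneg_right hs (hF0 ω)
      have h2 := mul_le_mul_of_nonneg_left h hu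
      linarith
    · simp
  refine (lintegral_mono hpt).trans ?_
  rw [lintegral_add_left measurable_const, lintegral_const_mul _ (by fun_prop)]
  simp only [lintegral_const, measure_univ, mul_one]
  rw [ENNReal.ofReal_add zero_le_one (by positivity), ENNReal.ofReal_one, mul_comm D,
    ENNReal.ofReal_mul (Real.exp_pos _).le]
  gcongr

/-- Jensen's inequality with the missing mass placed at 0, derived from the tangent line of exp at
the mean. -/
theorem exp_sum_le {J : Finset ι} {w f : ι → ℝ} (hw : ∀ i ∈ J, 0 ≤ w i) (hw1 : ∑ i ∈ J, w i ≤ 1) :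
    Real.exp (∑ i ∈ J, w i * f i) ≤ ∑ i ∈ J, w i * Real.exp (f i) + (1 - ∑ i ∈ J, w i) := by
  set m := ∑ i ∈ J, w i * f i with hm
  have h1 : ∀ x : ℝ, Real.exp m * (1 + x - m) ≤ Real.exp x := fun x => by
    have := mul_le_mul_of_nonneg_left (Real.add_one_le_exp (x - m)) (Real.exp_pos m).le
    rw [← Real.exp_add] at this
    ring_nf at this ⊢
    exact this
  have h2 : ∑ i ∈ J, w i * (Real.exp m * (1 + f i - m)) ≤ ∑ i ∈ J, w i * Real.exp (f i) :=
    Finset.sum_le_sum fun i hi => mul_le_mul_of_nonneg_left (h1 _) (hw i hi)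
  have h3 : ∑ i ∈ J, w i * (Real.exp m * (1 + f i - m)) =
      Real.exp m * ((∑ i ∈ J, w i) * (1 - m) + m) := by
    rw [hm, Finset.sum_mul, ← Finset.sum_add_distrib, Finset.mul_sum, ← hm]
    exact Finset.sum_congr rfl fun i _ => by ring
  have h4 := mul_le_mul_of_nonneg_left (h1 0) (sub_nonneg.2 hw1)
  rw [Real.exp_zero] at h4
  rw [h3] at h2
  linarith

/-- Bounds of the form 1 + τ survive sub-convex combinations whatever the dependence between the
variables. Boxes, scales, shifts and observables can therefore be averaged at the price of larger
exponents only. -/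
theorem lintegral_exp_sum_mul_le [IsProbabilityMeasure P] {J : Finset ι} {w : ι → ℝ}
    {f : ι → Ω → ℝ} {τ : ℝ} (hf : ∀ i, Measurable (f i)) (hτ : 0 ≤ τ) (hw : ∀ i ∈ J, 0 ≤ w i)
    (hw1 : ∑ i ∈ J, w i ≤ 1)
    (h : ∀ i ∈ J, ∫⁻ ω, ENNReal.ofReal (Real.exp (f i ω)) ∂P ≤ ENNReal.ofReal (1 + τ)) :
    ∫⁻ ω, ENNReal.ofReal (Real.exp (∑ i ∈ J, w i * f i ω)) ∂P ≤ ENNReal.ofReal (1 + τ) := by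
  have hpt : ∀ ω, ENNReal.ofReal (Real.exp (∑ i ∈ J, w i * f i ω)) ≤
      (∑ i ∈ J, ENNReal.ofReal (w i) * ENNReal.ofReal (Real.exp (f i ω))) +
        ENNReal.ofReal (1 - ∑ i ∈ J, w i) := by
    intro ω
    refine (ENNReal.ofReal_le_ofReal (exp_sum_le (f := fun i => f i ω) hw hw1)).trans
      (le_of_eq ?_)
    rw [ENNReal.ofReal_add (Finset.sum_nonneg fun i hi =>
      mul_nonneg (hw i hi) (Real.exp_pos _).le) (by linarith), ENNReal.ofReal_sum_of_nonneg
      fun i hi => mul_nonneg (hw i hi) (Real.exp_pos _).le]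
    congr 1
    exact Finset.sum_congr rfl fun i hi => ENNReal.ofReal_mul (hw i hi)
  refine (lintegral_mono hpt).trans ?_
  rw [lintegral_add_right _ measurable_const, lintegral_finsetSum _ fun i _ => by
    have := hf i; fun_prop]
  simp only [lintegral_const, measure_univ, mul_one]
  have h1 : ∀ i ∈ J, ∫⁻ ω, ENNReal.ofReal (w i) * ENNReal.ofReal (Real.exp (f i ω)) ∂P ≤
      ENNReal.ofReal (w i * (1 + τ)) := fun i hi => by
    rw [lintegral_const_mul _ (by have := hf i; fun_prop), ENNReal.ofReal_mul (hw i hi)]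
    gcongr
    exact h i hi
  refine (add_le_add (Finset.sum_le_sum h1) le_rfl).trans ?_
  rw [← ENNReal.ofReal_sum_of_nonneg fun i hi => mul_nonneg (hw i hi) (by linarith),
    ← ENNReal.ofReal_add (Finset.sum_nonneg fun i hi => mul_nonneg (hw i hi) (by linarith))
      (by linarith), ← Finset.sum_mul]
  refine ENNReal.ofReal_le_ofReal ?_
  nlinarith

end Moments

/-! ### The observables -/

section Observables

variable {A B ε lam : ℝ} {n : ℕ} {r : Site} {a : Site → ℝ}

instance : Nonempty Shift := ⟨fun _ => ⟨0, by simp⟩⟩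

theorem card_shift : Fintype.card Shift = 274625 := by
  rw [Fintype.card_fun, Fintype.card_coe]
  simp

theorem card_shifted (n : ℕ) (r : Site) (k : Shift) : (shifted n r k).card = n ^ 3 := card_cube _ _

theorem gradEnergy_le (bc : BC) (hl : 0 ≤ lam) (hn : 0 < n) :
    gradEnergy ε lam n a bc r ≤ gradEnergy ε 0 n a bc r :=
  ciSup_mono (Set.finite_range _).bddAbove fun _ =>
    div_le_div_of_nonneg_right (gradSq_field_le_zero bc ε hl hn _ a) (Nat.cast_nonneg _)

theorem fieldEnergy_le (bc : BC) (hl : 0 ≤ lam) (hn : 0 < n) :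
    fieldEnergy ε lam n a bc r ≤ fieldEnergy ε 0 n a bc r :=
  ciSup_mono (Set.finite_range _).bddAbove fun _ =>
    div_le_div_of_nonneg_right (sum_field_sq_le_zero bc ε hl hn _ a) (Nat.cast_nonneg _)

theorem gradEnergy_nonneg (bc : BC) : 0 ≤ gradEnergy ε lam n a bc r :=
  Real.iSup_nonneg fun _ => div_nonneg (Finset.sum_nonneg fun _ _ => sq_nonneg _) (Nat.cast_nonneg _)

theorem fieldEnergy_nonneg (bc : BC) : 0 ≤ fieldEnergy ε lam n a bc r :=
  Real.iSup_nonneg fun _ => div_nonneg (Finset.sum_nonneg fun _ _ => sq_nonneg _) (Nat.cast_nonneg _)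

/-- The rate n/(4ε²) is chosen so that the energy density of a single shifted cube becomes the
normalised sum of squares of `lintegral_exp_grad_energy_le`. The maximum over the 65³ = 274625
shifts costs their number. -/
theorem lintegral_exp_gradEnergy_le (bc : BC) (hε : 0 < ε) (hn : 0 < n) :
    ∫⁻ a, ENNReal.ofReal (Real.exp (n / (4 * ε ^ 2) * gradEnergy ε 0 n a bc r)) ∂gaussField ≤
      ENNReal.ofReal (274625 * Real.exp (18 * n)) := by
  have hn' : (0 : ℝ) < n := by exact_mod_cast hn
  refine lintegral_exp_le_of_exists (s := (Finset.univ : Finset Shift))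
    (f := fun k a => (∑ j : Mode n, invEig bc j *
      coef bc (fun i => r i + ((n / 16 : ℕ) : ℤ) * (k i : ℤ)) a j ^ 2) / (4 * n ^ 2))
    (fun k => ?_) (fun a => ?_) (fun k _ => lintegral_exp_grad_energy_le bc hn _)
    (Real.exp_pos _).le (by rw [Finset.card_univ, card_shift]; norm_num)
  · have := fun j => measurable_coef bc (n := n) (fun i => r i + ((n / 16 : ℕ) : ℤ) * (k i : ℤ)) j
    fun_prop
  · obtain ⟨k, hk⟩ := exists_eq_ciSup_of_finite (f := fun k : Shift =>
      gradSq (shifted n r k) bc (field ε 0 (shifted n r k) a bc) / (shifted n r k).card)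
    refine ⟨k, by simp only [Finset.mem_univ], le_of_eq ?_⟩
    rw [gradEnergy, ← hk, card_shifted, shifted, gradSq_field_zero bc ε hn]
    push_cast
    field_simp

theorem lintegral_exp_fieldEnergy_le (bc : BC) (hε : 0 < ε) (hn : 0 < n) :
    ∫⁻ a, ENNReal.ofReal (Real.exp (1 / (4 * ε ^ 2 * n) * fieldEnergy ε 0 n a bc r)) ∂gaussField ≤
      ENNReal.ofReal (274625 * Real.exp 162) := by
  have hn' : (0 : ℝ) < n := by exact_mod_cast hn
  refine lintegral_exp_le_of_exists (s := (Finset.univ : Finset Shift))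
    (f := fun k a => (∑ j : Mode n, invEig bc j ^ 2 *
      coef bc (fun i => r i + ((n / 16 : ℕ) : ℤ) * (k i : ℤ)) a j ^ 2) / (4 * n ^ 4))
    (fun k => ?_) (fun a => ?_) (fun k _ => lintegral_exp_field_energy_le bc hn _)
    (Real.exp_pos _).le (by rw [Finset.card_univ, card_shift]; norm_num)
  · have := fun j => measurable_coef bc (n := n) (fun i => r i + ((n / 16 : ℕ) : ℤ) * (k i : ℤ)) j
    fun_prop
  · obtain ⟨k, hk⟩ := exists_eq_ciSup_of_finite (f := fun k : Shift =>
      (∑ x ∈ shifted n r k, field ε 0 (shifted n r k) a bc x ^ 2) / (shifted n r k).card)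
    refine ⟨k, by simp only [Finset.mem_univ], ?_⟩
    rw [fieldEnergy, ← hk, card_shifted]
    have h := sum_field_sq_le bc ε le_rfl hn (fun i => r i + ((n / 16 : ℕ) : ℤ) * (k i : ℤ)) a
    refine (mul_le_mul_of_nonneg_left (div_le_div_of_nonneg_right h (by positivity))
      (by positivity)).trans (le_of_eq ?_)
    push_cast
    field_simp

theorem lintegral_exp_maxDisorder_le (hn : 0 < n) :
    ∫⁻ a, ENNReal.ofReal (Real.exp (1 / 4 * maxDisorder n a r ^ 2)) ∂gaussField ≤
      ENNReal.ofReal (274625 * n ^ 3 * 2) := by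
  obtain ⟨s, hs⟩ : ∃ s : Finset Site,
      s = (Finset.univ : Finset Shift).biUnion fun k => shifted n r k := ⟨_, rfl⟩
  refine lintegral_exp_le_of_exists (s := s)
    (f := fun x a => 1 / 4 * a x ^ 2) (fun x => by fun_prop) (fun a => ?_) (fun x _ => ?_)
    (by norm_num) ?_
  · obtain ⟨k, hk⟩ := exists_eq_ciSup_of_finite (f := fun k : Shift =>
      ⨆ x : shifted n r k, |a x|)
    have hne : Nonempty (shifted n r k) := ⟨⟨_, mem_cube.2 fun i => ⟨le_rfl, by omega⟩⟩⟩
    obtain ⟨x, hx⟩ := exists_eq_ciSup_of_finite (f := fun x : shifted n r k => |a x|)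
    have hx' : (x : Site) ∈ s := by
      rw [hs, Finset.mem_biUnion]
      refine ⟨k, ?_, x.2⟩
      simp only [Finset.mem_univ]
    refine ⟨x, hx', le_of_eq ?_⟩
    rw [maxDisorder, ← hk, ← hx, sq_abs]
  · rw [(hasLaw_eval x).lintegral_comp (f := fun y => ENNReal.ofReal (Real.exp (1 / 4 * y ^ 2)))
      (by fun_prop), lintegral_exp_mul_sq_gaussianReal (by norm_num)]
    refine ENNReal.ofReal_le_ofReal ?_
    rw [Real.sqrt_le_left (by norm_num)]
    norm_num
  · rw [hs]
    have h := Finset.card_biUnion_le (s := (Finset.univ : Finset Shift))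
      (t := fun k => shifted n r k)
    simp only [card_shifted, Finset.sum_const, Finset.card_univ, card_shift, smul_eq_mul] at h
    exact_mod_cast h

theorem lintegral_exp_mul_abs_average_le (hn : 0 < n) (c : ℝ) (q : Site) :
    ∫⁻ a, ENNReal.ofReal (Real.exp (c * Real.sqrt (n ^ 3) * |average a (cube n q)|)) ∂gaussField ≤
      ENNReal.ofReal (2 * Real.exp (c ^ 2 / 2)) := by
  have hn' : (0 : ℝ) < n := by exact_mod_cast hn
  have hs : 0 < Real.sqrt ((n : ℝ) ^ 3) := Real.sqrt_pos.2 (by positivity)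
  have hss : Real.sqrt ((n : ℝ) ^ 3) ^ 2 = n ^ 3 := Real.sq_sqrt (by positivity)
  have key : ∀ d : ℝ, d ^ 2 = c ^ 2 → ∫⁻ a, ENNReal.ofReal (Real.exp
      (d * Real.sqrt (n ^ 3) * average a (cube n q))) ∂gaussField =
      ENNReal.ofReal (Real.exp (c ^ 2 / 2)) := by
    intro d hd
    have h := lintegral_exp_sum_mul_gaussian (P := gaussField) (ι := cube n q)
      (b := fun x a => a x) (fun x => by fun_prop) (fun x => hasLaw_eval x)
      (iIndepFun_eval.precomp Subtype.val_injective) (fun _ => d * Real.sqrt (n ^ 3) / n ^ 3)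
    have e : ∑ _i : cube n q, (d * Real.sqrt ((n : ℝ) ^ 3) / n ^ 3) ^ 2 = c ^ 2 := by
      rw [Finset.sum_const, Finset.card_univ, Fintype.card_coe, card_cube, nsmul_eq_mul, div_pow,
        mul_pow, hss, hd]
      push_cast
      field_simp
    rw [e] at h
    rw [← h]
    refine lintegral_congr fun a => ?_
    congr 2
    rw [average, card_cube, ← Finset.mul_sum, Finset.sum_coe_sort (cube n q) (fun x => a x)]
    push_cast
    field_simp
  have h := lintegral_exp_le_of_exists (P := gaussField) (s := {c, -c})
    (F := fun a => c * Real.sqrt (n ^ 3) * |average a (cube n q)|)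
    (f := fun d a => d * Real.sqrt (n ^ 3) * average a (cube n q)) (N := 2)
    (D := Real.exp (c ^ 2 / 2)) (fun d => by
      have := (continuous_average (cube n q)).measurable
      fun_prop) (fun a => ?_) (fun d hd => (key d ?_).le) (Real.exp_pos _).le
      (by exact_mod_cast Finset.card_le_two)
  · exact h
  · rcases abs_cases (average a (cube n q)) with ⟨h, _⟩ | ⟨h, _⟩
    · exact ⟨c, by simp, by rw [h]⟩
    · exact ⟨-c, by simp, by rw [h]; linarith⟩
  · rw [Finset.mem_insert, Finset.mem_singleton] at hd
    rcases hd with rfl | rfl <;> ring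

/-- The averages over overlapping shifts are dependent, so their sum is written as the mean of
274625 multiples of single terms. The constant exp(274625²/2) is the Gaussian moment of one such
multiple. -/
theorem lintegral_exp_sum_average_le (hn : 0 < n) :
    ∫⁻ a, ENNReal.ofReal (Real.exp (Real.sqrt (n ^ 3) *
      ∑ k : Shift, |average a (shifted n r k)|)) ∂gaussField ≤
      ENNReal.ofReal (2 * Real.exp (274625 ^ 2 / 2)) := by
  have h1 : (1 : ℝ) ≤ 2 * Real.exp (274625 ^ 2 / 2) := by
    have := Real.add_one_le_exp ((274625 : ℝ) ^ 2 / 2)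
    have := Real.exp_pos ((274625 : ℝ) ^ 2 / 2)
    nlinarith
  have h := lintegral_exp_sum_mul_le (P := gaussField) (J := (Finset.univ : Finset Shift))
    (w := fun _ => 1 / 274625)
    (f := fun k a => 274625 * Real.sqrt (n ^ 3) * |average a (shifted n r k)|)
    (τ := 2 * Real.exp (274625 ^ 2 / 2) - 1) (fun k => by
      have := (continuous_average (shifted n r k)).measurable
      fun_prop) (by linarith) (fun _ _ => by norm_num)
    (by rw [Finset.sum_const, Finset.card_univ, card_shift]; norm_num) (fun k _ => by
      have e : 1 + (2 * Real.exp (274625 ^ 2 / 2) - 1) = 2 * Real.exp ((274625 : ℝ) ^ 2 / 2) := by ring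
      rw [e]
      exact lintegral_exp_mul_abs_average_le hn 274625 _)
  have e : 1 + (2 * Real.exp (274625 ^ 2 / 2) - 1) = 2 * Real.exp ((274625 : ℝ) ^ 2 / 2) := by ring
  rw [e] at h
  refine le_trans (le_of_eq (lintegral_congr fun a => ?_)) h
  refine congrArg (fun x => ENNReal.ofReal (Real.exp x)) ?_
  rw [Finset.mul_sum]
  have h3 : ∀ k : Shift, Real.sqrt (n ^ 3) * |average a (shifted n r k)| = 1 / 274625 * (274625 * Real.sqrt (n ^ 3) * |average a (shifted n r k)|) := fun k => by ring
  simp only [h3]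

theorem one_sub_Xi_eq : 1 - Xi A B ε n a r = Set.indicator {a | ¬ GoodBox A B ε n a r} 1 a := by
  classical
  simp only [Xi, Set.indicator_apply, Set.mem_ofPred_eq, Pi.one_apply]
  by_cases h : GoodBox A B ε n a r <;> simp [h]

theorem one_sub_Xi_nonneg : 0 ≤ 1 - Xi A B ε n a r := by
  rw [one_sub_Xi_eq]
  exact Set.indicator_nonneg (fun _ _ => zero_le_one) _

theorem measurable_one_sub_Xi (hn : 0 < n) : Measurable fun a => 1 - Xi A B ε n a r :=
  measurable_const.sub (measurable_indicator_setOf (fun _ => measurableSet_goodBox hn) r)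

theorem lintegral_exp_one_sub_Xi_le (hn : 0 < n) {p u : ℝ} (hp : 0 ≤ p)
    (h : ∀ q : Site, gaussField {a | ¬ Nice A B ε n a (cube n q)} ≤ ENNReal.ofReal p) :
    ∫⁻ a, ENNReal.ofReal (Real.exp (u * (1 - Xi A B ε n a r))) ∂gaussField ≤
      ENNReal.ofReal (1 + 274625 * p * Real.exp u) := by
  have hm : MeasurableSet {a | ¬ GoodBox A B ε n a r} := (measurableSet_goodBox hn).compl
  have h1 : gaussField {a | ¬ GoodBox A B ε n a r} ≤ ENNReal.ofReal (274625 * p) := by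
    have e : {a | ¬ GoodBox A B ε n a r} =
        ⋃ k : Shift, {a | ¬ Nice A B ε n a (shifted n r k)} := by
      ext a; simp [GoodBox]
    rw [e]
    refine (measure_iUnion_le _).trans ?_
    rw [tsum_fintype]
    refine (Finset.sum_le_sum fun k _ => h _).trans ?_
    rw [Finset.sum_const, Finset.card_univ, card_shift, nsmul_eq_mul, ENNReal.ofReal_mul (by norm_num)]
    norm_num
  have hpt : ∀ a, ENNReal.ofReal (Real.exp (u * (1 - Xi A B ε n a r))) ≤
      1 + Set.indicator {a | ¬ GoodBox A B ε n a r} (fun _ => ENNReal.ofReal (Real.exp u)) a := by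
    intro a
    rw [one_sub_Xi_eq]
    by_cases ha : a ∈ {a | ¬ GoodBox A B ε n a r}
    · rw [Set.indicator_of_mem ha, Set.indicator_of_mem ha, Pi.one_apply, mul_one]
      exact le_add_self
    · rw [Set.indicator_of_notMem ha, Set.indicator_of_notMem ha]
      simp
  refine (lintegral_mono hpt).trans ?_
  rw [lintegral_add_left measurable_const, lintegral_indicator_const hm]
  simp only [lintegral_const, measure_univ, mul_one]
  rw [ENNReal.ofReal_add zero_le_one (by positivity), ENNReal.ofReal_one, mul_comm _ (Real.exp u),
    ENNReal.ofReal_mul (Real.exp_pos _).le]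
  gcongr

end Observables

/-! ### The weights -/

section Weights

variable {A B ε : ℝ} {n : ℕ} {r : Site} {a b : Site → ℝ}

/-- The bound for the averages of the disorder. -/
noncomputable def avgBound (n : ℕ) : ℝ := (n : ℝ) ^ (-3 / 2 : ℝ) * Real.log n ^ 50

/-- The contributions of a cube to the sums that decide whether a set is clean, each normalised
by the bound that is required of it. -/
noncomputable def weight (A B ε : ℝ) (n : ℕ) (r : Site) (a : Site → ℝ) : Fin 7 → ℝ
  | 0 => |Real.log ε| ^ 55 * trunc 1 (1 - Xi A B ε n a r)
  | 1 => (ε ^ (9 / 4 : ℝ))⁻¹ * trunc (ε ^ 2 * |Real.log ε|) (gradEnergy ε 0 n a .dirichlet r)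
  | 2 => (ε ^ (9 / 4 : ℝ))⁻¹ * trunc (ε ^ 2 * |Real.log ε|) (gradEnergy ε 0 n a .neumann r)
  | 3 => trunc 1 (fieldEnergy ε 0 n a .dirichlet r)
  | 4 => trunc 1 (fieldEnergy ε 0 n a .neumann r)
  | 5 => |Real.log ε| ^ 75 * trunc (|Real.log ε| ^ 100) (maxDisorder n a r ^ 2)
  | 6 => 2 / avgBound n * trunc (avgBound n / 2) (∑ k : Shift, |average a (shifted n r k)|)

theorem avgBound_pos (hn : 2 ≤ n) : 0 < avgBound n := by
  have h1 : (0 : ℝ) < n := by exact_mod_cast (by omega : 0 < n)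
  have h2 : 0 < Real.log n := Real.log_pos (by exact_mod_cast (by omega : 1 < n))
  unfold avgBound
  positivity

theorem avgBound_nonneg : 0 ≤ avgBound n := by
  unfold avgBound
  have : 0 ≤ Real.log (n : ℝ) := Real.log_natCast_nonneg n
  positivity

theorem weight_nonneg (hε : 0 < ε) (i : Fin 7) : 0 ≤ weight A B ε n r a i := by
  have h := avgBound_nonneg (n := n)
  match i with
  | 0 => exact mul_nonneg (by positivity) (trunc_nonneg one_sub_Xi_nonneg)
  | 1 => exact mul_nonneg (by positivity) (trunc_nonneg (gradEnergy_nonneg _))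
  | 2 => exact mul_nonneg (by positivity) (trunc_nonneg (gradEnergy_nonneg _))
  | 3 => exact trunc_nonneg (fieldEnergy_nonneg _)
  | 4 => exact trunc_nonneg (fieldEnergy_nonneg _)
  | 5 => exact mul_nonneg (by positivity) (trunc_nonneg (by positivity))
  | 6 => exact mul_nonneg (by positivity) (trunc_nonneg (Finset.sum_nonneg fun _ _ => abs_nonneg _))

theorem measurable_weight (hn : 0 < n) (i : Fin 7) :
    Measurable fun a => weight A B ε n r a i := by
  match i with
  | 0 => exact ((measurable_trunc _).comp (measurable_one_sub_Xi hn)).const_mul _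
  | 1 => exact ((measurable_trunc _).comp (measurable_gradEnergy _ le_rfl hn)).const_mul _
  | 2 => exact ((measurable_trunc _).comp (measurable_gradEnergy _ le_rfl hn)).const_mul _
  | 3 => exact (measurable_trunc _).comp (measurable_fieldEnergy _ le_rfl hn)
  | 4 => exact (measurable_trunc _).comp (measurable_fieldEnergy _ le_rfl hn)
  | 5 => exact ((measurable_trunc _).comp (measurable_maxDisorder.pow_const 2)).const_mul _
  | 6 => exact ((measurable_trunc _).comp measurable_sum_average).const_mul _

theorem weight_congr (h : AgreeShifts n r a b) (i : Fin 7) :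
    weight A B ε n r a i = weight A B ε n r b i := by
  match i with
  | 0 => simp only [weight, Xi_congr h]
  | 1 => simp only [weight, gradEnergy_congr h]
  | 2 => simp only [weight, gradEnergy_congr h]
  | 3 => simp only [weight, fieldEnergy_congr h]
  | 4 => simp only [weight, fieldEnergy_congr h]
  | 5 => simp only [weight, maxDisorder_congr h]
  | 6 => simp only [weight, sum_average_congr h]

/-- The numerical conditions on a scale under which the weights have small exponential moments. -/
structure ScaleBounds (ε σ τ : ℝ) (n : ℕ) : Prop where
  n_ge : 36 ≤ n
  sq_le : 16 * (|Real.log ε| ^ 30) ^ 2 ≤ n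
  one_le_log : 1 ≤ Real.log n ^ 90
  log_le : Real.log n ^ 90 + 1 ≤ n / 16
  bad_rate : σ * |Real.log ε| ^ 55 ≤ |Real.log ε| ^ 10 / 2
  bad_le : (1 + 274625 * niceError (|Real.log ε| ^ 30) n * Real.exp (|Real.log ε| ^ 10)) *
    Real.exp (-(|Real.log ε| ^ 10 * 1 / 2)) ≤ τ
  grad_rate : σ * (ε ^ (9 / 4 : ℝ))⁻¹ ≤ n / (4 * ε ^ 2) / 2
  grad_le : 274625 * Real.exp (18 * n) *
    Real.exp (-(n / (4 * ε ^ 2) * (ε ^ 2 * |Real.log ε|) / 2)) ≤ τ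
  field_rate : σ ≤ 1 / (4 * ε ^ 2 * n) / 2
  field_le : 274625 * Real.exp 162 * Real.exp (-(1 / (4 * ε ^ 2 * n) * 1 / 2)) ≤ τ
  disorder_rate : σ * |Real.log ε| ^ 75 ≤ 1 / 4 / 2
  disorder_le : 274625 * n ^ 3 * 2 * Real.exp (-(1 / 4 * |Real.log ε| ^ 100 / 2)) ≤ τ
  average_rate : σ * (2 / avgBound n) ≤ Real.sqrt (n ^ 3) / 2
  average_le : 2 * Real.exp (274625 ^ 2 / 2) *
    Real.exp (-(Real.sqrt (n ^ 3) * (avgBound n / 2) / 2)) ≤ τ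

theorem niceError_nonneg (T : ℝ) (n : ℕ) : 0 ≤ niceError T n := by
  unfold niceError; positivity

theorem ScaleBounds.measure_not_nice_le {σ τ : ℝ} (h : ScaleBounds ε σ τ n) (hε : 0 < ε)
    (hA : A ≤ 1 / 384) (hB : 76 ≤ B) (q : Site) :
    gaussField {a | ¬ Nice A B ε n a (cube n q)} ≤
      ENNReal.ofReal (niceError (|Real.log ε| ^ 30) n) := by
  refine le_trans (measure_mono (t := {a | ¬ NiceEvents B ε (|Real.log ε| ^ 30) n q a})
    fun a ha hc => ha ?_) (measure_not_niceEvents_le hB hε (by positivity)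
    (by have := h.n_ge; omega) h.one_le_log q)
  exact NiceEvents.nice hc hε h.n_ge h.sq_le hA h.one_le_log h.log_le

/-- The normalisation κ may be large as long as σκ stays below half the rate u at which F has
exponential moments. Each observable thus needs two numerical checks: its rate, and the smallness of
D exp(-uθ/2). -/
theorem lintegral_exp_mul_trunc_le {F : (Site → ℝ) → ℝ} (hF : Measurable F) (hF0 : ∀ a, 0 ≤ F a)
    {σ κ u θ D τ : ℝ} (hu : 0 ≤ u) (hs : σ * κ ≤ u / 2)
    (hD : ∫⁻ a, ENNReal.ofReal (Real.exp (u * F a)) ∂gaussField ≤ ENNReal.ofReal D)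
    (hτ : D * Real.exp (-(u * θ / 2)) ≤ τ) :
    ∫⁻ a, ENNReal.ofReal (Real.exp (σ * (κ * trunc θ (F a)))) ∂gaussField ≤
      ENNReal.ofReal (1 + τ) := by
  simp only [← mul_assoc]
  exact (lintegral_exp_trunc_le hF hF0 hu hs hD).trans (ENNReal.ofReal_le_ofReal (by linarith))

theorem ScaleBounds.lintegral_exp_weight_le {σ τ : ℝ} (h : ScaleBounds ε σ τ n) (hε : 0 < ε)
    (hA : A ≤ 1 / 384) (hB : 76 ≤ B) (i : Fin 7) :
    ∫⁻ a, ENNReal.ofReal (Real.exp (σ * weight A B ε n r a i)) ∂gaussField ≤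
      ENNReal.ofReal (1 + τ) := by
  have hn : 0 < n := by have := h.n_ge; omega
  match i with
  | 0 =>
    exact lintegral_exp_mul_trunc_le (measurable_one_sub_Xi hn) (fun _ => one_sub_Xi_nonneg)
      (by positivity) h.bad_rate (lintegral_exp_one_sub_Xi_le hn (niceError_nonneg _ _)
      (h.measure_not_nice_le hε hA hB)) h.bad_le
  | 1 =>
    exact lintegral_exp_mul_trunc_le (measurable_gradEnergy _ le_rfl hn)
      (fun _ => gradEnergy_nonneg _) (by positivity) h.grad_rate
      (lintegral_exp_gradEnergy_le _ hε hn) h.grad_le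
  | 2 =>
    exact lintegral_exp_mul_trunc_le (measurable_gradEnergy _ le_rfl hn)
      (fun _ => gradEnergy_nonneg _) (by positivity) h.grad_rate
      (lintegral_exp_gradEnergy_le _ hε hn) h.grad_le
  | 3 =>
    have := lintegral_exp_mul_trunc_le (κ := 1) (σ := σ) (measurable_fieldEnergy (r := r) .dirichlet le_rfl hn)
      (fun _ => fieldEnergy_nonneg _) (by positivity) (by rw [mul_one]; exact h.field_rate)
      (lintegral_exp_fieldEnergy_le _ hε hn) h.field_le
    simpa only [one_mul, weight] using this
  | 4 =>
    have := lintegral_exp_mul_trunc_le (κ := 1) (σ := σ) (measurable_fieldEnergy (r := r) .neumann le_rfl hn)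
      (fun _ => fieldEnergy_nonneg _) (by positivity) (by rw [mul_one]; exact h.field_rate)
      (lintegral_exp_fieldEnergy_le _ hε hn) h.field_le
    simpa only [one_mul, weight] using this
  | 5 =>
    exact lintegral_exp_mul_trunc_le (measurable_maxDisorder.pow_const 2) (fun _ => sq_nonneg _)
      (by norm_num) h.disorder_rate (lintegral_exp_maxDisorder_le hn) h.disorder_le
  | 6 =>
    exact lintegral_exp_mul_trunc_le measurable_sum_average
      (fun _ => Finset.sum_nonneg fun _ _ => abs_nonneg _)
      (by positivity) h.average_rate (lintegral_exp_sum_average_le hn) h.average_le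

/-- The corners of the cubes of side `n` in the cube of side `L` with index `q`. -/
noncomputable def corners (L n : ℕ) (q : Site) : Finset Site := by
  classical exact (cube L fun i => L * q i).filter (Aligned n)

theorem mem_corners {L : ℕ} (hL : 0 < L) {q : Site} :
    r ∈ corners L n q ↔ boxIndex L r = q ∧ Aligned n r := by
  classical
  rw [corners, Finset.mem_filter, mem_cube_iff_boxIndex hL]

/-- The weight of a cube of side `L`. -/
noncomputable def boxWeight (A B ε : ℝ) (q : Site) (a : Site → ℝ) : ℝ :=
  ∑ n ∈ scales ε, ∑ r ∈ corners (bigL ε) n q, (n / bigL ε : ℝ) ^ 3 * ∑ i, weight A B ε n r a i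

theorem boxWeight_nonneg (hε : 0 < ε) (q : Site) (a : Site → ℝ) : 0 ≤ boxWeight A B ε q a :=
  Finset.sum_nonneg fun _ _ => Finset.sum_nonneg fun _ _ => mul_nonneg (by positivity)
    (Finset.sum_nonneg fun i _ => weight_nonneg hε i)

theorem measurable_boxWeight (h0 : ∀ n ∈ scales ε, 0 < n) (q : Site) :
    Measurable (boxWeight A B ε q) := by
  unfold boxWeight
  exact Finset.measurable_sum _ fun n hn => Finset.measurable_sum _ fun r _ =>
    (Finset.measurable_sum _ fun i _ => measurable_weight (h0 n hn) i).const_mul _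

/-- An interval of length L contains at most L/n + 1 ≤ 2L/n multiples of n, hence the constant 2³. A
constant loss is harmless here, so divisibility of L by n is not needed. -/
theorem card_corners_le {L : ℕ} (hn : 0 < n) (hnL : n ≤ L) (q : Site) :
    ((corners L n q).card : ℝ) * (n / L) ^ 3 ≤ 8 := by
  classical
  have hn' : (0 : ℝ) < n := by exact_mod_cast hn
  have hL' : (0 : ℝ) < L := by exact_mod_cast (by omega : 0 < L)
  have h1 : corners L n q ⊆ Fintype.piFinset fun i =>
      (Finset.Ico (L * q i : ℤ) (L * q i + L)).filter ((n : ℤ) ∣ ·) := by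
    intro r hr
    rw [corners, Finset.mem_filter, mem_cube] at hr
    rw [Fintype.mem_piFinset]
    intro i
    rw [Finset.mem_filter, Finset.mem_Ico]
    exact ⟨hr.1 i, hr.2 i⟩
  have h2 : ∀ i, (((Finset.Ico (L * q i : ℤ) (L * q i + L)).filter ((n : ℤ) ∣ ·)).card : ℝ) ≤
      2 * (L / n) := by
    intro i
    have h := Int.Ico_filter_dvd_card (L * q i : ℤ) (L * q i + L) (r := n) (by exact_mod_cast hn)
    have h' : (((Finset.Ico (L * q i : ℤ) (L * q i + L)).filter ((n : ℤ) ∣ ·)).card : ℝ) =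
        ((max (⌈((L * q i + L : ℤ) : ℚ) / (n : ℤ)⌉ - ⌈((L * q i : ℤ) : ℚ) / (n : ℤ)⌉) 0 : ℤ) : ℝ) := by
      exact_mod_cast congrArg (fun z : ℤ => (z : ℝ)) h
    have h1n : (1 : ℝ) ≤ L / n := by
      rw [le_div_iff₀ hn', one_mul]; exact_mod_cast hnL
    rw [h', Int.cast_max, Int.cast_zero, max_le_iff]
    refine ⟨?_, by positivity⟩
    have h3 : ((⌈((L * q i + L : ℤ) : ℚ) / (n : ℤ)⌉ : ℚ)) < ((L * q i + L : ℤ) : ℚ) / (n : ℤ) + 1 :=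
      Int.ceil_lt_add_one _
    have h4 : ((L * q i : ℤ) : ℚ) / (n : ℤ) ≤ ((⌈((L * q i : ℤ) : ℚ) / (n : ℤ)⌉ : ℚ)) := Int.le_ceil _
    have h5 : ((⌈((L * q i + L : ℤ) : ℚ) / (n : ℤ)⌉ : ℚ)) - ((⌈((L * q i : ℤ) : ℚ) / (n : ℤ)⌉ : ℚ)) ≤
        (L : ℚ) / n + 1 := by
      have e : ((L * q i + L : ℤ) : ℚ) / (n : ℤ) = ((L * q i : ℤ) : ℚ) / (n : ℤ) + (L : ℚ) / n := by
        push_cast; ring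
      rw [e] at h3
      rw [e]
      linarith
    have h6 : ((⌈((L * q i + L : ℤ) : ℚ) / (n : ℤ)⌉ : ℝ)) - ((⌈((L * q i : ℤ) : ℚ) / (n : ℤ)⌉ : ℝ)) ≤
        (L : ℝ) / n + 1 := by
      have h7 := (Rat.cast_le (K := ℝ)).2 h5
      push_cast at h7 ⊢
      exact h7
    push_cast at h6 ⊢
    linarith
  have h3 : ((corners L n q).card : ℝ) ≤ (2 * (L / n)) ^ 3 := by
    refine (Nat.cast_le.2 (Finset.card_le_card h1)).trans ?_
    rw [Fintype.card_piFinset, Nat.cast_prod]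
    refine (Finset.prod_le_prod (fun i _ => Nat.cast_nonneg _) fun i _ => h2 i).trans ?_
    simp
  calc ((corners L n q).card : ℝ) * (n / L) ^ 3 ≤ (2 * (L / n)) ^ 3 * (n / L) ^ 3 := by gcongr
    _ = 8 := by field_simp; norm_num

theorem card_scales_le (ε : ℝ) : ((scales ε).card : ℝ) ≤ 3 := by
  exact_mod_cast Finset.card_le_three

/-- The factor 21000 = 125 · 3 · 8 · 7 reserves room for four averages: 125 colours, three scales,
total mass at most 8 of the subcubes of a box, and seven observables. The last three are carried out
here by convexity, without independence. -/
theorem lintegral_exp_boxWeight_le {s τ : ℝ} (hτ : 0 ≤ τ)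
    (h : ∀ n ∈ scales ε, n ≤ bigL ε ∧ ScaleBounds ε (21000 * s) τ n) (hε : 0 < ε)
    (hA : A ≤ 1 / 384) (hB : 76 ≤ B) (q : Site) :
    ∫⁻ a, ENNReal.ofReal (Real.exp (125 * s * boxWeight A B ε q a)) ∂gaussField ≤
      ENNReal.ofReal (1 + τ) := by
  have h0 : ∀ n ∈ scales ε, 0 < n := fun n hn => by have := (h n hn).2.n_ge; omega
  have hX : ∀ n ∈ scales ε, ∀ r, ∫⁻ a, ENNReal.ofReal (Real.exp (3000 * s *
      ∑ i, weight A B ε n r a i)) ∂gaussField ≤ ENNReal.ofReal (1 + τ) := by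
    intro n hn r
    refine le_trans (le_of_eq (lintegral_congr fun a => ?_)) (lintegral_exp_sum_mul_le
      (J := Finset.univ) (w := fun _ => 1 / 7) (f := fun i a => 21000 * s * weight A B ε n r a i)
      (fun i => (measurable_weight (h0 n hn) i).const_mul _) hτ (fun _ _ => by norm_num) (by simp)
      fun i _ => (h n hn).2.lintegral_exp_weight_le hε hA hB i)
    rw [Finset.mul_sum]
    refine congrArg (fun x => ENNReal.ofReal (Real.exp x)) (Finset.sum_congr rfl fun i _ => ?_)
    ring
  have hmX : ∀ n ∈ scales ε, ∀ r, Measurable fun a => ∑ i, weight A B ε n r a i :=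
    fun n hn r => Finset.measurable_sum _ fun i _ => measurable_weight (h0 n hn) i
  have hS : ∀ n ∈ scales ε, ∫⁻ a, ENNReal.ofReal (Real.exp (375 * s *
      ∑ r ∈ corners (bigL ε) n q, (n / bigL ε : ℝ) ^ 3 * ∑ i, weight A B ε n r a i)) ∂gaussField ≤
      ENNReal.ofReal (1 + τ) := by
    intro n hn
    refine le_trans (le_of_eq (lintegral_congr fun a => ?_)) (lintegral_exp_sum_mul_le
      (J := corners (bigL ε) n q) (w := fun _ => (n / bigL ε : ℝ) ^ 3 / 8)
      (f := fun r a => 3000 * s * ∑ i, weight A B ε n r a i)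
      (fun r => (hmX n hn r).const_mul _) hτ (fun _ _ => by positivity) ?_
      fun r _ => hX n hn r)
    · rw [Finset.mul_sum]
      refine congrArg (fun x => ENNReal.ofReal (Real.exp x)) (Finset.sum_congr rfl fun i _ => ?_)
      ring
    · rw [Finset.sum_const, nsmul_eq_mul, ← mul_div_assoc, div_le_one (by norm_num)]
      exact card_corners_le (h0 n hn) (h n hn).1 q
  classical
  refine le_trans (le_of_eq (lintegral_congr fun a => ?_)) (lintegral_exp_sum_mul_le
    (J := (scales ε).attach) (w := fun _ => (1 / 3 : ℝ)) (f := fun n a => 375 * s *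
      ∑ r ∈ corners (bigL ε) n q, ((n : ℕ) / bigL ε : ℝ) ^ 3 * ∑ i, weight A B ε n r a i)
    (fun n => (Finset.measurable_sum _ fun r _ => (hmX n n.2 r).const_mul _).const_mul _) hτ
    (fun _ _ => by norm_num) ?_ fun n _ => hS n n.2)
  · rw [boxWeight, Finset.mul_sum, ← Finset.sum_attach]
    refine congrArg (fun x => ENNReal.ofReal (Real.exp x)) (Finset.sum_congr rfl fun i _ => ?_)
    ring
  · rw [Finset.sum_const, Finset.card_attach, nsmul_eq_mul]
    linarith [card_scales_le ε]

/-- Shifts move a cube of side n by at most 2n ≤ 2L in each direction. Because n divides L, the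
unshifted cube lies inside the box of its corner, so a block of side 5L suffices. -/
theorem shifted_subset_block {L : ℕ} (hn : 0 < n) (hnL : n ∣ L) (hL : 0 < L) {q : Site}
    (hr : r ∈ corners L n q) (k : Shift) : shifted n r k ⊆ block L q := by
  obtain ⟨h1, h2⟩ := (mem_corners hL).1 hr
  rw [← mem_cube_iff_boxIndex hL, mem_cube] at h1
  intro x hx
  rw [shifted, mem_cube] at hx
  rw [block, mem_cube]
  intro i
  obtain ⟨m, hm⟩ := hnL
  obtain ⟨j, hj⟩ := h2 i
  have hk := Finset.mem_Icc.1 (k i).2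
  have h3 := h1 i
  have h4 := hx i
  have hn' : (0 : ℤ) < n := by exact_mod_cast hn
  have hLn : (n : ℤ) ≤ L := by exact_mod_cast Nat.le_of_dvd hL ⟨m, hm⟩
  have hm' : (L : ℤ) = n * m := by exact_mod_cast hm
  have h16 : (((n / 16 : ℕ) : ℤ)) * 16 ≤ n := by exact_mod_cast Nat.div_mul_le_self n 16
  have h16' : (0 : ℤ) ≤ ((n / 16 : ℕ) : ℤ) := by positivity
  have e1 : ((n / 16 : ℕ) : ℤ) * (k i : ℤ) ≤ 2 * n := by nlinarith
  have e2 : -(2 * n : ℤ) ≤ ((n / 16 : ℕ) : ℤ) * (k i : ℤ) := by nlinarith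
  have e3 : r i + n ≤ L * q i + L := by
    rw [hj, hm'] at h3 ⊢
    have h5 : j < m * q i + m := by
      by_contra hc
      push Not at hc
      nlinarith
    nlinarith
  constructor
  · nlinarith
  · push_cast
    nlinarith

theorem dependsOn_boxWeight (h0 : ∀ n ∈ scales ε, 0 < n ∧ n ∣ bigL ε) (hL : 0 < bigL ε)
    (q : Site) : DependsOn (boxWeight A B ε q) (block (bigL ε) q : Set Site) := by
  intro a b hab
  refine Finset.sum_congr rfl fun n hn => Finset.sum_congr rfl fun r hr => ?_
  rw [Finset.sum_congr rfl fun i _ => weight_congr (fun k x hx =>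
    hab x (shifted_subset_block (h0 n hn).1 (h0 n hn).2 hL hr k hx)) i]

end Weights

/-! ### Sets that are not clean are heavy -/

section Unclean

variable {A B ε : ℝ} {n : ℕ} {a : Site → ℝ} {Y : Set Site}

theorem eq_mul_boxIndex (hn : 0 < n) {r x : Site} (hr : Aligned n r) (hx : x ∈ cube n r) :
    r = fun i => n * boxIndex n x i := by
  choose q hq using hr
  have e : r = fun i => n * q i := funext hq
  rw [e, mem_cube_iff_boxIndex hn] at hx
  rw [e, hx]

theorem card_le_boxCount (hn : 0 < n) (hY : Y.Finite) {S : Finset Site}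
    (hS : ∀ r ∈ S, Aligned n r ∧ (cube n r : Set Site) ⊆ Y) : (S.card : ℝ) ≤ boxCount n Y := by
  classical
  have h1 : (S.biUnion (cube n)).card = S.card * n ^ 3 := by
    rw [Finset.card_biUnion, Finset.sum_congr rfl fun r _ => card_cube n r, Finset.sum_const,
      smul_eq_mul]
    intro r hr r' hr' hne
    refine Finset.disjoint_left.2 fun x hx hx' => ?_
    exact hne ((eq_mul_boxIndex hn (hS r hr).1 hx).trans (eq_mul_boxIndex hn (hS r' hr').1 hx').symm)
  have h2 : (S.biUnion (cube n)).card ≤ Y.ncard := by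
    rw [← Set.ncard_coe_finset]
    refine Set.ncard_le_ncard ?_ hY
    intro x hx
    obtain ⟨r, hr, hxr⟩ := Finset.mem_biUnion.1 (Finset.mem_coe.1 hx)
    exact (hS r hr).2 hxr
  rw [boxCount, le_div_iff₀ (by positivity)]
  rw [h1] at h2
  exact_mod_cast h2

theorem boxCount_mono {Z : Set Site} (hZ : Z.Finite) (h : Y ⊆ Z) : boxCount n Y ≤ boxCount n Z :=
  div_le_div_of_nonneg_right (Nat.cast_le.2 (Set.ncard_le_ncard h hZ)) (by positivity)

theorem boxCount_nonneg : 0 ≤ boxCount n Y := by unfold boxCount; positivity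

theorem one_sub_Xi_le_trunc {r : Site} : 1 - Xi A B ε n a r ≤ trunc 1 (1 - Xi A B ε n a r) := by
  classical
  simp only [Xi, Set.indicator_apply, Set.mem_ofPred_eq, Pi.one_apply, trunc]
  by_cases h : GoodBox A B ε n a r <;> simp [h]

theorem mul_indicator_le_trunc {F : Site → ℝ} {p : Site → Prop} {r : Site} {θ F' : ℝ}
    (hF : F r ≤ F') (hF' : 0 ≤ F') (h : p r → θ ≤ F') :
    F r * Set.indicator {r | p r} (1 : Site → ℝ) r ≤ trunc θ F' := by
  classical
  simp only [Set.indicator_apply, Set.mem_ofPred_eq, Pi.one_apply]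
  split_ifs with hp
  · rw [mul_one, trunc, if_pos (h hp)]
    exact hF
  · rw [mul_zero]
    exact trunc_nonneg hF'

/-- Energies decrease with the mass, so massless observables control both masses. The comparison is
with the box count of Y rather than of δ(Y), because goodness is required relative to Y itself; for
regularity this is more than enough, as Y ⊆ δ(Y). -/
theorem clean_of_sum_weight_le (hY : Y.Finite) (hn : ∀ n ∈ scales ε, 2 ≤ n)
    (hℓ : ell ε ≤ bigL ε) (hℓ0 : 0 < ell ε) (hε : 0 < ε) (hlog : 2 ≤ |Real.log ε| ^ 2)
    (h : ∀ n ∈ scales ε, ∑ᶠ r ∈ boxesIn n (enlarge (ell ε) (bigL ε) Y),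
      ∑ i, weight A B ε n r a i ≤ boxCount n Y) : Clean A B ε a Y := by
  have hL : 0 < bigL ε := by have := hn (bigL ε) (by simp [scales]); omega
  set D := enlarge (ell ε) (bigL ε) Y with hD
  have hYD : Y ⊆ D := subset_enlarge hL hℓ0 Y
  have hDf : D.Finite := finite_enlarge hL hℓ hY
  have hℒ : 0 < |Real.log ε| := by
    by_contra hc
    have : |Real.log ε| = 0 := le_antisymm (not_lt.1 hc) (abs_nonneg _)
    rw [this] at hlog
    norm_num at hlog
  intro n hnS
  have hn2 := hn n hnS
  have hn0 : 0 < n := by omega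
  have hb := boxCount_mono (n := n) hDf hYD
  have hb0 := boxCount_nonneg (n := n) (Y := Y)
  set S := (finite_boxesIn hn0 hDf).toFinset with hS
  have hcard : (S.card : ℝ) ≤ boxCount n D :=
    card_le_boxCount hn0 hDf fun r hr => by
      have hr' : r ∈ boxesIn n D := (Set.Finite.mem_toFinset _).1 hr
      exact hr'
  have hi : ∀ i, ∑ r ∈ S, weight A B ε n r a i ≤ boxCount n Y := by
    intro i
    refine le_trans (Finset.sum_le_sum fun r _ => ?_) ((finsum_mem_eq_finite_toFinset_sum _
      (finite_boxesIn hn0 hDf)).symm.le.trans (h n hnS))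
    exact Finset.single_le_sum (f := fun i => weight A B ε n r a i)
      (fun i _ => weight_nonneg hε i) (Finset.mem_univ i)
  have hgrad : ∀ bc, ∑ r ∈ S, trunc (ε ^ 2 * |Real.log ε|) (gradEnergy ε 0 n a bc r) ≤
      ε ^ (9 / 4 : ℝ) * boxCount n Y := by
    intro bc
    have key : ∑ r ∈ S, (ε ^ (9 / 4 : ℝ))⁻¹ *
        trunc (ε ^ 2 * |Real.log ε|) (gradEnergy ε 0 n a bc r) ≤ boxCount n Y := by
      cases bc
      · exact hi 1
      · exact hi 2
    rwa [← Finset.mul_sum, inv_mul_le_iff₀ (by positivity)] at key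
  -- For the field energy the whole sum is bounded, not only its large part: each term is at most 1
  -- plus its truncation, and two box counts fit below |log ε|² box counts.
  have hfld : ∀ bc, ∑ r ∈ S, fieldEnergy ε 0 n a bc r ≤ |Real.log ε| ^ 2 * boxCount n D := by
    intro bc
    have key : ∑ r ∈ S, trunc 1 (fieldEnergy ε 0 n a bc r) ≤ boxCount n Y := by
      cases bc
      · exact hi 3
      · exact hi 4
    have h1 : ∑ r ∈ S, fieldEnergy ε 0 n a bc r ≤
        ∑ r ∈ S, (1 + trunc 1 (fieldEnergy ε 0 n a bc r)) :=
      Finset.sum_le_sum fun r _ => le_add_trunc zero_le_one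
    rw [Finset.sum_add_distrib, Finset.sum_const, nsmul_eq_mul, mul_one] at h1
    nlinarith
  refine ⟨?_, fun bc lam hl => ?_, fun bc lam hl => ?_, ?_, ?_⟩
  · rw [GoodSet, bracket_eq_sum hn0 hY]
    have h1 := hi 0
    simp only [weight] at h1
    rw [← Finset.mul_sum] at h1
    have h2 : ∑ r ∈ (finite_boxesIn hn0 hY).toFinset, (1 - Xi A B ε n a r) * (1 : Site → ℝ) r ≤
        ∑ r ∈ S, trunc 1 (1 - Xi A B ε n a r) := by
      refine (Finset.sum_le_sum fun r _ => ?_).trans (Finset.sum_le_sum_of_subset_of_nonneg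
        (f := fun r => trunc 1 (1 - Xi A B ε n a r)) ?_ fun r _ _ => trunc_nonneg one_sub_Xi_nonneg)
      · rw [Pi.one_apply, mul_one]
        exact one_sub_Xi_le_trunc
      · intro r hr
        rw [Set.Finite.mem_toFinset] at hr ⊢
        exact ⟨hr.1, hr.2.trans hYD⟩
    refine h2.trans ?_
    rw [zpow_neg, ← div_eq_inv_mul, le_div_iff₀ (by positivity), mul_comm]
    exact_mod_cast h1
  · rw [bracket_eq_sum hn0 hDf]
    have hl0 := masses_nonneg hl
    refine (Finset.sum_le_sum fun r _ => mul_indicator_le_trunc (gradEnergy_le bc hl0 hn0)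
      (gradEnergy_nonneg bc) fun hp => hp.trans (gradEnergy_le bc hl0 hn0)).trans
      ((hgrad bc).trans ?_)
    gcongr
  · rw [bracket_eq_sum hn0 hDf]
    have hl0 := masses_nonneg hl
    refine (Finset.sum_le_sum fun r _ => ?_).trans (hfld bc)
    -- The indicator is simply dropped, so the cutoff in the regularity condition plays no role.
    refine le_trans (mul_le_mul_of_nonneg_left (Set.indicator_le_self' (fun _ _ => zero_le_one) r)
      (fieldEnergy_nonneg bc)) ?_
    rw [mul_one]
    exact fieldEnergy_le bc hl0 hn0
  · rw [bracket_eq_sum hn0 hDf]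
    have h1 := hi 5
    simp only [weight] at h1
    rw [← Finset.mul_sum] at h1
    refine (Finset.sum_le_sum fun r _ => mul_indicator_le_trunc (θ := |Real.log ε| ^ 100)
      (F := fun r => maxDisorder n a r ^ 2) le_rfl (sq_nonneg _) fun hp => ?_).trans ?_
    · have := pow_le_pow_left₀ (by positivity) (le_of_lt hp) 2
      rwa [← pow_mul] at this
    · rw [zpow_neg, ← div_eq_inv_mul, le_div_iff₀ (by positivity), mul_comm]
      refine le_trans ?_ hb
      exact_mod_cast h1
  · rw [bracket_eq_sum hn0 hDf]
    have hc := avgBound_pos hn2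
    have h1 := hi 6
    simp only [weight] at h1
    rw [← Finset.mul_sum, div_mul_eq_mul_div, div_le_iff₀ hc] at h1
    have h2 : ∑ r ∈ S, (∑ k : Shift, |average a (shifted n r k)|) * (1 : Site → ℝ) r ≤
        -- Half of the allowance for the averages covers the untruncated part, one half-bound for
        -- each cube of δ(Y); the other half covers the truncations.
        ∑ r ∈ S, (avgBound n / 2 + trunc (avgBound n / 2) (∑ k : Shift, |average a (shifted n r k)|)) :=
      Finset.sum_le_sum fun r _ => by
        rw [Pi.one_apply, mul_one]
        exact le_add_trunc (by positivity)
    refine h2.trans ?_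
    rw [Finset.sum_add_distrib, Finset.sum_const, nsmul_eq_mul]
    change _ ≤ avgBound n * boxCount n D
    nlinarith

/-- The indices of the boxes of a finite set. -/
noncomputable def boxIndices (n : ℕ) (hY : Y.Finite) : Finset Site := by
  classical exact hY.toFinset.image (boxIndex n)

theorem mem_boxIndices (hY : Y.Finite) {q : Site} :
    q ∈ boxIndices n hY ↔ ∃ y ∈ Y, boxIndex n y = q := by
  classical
  simp [boxIndices]

theorem card_boxIndices_le (hn : 0 < n) (hY : Y.Finite) (hm : ScaleMeasurable n Y) :
    ((boxIndices n hY).card : ℝ) ≤ boxCount n Y := by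
  classical
  have hinj : Function.Injective fun (q : Site) (i : Fin 3) => (n : ℤ) * q i := by
    intro q q' h
    funext i
    have := congrFun h i
    exact mul_left_cancel₀ (by exact_mod_cast hn.ne') this
  rw [← Finset.card_image_of_injective (boxIndices n hY) hinj]
  refine card_le_boxCount hn hY fun r hr => ?_
  obtain ⟨q, hq, rfl⟩ := Finset.mem_image.1 hr
  obtain ⟨y, hy, hyq⟩ := (mem_boxIndices hY).1 hq
  refine ⟨fun i => dvd_mul_right _ _, fun x hx => ?_⟩
  exact hm.mem_of_boxIndex_eq hn hy (((mem_cube_iff_boxIndex hn).1 hx).trans hyq.symm)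

/-- Failure of cleanness makes the sum of weights at some scale n exceed the number of cubes of side
n in Y. The factor (n/L)³ in the box weight turns this number into the number of boxes of side L, so
that all three scales are measured in the same unit. -/
theorem heavy_of_not_clean (hY : Y.Finite) (hc : LatticeConnected Y)
    (hm : ScaleMeasurable (bigL ε) Y) (hn : ∀ n ∈ scales ε, 2 ≤ n)
    (hℓ : ell ε ≤ bigL ε) (hℓ0 : 0 < ell ε) (hε : 0 < ε) (hlog : 2 ≤ |Real.log ε| ^ 2)
    (h : ¬ Clean A B ε a Y) {x : Site} (hx : x ∈ closedHull (ell ε) (bigL ε) Y) :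
    Heavy (boxWeight A B ε) (boxIndices (bigL ε) hY).card (boxIndex (bigL ε) x) a := by
  classical
  have hL : 0 < bigL ε := by have := hn (bigL ε) (by simp [scales]); omega
  have hDf : (enlarge (ell ε) (bigL ε) Y).Finite := finite_enlarge hL hℓ hY
  have hlink := hc.linked hL hY (fun q => mem_boxIndices hY)
  refine ⟨boxIndices (bigL ε) hY, boxIndices (bigL ε) hDf, rfl, hlink,
    exists_near_of_mem_closedHull hL hℓ (fun q => mem_boxIndices hY) hlink hx, ?_, ?_⟩
  · intro v hv
    obtain ⟨y, hy, rfl⟩ := (mem_boxIndices hDf).1 hv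
    obtain ⟨z, hz, hyz⟩ := exists_near_of_mem_enlarge hL hℓ hy
    exact ⟨_, (mem_boxIndices hY).2 ⟨z, hz, rfl⟩, hyz⟩
  · obtain ⟨n, hnS, hlt⟩ : ∃ n ∈ scales ε, boxCount n Y <
        ∑ᶠ r ∈ boxesIn n (enlarge (ell ε) (bigL ε) Y), ∑ i, weight A B ε n r a i := by
      by_contra! hno
      exact h (clean_of_sum_weight_le hY hn hℓ hℓ0 hε hlog hno)
    have hn0 : 0 < n := by have := hn n hnS; omega
    have hn' : (0 : ℝ) < n := by exact_mod_cast hn0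
    have hL' : (0 : ℝ) < bigL ε := by exact_mod_cast hL
    rw [finsum_mem_eq_finite_toFinset_sum _ (finite_boxesIn hn0 hDf)] at hlt
    set S := (finite_boxesIn hn0 hDf).toFinset with hS
    have hmem : ∀ r ∈ S, boxIndex (bigL ε) r ∈ boxIndices (bigL ε) hDf := by
      intro r hr
      have hr' := ((Set.Finite.mem_toFinset _).1 hr).2
      refine (mem_boxIndices hDf).2 ⟨r, hr' ?_, rfl⟩
      rw [Finset.mem_coe, mem_cube]
      intro i
      constructor <;> omega
    have h1 : ∑ r ∈ S, ∑ i, weight A B ε n r a i ≤ ∑ q ∈ boxIndices (bigL ε) hDf,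
        ∑ r ∈ corners (bigL ε) n q, ∑ i, weight A B ε n r a i := by
      rw [← Finset.sum_fiberwise_of_maps_to hmem]
      refine Finset.sum_le_sum fun q _ => Finset.sum_le_sum_of_subset_of_nonneg ?_
        fun r _ _ => Finset.sum_nonneg fun i _ => weight_nonneg hε i
      intro r hr
      rw [Finset.mem_filter] at hr
      exact (mem_corners hL).2 ⟨hr.2, ((Set.Finite.mem_toFinset _).1 hr.1).1⟩
    have h2 : (n / bigL ε : ℝ) ^ 3 * ∑ q ∈ boxIndices (bigL ε) hDf,
        ∑ r ∈ corners (bigL ε) n q, ∑ i, weight A B ε n r a i ≤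
        ∑ q ∈ boxIndices (bigL ε) hDf, boxWeight A B ε q a := by
      rw [Finset.mul_sum]
      refine Finset.sum_le_sum fun q _ => ?_
      rw [Finset.mul_sum, boxWeight]
      exact Finset.single_le_sum (f := fun n : ℕ => ∑ r ∈ corners (bigL ε) n q,
        (n / bigL ε : ℝ) ^ 3 * ∑ i, weight A B ε n r a i) (fun m _ => Finset.sum_nonneg fun r _ =>
        mul_nonneg (by positivity) (Finset.sum_nonneg fun i _ => weight_nonneg hε i)) hnS
    have h3 : ((boxIndices (bigL ε) hY).card : ℝ) ≤ (n / bigL ε : ℝ) ^ 3 * boxCount n Y := by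
      refine (card_boxIndices_le hL hY hm).trans (le_of_eq ?_)
      rw [boxCount, boxCount]
      field_simp
    refine h3.trans_lt (lt_of_lt_of_le ?_ h2)
    exact mul_lt_mul_of_pos_left (hlt.trans_le h1) (by positivity)

end Unclean

/-! ### The variance of the bad volume -/

/-- The qualitative conditions on the scales. -/
structure GoodScales (ε : ℝ) : Prop where
  eps_pos : 0 < ε
  two_le : ∀ n ∈ scales ε, 2 ≤ n
  dvd : ∀ n ∈ scales ε, n ∣ bigL ε
  ell_le : ell ε ≤ bigL ε
  log_ge : 2 ≤ |Real.log ε| ^ 2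

namespace GoodScales

variable {ε : ℝ}

theorem pos (h : GoodScales ε) : ∀ n ∈ scales ε, 0 < n := fun n hn => by
  have := h.two_le n hn; omega

theorem bigL_pos (h : GoodScales ε) : 0 < bigL ε := h.pos _ (by simp [scales])

theorem ell_pos (h : GoodScales ε) : 0 < ell ε := h.pos _ (by simp [scales])

end GoodScales

/-- The bounded connected measurable sets whose hull contains `x`. -/
def Surrounds (ε : ℝ) (x : Site) (Y : Set Site) : Prop :=
  Y.Finite ∧ LatticeConnected Y ∧ ScaleMeasurable (bigL ε) Y ∧
    x ∈ closedHull (ell ε) (bigL ε) Y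

theorem mem_badSet {A B ε : ℝ} {a : Site → ℝ} {x : Site} :
    x ∈ badSet A B ε a ↔ ∃ Y, Surrounds ε x Y ∧ ¬ Clean A B ε a Y := by
  simp only [badSet, Set.mem_iUnion, Set.mem_ofPred_eq, Surrounds, exists_prop]
  constructor
  · rintro ⟨Y, ⟨h1, h2, h3, h4⟩, h5⟩
    exact ⟨Y, ⟨h1, h2, h3, h5⟩, h4⟩
  · rintro ⟨Y, ⟨h1, h2, h3, h5⟩, h4⟩
    exact ⟨Y, ⟨h1, h2, h3, h4⟩, h5⟩

/-- The event that `x` is surrounded by a set of at most `R` boxes that is not clean. -/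
def badWithin (A B ε : ℝ) (R : ℕ) (x : Site) : Set (Site → ℝ) :=
  {a | ∃ Y, (Surrounds ε x Y ∧ ∀ hY : Y.Finite, (boxIndices (bigL ε) hY).card ≤ R) ∧
    ¬ Clean A B ε a Y}

/-- The event that `x` belongs to the bad set. -/
def badAt (A B ε : ℝ) (x : Site) : Set (Site → ℝ) := {a | x ∈ badSet A B ε a}

/-- The sites on which `badWithin` depends. -/
noncomputable def region (L R : ℕ) (p : Site) : Finset Site :=
  (Finset.Icc (fun i => p i - (4 * R + 3)) (fun i => p i + (4 * R + 3))).biUnion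
    fun q => cube L fun i => L * q i

theorem mem_region {L R : ℕ} (hL : 0 < L) {p z : Site} :
    z ∈ region L R p ↔ Near (4 * R + 3) (boxIndex L z) p := by
  simp only [region, Finset.mem_biUnion, mem_cube_iff_boxIndex hL, Finset.mem_Icc, exists_eq_right',
    Near, Pi.le_def, ← forall_and]
  refine forall_congr' fun i => ?_
  rw [abs_le]
  constructor <;> rintro ⟨h1, h2⟩ <;> constructor <;> linarith

theorem mem_block_iff {L : ℕ} (hL : 0 < L) {q x : Site} :
    x ∈ block L q → Near 2 (boxIndex L x) q := by
  intro h i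
  rw [block, mem_cube] at h
  have h1 := h i
  have hL' : (0 : ℤ) < L := by exact_mod_cast hL
  have h2 : q i - 2 ≤ x i / L := by
    rw [Int.le_ediv_iff_mul_le hL']; linarith
  have h3 : x i / L < q i + 3 := by
    rw [Int.ediv_lt_iff_lt_mul hL']
    push_cast at h1
    linarith
  rw [abs_le]
  simp only [boxIndex]
  constructor <;> omega

theorem near_of_linked {V : Finset Site} (hV : Linked V) {q v : Site} (hq : q ∈ V) (hv : v ∈ V) :
    Near (2 * V.card) v q := by
  obtain ⟨f, hf0, hf, hcov⟩ := hV.exists_walk hq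
  obtain ⟨i, hi, rfl⟩ := hcov v hv
  have h := near_of_steps hf 0 i
  rw [zero_add, hf0] at h
  exact h.mono (by exact_mod_cast hi)

theorem badWithin_subset {A B ε : ℝ} (R : ℕ) (x : Site) :
    badWithin A B ε R x ⊆ badAt A B ε x := by
  rintro a ⟨Y, ⟨hY, -⟩, hc⟩
  exact mem_badSet.2 ⟨Y, hY, hc⟩

section Cov

variable {A B ε : ℝ} (h : GoodScales ε)

include h

theorem measurableSet_badWithin (R : ℕ) (x : Site) : MeasurableSet (badWithin A B ε R x) :=
  measurableSet_exists_not_clean h.pos h.ell_le _ fun _ hY => hY.1.1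

theorem measurableSet_badAt (x : Site) : MeasurableSet (badAt A B ε x) := by
  simp only [badAt, mem_badSet]
  exact measurableSet_exists_not_clean h.pos h.ell_le _ fun _ hY => hY.1

theorem badAt_subset (R : ℕ) (x : Site) : badAt A B ε x ⊆ badWithin A B ε R x ∪
    {a | ∃ N, R < N ∧ Heavy (boxWeight A B ε) N (boxIndex (bigL ε) x) a} := by
  intro a ha
  obtain ⟨Y, hY, hc⟩ := mem_badSet.1 ha
  by_cases hR : (boxIndices (bigL ε) hY.1).card ≤ R
  · exact Or.inl ⟨Y, ⟨hY, fun _ => hR⟩, hc⟩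
  · exact Or.inr ⟨_, not_le.1 hR, heavy_of_not_clean hY.1 hY.2.1 hY.2.2.1 h.two_le h.ell_le h.ell_pos
      h.eps_pos h.log_ge hc hY.2.2.2⟩

/-- The radius 4R + 3 adds up along a chain of box indices: 2 from a site of a shifted cube to the
box of its corner, 1 from there to Y, 2R across Y, and 2R from Y to a site of its hull. -/
theorem dependsOn_badWithin (R : ℕ) (x : Site) :
    DependsOn (fun a => a ∈ badWithin A B ε R x)
      (region (bigL ε) R (boxIndex (bigL ε) x) : Set Site) := by
  have key : ∀ a b : Site → ℝ, (∀ z ∈ region (bigL ε) R (boxIndex (bigL ε) x), a z = b z) →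
      a ∈ badWithin A B ε R x → b ∈ badWithin A B ε R x := by
    rintro a b hab ⟨Y, ⟨hY, hR⟩, hc⟩
    refine ⟨Y, ⟨hY, hR⟩, fun hb => hc ?_⟩
    refine hb.congr (subset_enlarge h.bigL_pos h.ell_pos Y) fun n hn r hr k z hz => ?_
    refine (hab z ((mem_region h.bigL_pos).2 ?_)).symm
    have hlink := hY.2.1.linked h.bigL_pos hY.1 (fun q => mem_boxIndices hY.1)
    obtain ⟨q, hq, hqx⟩ := exists_near_of_mem_closedHull h.bigL_pos h.ell_le
      (fun q => mem_boxIndices hY.1) hlink hY.2.2.2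
    have hrD : r ∈ enlarge (ell ε) (bigL ε) Y := hr.2 (by
      rw [Finset.mem_coe, mem_cube]
      intro i
      have := h.pos n hn
      constructor <;> omega)
    obtain ⟨y, hy, hry⟩ := exists_near_of_mem_enlarge h.bigL_pos h.ell_le hrD
    have h1 := mem_block_iff h.bigL_pos (shifted_subset_block (h.pos n hn) (h.dvd n hn) h.bigL_pos
      ((mem_corners h.bigL_pos).2 ⟨rfl, hr.1⟩) k hz)
    have h2 := near_of_linked hlink hq ((mem_boxIndices hY.1).2 ⟨y, hy, rfl⟩)
    refine (((h1.trans hry).trans h2).trans hqx).mono ?_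
    have := hR hY.1
    omega
  intro a b hab
  exact propext ⟨key a b fun z hz => hab z hz, key b a fun z hz => (hab z hz).symm⟩

theorem measure_badWithin_inter {R : ℕ} {x y : Site}
    (hxy : ¬ Near (8 * R + 6) (boxIndex (bigL ε) x) (boxIndex (bigL ε) y)) :
    gaussField (badWithin A B ε R x ∩ badWithin A B ε R y) =
      gaussField (badWithin A B ε R x) * gaussField (badWithin A B ε R y) := by
  have hdis : Disjoint (region (bigL ε) R (boxIndex (bigL ε) x))
      (region (bigL ε) R (boxIndex (bigL ε) y)) := by
    refine Finset.disjoint_left.2 fun z hz hz' => hxy ?_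
    rw [mem_region h.bigL_pos] at hz hz'
    exact (hz.symm.trans hz').mono (by linarith)
  have hm : ∀ z, Measurable fun a => a ∈ badWithin A B ε R z := fun z =>
    measurableSet_setOfPred.1 (measurableSet_badWithin h R z)
  have hi := indepFun_of_dependsOn (hm x) (hm y) (dependsOn_badWithin (A := A) (B := B) h R x)
    (dependsOn_badWithin (A := A) (B := B) h R y) hdis
  have := hi.measure_inter_preimage_eq_mul {True} {True} trivial trivial
  have e : ∀ z, (fun a => a ∈ badWithin A B ε R z) ⁻¹' {True} = badWithin A B ε R z := fun z => by
    ext a; simp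
  rwa [e, e] at this

variable {H κ : ℝ} (hκ : 0 < κ) (hκ1 : κ ≤ 1)
  (hH : ∀ (R : ℕ) (p : Site), gaussField {a | ∃ N, R < N ∧ Heavy (boxWeight A B ε) N p a} ≤
    ENNReal.ofReal (H * Real.exp (-(κ * R))))

include hH

/-- The case R = 0 of the tail bound: a heavy set is never empty, so it has more than 0 boxes. -/
theorem measureReal_badAt_le (hH0 : 0 ≤ H) (x : Site) : gaussField.real (badAt A B ε x) ≤ H := by
  refine ENNReal.toReal_le_of_le_ofReal hH0 ?_
  refine le_trans (measure_mono ?_) ((hH 0 (boxIndex (bigL ε) x)).trans (le_of_eq (by simp)))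
  intro a ha
  obtain ⟨Y, hY, hc⟩ := mem_badSet.1 ha
  have hh := heavy_of_not_clean hY.1 hY.2.1 hY.2.2.1 h.two_le h.ell_le h.ell_pos
      h.eps_pos h.log_ge hc hY.2.2.2
  exact ⟨_, hh.pos, hh⟩

/-- Up to a large heavy set near x or y, both events are the localised ones, which are independent.
Since localised events are contained in the true ones, the product of their probabilities errs in
the favourable direction, so only the joint event pays an error. -/
theorem measureReal_inter_sub_le (hH0 : 0 ≤ H) {R : ℕ} {x y : Site}
    (hxy : ¬ Near (8 * R + 6) (boxIndex (bigL ε) x) (boxIndex (bigL ε) y)) :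
    gaussField.real (badAt A B ε x ∩ badAt A B ε y) -
      gaussField.real (badAt A B ε x) * gaussField.real (badAt A B ε y) ≤
      2 * H * Real.exp (-(κ * R)) := by
  set T : Site → Set (Site → ℝ) :=
    fun x => {a | ∃ N, R < N ∧ Heavy (boxWeight A B ε) N (boxIndex (bigL ε) x) a} with hT
  have hTr : ∀ x, gaussField.real (T x) ≤ H * Real.exp (-(κ * R)) := fun x =>
    ENNReal.toReal_le_of_le_ofReal (by positivity) (hH R _)
  have h1 : badAt A B ε x ∩ badAt A B ε y ⊆
      (badWithin A B ε R x ∩ badWithin A B ε R y) ∪ (T x ∪ T y) := by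
    rintro a ⟨hx, hy⟩
    rcases badAt_subset h R x hx with hx | hx
    · rcases badAt_subset h R y hy with hy | hy
      · exact Or.inl ⟨hx, hy⟩
      · exact Or.inr (Or.inr hy)
    · exact Or.inr (Or.inl hx)
  have h2 : gaussField.real (badAt A B ε x ∩ badAt A B ε y) ≤
      gaussField.real (badWithin A B ε R x ∩ badWithin A B ε R y) +
        (gaussField.real (T x) + gaussField.real (T y)) :=
    (measureReal_mono h1).trans ((measureReal_union_le _ _).trans
      (add_le_add le_rfl (measureReal_union_le _ _)))
  have h3 : gaussField.real (badWithin A B ε R x ∩ badWithin A B ε R y) =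
      gaussField.real (badWithin A B ε R x) * gaussField.real (badWithin A B ε R y) := by
    rw [measureReal_def, measure_badWithin_inter h hxy, ENNReal.toReal_mul]
    rfl
  have h4 : gaussField.real (badWithin A B ε R x) * gaussField.real (badWithin A B ε R y) ≤
      gaussField.real (badAt A B ε x) * gaussField.real (badAt A B ε y) :=
    mul_le_mul (measureReal_mono (badWithin_subset R x)) (measureReal_mono (badWithin_subset R y))
      measureReal_nonneg measureReal_nonneg
  linarith [hTr x, hTr y]

include hκ hκ1

/-- The localisation radius is chosen as R = q - 1, where q is the integer part of the distance
divided by 8L. The loss of at most 2 between R and the distance in these units gives e² as κ ≤ 1.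
Bounding the sum of coordinate distances by three times the largest turns the decay into a product
that can be summed coordinate by coordinate. -/
theorem measureReal_inter_sub_le_prod (hH0 : 0 ≤ H) (x y : Site) :
    gaussField.real (badAt A B ε x ∩ badAt A B ε y) -
      gaussField.real (badAt A B ε x) * gaussField.real (badAt A B ε y) ≤
      2 * H * Real.exp 2 * ∏ i, Real.exp (-(κ / (24 * bigL ε) * |((x i - y i : ℤ) : ℝ)|)) := by
  have hL := h.bigL_pos
  have hL' : (0 : ℝ) < bigL ε := by exact_mod_cast hL
  obtain ⟨i, -, hi⟩ := Finset.exists_max_image Finset.univ (fun i => |x i - y i|)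
    Finset.univ_nonempty
  set q := (|x i - y i|).toNat / (8 * bigL ε) with hq
  have hd0 : (((|x i - y i|).toNat : ℕ) : ℝ) = |((x i - y i : ℤ) : ℝ)| := by
    have : (((|x i - y i|).toNat : ℕ) : ℤ) = |x i - y i| := Int.toNat_of_nonneg (abs_nonneg _)
    rw [← Int.cast_abs]
    exact_mod_cast congrArg (fun z : ℤ => (z : ℝ)) this
  have hbound : gaussField.real (badAt A B ε x ∩ badAt A B ε y) -
      gaussField.real (badAt A B ε x) * gaussField.real (badAt A B ε y) ≤
      2 * H * Real.exp (-(κ * ((q - 1 : ℕ) : ℝ))) := by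
    rcases Nat.eq_zero_or_pos q with h0 | h0
    · rw [h0]
      have h1 : gaussField.real (badAt A B ε x ∩ badAt A B ε y) ≤ H :=
        (measureReal_mono Set.inter_subset_left).trans (measureReal_badAt_le h hH hH0 x)
      have h2 : 0 ≤ gaussField.real (badAt A B ε x) * gaussField.real (badAt A B ε y) :=
        mul_nonneg measureReal_nonneg measureReal_nonneg
      simp only [zero_tsub, Nat.cast_zero, mul_zero, neg_zero, Real.exp_zero, mul_one]
      linarith
    -- Coordinates at distance at least 8Lq lie in boxes whose indices differ by at least 8q, more
    -- than the 8(q - 1) + 6 that would allow the regions to meet.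
    · refine measureReal_inter_sub_le h hH hH0 fun hn => ?_
      have h1 := hn i
      have h2 : 8 * bigL ε * q ≤ (|x i - y i|).toNat := Nat.mul_div_le _ _
      have h3 : (8 * bigL ε * q : ℤ) ≤ |x i - y i| := by
        have := Int.toNat_of_nonneg (abs_nonneg (x i - y i))
        zify at h2
        rwa [this] at h2
      have hLz : (0 : ℤ) < bigL ε := by exact_mod_cast hL
      have a1 := Int.mul_ediv_add_emod (x i) (bigL ε)
      have a2 := Int.emod_nonneg (x i) hLz.ne'
      have a3 := Int.emod_lt_of_pos (x i) hLz
      have b1 := Int.mul_ediv_add_emod (y i) (bigL ε)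
      have b2 := Int.emod_nonneg (y i) hLz.ne'
      have b3 := Int.emod_lt_of_pos (y i) hLz
      simp only [boxIndex] at h1
      have hq1 : ((q - 1 : ℕ) : ℤ) = q - 1 := by push_cast [Nat.cast_sub h0]; ring
      rw [hq1] at h1
      obtain ⟨c1, c2⟩ := abs_le.1 h1
      have c3 := mul_le_mul_of_nonneg_left c1 hLz.le
      have c4 := mul_le_mul_of_nonneg_left c2 hLz.le
      rcases abs_cases (x i - y i) with ⟨e, _⟩ | ⟨e, _⟩ <;> rw [e] at h3 <;> nlinarith
  refine hbound.trans ?_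
  rw [← Real.exp_sum, mul_assoc (2 * H), ← Real.exp_add]
  refine mul_le_mul_of_nonneg_left (Real.exp_le_exp.2 ?_) (by positivity)
  have hsum : ∑ j, |((x j - y j : ℤ) : ℝ)| ≤ 3 * |((x i - y i : ℤ) : ℝ)| := by
    refine (Finset.sum_le_card_nsmul _ _ (|((x i - y i : ℤ) : ℝ)|) fun j hj => ?_).trans
      (by simp)
    rw [← Int.cast_abs, ← Int.cast_abs]
    exact_mod_cast hi j hj
  rw [Finset.sum_neg_distrib, ← Finset.mul_sum]
  have h5 : |((x i - y i : ℤ) : ℝ)| / (8 * bigL ε) ≤ q + 1 := by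
    have h6 := Nat.lt_div_mul_add (a := (|x i - y i|).toNat) (b := 8 * bigL ε) (by omega)
    rw [div_le_iff₀ (by positivity), ← hd0]
    have h7 : (|x i - y i|).toNat ≤ (q + 1) * (8 * bigL ε) := by
      rw [← hq] at h6
      linarith
    exact_mod_cast h7
  have h6 : (q : ℝ) - 1 ≤ ((q - 1 : ℕ) : ℝ) := by
    have : q ≤ (q - 1) + 1 := by omega
    have h8 : (q : ℝ) ≤ ((q - 1 : ℕ) : ℝ) + 1 := by exact_mod_cast this
    linarith
  have h7 : κ / (24 * bigL ε) * ∑ j, |((x j - y j : ℤ) : ℝ)| ≤ κ * ((q : ℝ) + 1) := by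
    calc κ / (24 * bigL ε) * ∑ j, |((x j - y j : ℤ) : ℝ)|
        ≤ κ / (24 * bigL ε) * (3 * |((x i - y i : ℤ) : ℝ)|) := by gcongr
      _ = κ * (|((x i - y i : ℤ) : ℝ)| / (8 * bigL ε)) := by field_simp; ring
      _ ≤ _ := by gcongr
  have h8 := mul_le_mul_of_nonneg_left h6 hκ.le
  linarith

end Cov

/-! ### Lattice sums of exponentially decaying covariances. -/

theorem sum_Icc_exp_le {t : ℝ} (ht : 0 < t) (ht1 : t ≤ 1) (c : ℤ) (M : ℕ) :
    ∑ j ∈ Finset.Icc (c - M) (c + M), Real.exp (-(t * |((c - j : ℤ) : ℝ)|)) ≤ 4 / t := by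
  have hρ : Real.exp (-t) < 1 := by rw [Real.exp_lt_one_iff]; linarith
  have hg : ∀ m : ℕ, ∑ j ∈ Finset.range m, Real.exp (-t) ^ j ≤ 2 / t := by
    intro m
    have h1 := (summable_geometric_of_lt_one (Real.exp_pos (-t)).le hρ).sum_le_tsum (Finset.range m)
      fun _ _ => by positivity
    rw [tsum_geometric_of_lt_one (Real.exp_pos (-t)).le hρ] at h1
    refine h1.trans ?_
    rw [inv_le_comm₀ (by linarith) (by positivity), inv_div]
    have h2 : Real.exp (-t) ≤ 1 / (1 + t) := by
      rw [Real.exp_neg, ← one_div]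
      exact one_div_le_one_div_of_le (by positivity) (by linarith [Real.add_one_le_exp t])
    have h3 : 1 / (1 + t) ≤ 1 - t / 2 := by
      rw [div_le_iff₀ (by positivity)]
      nlinarith
    linarith
  have hsub : Finset.Icc (c - M) (c + M) ⊆ (Finset.range (M + 1)).image (fun j : ℕ => c - j) ∪
      (Finset.range (M + 1)).image (fun j : ℕ => c + (j : ℤ)) := by
    intro j hj
    rw [Finset.mem_Icc] at hj
    rw [Finset.mem_union, Finset.mem_image, Finset.mem_image]
    rcases le_total j c with hjc | hjc
    · exact Or.inl ⟨(c - j).toNat, by rw [Finset.mem_range]; omega, by omega⟩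
    · exact Or.inr ⟨(j - c).toNat, by rw [Finset.mem_range]; omega, by omega⟩
  have hpos : ∀ j : ℤ, 0 ≤ Real.exp (-(t * |((c - j : ℤ) : ℝ)|)) := fun j => (Real.exp_pos _).le
  refine (Finset.sum_le_sum_of_subset_of_nonneg hsub fun j _ _ => hpos j).trans ?_
  have hun : ∀ s s' : Finset ℤ, ∑ j ∈ s ∪ s', Real.exp (-(t * |((c - j : ℤ) : ℝ)|)) ≤
      (∑ j ∈ s, Real.exp (-(t * |((c - j : ℤ) : ℝ)|))) +
        ∑ j ∈ s', Real.exp (-(t * |((c - j : ℤ) : ℝ)|)) := fun s s' => by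
    rw [← Finset.sum_union_inter]
    exact le_add_of_nonneg_right (Finset.sum_nonneg fun j _ => hpos j)
  refine (hun _ _).trans ?_
  have e4 : 4 / t = 2 / t + 2 / t := by ring
  rw [e4]
  refine add_le_add ?_ ?_
  · rw [Finset.sum_image (fun a _ b _ hab => by simpa using hab)]
    refine le_trans (le_of_eq (Finset.sum_congr rfl fun j _ => ?_)) (hg (M + 1))
    rw [← Real.exp_nat_mul]
    congr 1
    simp
    ring
  · rw [Finset.sum_image (fun a _ b _ hab => by simpa using hab)]
    refine le_trans (le_of_eq (Finset.sum_congr rfl fun j _ => ?_)) (hg (M + 1))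
    rw [← Real.exp_nat_mul]
    congr 1
    simp
    ring

theorem sum_prod_exp_le {t : ℝ} (ht : 0 < t) (ht1 : t ≤ 1) (x : Site) (S : Finset Site) :
    ∑ y ∈ S, ∏ i, Real.exp (-(t * |((x i - y i : ℤ) : ℝ)|)) ≤ (4 / t) ^ 3 := by
  obtain ⟨M, hM⟩ : ∃ M : ℕ, ∀ y ∈ S, ∀ i, |y i - x i| ≤ M := by
    refine ⟨S.sup fun y => ∑ i, (|y i - x i|).toNat, fun y hy i => ?_⟩
    have h1 : (|y i - x i|).toNat ≤ ∑ i, (|y i - x i|).toNat :=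
      Finset.single_le_sum (f := fun i => (|y i - x i|).toNat) (fun _ _ => Nat.zero_le _)
        (Finset.mem_univ i)
    have h2 := Finset.le_sup (f := fun y : Site => ∑ i, (|y i - x i|).toNat) hy
    have h3 := Int.toNat_of_nonneg (abs_nonneg (y i - x i))
    rw [← h3]
    exact_mod_cast h1.trans h2
  have hsub : S ⊆ Fintype.piFinset fun i => Finset.Icc (x i - M) (x i + M) := by
    intro y hy
    rw [Fintype.mem_piFinset]
    intro i
    have := abs_le.1 (hM y hy i)
    rw [Finset.mem_Icc]
    constructor <;> linarith
  refine (Finset.sum_le_sum_of_subset_of_nonneg hsub fun y _ _ =>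
    Finset.prod_nonneg fun i _ => (Real.exp_pos _).le).trans ?_
  rw [← Finset.prod_univ_sum (fun i => Finset.Icc (x i - (M : ℤ)) (x i + M))
    (fun i j => Real.exp (-(t * |((x i - j : ℤ) : ℝ)|)))]
  refine (Finset.prod_le_prod (fun i _ => Finset.sum_nonneg fun j _ => (Real.exp_pos _).le)
    fun i _ => sum_Icc_exp_le ht ht1 (x i) M).trans (le_of_eq ?_)
  rw [Finset.prod_const, Finset.card_univ, Fintype.card_fin]

/-! ### The bad volume -/

theorem badCount_eq_sum (A B ε : ℝ) {Λ : Set Site} (hΛ : Λ.Finite) (a : Site → ℝ) :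
    badCount A B ε a Λ = ∑ x ∈ hΛ.toFinset, (badAt A B ε x).indicator (1 : (Site → ℝ) → ℝ) a := by
  classical
  have e : badSet A B ε a ∩ Λ = ((hΛ.toFinset.filter fun x => a ∈ badAt A B ε x : Finset Site) : Set Site) := by
    ext x
    rw [Finset.mem_coe, Finset.mem_filter, Set.Finite.mem_toFinset]
    exact and_comm
  rw [badCount, e, Set.ncard_coe_finset, Finset.card_filter]
  push_cast
  refine Finset.sum_congr rfl fun x _ => ?_
  simp [Set.indicator_apply]

theorem badCount_mono (A B ε : ℝ) (a : Site → ℝ) {Λ Λ' : Set Site} (hΛ' : Λ'.Finite) (h : Λ ⊆ Λ') :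
    badCount A B ε a Λ ≤ badCount A B ε a Λ' :=
  Nat.cast_le.2 (Set.ncard_le_ncard (Set.inter_subset_inter_right _ h)
    (hΛ'.subset Set.inter_subset_right))

section Volume

variable {A B ε H κ : ℝ} (h : GoodScales ε) {Λ : Set Site} (hΛ : Λ.Finite)

include h

theorem memLp_indicator_badAt (x : Site) :
    MemLp ((badAt A B ε x).indicator (1 : (Site → ℝ) → ℝ)) 2 gaussField :=
  memLp_indicator_const 2 (measurableSet_badAt h x) 1 (Or.inr (measure_ne_top _ _))

include hΛ

theorem memLp_badCount : MemLp (fun a => badCount A B ε a Λ) 2 gaussField := by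
  simp only [badCount_eq_sum A B ε hΛ]
  exact memLp_finsetSum _ fun x _ => memLp_indicator_badAt h x

variable (hκ : 0 < κ) (hκ1 : κ ≤ 1) (hH0 : 0 ≤ H)
  (hH : ∀ (R : ℕ) (p : Site), gaussField {a | ∃ N, R < N ∧ Heavy (boxWeight A B ε) N p a} ≤
    ENNReal.ofReal (H * Real.exp (-(κ * R))))

include hH0 hH

theorem integral_badCount_le : ∫ a, badCount A B ε a Λ ∂gaussField ≤ H * Λ.ncard := by
  simp only [badCount_eq_sum A B ε hΛ]
  rw [integral_finsetSum _ fun x _ => (memLp_indicator_badAt h x).integrable (by norm_num)]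
  refine (Finset.sum_le_card_nsmul _ _ H fun x _ => ?_).trans (le_of_eq ?_)
  · rw [integral_indicator_one (measurableSet_badAt h x)]
    exact measureReal_badAt_le h hH hH0 x
  · rw [nsmul_eq_mul, Set.ncard_eq_toFinset_card _ hΛ, mul_comm]

include hκ hκ1

/-- The variance is the double sum of covariances. Each row is bounded by a three-dimensional
geometric sum with decay length 24L/κ, whence the factor (4 · 24L/κ)³ per site. -/
theorem variance_badCount_le : variance (fun a => badCount A B ε a Λ) gaussField ≤
    2 * H * Real.exp 2 * (96 * bigL ε / κ) ^ 3 * Λ.ncard := by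
  have hL : (1 : ℝ) ≤ bigL ε := by exact_mod_cast h.bigL_pos
  simp only [badCount_eq_sum A B ε hΛ]
  rw [variance_fun_sum' fun x _ => memLp_indicator_badAt h x]
  have hcov : ∀ x y, cov[(badAt A B ε x).indicator (1 : (Site → ℝ) → ℝ),
      (badAt A B ε y).indicator (1 : (Site → ℝ) → ℝ); gaussField] ≤
      2 * H * Real.exp 2 * ∏ i, Real.exp (-(κ / (24 * bigL ε) * |((x i - y i : ℤ) : ℝ)|)) := by
    intro x y
    rw [covariance_eq_sub (memLp_indicator_badAt h x) (memLp_indicator_badAt h y),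
      ← Set.inter_indicator_one, integral_indicator_one (measurableSet_badAt h x),
      integral_indicator_one (measurableSet_badAt h y),
      integral_indicator_one ((measurableSet_badAt h x).inter (measurableSet_badAt h y))]
    exact measureReal_inter_sub_le_prod h hκ hκ1 hH hH0 x y
  have hrow : ∀ x ∈ hΛ.toFinset, ∑ y ∈ hΛ.toFinset, cov[(badAt A B ε x).indicator
      (1 : (Site → ℝ) → ℝ), (badAt A B ε y).indicator (1 : (Site → ℝ) → ℝ); gaussField] ≤
      2 * H * Real.exp 2 * (96 * bigL ε / κ) ^ 3 := by
    intro x _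
    refine (Finset.sum_le_sum fun y _ => hcov x y).trans ?_
    rw [← Finset.mul_sum]
    refine mul_le_mul_of_nonneg_left ?_ (by positivity)
    refine (sum_prod_exp_le (by positivity) ?_ x _).trans (le_of_eq ?_)
    · rw [div_le_one (by positivity)]
      linarith
    · congr 1
      field_simp
      norm_num
  refine (Finset.sum_le_card_nsmul _ _ _ hrow).trans (le_of_eq ?_)
  rw [nsmul_eq_mul, Set.ncard_eq_toFinset_card _ hΛ, mul_comm]

end Volume

/-! ### The law of large numbers -/

theorem exists_le_ncard {Λ : ℕ → Set Site} (hf : ∀ N, (Λ N).Finite) (hmono : Monotone Λ)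
    (hun : (⋃ N, Λ N) = Set.univ) (m : ℕ) : ∃ N₀, ∀ N ≥ N₀, m ≤ (Λ N).ncard := by
  obtain ⟨s, hs⟩ := Infinite.exists_subset_card_eq Site m
  have h1 : ∀ t : Finset Site, ∃ N, (t : Set Site) ⊆ Λ N := by
    intro t
    have h2 : ∀ x : Site, ∃ N, x ∈ Λ N := fun x => Set.mem_iUnion.1 (hun ▸ Set.mem_univ x)
    choose f hf using h2
    exact ⟨t.sup f, fun x hx => hmono (Finset.le_sup (Finset.mem_coe.1 hx)) (hf x)⟩
  obtain ⟨N₀, hN₀⟩ := h1 s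
  refine ⟨N₀, fun N hN => ?_⟩
  rw [← hs, ← Set.ncard_coe_finset]
  exact Set.ncard_le_ncard (hN₀.trans (hmono hN)) (hf N)

/-- Along monotone sequences of sets, increasing functionals that satisfy a Chebyshev bound obey a
law of large numbers. -/
theorem ae_eventually_le_of_chebyshev {Ω : Type*} [MeasurableSpace Ω] {P : Measure Ω}
    {X : Set Site → Ω → ℝ} {Λ : ℕ → Set Site} (hf : ∀ N, (Λ N).Finite) (hmono : Monotone Λ)
    (hun : (⋃ N, Λ N) = Set.univ) {b w : ℝ} (hb : 0 ≤ b) (hw : 0 ≤ w)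
    (hX : ∀ N M ω, Λ N ⊆ Λ M → X (Λ N) ω ≤ X (Λ M) ω)
    (hP : ∀ N, 0 < (Λ N).ncard →
      P {ω | b * (Λ N).ncard < X (Λ N) ω} ≤ ENNReal.ofReal (w / (Λ N).ncard)) :
    ∀ᵐ ω ∂P, ∃ N₀ : ℕ, ∀ N ≥ N₀, X (Λ N) ω ≤ 2 * b * (Λ N).ncard := by
  set E : ℕ → Set Ω := fun k => {ω | ∃ N, 2 ^ k ≤ (Λ N).ncard ∧ (Λ N).ncard < 2 ^ (k + 1) ∧
    2 * b * (Λ N).ncard < X (Λ N) ω} with hE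
  have hEk : ∀ k, P (E k) ≤ ENNReal.ofReal (w * (1 / 2) ^ k) := by
    intro k
    by_cases hne : ∃ N, 2 ^ k ≤ (Λ N).ncard ∧ (Λ N).ncard < 2 ^ (k + 1)
    -- A single set represents all those with volume in [2^k, 2^(k+1)), namely one of maximal
    -- volume. By monotonicity it contains all the others, and its volume is at most twice theirs;
    -- this is the factor 2 in the conclusion. Summability over k then needs no growth condition on
    -- the sequence.
    · obtain ⟨M, ⟨hM1, hM2⟩, hmax⟩ : ∃ M, (2 ^ k ≤ (Λ M).ncard ∧ (Λ M).ncard < 2 ^ (k + 1)) ∧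
          ∀ N, 2 ^ k ≤ (Λ N).ncard ∧ (Λ N).ncard < 2 ^ (k + 1) → (Λ N).ncard ≤ (Λ M).ncard := by
        obtain ⟨v, ⟨M, hM, rfl⟩, hv⟩ := Set.exists_max_image
          ((fun N => (Λ N).ncard) '' {N | 2 ^ k ≤ (Λ N).ncard ∧ (Λ N).ncard < 2 ^ (k + 1)}) id
          ((Set.finite_lt_nat (2 ^ (k + 1))).subset (by rintro _ ⟨N, hN, rfl⟩; exact hN.2))
          (Set.Nonempty.image _ hne)
        exact ⟨M, hM, fun N hN => hv _ ⟨N, hN, rfl⟩⟩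
      have hsub : E k ⊆ {ω | b * (Λ M).ncard < X (Λ M) ω} := by
        rintro ω ⟨N, hN1, hN2, hN3⟩
        have hNM : Λ N ⊆ Λ M := by
          rcases le_total N M with hle | hle
          · exact hmono hle
          -- A later set in the same range contains the maximal one and is not larger, so it equals
          -- it.
          · exact (Set.eq_of_subset_of_ncard_le (hmono hle) (hmax N ⟨hN1, hN2⟩) (hf N)).ge
        have h1 : ((Λ M).ncard : ℝ) ≤ 2 * (Λ N).ncard := by
          have : (Λ M).ncard ≤ 2 * (Λ N).ncard := by rw [pow_succ] at hM2; omega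
          exact_mod_cast this
        have h2 := mul_le_mul_of_nonneg_left h1 hb
        have h3 := hX N M ω hNM
        simp only [Set.mem_ofPred_eq]
        linarith
      have hMpos : 0 < (Λ M).ncard := lt_of_lt_of_le (by positivity) hM1
      refine (measure_mono hsub).trans ((hP M hMpos).trans (ENNReal.ofReal_le_ofReal ?_))
      rw [one_div, inv_pow, ← div_eq_mul_inv]
      refine div_le_div_of_nonneg_left hw (by positivity) ?_
      exact_mod_cast hM1
    · have : E k = ∅ := by
        ext ω
        simp only [hE, Set.mem_ofPred_eq, Set.mem_empty_iff_false, iff_false]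
        rintro ⟨N, h1, h2, -⟩
        exact hne ⟨N, h1, h2⟩
      rw [this, measure_empty]
      exact zero_le
  have hsum : ∑' k, P (E k) ≠ ∞ := by
    refine ne_top_of_le_ne_top ?_ (ENNReal.tsum_le_tsum hEk)
    rw [← ENNReal.ofReal_tsum_of_nonneg (fun k => by positivity)
      ((summable_geometric_of_lt_one (by norm_num) (by norm_num)).mul_left w)]
    exact ENNReal.ofReal_ne_top
  filter_upwards [ae_eventually_notMem hsum] with ω hω
  obtain ⟨k₀, hk₀⟩ := eventually_atTop.1 hω
  obtain ⟨N₀, hN₀⟩ := exists_le_ncard hf hmono hun (2 ^ k₀)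
  refine ⟨N₀, fun N hN => ?_⟩
  by_contra hc
  push Not at hc
  have hpos : (Λ N).ncard ≠ 0 := by
    have := hN₀ N hN
    have h2 : 0 < 2 ^ k₀ := by positivity
    omega
  refine hk₀ (Nat.log 2 (Λ N).ncard) ?_ ⟨N, Nat.pow_log_le_self 2 hpos,
    Nat.lt_pow_succ_log_self (by norm_num) _, hc⟩
  exact Nat.le_log_of_pow_le (by norm_num) (hN₀ N hN)

section LLN

variable {A B ε H κ : ℝ} (h : GoodScales ε) (hκ : 0 < κ) (hκ1 : κ ≤ 1) (hH0 : 0 ≤ H)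
  (hH : ∀ (R : ℕ) (p : Site), gaussField {a | ∃ N, R < N ∧ Heavy (boxWeight A B ε) N p a} ≤
    ENNReal.ofReal (H * Real.exp (-(κ * R))))

include h hκ hκ1 hH0 hH

/-- Chebyshev's inequality around a mean of at most H|Λ| with deviation d|Λ|: as the variance is
linear in the volume, the probability is of order 1/|Λ|, summable along dyadic volumes. -/
theorem ae_badCount_le {Λ : ℕ → Set Site} (hf : ∀ N, (Λ N).Finite) (hmono : Monotone Λ)
    (hun : (⋃ N, Λ N) = Set.univ) {d : ℝ} (hd : 0 < d) :
    ∀ᵐ a ∂gaussField, ∃ N₀ : ℕ, ∀ N ≥ N₀,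
      badCount A B ε a (Λ N) ≤ 2 * (H + d) * (Λ N).ncard := by
  set v := 2 * H * Real.exp 2 * (96 * bigL ε / κ) ^ 3 with hv
  have hv0 : 0 ≤ v := by positivity
  refine ae_eventually_le_of_chebyshev (X := fun Λ a => badCount A B ε a Λ) hf hmono hun
    (b := H + d) (w := v / d ^ 2) (by linarith) (by positivity)
    (fun N M a hNM => badCount_mono A B ε a (hf M) hNM) fun N hN => ?_
  have hN' : (0 : ℝ) < (Λ N).ncard := by exact_mod_cast hN
  have h1 := meas_ge_le_variance_div_sq (memLp_badCount (A := A) (B := B) h (hf N))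
    (c := d * (Λ N).ncard) (by positivity)
  refine (measure_mono fun a ha => ?_).trans (h1.trans (ENNReal.ofReal_le_ofReal ?_))
  · simp only [Set.mem_ofPred_eq] at ha ⊢
    have h2 := integral_badCount_le (A := A) (B := B) h (hf N) hH0 hH
    refine le_trans ?_ (le_abs_self _)
    linarith
  · have h3 := variance_badCount_le (A := A) (B := B) h (hf N) hκ hκ1 hH0 hH
    rw [div_div, div_le_div_iff₀ (by positivity) (by positivity)]
    rw [← hv] at h3
    have h4 := mul_le_mul_of_nonneg_right h3 (show 0 ≤ d ^ 2 * ((Λ N).ncard : ℝ) by positivity)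
    refine h4.trans (le_of_eq ?_)
    ring

end LLN

/-! ### Small disorder -/

theorem eventually_mul_pow_le_exp (C : ℝ) (k : ℕ) {c : ℝ} (hc : 0 < c) :
    ∀ᶠ t : ℝ in atTop, C * t ^ k ≤ Real.exp (c * t) := by
  have h := (isLittleO_pow_exp_pos_mul_atTop k hc).def (c := (|C| + 1)⁻¹) (by positivity)
  filter_upwards [h, eventually_ge_atTop 0] with t ht ht0
  rw [Real.norm_of_nonneg (by positivity), Real.norm_of_nonneg (Real.exp_pos _).le,
    inv_mul_eq_div, le_div_iff₀ (by positivity)] at ht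
  have h1 : C * t ^ k ≤ (|C| + 1) * t ^ k :=
    mul_le_mul_of_nonneg_right (by linarith [le_abs_self C]) (by positivity)
  linarith

theorem eventually_mul_pow_le_pow (C : ℝ) {i j : ℕ} (hij : i < j) :
    ∀ᶠ t : ℝ in atTop, C * t ^ i ≤ t ^ j := by
  have h := (Asymptotics.isLittleO_pow_pow_atTop_of_lt (𝕜 := ℝ) hij).def (c := (|C| + 1)⁻¹) (by positivity)
  filter_upwards [h, eventually_ge_atTop 0] with t ht ht0
  rw [Real.norm_of_nonneg (by positivity), Real.norm_of_nonneg (by positivity),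
    inv_mul_eq_div, le_div_iff₀ (by positivity)] at ht
  have h1 : C * t ^ i ≤ (|C| + 1) * t ^ i :=
    mul_le_mul_of_nonneg_right (by linarith [le_abs_self C]) (by positivity)
  linarith

theorem pow_le_exp_natCast (m : ℕ) : (2.7 : ℝ) ^ m ≤ Real.exp m := by
  have h := Real.exp_one_gt_d9
  have e : Real.exp m = Real.exp 1 ^ m := by rw [← Real.exp_nat_mul, mul_one]
  rw [e]
  exact pow_le_pow_left₀ (by norm_num) (by linarith) m

/-- The parameter `t = |log ε|` is large. -/
structure LargeLog (t : ℝ) : Prop where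
  ge : 10 ^ 11 ≤ t
  exp_sixty : 16 * t ^ 60 ≤ Real.exp (1 / 2 * t)
  exp_ninety : (16 * 2 ^ 90 + 16) * t ^ 90 ≤ Real.exp (1 / 2 * t)
  exp_twenty : 4 * t ^ 20 ≤ Real.exp (1 / 2 * t)
  exp_quarter : 8 * t ^ 0 ≤ Real.exp (1 / 4 * t)
  exp_nine : 32 * t ^ 9 ≤ Real.exp (1 * t)
  exp_four : 16 * t ^ 4 ≤ Real.exp (1 * t)
  pow_ten : 4 * t ^ 5 ≤ t ^ 10
  pow_twenty : 3 * t ^ 10 ≤ t ^ 20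
  pow_sixty : 20736 * t ^ 20 ≤ t ^ 60
  pow_ninety : 4 * 2 ^ 90 * t ^ 20 ≤ t ^ 90
  pow_hundred : 24 * t ^ 5 ≤ t ^ 100
  pow_fifty : 8 * 2 ^ 50 * t ^ 5 ≤ t ^ 50

theorem eventually_largeLog : ∀ᶠ t : ℝ in atTop, LargeLog t := by
  filter_upwards [eventually_ge_atTop (10 ^ 11), eventually_mul_pow_le_exp 16 60 one_half_pos,
    eventually_mul_pow_le_exp (16 * 2 ^ 90 + 16) 90 one_half_pos,
    eventually_mul_pow_le_exp 4 20 one_half_pos,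
    eventually_mul_pow_le_exp 8 0 (c := 1 / 4) (by norm_num),
    eventually_mul_pow_le_exp 32 9 one_pos,
    eventually_mul_pow_le_exp 16 4 one_pos,
    eventually_mul_pow_le_pow 4 (i := 5) (j := 10) (by norm_num),
    eventually_mul_pow_le_pow 3 (i := 10) (j := 20) (by norm_num),
    eventually_mul_pow_le_pow 20736 (i := 20) (j := 60) (by norm_num),
    eventually_mul_pow_le_pow (4 * 2 ^ 90) (i := 20) (j := 90) (by norm_num),
    eventually_mul_pow_le_pow 24 (i := 5) (j := 100) (by norm_num),
    eventually_mul_pow_le_pow (8 * 2 ^ 50) (i := 5) (j := 50) (by norm_num)]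
    with t ht e1 e2 e3 e4 e5 e6 p1 p2 p3 p4 p5 p6
  exact ⟨ht, e1, e2, e3, e4, e5, e6, p1, p2, p3, p4, p5, p6⟩

/-- The range of the scales in terms of `t = |log ε|`. -/
structure ScaleRange (t : ℝ) (n : ℕ) : Prop where
  large : LargeLog t
  le : Real.exp (1 / 2 * t) ≤ n
  le_mul : (n : ℝ) ≤ 2 * Real.exp t * t ^ 4

namespace ScaleRange

variable {t : ℝ} {n : ℕ} (h : ScaleRange t n)

include h

theorem one_le : 1 ≤ t := by linarith [h.large.ge]

theorem t_pos : 0 < t := by linarith [h.one_le]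

theorem le_pow {k : ℕ} (hk : k ≠ 0) : t ≤ t ^ k := le_self_pow₀ h.one_le hk

theorem mul_self_le_pow {k : ℕ} (hk : 2 ≤ k) : t * t ≤ t ^ k := by
  rw [← pow_two]
  exact pow_le_pow_right₀ h.one_le hk

theorem abs_log : |Real.log (Real.exp (-t))| = t := by
  rw [Real.log_exp, abs_neg, abs_of_pos h.t_pos]

theorem cast_pos : (0 : ℝ) < n := (Real.exp_pos _).trans_le h.le

theorem le_exp : (n : ℝ) ≤ Real.exp (2 * t) := by
  have e : Real.exp (2 * t) = Real.exp t * Real.exp t := by rw [← Real.exp_add]; ring_nf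
  have h6 := h.large.exp_four
  rw [one_mul] at h6
  have h4 : 0 < t ^ 4 := by have := h.t_pos; positivity
  rw [e]
  refine h.le_mul.trans ?_
  have := mul_le_mul_of_nonneg_left (show 2 * t ^ 4 ≤ Real.exp t by linarith) (Real.exp_pos t).le
  linarith

theorem pow_le_exp (k : ℕ) : (n : ℝ) ^ k ≤ Real.exp (2 * k * t) := by
  refine (pow_le_pow_left₀ h.cast_pos.le h.le_exp k).trans (le_of_eq ?_)
  rw [← Real.exp_nat_mul]
  ring_nf

theorem le_log : 1 / 2 * t ≤ Real.log n := by
  rw [Real.le_log_iff_exp_le h.cast_pos]; exact h.le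

theorem log_le : Real.log n ≤ 2 * t := by
  rw [Real.log_le_iff_le_exp h.cast_pos]; exact h.le_exp

theorem one_le_log : 1 ≤ Real.log n := by linarith [h.le_log, h.large.ge]

theorem pow_twenty_le : t ^ 20 ≤ n / 4 := by linarith [h.large.exp_twenty, h.le]

theorem pow_twenty_le_log : t ^ 20 ≤ Real.log n ^ 90 / 4 := by
  have h0 := h.t_pos
  have h1 := pow_le_pow_left₀ (by positivity) h.le_log 90
  have h2 := h.large.pow_ninety
  rw [mul_pow] at h1
  norm_num at h1 h2 ⊢
  linarith

theorem pow_five_le_log : 2 * t ^ 5 ≤ Real.log n ^ 50 / 4 := by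
  have h0 := h.t_pos
  have h1 := pow_le_pow_left₀ (by positivity) h.le_log 50
  have h2 := h.large.pow_fifty
  rw [mul_pow] at h1
  norm_num at h1 h2 ⊢
  linarith

theorem le_pow_five : 10 ^ 11 ≤ t ^ 5 := h.large.ge.trans (h.le_pow (by norm_num))

omit h in
theorem exp_neg_sq (t : ℝ) : Real.exp (-t) ^ 2 = Real.exp (-(2 * t)) := by
  rw [← Real.exp_nat_mul]; push_cast; ring_nf

theorem sqrt_mul_rpow : Real.sqrt ((n : ℝ) ^ 3) * (n : ℝ) ^ (-3 / 2 : ℝ) = 1 := by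
  rw [Real.sqrt_eq_rpow, ← Real.rpow_natCast, ← Real.rpow_mul h.cast_pos.le,
    ← Real.rpow_add h.cast_pos]
  norm_num

/-- The exponent 80 in s = t^(-80) has to exceed 75, the largest power of |log ε| that normalises an
observable; the constants are absorbed by a further power of t. -/
theorem rate_le {k : ℕ} (hk : k < 80) : 21000 * (t ^ 80)⁻¹ * t ^ k ≤ 1 / 8 := by
  have h0 := h.t_pos
  have e : t ^ 80 = t ^ (80 - k) * t ^ k := by rw [← pow_add]; congr 1; omega
  have h1 := h.le_pow (k := 80 - k) (by omega)
  have e2 : 21000 * (t ^ 80)⁻¹ * t ^ k = 21000 / t ^ (80 - k) := by rw [e]; field_simp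
  rw [e2, div_le_div_iff₀ (by positivity) (by norm_num)]
  linarith [h.large.ge]

theorem rate_le' : 21000 * (t ^ 80)⁻¹ ≤ 1 / 8 := by simpa using h.rate_le (k := 0) (by norm_num)

/-- In units of 1 the field energy has exponential moments at a rate of order 1/(ε²n), which is
still nearly e^t at the largest scale because n ≤ 2 e^t t⁴. A truncation threshold of 1 is therefore
ample. -/
theorem le_field_rate : Real.exp t / (16 * t ^ 4) ≤ 1 / (4 * Real.exp (-t) ^ 2 * n) / 2 := by
  have h0 := h.t_pos
  have hn := h.cast_pos
  rw [exp_neg_sq, div_div, div_le_div_iff₀ (by positivity) (by positivity)]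
  have h1 : Real.exp t * (4 * Real.exp (-(2 * t)) * n * 2) = 8 * Real.exp (-t) * n := by
    have : Real.exp t * Real.exp (-(2 * t)) = Real.exp (-t) := by rw [← Real.exp_add]; ring_nf
    rw [← this]; ring
  rw [h1]
  refine (mul_le_mul_of_nonneg_left h.le_mul (by positivity)).trans (le_of_eq ?_)
  have : Real.exp (-t) * Real.exp t = 1 := by rw [← Real.exp_add]; simp
  linear_combination 16 * t ^ 4 * this

theorem pow_five_le_exp : t ^ 5 + 175 ≤ Real.exp t / (16 * t ^ 4) := by
  have h0 := h.t_pos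
  have h4 : 0 < t ^ 4 := by positivity
  have h5 := h.large.exp_nine
  have h6 := h.le_pow_five
  rw [one_mul] at h5
  rw [le_div_iff₀ (by positivity)]
  have h7 : 175 * t ^ 4 ≤ t ^ 5 * t ^ 4 := mul_le_mul_of_nonneg_right (by linarith) h4.le
  have h8 : t ^ 5 * t ^ 4 = t ^ 9 := by ring
  linarith

/-- All three errors in `niceError` are at most exp(-t^20), which beats both the polynomial n^13 ≤
exp(26t) and the factor exp(t^10) of the exponential moment. The gain is then exp(-t^10/2), far
below exp(-t^5). -/
theorem bad_le : (1 + 274625 * niceError (t ^ 30) n * Real.exp (t ^ 10)) *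
    Real.exp (-(t ^ 10 * 1 / 2)) ≤ Real.exp (-t ^ 5) := by
  have hn13 : (n : ℝ) ^ 13 ≤ Real.exp (26 * t) := (h.pow_le_exp 13).trans (le_of_eq (by norm_num))
  have hsum : Real.exp (-((t ^ 30) ^ 2 / 20736)) + Real.exp (-(n / 4)) +
      Real.exp (-(Real.log n ^ 90 / 4)) ≤ 3 * Real.exp (-t ^ 20) := by
    have a1 : Real.exp (-((t ^ 30) ^ 2 / 20736)) ≤ Real.exp (-t ^ 20) := by
      rw [Real.exp_le_exp, ← pow_mul]; linarith [h.large.pow_sixty]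
    have a2 : Real.exp (-((n : ℝ) / 4)) ≤ Real.exp (-t ^ 20) := by
      rw [Real.exp_le_exp]; linarith [h.pow_twenty_le]
    have a3 : Real.exp (-(Real.log n ^ 90 / 4)) ≤ Real.exp (-t ^ 20) := by
      rw [Real.exp_le_exp]; linarith [h.pow_twenty_le_log]
    linarith
  have hne : 274625 * niceError (t ^ 30) n * Real.exp (t ^ 10) ≤ 1 := by
    calc 274625 * niceError (t ^ 30) n * Real.exp (t ^ 10)
        ≤ 274625 * (100 * Real.exp (26 * t) * (3 * Real.exp (-t ^ 20))) * Real.exp (t ^ 10) := by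
          unfold niceError; gcongr
      _ = 82387500 * Real.exp (26 * t + -t ^ 20 + t ^ 10) := by
          rw [Real.exp_add, Real.exp_add]; ring
      _ ≤ Real.exp 20 * Real.exp (26 * t + -t ^ 20 + t ^ 10) := by
          refine mul_le_mul_of_nonneg_right ?_ (Real.exp_pos _).le
          have := pow_le_exp_natCast 20
          norm_num at this ⊢
          linarith
      _ ≤ 1 := by
          rw [← Real.exp_add, Real.exp_le_one_iff]
          have h1 := h.mul_self_le_pow (k := 10) (by norm_num)
          have h2 := mul_le_mul_of_nonneg_right (show 27 ≤ t by linarith [h.large.ge]) h.t_pos.le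
          linarith [h.large.pow_twenty, h.large.ge]
  have h5 : Real.exp (-(t ^ 10 * 1 / 2)) ≤ Real.exp (-1) * Real.exp (-t ^ 5) := by
    rw [← Real.exp_add, Real.exp_le_exp]
    linarith [h.large.pow_ten, h.le_pow_five]
  have h6 : 2 * Real.exp (-1) ≤ 1 := by
    rw [Real.exp_neg, ← div_eq_mul_inv, div_le_one (Real.exp_pos _)]
    linarith [Real.exp_one_gt_d9]
  calc _ ≤ (1 + 1) * (Real.exp (-1) * Real.exp (-t ^ 5)) := by gcongr
    _ = (2 * Real.exp (-1)) * Real.exp (-t ^ 5) := by ring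
    _ ≤ 1 * Real.exp (-t ^ 5) := by gcongr
    _ = _ := one_mul _

/-- The rate n/(8ε²) is at least of order exp(5t/2), since n ≥ exp(t/2), whereas the normalisation
is only ε^(-9/4) = exp(9t/4). -/
theorem grad_rate : 21000 * (t ^ 80)⁻¹ * (Real.exp (-t) ^ (9 / 4 : ℝ))⁻¹ ≤
    n / (4 * Real.exp (-t) ^ 2) / 2 := by
  have h1 : (Real.exp (-t) ^ (9 / 4 : ℝ))⁻¹ = Real.exp (9 / 4 * t) := by
    rw [← Real.exp_mul, ← Real.exp_neg]; ring_nf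
  rw [h1, exp_neg_sq]
  calc 21000 * (t ^ 80)⁻¹ * Real.exp (9 / 4 * t) ≤ 1 * Real.exp (9 / 4 * t) :=
        mul_le_mul_of_nonneg_right (by linarith [h.rate_le']) (Real.exp_pos _).le
    _ ≤ Real.exp (1 / 2 * t) / (4 * Real.exp (-(2 * t))) / 2 := by
      rw [div_div, le_div_iff₀ (by positivity)]
      have h2 : 1 * Real.exp (9 / 4 * t) * (4 * Real.exp (-(2 * t)) * 2) =
          8 * Real.exp (1 / 4 * t) := by
        have : Real.exp (9 / 4 * t) * Real.exp (-(2 * t)) = Real.exp (1 / 4 * t) := by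
          rw [← Real.exp_add]; ring_nf
        rw [← this]; ring
      have h3 : Real.exp (1 / 2 * t) = Real.exp (1 / 4 * t) * Real.exp (1 / 4 * t) := by
        rw [← Real.exp_add]; ring_nf
      rw [h2, h3]
      have h4 := h.large.exp_quarter
      rw [pow_zero, mul_one] at h4
      exact mul_le_mul_of_nonneg_right h4 (Real.exp_pos _).le
    _ ≤ _ := by
      have := h.le
      gcongr

/-- At the threshold ε² t the gain is exp(-nt/8), against the moment exp(18n): the logarithm in the
truncation level is what beats a mean energy of volume order. -/
theorem grad_le : 274625 * Real.exp (18 * n) * Real.exp (-(n / (4 * Real.exp (-t) ^ 2) *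
    (Real.exp (-t) ^ 2 * t) / 2)) ≤ Real.exp (-t ^ 5) := by
  have h1 : (n : ℝ) / (4 * Real.exp (-t) ^ 2) * (Real.exp (-t) ^ 2 * t) / 2 = n * t / 8 := by
    have := Real.exp_pos (-t)
    field_simp
    ring
  rw [h1]
  calc 274625 * Real.exp (18 * n) * Real.exp (-(n * t / 8))
      ≤ Real.exp 13 * Real.exp (18 * n) * Real.exp (-(n * t / 8)) := by
        have := pow_le_exp_natCast 13
        norm_num at this
        have h2 : (274625 : ℝ) ≤ Real.exp 13 := by linarith
        gcongr
    _ ≤ _ := by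
        rw [← Real.exp_add, ← Real.exp_add, Real.exp_le_exp]
        have h2 := mul_le_mul_of_nonneg_left (show 160 ≤ t by linarith [h.large.ge]) h.cast_pos.le
        have h3 : t ^ 5 ≤ t ^ 20 := pow_le_pow_right₀ h.one_le (by norm_num)
        linarith [h.pow_twenty_le, h.le_pow_five]

theorem field_le : 274625 * Real.exp 162 *
    Real.exp (-(1 / (4 * Real.exp (-t) ^ 2 * n) * 1 / 2)) ≤ Real.exp (-t ^ 5) := by
  rw [mul_one]
  calc _ ≤ Real.exp 13 * Real.exp 162 * Real.exp (-(1 / (4 * Real.exp (-t) ^ 2 * n) / 2)) := by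
        have := pow_le_exp_natCast 13
        norm_num at this
        have h2 : (274625 : ℝ) ≤ Real.exp 13 := by linarith
        gcongr
    _ ≤ _ := by
        rw [← Real.exp_add, ← Real.exp_add, Real.exp_le_exp]
        linarith [h.le_field_rate, h.pow_five_le_exp]

theorem disorder_le : 274625 * (n : ℝ) ^ 3 * 2 * Real.exp (-(1 / 4 * t ^ 100 / 2)) ≤
    Real.exp (-t ^ 5) := by
  have hn3 : (n : ℝ) ^ 3 ≤ Real.exp (6 * t) := (h.pow_le_exp 3).trans (le_of_eq (by norm_num))
  calc 274625 * (n : ℝ) ^ 3 * 2 * Real.exp (-(1 / 4 * t ^ 100 / 2))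
      = 549250 * (n : ℝ) ^ 3 * Real.exp (-(1 / 4 * t ^ 100 / 2)) := by ring
    _ ≤ Real.exp 14 * Real.exp (6 * t) * Real.exp (-(1 / 4 * t ^ 100 / 2)) := by
        have := pow_le_exp_natCast 14
        norm_num at this
        have h2 : (549250 : ℝ) ≤ Real.exp 14 := by linarith
        gcongr
    _ ≤ _ := by
        rw [← Real.exp_add, ← Real.exp_add, Real.exp_le_exp]
        have h1 := h.mul_self_le_pow (k := 5) (by norm_num)
        have h2 := mul_le_mul_of_nonneg_right (show 20 ≤ t by linarith [h.large.ge]) h.t_pos.le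
        linarith [h.large.pow_hundred, h.large.ge]

theorem average_rate : 21000 * (t ^ 80)⁻¹ * (2 / avgBound n) ≤ Real.sqrt (n ^ 3) / 2 := by
  have hn := h.cast_pos
  have hs : 0 < Real.sqrt ((n : ℝ) ^ 3) := Real.sqrt_pos.2 (by positivity)
  have hlog : 0 < Real.log (n : ℝ) := by linarith [h.one_le_log]
  have hc : 2 / avgBound n = 2 * Real.sqrt ((n : ℝ) ^ 3) / Real.log n ^ 50 := by
    have h1 : (n : ℝ) ^ (-3 / 2 : ℝ) = (Real.sqrt ((n : ℝ) ^ 3))⁻¹ :=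
      eq_inv_of_mul_eq_one_right h.sqrt_mul_rpow
    rw [avgBound, h1]
    field_simp
  have h2 : 2 * Real.sqrt ((n : ℝ) ^ 3) / Real.log n ^ 50 ≤ 2 * Real.sqrt ((n : ℝ) ^ 3) :=
    div_le_self (by positivity) (one_le_pow₀ h.one_le_log)
  rw [hc]
  calc _ ≤ 1 / 8 * (2 * Real.sqrt ((n : ℝ) ^ 3)) :=
        mul_le_mul h.rate_le' h2 (by positivity) (by norm_num)
    _ ≤ _ := by linarith

/-- With the scaling n^(-3/2) of an average removed, the gain is exp(-log⁵⁰ n / 4). It has to beat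
exp(274625²/2), about exp(3.8 · 10^10), and this motivates the size 10^11 demanded of t. -/
theorem average_le : 2 * Real.exp (274625 ^ 2 / 2) *
    Real.exp (-(Real.sqrt (n ^ 3) * (avgBound n / 2) / 2)) ≤ Real.exp (-t ^ 5) := by
  have h1 : Real.sqrt ((n : ℝ) ^ 3) * (avgBound n / 2) / 2 = Real.log n ^ 50 / 4 := by
    rw [avgBound]
    linear_combination Real.log n ^ 50 / 4 * h.sqrt_mul_rpow
  rw [h1]
  calc _ ≤ Real.exp 1 * Real.exp (274625 ^ 2 / 2) * Real.exp (-(Real.log n ^ 50 / 4)) := by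
        have := Real.exp_one_gt_d9
        have h2 : 2 ≤ Real.exp 1 := by linarith
        gcongr
    _ ≤ _ := by
        rw [← Real.exp_add, ← Real.exp_add, Real.exp_le_exp]
        have h2 := h.le_pow_five
        norm_num at h2 ⊢
        linarith [h.pow_five_le_log]

theorem scaleBounds :
    ScaleBounds (Real.exp (-t)) (21000 * (t ^ 80)⁻¹) (Real.exp (-t ^ 5)) n := by
  have habs := h.abs_log
  refine ⟨?_, ?_, one_le_pow₀ h.one_le_log, ?_, ?_, ?_, h.grad_rate, ?_, ?_, h.field_le, ?_, ?_,
    h.average_rate, h.average_le⟩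
  · have h1 := h.le_pow (k := 20) (by norm_num)
    have : (36 : ℝ) ≤ n := by linarith [h.pow_twenty_le, h.large.ge]
    exact_mod_cast this
  · rw [habs, ← pow_mul]
    exact h.large.exp_sixty.trans h.le
  · have h1 := pow_le_pow_left₀ (by linarith [h.one_le_log]) h.log_le 90
    have h2 := one_le_pow₀ (n := 90) h.one_le
    rw [mul_pow] at h1
    linarith [h.large.exp_ninety, h.le]
  · rw [habs]
    have h3 := h.le_pow (k := 10) (by norm_num)
    linarith [h.rate_le (k := 55) (by norm_num), h.one_le]
  · rw [habs]; exact h.bad_le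
  · rw [habs]; exact h.grad_le
  · refine le_trans ?_ h.le_field_rate
    linarith [h.rate_le', h.pow_five_le_exp, h.le_pow_five]
  · rw [habs]
    linarith [h.rate_le (k := 75) (by norm_num)]
  · rw [habs]; exact h.disorder_le

end ScaleRange

/-! ### The size of the powers of two ℓ and L. -/

theorem le_two_pow_ceil_logb {x : ℝ} (hx : 1 ≤ x) :
    x ≤ ((2 ^ ⌈Real.logb 2 x⌉₊ : ℕ) : ℝ) ∧ ((2 ^ ⌈Real.logb 2 x⌉₊ : ℕ) : ℝ) ≤ 2 * x := by
  have hx0 : 0 < x := by linarith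
  have hl : 0 ≤ Real.logb 2 x := Real.logb_nonneg (by norm_num) hx
  have e : x = (2 : ℝ) ^ Real.logb 2 x := (Real.rpow_logb (by norm_num) (by norm_num) hx0).symm
  push_cast
  rw [← Real.rpow_natCast]
  constructor
  · conv_lhs => rw [e]
    exact Real.rpow_le_rpow_of_exponent_le (by norm_num) (Nat.le_ceil _)
  · have h2 : 2 * x = (2 : ℝ) ^ (Real.logb 2 x + 1) := by
      rw [Real.rpow_add (by norm_num), ← e, Real.rpow_one, mul_comm]
    rw [h2]
    exact Real.rpow_le_rpow_of_exponent_le (by norm_num) (Nat.ceil_lt_add_one hl).le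

theorem two_pow_floor_logb_le {x : ℝ} (hx : 1 ≤ x) :
    x / 2 ≤ ((2 ^ ⌊Real.logb 2 x⌋₊ : ℕ) : ℝ) ∧ ((2 ^ ⌊Real.logb 2 x⌋₊ : ℕ) : ℝ) ≤ x := by
  have hx0 : 0 < x := by linarith
  have hl : 0 ≤ Real.logb 2 x := Real.logb_nonneg (by norm_num) hx
  have e : x = (2 : ℝ) ^ Real.logb 2 x := (Real.rpow_logb (by norm_num) (by norm_num) hx0).symm
  push_cast
  rw [← Real.rpow_natCast]
  constructor
  · have h2 : x / 2 = (2 : ℝ) ^ (Real.logb 2 x - 1) := by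
      rw [Real.rpow_sub (by norm_num), ← e, Real.rpow_one]
    rw [h2]
    exact Real.rpow_le_rpow_of_exponent_le (by norm_num) (by linarith [Nat.lt_floor_add_one (Real.logb 2 x)])
  · conv_rhs => rw [e]
    exact Real.rpow_le_rpow_of_exponent_le (by norm_num) (Nat.floor_le hl)

namespace LargeLog

variable {t : ℝ} (h : LargeLog t)

include h

theorem pos : 0 < t := by linarith [h.ge]

theorem one_le : 1 ≤ t := by linarith [h.ge]

theorem abs_log : |Real.log (Real.exp (-t))| = t := by
  rw [Real.log_exp, abs_neg, abs_of_pos h.pos]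

theorem four_mul_exp_le : 4 * Real.exp (1 / 2 * t) ≤ Real.exp t / t ^ 4 := by
  have h0 := h.pos
  have h1 : t ^ 4 ≤ t ^ 20 := pow_le_pow_right₀ h.one_le (by norm_num)
  have h2 : Real.exp t = Real.exp (1 / 2 * t) * Real.exp (1 / 2 * t) := by
    rw [← Real.exp_add]; ring_nf
  rw [le_div_iff₀ (by positivity), h2]
  have h3 := mul_le_mul_of_nonneg_left (show 4 * t ^ 4 ≤ Real.exp (1 / 2 * t) by
    linarith [h.exp_twenty]) (Real.exp_pos (1 / 2 * t)).le
  linarith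

theorem one_le_exp_half : 1 ≤ Real.exp (1 / 2 * t) := Real.one_le_exp (by linarith [h.pos])

theorem ell_eq : ell (Real.exp (-t)) = 2 ^ ⌊Real.logb 2 (Real.exp t / t ^ 4)⌋₊ := by
  rw [ell, h.abs_log, Real.exp_neg, inv_inv, zpow_neg, div_eq_mul_inv]
  norm_cast

theorem bigL_eq : bigL (Real.exp (-t)) = 2 ^ ⌈Real.logb 2 (Real.exp t * t ^ 4)⌉₊ := by
  rw [bigL, h.abs_log, Real.exp_neg, inv_inv]

theorem div_le_mul : Real.exp t / t ^ 4 ≤ Real.exp t * t ^ 4 := by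
  have h0 := h.pos
  have h1 : 1 ≤ t ^ 4 := one_le_pow₀ h.one_le
  refine (div_le_self (Real.exp_pos t).le h1).trans ?_
  exact le_mul_of_one_le_right (Real.exp_pos t).le h1

theorem one_le_div : 1 ≤ Real.exp t / t ^ 4 := by
  linarith [h.four_mul_exp_le, h.one_le_exp_half]

/-- All three scales are powers of two between exp(t/2) and 2 e^t t⁴; for small ε the exponent of ℓ
is positive, so ℓ/2 is one too. The floor for ℓ and the ceiling for L make the exponents ordered,
which gives divisibility. -/
theorem scales_spec : ∀ n ∈ scales (Real.exp (-t)), ScaleRange t n ∧ n ∣ bigL (Real.exp (-t)) := by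
  have h0 := h.pos
  have hy := two_pow_floor_logb_le h.one_le_div
  have hx := le_two_pow_ceil_logb (h.one_le_div.trans h.div_le_mul)
  rw [← h.ell_eq] at hy
  rw [← h.bigL_eq] at hx
  have h4 := h.four_mul_exp_le
  have h1 := h.one_le_exp_half
  have hkl : ⌊Real.logb 2 (Real.exp t / t ^ 4)⌋₊ ≤ ⌈Real.logb 2 (Real.exp t * t ^ 4)⌉₊ :=
    (Nat.floor_le_ceil _).trans (Nat.ceil_mono (Real.logb_le_logb_of_le (by norm_num)
      (by positivity) h.div_le_mul))
  have hk : ⌊Real.logb 2 (Real.exp t / t ^ 4)⌋₊ ≠ 0 := by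
    intro hk
    have := h.ell_eq
    rw [hk, pow_zero] at this
    rw [this, Nat.cast_one] at hy
    linarith [hy.1]
  have hhalf : ell (Real.exp (-t)) / 2 * 2 = ell (Real.exp (-t)) :=
    Nat.div_mul_cancel (by rw [h.ell_eq]; exact dvd_pow_self 2 hk)
  have hhalf' : ((ell (Real.exp (-t)) / 2 : ℕ) : ℝ) * 2 = ell (Real.exp (-t)) := by
    exact_mod_cast hhalf
  have hdvd : ell (Real.exp (-t)) ∣ bigL (Real.exp (-t)) := by
    rw [h.ell_eq, h.bigL_eq]
    exact pow_dvd_pow 2 hkl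
  have hlm := h.div_le_mul
  have hp : 0 < Real.exp t * t ^ 4 := by positivity
  intro n hn
  simp only [scales, Finset.mem_insert, Finset.mem_singleton] at hn
  rcases hn with rfl | rfl | rfl
  · exact ⟨⟨h, by linarith [hy.1], by linarith [hy.2]⟩, (Dvd.intro _ hhalf).trans hdvd⟩
  · exact ⟨⟨h, by linarith [hy.1], by linarith [hy.2]⟩, hdvd⟩
  · exact ⟨⟨h, by linarith [hx.1], by linarith [hx.2]⟩, dvd_rfl⟩

theorem goodScales : GoodScales (Real.exp (-t)) where
  eps_pos := Real.exp_pos _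
  two_le n hn := by
    have := (h.scales_spec n hn).1.scaleBounds.n_ge
    omega
  dvd n hn := (h.scales_spec n hn).2
  ell_le := Nat.le_of_dvd (by rw [bigL]; positivity) (h.scales_spec _ (by simp [scales])).2
  log_ge := by
    rw [h.abs_log]
    have := h.ge
    nlinarith

end LargeLog

/-! ### Choice of the parameters and the final numerical estimates. -/

/-- The constant in the tail bound for heavy sets. -/
noncomputable def tailConst (t : ℝ) : ℝ :=
  8 * 486000000 * (⌈96 / (t ^ 80)⁻¹⌉₊ : ℝ) ^ 3 * Real.exp (-t ^ 5) / ((t ^ 80)⁻¹) ^ 5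

theorem tailConst_nonneg (t : ℝ) : 0 ≤ tailConst t := by unfold tailConst; positivity

theorem LargeLog.ceil_le {t : ℝ} (h : LargeLog t) : (⌈96 / (t ^ 80)⁻¹⌉₊ : ℝ) ≤ 97 * t ^ 80 := by
  have h0 := h.pos
  have h1 := Nat.ceil_lt_add_one (show 0 ≤ 96 / (t ^ 80)⁻¹ by positivity)
  have h2 : 1 ≤ t ^ 80 := one_le_pow₀ h.one_le
  rw [div_inv_eq_mul] at *
  linarith

/-- The general bound is used with s = t^(-80), τ = exp(-t^5) and K = ⌈96/s⌉ ≤ 97 t^80. The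
assumption on t is the condition 375 K³ τ ≤ s/12 with τ replaced by the larger e^(-t). -/
theorem LargeLog.measure_heavy_le {t A B : ℝ} (h : LargeLog t) (hA : A ≤ 1 / 384) (hB : 76 ≤ B)
    (ht : 4500 * 97 ^ 3 * t ^ 320 ≤ Real.exp (1 * t)) (R : ℕ) (p : Site) :
    gaussField {a | ∃ N, R < N ∧ Heavy (boxWeight A B (Real.exp (-t))) N p a} ≤
      ENNReal.ofReal (tailConst t * Real.exp (-((t ^ 80)⁻¹ / 4 * R))) := by
  have h0 := h.pos
  have h1 : 1 ≤ t ^ 80 := one_le_pow₀ h.one_le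
  have hg := h.goodScales
  have hs1 : (t ^ 80)⁻¹ ≤ 1 := inv_le_one_of_one_le₀ h1
  have hcond : 375 * (⌈96 / (t ^ 80)⁻¹⌉₊ : ℝ) ^ 3 * Real.exp (-t ^ 5) ≤ (t ^ 80)⁻¹ / 12 := by
    have h2 : 375 * (⌈96 / (t ^ 80)⁻¹⌉₊ : ℝ) ^ 3 * Real.exp (-t ^ 5) ≤
        375 * (97 * t ^ 80) ^ 3 * Real.exp (-t) := by
      have h3 : t ≤ t ^ 5 := le_self_pow₀ h.one_le (by norm_num)
      have h4 := h.ceil_le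
      gcongr
    refine h2.trans ?_
    rw [Real.exp_neg, inv_eq_one_div (t ^ 80), div_div, ← div_eq_mul_inv,
      div_le_div_iff₀ (Real.exp_pos _) (by positivity)]
    rw [one_mul] at ht
    refine le_trans (le_of_eq ?_) (ht.trans (one_mul _).ge)
    ring
  have := measure_exists_heavy_le (measurable_boxWeight (A := A) (B := B) hg.pos)
    (dependsOn_boxWeight (fun n hn => ⟨hg.pos n hn, hg.dvd n hn⟩) hg.bigL_pos)
    (boxWeight_nonneg hg.eps_pos) (s := (t ^ 80)⁻¹) (by positivity) (by linarith)
    (Real.exp_pos (-t ^ 5)).le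
    (lintegral_exp_boxWeight_le (Real.exp_pos _).le (fun n hn =>
      ⟨Nat.le_of_dvd hg.bigL_pos (hg.dvd n hn), (h.scales_spec n hn).1.scaleBounds⟩)
      hg.eps_pos hA hB) (Nat.le_ceil _) hcond R p
  refine this.trans (le_of_eq ?_)
  rw [tailConst]
  congr 3
  ring

theorem LargeLog.tailConst_le {t : ℝ} (h : LargeLog t) :
    tailConst t ≤ 8 * 486000000 * 97 ^ 3 * t ^ 640 * Real.exp (-t ^ 5) := by
  have h0 := h.pos
  have h1 := h.ceil_le
  rw [tailConst]
  calc _ ≤ 8 * 486000000 * (97 * t ^ 80) ^ 3 * Real.exp (-t ^ 5) / ((t ^ 80)⁻¹) ^ 5 := by gcongr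
    _ = _ := by field_simp

theorem LargeLog.exp_neg_pow_five_le {t : ℝ} (h : LargeLog t) :
    Real.exp (4 * t) * Real.exp (-t ^ 5) ≤ Real.exp (-t ^ 2) := by
  rw [← Real.exp_add, Real.exp_le_exp]
  have h1 : t ^ 3 ≤ t ^ 5 := pow_le_pow_right₀ h.one_le (by norm_num)
  have h2 := h.ge
  have h0 := h.pos
  nlinarith [mul_le_mul_of_nonneg_left (show 2 ≤ t by linarith) (sq_nonneg t),
    mul_le_mul_of_nonneg_left (show 4 ≤ t by linarith) h0.le]

theorem LargeLog.tailConst_le_exp {t : ℝ} (h : LargeLog t)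
    (ht : 8 * 486000000 * 97 ^ 3 * t ^ 640 ≤ Real.exp (1 * t)) :
    tailConst t ≤ Real.exp (-t ^ 2) := by
  refine h.tailConst_le.trans (le_trans ?_ h.exp_neg_pow_five_le)
  refine mul_le_mul_of_nonneg_right (ht.trans (Real.exp_le_exp.2 ?_)) (Real.exp_pos _).le
  linarith [h.pos]

/-- The cube of L ≤ 2 e^t t⁴ contributes e^(3t), and the powers of t combine to 640 + 3 · 84 = 892.
One more e^t absorbs the polynomial, and exp(4t - t^5) ≤ exp(-t²). -/
theorem LargeLog.variance_const_le {t : ℝ} (h : LargeLog t)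
    (ht : 16 * (8 * 486000000 * 97 ^ 3) * 768 ^ 3 * t ^ 892 ≤ Real.exp (1 * t)) :
    2 * tailConst t * Real.exp 2 * (96 * bigL (Real.exp (-t)) / ((t ^ 80)⁻¹ / 4)) ^ 3 ≤
      Real.exp (-t ^ 2) := by
  have h0 := h.pos
  have hL : (bigL (Real.exp (-t)) : ℝ) ≤ 2 * (Real.exp t * t ^ 4) := by
    have := (le_two_pow_ceil_logb (h.one_le_div.trans h.div_le_mul)).2
    rwa [← h.bigL_eq] at this
  have he : Real.exp 2 ≤ 8 := by
    have h1 : Real.exp 2 = Real.exp 1 * Real.exp 1 := by rw [← Real.exp_add]; norm_num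
    rw [h1]
    nlinarith [Real.exp_one_lt_d9, Real.exp_pos 1]
  have h3 : Real.exp (4 * t) = Real.exp t * Real.exp t ^ 3 := by
    rw [← Real.exp_nat_mul, ← Real.exp_add]; push_cast; ring_nf
  have hT := h.tailConst_le
  have hT0 := tailConst_nonneg t
  rw [one_mul] at ht
  calc _ ≤ 2 * (8 * 486000000 * 97 ^ 3 * t ^ 640 * Real.exp (-t ^ 5)) * 8 *
        (96 * (2 * (Real.exp t * t ^ 4)) / ((t ^ 80)⁻¹ / 4)) ^ 3 := by gcongr
    _ = (16 * (8 * 486000000 * 97 ^ 3) * 768 ^ 3 * t ^ 892) * Real.exp t ^ 3 * Real.exp (-t ^ 5) := by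
        field_simp
        ring
    _ ≤ Real.exp t * Real.exp t ^ 3 * Real.exp (-t ^ 5) := by gcongr
    _ = Real.exp (4 * t) * Real.exp (-t ^ 5) := by rw [h3]
    _ ≤ _ := h.exp_neg_pow_five_le

theorem eventually_bounds : ∀ᶠ t : ℝ in atTop, GoodScales (Real.exp (-t)) ∧ 0 < t ∧
    (t ^ 80)⁻¹ ≤ 1 ∧ tailConst t ≤ Real.exp (-t ^ 2) ∧
    2 * tailConst t * Real.exp 2 * (96 * bigL (Real.exp (-t)) / ((t ^ 80)⁻¹ / 4)) ^ 3 ≤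
      Real.exp (-t ^ 2) ∧
    ∀ A B : ℝ, A ≤ 1 / 384 → 76 ≤ B → ∀ (R : ℕ) (p : Site),
      gaussField {a | ∃ N, R < N ∧ Heavy (boxWeight A B (Real.exp (-t))) N p a} ≤
        ENNReal.ofReal (tailConst t * Real.exp (-((t ^ 80)⁻¹ / 4 * R))) := by
  filter_upwards [eventually_largeLog, eventually_mul_pow_le_exp (4500 * 97 ^ 3) 320 one_pos,
    eventually_mul_pow_le_exp (8 * 486000000 * 97 ^ 3) 640 one_pos,
    eventually_mul_pow_le_exp (16 * (8 * 486000000 * 97 ^ 3) * 768 ^ 3) 892 one_pos]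
    with t h h1 h2 h3
  exact ⟨h.goodScales, h.pos, inv_le_one_of_one_le₀ (one_le_pow₀ h.one_le),
    h.tailConst_le_exp h2, h.variance_const_le h3, fun A B hA hB => h.measure_heavy_le hA hB h1⟩

/-- The bad volume is a function of the disorder alone, so its integrability, variance and almost
sure behaviour can be computed under the canonical product measure. -/
theorem hasLaw_gaussField {Ω : Type*} [MeasurableSpace Ω] {P : Measure Ω}
    [IsProbabilityMeasure P] {α : RFO.Site → Ω → ℝ} (hα : ∀ x, HasLaw (α x) (gaussianReal 0 1) P)
    (hindep : iIndepFun α P) : HasLaw (fun ω x => α x ω) RFO.gaussField P :=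
  hindep.hasLaw_infinitePi hα (aemeasurable_pi_lambda _ fun x => (hα x).aemeasurable)

end RFO

theorem lemma3p2 :
    ∃ A₀ > (0 : ℝ), ∃ B₀ > (0 : ℝ), ∀ A B : ℝ, 0 < A → A ≤ A₀ → B₀ ≤ B →
    ∃ ε₀ > (0 : ℝ), ∃ c > (0 : ℝ), ∃ C > (0 : ℝ), ∀ ε : ℝ, 0 < ε → ε < ε₀ →
    ∀ (Ω : Type*) [MeasurableSpace Ω] (P : Measure Ω) [IsProbabilityMeasure P]
      (α : RFO.Site → Ω → ℝ),
      (∀ x, HasLaw (α x) (gaussianReal 0 1) P) → iIndepFun α P →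
      (∀ Λ : Set RFO.Site, Λ.Finite → RFO.ScaleMeasurable (RFO.bigL ε) Λ →
        MemLp (fun ω => RFO.badCount A B ε (fun x => α x ω) Λ) 2 P ∧
        variance (fun ω => RFO.badCount A B ε (fun x => α x ω) Λ) P
          ≤ C * Real.exp (-c * Real.log ε ^ 2) * (Λ.ncard : ℝ)) ∧
      (∀ Λ : ℕ → Set RFO.Site,
        (∀ N, (Λ N).Finite ∧ RFO.ScaleMeasurable (RFO.bigL ε) (Λ N)) →
        Monotone Λ → (⋃ N, Λ N) = Set.univ →
        ∀ᵐ ω ∂P, ∃ N₀ : ℕ, ∀ N ≥ N₀,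
          RFO.badCount A B ε (fun x => α x ω) (Λ N) / ((Λ N).ncard : ℝ)
            ≤ C * Real.exp (-c * |Real.log ε| ^ 2)) := by
  -- The bound 1/384 comes from the lower bound on the gradient energy, 76 from the exponential
  -- moment of that energy.
  refine ⟨1 / 384, by norm_num, 76, by norm_num, fun A B _ hA hB => ?_⟩
  obtain ⟨T, hT⟩ := eventually_atTop.1 RFO.eventually_bounds
  -- The constant 4 is 2(H + d) with both H and d at most exp(-t²): the factor 2 stems from the
  -- dyadic ranges of volumes, and d = exp(-t²) is the deviation used in Chebyshev's inequality.
  refine ⟨Real.exp (-T), Real.exp_pos _, 1, one_pos, 4, by norm_num,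
    fun ε hε hεT Ω _ P _ α hα hindep => ?_⟩
  obtain ⟨t, rfl⟩ : ∃ t, ε = Real.exp (-t) := ⟨-Real.log ε, by rw [neg_neg, Real.exp_log hε]⟩
  have htT : T ≤ t := by
    have := Real.exp_lt_exp.1 hεT
    linarith
  obtain ⟨hgood, ht, hκ1, htail, hvar, hheavy⟩ := hT t htT
  have hlaw := RFO.hasLaw_gaussField hα hindep
  have hκ : 0 < (t ^ 80)⁻¹ / 4 := by positivity
  have hH0 := RFO.tailConst_nonneg t
  have hκ2 : (t ^ 80)⁻¹ / 4 ≤ 1 := by linarith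
  have hH := hheavy A B hA hB
  rw [Real.log_exp, sq_abs, neg_sq, neg_one_mul]
  refine ⟨fun Λ hΛ _ => ?_, fun Λ hΛ hmono hun => ?_⟩
  · have hmem : MemLp (fun a => RFO.badCount A B (Real.exp (-t)) a Λ) 2
        (P.map fun ω x => α x ω) := hlaw.map_eq ▸ RFO.memLp_badCount hgood hΛ
    refine ⟨hmem.comp_of_map hlaw.aemeasurable, ?_⟩
    have h1 := variance_map hmem.aestronglyMeasurable.aemeasurable hlaw.aemeasurable
    rw [hlaw.map_eq] at h1
    have h2 := RFO.variance_badCount_le hgood hΛ hκ hκ2 hH0 hH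
    rw [h1] at h2
    exact h2.trans (mul_le_mul_of_nonneg_right (by linarith [Real.exp_pos (-t ^ 2)])
      (by positivity))
  · have h1 := RFO.ae_badCount_le hgood hκ hκ2 hH0 hH (fun N => (hΛ N).1) hmono hun
      (Real.exp_pos (-t ^ 2))
    rw [← hlaw.map_eq] at h1
    filter_upwards [ae_of_ae_map hlaw.aemeasurable h1] with ω ⟨N₀, hN₀⟩
    -- The quotient needs no positivity of the volume: division by zero gives 0, which satisfies the
    -- bound.
    refine ⟨N₀, fun N hN => div_le_of_le_mul₀ (by positivity) (by positivity)
      ((hN₀ N hN).trans (mul_le_mul_of_nonneg_right (by linarith) (by positivity)))⟩
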